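/- Let $d\ge 4$ and let $(M,\boldsymbol c,\sigma)$ be a conformally compact structure: $M$ is a compact smooth $d$-manifold with boundary $\Sigma=\partial M$, $\boldsymbol c$ is a conformal class of smooth Riemannian metrics on $M$, and $\sigma$ is a non-negative smooth density of weight $1$ with $\sigma^{-1}(0)=\Sigma$ and $d\sigma\neq 0$ along $\Sigma$. A (tensor-valued) density of weight $w$ is a family of smooth tensor fields, one for each $g\in\boldsymbol c$, whose representatives satisfy $T^{\Omega^2g}=\Omega^wT^g$; $[w]$ denotes weight $w$. Let $\mathcal V M\to M$ be a smooth vector bundle of finite rank. For a smooth connection $\nabla^A$ on $\mathcal V M$ with curvature $F$, define the weight $-1$ current, in the scale $g\in\boldsymbol c$ and with $n=d\sigma$, by $$ j_b[A]=\sigma\,\nabla^aF_{ab}-(d-4)\,n^aF_{ab}, $$ where $\nabla$ is coupled to the Levi-Civita connection of $g$. The boundary condition of $\nabla^A$ is the connection $\bar\nabla^{\bar A}$ it induces on $\mathcal V\Sigma=\mathcal V M|_\Sigma$ by $\bar\nabla^{\bar A}_v=\nabla^A_v$ for $v\in T\Sigma$. Call $\nabla^A$ asymptotically Yang–Mills if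 $j[A]=\sigma^{d-4}k$ for some smooth $k\in\Gamma(T^*M\otimes\operatorname{End}\mathcal V M[3-d])$. The obstruction current $\bar k\in\Gamma(T^*\Sigma\otimes\operatorname{End}\mathcal V\Sigma[3-d])$ of a boundary connection $\bar\nabla^{\bar A}$ is $k|_\Sigma$, for any asymptotically Yang–Mills connection with boundary condition $\bar\nabla^{\bar A}$ and current $\sigma^{d-4}k$. Write $X=\mathcal O(\sigma^\infty)$ if for every $\ell\in\mathbb N$ there is a smooth density-valued $Y_\ell$ with $X=\sigma^\ell Y_\ell$. Let $\nabla^{A_0}$ be a smooth asymptotically Yang–Mills connection with boundary condition $\bar\nabla^{\bar A}$, and suppose that the obstruction current $\bar k$ of $\bar\nabla^{\bar A}$ vanishes. Then $$ j[A_0]=\sigma^{d-3}k^{(1)}\quad\text{for some smooth } k^{(1)}\in\Gamma(T^*M\otimes\operatorname{End}\mathcal V M[2-d]). $$ Moreover, suppose that there is a smooth section $E\in\Gamma(T^*\Sigma\otimes\operatorname{End}\mathcal V\Sigma[3-d])$ satisfying the modified Gauss law $$ \bar\nabla^{\bar A}_aE^a=\frac1{d-3}\,\hat n^ak^{(1)}_a\quad\text{along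 }\Sigma, $$ where, in a scale $g\in\boldsymbol c$, $\hat n=n/|n|_g$ and $\bar\nabla^{\bar A}$ is coupled to the Levi-Civita connection of the induced metric on $\Sigma$. Then there is a smooth asymptotically Yang–Mills connection $\nabla^A$ on $\mathcal V M$ with boundary condition $\bar\nabla^{\bar A}$ such that $j[A]=\mathcal O(\sigma^\infty)$. -/

import Mathlib

open Bundle
open scoped Manifold ContDiff Bundle

noncomputable section

namespace YangMills

/-! ### Riemannian calculus in index-free form

`M` is a manifold of dimension `m`, possibly with boundary.  The tensor fields below are plain
functions of points and tangent vectors.  Wherever a tangent vector at `x` has to be differentiated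
it is first extended by `FiberBundle.extend`, i.e. to the vector field that is constant in the
preferred trivialization at `x`; the outcome is tensorial. -/

section Calculus

variable {m : ℕ} {H : Type*} [TopologicalSpace H]
  {I : ModelWithCorners ℝ (EuclideanSpace ℝ (Fin m)) H}
  {M : Type*} [TopologicalSpace M] [ChartedSpace H M] [IsManifold I 1 M]

/-- The coordinate basis of `T_x M` (with respect to the preferred chart at `x`). -/
def coordVec (I : ModelWithCorners ℝ (EuclideanSpace ℝ (Fin m)) H) (x : M) (i : Fin m) :
    TangentSpace I x :=
  (EuclideanSpace.single i (1 : ℝ) : EuclideanSpace ℝ (Fin m))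

/-- The vector field, smooth near `x`, extending a tangent vector `v` at `x`. -/
def extendVec {x : M} (v : TangentSpace I x) : Π y : M, TangentSpace I y :=
  FiberBundle.extend (EuclideanSpace ℝ (Fin m)) v

/-- The matrix `g_{ij}` of a bilinear form field in the coordinate basis at `x`. -/
def gram (g : Π x : M, TangentSpace I x → TangentSpace I x → ℝ) (x : M) :
    Matrix (Fin m) (Fin m) ℝ :=
  Matrix.of fun i j => g x (coordVec I x i) (coordVec I x j)

/-- Contraction with the inverse metric: `g^{ij} T(e_i, e_j)`. -/
def metricTrace (g : Π x : M, TangentSpace I x → TangentSpace I x → ℝ) (x : M)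
    {W : Type*} [AddCommGroup W] [Module ℝ W]
    (T : TangentSpace I x → TangentSpace I x → W) : W :=
  ∑ i, ∑ j, (gram g x)⁻¹ i j • T (coordVec I x i) (coordVec I x j)

/-- Raising the index of a covector: `(θ^♯)^i = g^{ij} θ_j`. -/
def sharp (g : Π x : M, TangentSpace I x → TangentSpace I x → ℝ) (x : M)
    (θ : TangentSpace I x → ℝ) : TangentSpace I x :=
  metricTrace g x fun u v => θ v • u

/-- The Koszul expression, equal to `g(∇_X Y, Z)` for the Levi-Civita connection of `g`. -/
def koszul (g : Π x : M, TangentSpace I x → TangentSpace I x → ℝ)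
    (X Y Z : Π x : M, TangentSpace I x) (x : M) : ℝ :=
  (1 / 2 : ℝ) *
    (mvfderiv I (fun y => g y (Y y) (Z y)) x (X x)
      + mvfderiv I (fun y => g y (Z y) (X y)) x (Y x)
      - mvfderiv I (fun y => g y (X y) (Y y)) x (Z x)
      + g x (VectorField.mlieBracket I X Y x) (Z x)
      - g x (VectorField.mlieBracket I Y Z x) (X x)
      + g x (VectorField.mlieBracket I Z X x) (Y x))

/-- The Levi-Civita derivative `∇_X Y` at `x`. -/
def leviCivita (g : Π x : M, TangentSpace I x → TangentSpace I x → ℝ)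
    (X Y : Π x : M, TangentSpace I x) (x : M) : TangentSpace I x :=
  sharp g x fun v => koszul g X Y (extendVec v) x

/-- The gradient `n^a = g^{ab} ∇_b r` of a function. -/
def gradient (g : Π x : M, TangentSpace I x → TangentSpace I x → ℝ) (r : M → ℝ) (x : M) :
    TangentSpace I x :=
  sharp g x fun v => mvfderiv I r x v

/-- The unit vector `n̂^a = n^a / |n|_g`, where `n = d r`. -/
def unitNormal (g : Π x : M, TangentSpace I x → TangentSpace I x → ℝ) (r : M → ℝ) (x : M) :
    TangentSpace I x :=
  (Real.sqrt (g x (gradient g r x) (gradient g r x)))⁻¹ • gradient g r x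

variable {F : Type*} [NormedAddCommGroup F] [NormedSpace ℝ F]
  {V : M → Type*} [TopologicalSpace (TotalSpace F V)]
  [∀ x, AddCommGroup (V x)] [∀ x, Module ℝ (V x)] [∀ x, TopologicalSpace (V x)]
  [∀ x, IsTopologicalAddGroup (V x)] [∀ x, ContinuousSMul ℝ (V x)]
  [FiberBundle F V]

/-- `F(X,Y)s = ∇_X ∇_Y s - ∇_Y ∇_X s - ∇_{[X,Y]} s` for vector fields `X`, `Y` and a section `s`.
Recall that `A s x (X x)` is `(∇^A_X s)(x)`. -/
def curvatureOp (A : CovariantDerivative I F V) (X Y : Π x : M, TangentSpace I x)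
    (s : Π x : M, V x) (x : M) : V x :=
  A (fun y => A s y (Y y)) x (X x) - A (fun y => A s y (X y)) x (Y x)
    - A s x (VectorField.mlieBracket I X Y x)

/-- The curvature two-form `F^A` with values in `End V`. -/
def curvature (A : CovariantDerivative I F V) (x : M) (u v : TangentSpace I x) (z : V x) : V x :=
  curvatureOp A (extendVec u) (extendVec v) (FiberBundle.extend F z) x

/-- `(∇_u θ)(v) z` for an `End V`-valued one-form `θ`; `∇` is `A` coupled to Levi-Civita. -/
def covDerivOneForm (A : CovariantDerivative I F V)
    (g : Π x : M, TangentSpace I x → TangentSpace I x → ℝ)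
    (θ : Π x : M, TangentSpace I x → V x → V x)
    (x : M) (u v : TangentSpace I x) (z : V x) : V x :=
  A (fun y => θ y (extendVec v y) (FiberBundle.extend F z y)) x u
    - θ x (leviCivita g (extendVec u) (extendVec v) x) z
    - θ x v (A (FiberBundle.extend F z) x u)

/-- `(∇_u θ)(v, w) z` for an `End V`-valued two-form `θ`; `∇` is `A` coupled to Levi-Civita. -/
def covDerivTwoForm (A : CovariantDerivative I F V)
    (g : Π x : M, TangentSpace I x → TangentSpace I x → ℝ)
    (θ : Π x : M, TangentSpace I x → TangentSpace I x → V x → V x)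
    (x : M) (u v w : TangentSpace I x) (z : V x) : V x :=
  A (fun y => θ y (extendVec v y) (extendVec w y) (FiberBundle.extend F z y)) x u
    - θ x (leviCivita g (extendVec u) (extendVec v) x) w z
    - θ x v (leviCivita g (extendVec u) (extendVec w) x) z
    - θ x v w (A (FiberBundle.extend F z) x u)

/-- The divergence `∇^a θ_a` of an `End V`-valued one-form. -/
def divOneForm (A : CovariantDerivative I F V)
    (g : Π x : M, TangentSpace I x → TangentSpace I x → ℝ)
    (θ : Π x : M, TangentSpace I x → V x → V x) (x : M) (z : V x) : V x :=
  metricTrace g x fun u v => covDerivOneForm A g θ x u v z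

/-- The divergence `∇^a F_{ab}` of the curvature, as an `End V`-valued one-form. -/
def divCurvature (A : CovariantDerivative I F V)
    (g : Π x : M, TangentSpace I x → TangentSpace I x → ℝ)
    (x : M) (w : TangentSpace I x) (z : V x) : V x :=
  metricTrace g x fun u v => covDerivTwoForm A g (curvature A) x u v w z

/-- The conformally compact Yang-Mills current
`j_b = r ∇^a F_{ab} - (m - 4) n^a F_{ab}`, `n = d r`, in the scale `g`, where `m = dim M`. -/
def current (A : CovariantDerivative I F V)
    (g : Π x : M, TangentSpace I x → TangentSpace I x → ℝ) (r : M → ℝ)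
    (x : M) (w : TangentSpace I x) (z : V x) : V x :=
  r x • divCurvature A g x w z - ((m : ℝ) - 4) • curvature A x (gradient g r x) w z

end Calculus

/-! ### Conformally compact structures and density-valued currents -/

section ConformallyCompact

variable (d : ℕ) [NeZero d]
  (M : Type*) [TopologicalSpace M] [ChartedSpace (EuclideanHalfSpace d) M]
  [IsManifold (𝓡∂ d) ∞ M]

/-- Smooth Riemannian metrics on the manifold with boundary `M`. -/
abbrev Metric : Type _ :=
  ContMDiffRiemannianMetric (𝓡∂ d) ∞ (EuclideanSpace ℝ (Fin d))
    (fun x : M => TangentSpace (𝓡∂ d) x)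

variable {d M}

/-- `g' = Ω² g` with `Ω` smooth and positive. -/
def IsRescaling (Ω : M → ℝ) (g g' : Metric d M) : Prop :=
  ContMDiff (𝓡∂ d) 𝓘(ℝ, ℝ) ∞ Ω ∧ (∀ x, 0 < Ω x) ∧
    ∀ (x : M) (u v : TangentSpace (𝓡∂ d) x), g'.inner x u v = Ω x ^ 2 * g.inner x u v

variable (d M)

/-- A conformally compact structure `(M, c, σ)`: a conformal class `c` of metrics and a
non-negative weight one density `σ` (given by its representative in every scale `g ∈ c`)
with `σ⁻¹(0) = ∂M` and `d σ ≠ 0` along `∂M`. -/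
structure ConformallyCompact where
  /-- the metrics of the conformal class -/
  metrics : Set (Metric d M)
  nonempty : metrics.Nonempty
  conformal : ∀ g ∈ metrics, ∀ g' : Metric d M, g' ∈ metrics ↔ ∃ Ω, IsRescaling Ω g g'
  /-- the defining density, in each scale -/
  σ : metrics → M → ℝ
  smooth : ∀ g, ContMDiff (𝓡∂ d) 𝓘(ℝ, ℝ) ∞ (σ g)
  weight : ∀ (g g' : metrics) (Ω : M → ℝ), IsRescaling Ω g.1 g'.1 → ∀ x, σ g' x = Ω x * σ g x
  nonneg : ∀ g x, 0 ≤ σ g x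
  zero_iff : ∀ g x, σ g x = 0 ↔ x ∈ (𝓡∂ d).boundary M
  deriv_ne_zero : ∀ g, ∀ x ∈ (𝓡∂ d).boundary M, mvfderiv (𝓡∂ d) (σ g) x ≠ 0

variable {d M}

/-- A metric as a field of bilinear functions. -/
def Metric.form (g : Metric d M) :
    Π x : M, TangentSpace (𝓡∂ d) x → TangentSpace (𝓡∂ d) x → ℝ :=
  fun x u v => g.inner x u v

variable (F : Type*) [NormedAddCommGroup F] [NormedSpace ℝ F]
  (V : M → Type*) [TopologicalSpace (TotalSpace F V)]
  [∀ x, AddCommGroup (V x)] [∀ x, Module ℝ (V x)] [∀ x, TopologicalSpace (V x)]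
  [∀ x, IsTopologicalAddGroup (V x)] [∀ x, ContinuousSMul ℝ (V x)]
  [FiberBundle F V] [VectorBundle ℝ F V]

/-- Smooth sections of `T*M ⊗ End V [w]`: in each scale `g ∈ c` a smooth `End V`-valued one-form,
with `[g ; k] = [Ω² g ; Ω^w k]`. -/
structure CurrentDensity (c : ConformallyCompact d M) (w : ℤ) where
  /-- the representative in each scale -/
  toFun : c.metrics → Π x : M, TangentSpace (𝓡∂ d) x →L[ℝ] V x →L[ℝ] V x
  smooth : ∀ g, ContMDiff (𝓡∂ d)
    ((𝓡∂ d).prod 𝓘(ℝ, EuclideanSpace ℝ (Fin d) →L[ℝ] F →L[ℝ] F)) ∞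
    (fun x => TotalSpace.mk' (EuclideanSpace ℝ (Fin d) →L[ℝ] F →L[ℝ] F)
      (E := fun x : M => TangentSpace (𝓡∂ d) x →L[ℝ] V x →L[ℝ] V x) x (toFun g x))
  weight : ∀ (g g' : c.metrics) (Ω : M → ℝ), IsRescaling Ω g.1 g'.1 →
    ∀ x, toFun g' x = Ω x ^ w • toFun g x

variable {F V}

/-- `j[A] = σ^ℓ k`, as an identity of densities, i.e. in every scale of the conformal class. -/
def CurrentEq (c : ConformallyCompact d M) (A : CovariantDerivative (𝓡∂ d) F V)
    (ℓ : ℕ) {w : ℤ} (k : CurrentDensity F V c w) : Prop :=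
  ∀ (g : c.metrics) (x : M) (v : TangentSpace (𝓡∂ d) x) (z : V x),
    current A g.1.form (c.σ g) x v z = (c.σ g x) ^ ℓ • k.toFun g x v z

/-- Asymptotically Yang-Mills connections: smooth, with `j[A] = σ^{d-4} k` for a smooth
`k ∈ Γ(T*M ⊗ End V [3-d])`. -/
def IsAsymptoticallyYM (c : ConformallyCompact d M) (A : CovariantDerivative (𝓡∂ d) F V) :
    Prop :=
  A.ContMDiffCovariantDerivative ∞ ∧
    ∃ k : CurrentDensity F V c (3 - (d : ℤ)), CurrentEq c A (d - 4) k

/-- `j[A] = O(σ^∞)`: for every `ℓ` one has `j[A] = σ^ℓ k` with `k ∈ Γ(T*M ⊗ End V [-1-ℓ])`. -/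
def CurrentVanishesToInfiniteOrder (c : ConformallyCompact d M)
    (A : CovariantDerivative (𝓡∂ d) F V) : Prop :=
  ∀ ℓ : ℕ, ∃ k : CurrentDensity F V c (-1 - (ℓ : ℤ)), CurrentEq c A ℓ k

end ConformallyCompact

/-! ### The boundary -/

section PullbackInstances

variable {B B' : Type*} {F : Type*} {V : B → Type*} (f : B' → B) (x : B')

instance [∀ y, AddCommGroup (V y)] : AddCommGroup ((f *ᵖ V) x) :=
  inferInstanceAs (AddCommGroup (V (f x)))

instance [∀ y, AddCommGroup (V y)] [∀ y, TopologicalSpace (V y)]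
    [h : ∀ y, IsTopologicalAddGroup (V y)] : IsTopologicalAddGroup ((f *ᵖ V) x) :=
  h (f x)

instance [∀ y, AddCommGroup (V y)] [∀ y, Module ℝ (V y)] [∀ y, TopologicalSpace (V y)]
    [h : ∀ y, ContinuousSMul ℝ (V y)] : ContinuousSMul ℝ ((f *ᵖ V) x) :=
  h (f x)

end PullbackInstances

section Boundary

variable {d : ℕ} [NeZero d]
  {M : Type*} [TopologicalSpace M] [ChartedSpace (EuclideanHalfSpace d) M]
  [IsManifold (𝓡∂ d) ∞ M]
  {S : Type*} [TopologicalSpace S] [ChartedSpace (EuclideanSpace ℝ (Fin (d - 1))) S]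
  [IsManifold (𝓡 (d - 1)) ∞ S]

/-- `ι : S → M` presents the manifold `S` as the boundary of `M`. -/
def IsBoundaryInclusion (ι : C^∞⟮𝓡 (d - 1), S; 𝓡∂ d, M⟯) : Prop :=
  Manifold.IsSmoothEmbedding (𝓡 (d - 1)) (𝓡∂ d) ∞ ι ∧ Set.range ι = (𝓡∂ d).boundary M

/-- The tangent vector of `M` along the boundary given by a tangent vector of the boundary. -/
def pushVec (ι : C^∞⟮𝓡 (d - 1), S; 𝓡∂ d, M⟯) {y : S} (v : TangentSpace (𝓡 (d - 1)) y) :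
    TangentSpace (𝓡∂ d) (ι y) :=
  mfderiv (𝓡 (d - 1)) (𝓡∂ d) ι y v

/-- The metric `ḡ = ι* g` induced on the boundary. -/
def boundaryForm (ι : C^∞⟮𝓡 (d - 1), S; 𝓡∂ d, M⟯) (g : Metric d M) :
    Π y : S, TangentSpace (𝓡 (d - 1)) y → TangentSpace (𝓡 (d - 1)) y → ℝ :=
  fun y u v => g.inner (ι y) (pushVec ι u) (pushVec ι v)

variable {F : Type*} [NormedAddCommGroup F] [NormedSpace ℝ F]
  {V : M → Type*} [TopologicalSpace (TotalSpace F V)]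
  [∀ x, AddCommGroup (V x)] [∀ x, Module ℝ (V x)] [∀ x, TopologicalSpace (V x)]
  [∀ x, IsTopologicalAddGroup (V x)] [∀ x, ContinuousSMul ℝ (V x)]
  [FiberBundle F V] [VectorBundle ℝ F V]

/-- `∇^A` has boundary condition `∇̄`: for `v` tangent to the boundary and `s` a smooth section of
`V` one has `∇̄_v (s|_∂M) = ∇^A_v s`. -/
def HasBoundaryCondition (ι : C^∞⟮𝓡 (d - 1), S; 𝓡∂ d, M⟯)
    (A : CovariantDerivative (𝓡∂ d) F V)
    (Abar : CovariantDerivative (𝓡 (d - 1)) F (ι *ᵖ V)) : Prop :=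
  ∀ s : Π x : M, V x,
    ContMDiff (𝓡∂ d) ((𝓡∂ d).prod 𝓘(ℝ, F)) ∞ (fun x => TotalSpace.mk' F x (s x)) →
    ∀ (y : S) (v : TangentSpace (𝓡 (d - 1)) y),
      Abar (fun y' => s (ι y')) y v = A s (ι y) (pushVec ι v)

variable (F V) in
/-- Smooth sections of `T*∂M ⊗ End V|_∂M [w]`, represented in each scale `g ∈ c`. -/
structure BoundaryCurrentDensity (c : ConformallyCompact d M)
    (ι : C^∞⟮𝓡 (d - 1), S; 𝓡∂ d, M⟯) (w : ℤ) where
  /-- the representative in each scale -/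
  toFun : c.metrics →
    Π y : S, TangentSpace (𝓡 (d - 1)) y →L[ℝ] (ι *ᵖ V) y →L[ℝ] (ι *ᵖ V) y
  smooth : ∀ g, ContMDiff (𝓡 (d - 1))
    ((𝓡 (d - 1)).prod 𝓘(ℝ, EuclideanSpace ℝ (Fin (d - 1)) →L[ℝ] F →L[ℝ] F)) ∞
    (fun y => TotalSpace.mk' (EuclideanSpace ℝ (Fin (d - 1)) →L[ℝ] F →L[ℝ] F)
      (E := fun y : S => TangentSpace (𝓡 (d - 1)) y →L[ℝ] (ι *ᵖ V) y →L[ℝ] (ι *ᵖ V) y)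
      y (toFun g y))
  weight : ∀ (g g' : c.metrics) (Ω : M → ℝ), IsRescaling Ω g.1 g'.1 →
    ∀ y, toFun g' y = Ω (ι y) ^ w • toFun g y

/-- `kbar` is the obstruction current of the boundary connection `Abar`: the restriction to the
boundary of `k`, for an asymptotically Yang-Mills connection with boundary condition `Abar` and
`j[A] = σ^{d-4} k`. -/
def IsObstructionCurrent (c : ConformallyCompact d M) (ι : C^∞⟮𝓡 (d - 1), S; 𝓡∂ d, M⟯)
    (Abar : CovariantDerivative (𝓡 (d - 1)) F (ι *ᵖ V))
    (kbar : BoundaryCurrentDensity F V c ι (3 - (d : ℤ))) : Prop :=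
  ∃ A : CovariantDerivative (𝓡∂ d) F V, A.ContMDiffCovariantDerivative ∞ ∧
    HasBoundaryCondition ι A Abar ∧
    ∃ k : CurrentDensity F V c (3 - (d : ℤ)), CurrentEq c A (d - 4) k ∧
      ∀ (g : c.metrics) (y : S) (v : TangentSpace (𝓡 (d - 1)) y) (z : V (ι y)),
        kbar.toFun g y v z = k.toFun g (ι y) (pushVec ι v) z

/-- The modified Gauss law `∇̄_a E^a = (d-3)⁻¹ n̂^a k_a` along the boundary, in every scale. -/
def GaussLaw (c : ConformallyCompact d M) (ι : C^∞⟮𝓡 (d - 1), S; 𝓡∂ d, M⟯)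
    (Abar : CovariantDerivative (𝓡 (d - 1)) F (ι *ᵖ V))
    (E : BoundaryCurrentDensity F V c ι (3 - (d : ℤ)))
    (k : CurrentDensity F V c (2 - (d : ℤ))) : Prop :=
  ∀ (g : c.metrics) (y : S) (z : V (ι y)),
    divOneForm Abar (boundaryForm ι g.1) (fun y' v z' => E.toFun g y' v z') y z =
      (1 / ((d : ℝ) - 3)) • k.toFun g (ι y) (unitNormal g.1.form (c.σ g) (ι y)) z

end Boundary

end YangMills

end

noncomputable section

namespace YangMills

/-! ### Yang-Mills calculus in an algebra with commuting derivations -/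

/-- A family of commuting derivations of a commutative ring `R` and of an `R`-algebra `A`. -/
structure DiffAlg (κ R A : Type*) [CommRing R] [Ring A] [Algebra R A] where
  /-- the derivations of the scalars -/
  dR : κ → R →+ R
  /-- the derivations of the algebra -/
  dA : κ → A →+ A
  dR_mul : ∀ i f g, dR i (f * g) = dR i f * g + f * dR i g
  dA_mul : ∀ i X Y, dA i (X * Y) = dA i X * Y + X * dA i Y
  dA_smul : ∀ i (f : R) (X : A), dA i (f • X) = dR i f • X + f • dA i X
  dR_comm : ∀ i j f, dR i (dR j f) = dR j (dR i f)
  dA_comm : ∀ i j X, dA i (dA j X) = dA j (dA i X)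

namespace DiffAlg

variable {κ R A : Type*} [CommRing R] [Ring A] [Algebra R A] (𝔇 : DiffAlg κ R A)

lemma dR_one (i : κ) : 𝔇.dR i 1 = 0 := by
  have h := 𝔇.dR_mul i 1 1
  simpa using h

lemma dA_one (i : κ) : 𝔇.dA i 1 = 0 := by
  have h := 𝔇.dA_mul i 1 1
  simpa using h

lemma dR_pow_succ (i : κ) (s : R) (n : ℕ) :
    𝔇.dR i (s ^ (n + 1)) = ((n + 1 : ℕ) : R) * s ^ n * 𝔇.dR i s := by
  induction n with
  | zero => simp
  | succ n ih =>
    rw [pow_succ, 𝔇.dR_mul, ih]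
    push_cast
    ring

lemma mul_dR_pow (i : κ) (s : R) (n : ℕ) :
    s * 𝔇.dR i (s ^ n) = (n : R) * s ^ n * 𝔇.dR i s := by
  cases n with
  | zero => simp [dR_one]
  | succ n => rw [dR_pow_succ]; push_cast; ring

/-- The covariant derivative `D_i Y = ∂_i Y + [Γ_i, Y]`. -/
def cov (Γ : κ → A) (i : κ) : A →+ A where
  toFun Y := 𝔇.dA i Y + Γ i * Y - Y * Γ i
  map_zero' := by simp
  map_add' X Y := by rw [map_add, mul_add, add_mul]; abel

lemma cov_apply (Γ : κ → A) (i : κ) (Y : A) : 𝔇.cov Γ i Y = 𝔇.dA i Y + Γ i * Y - Y * Γ i := rfl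

/-- The curvature `F_ij = ∂_i Γ_j - ∂_j Γ_i + [Γ_i, Γ_j]`. -/
def curv (Γ : κ → A) (i j : κ) : A := 𝔇.dA i (Γ j) - 𝔇.dA j (Γ i) + Γ i * Γ j - Γ j * Γ i

lemma curv_swap (Γ : κ → A) (i j : κ) : 𝔇.curv Γ j i = -𝔇.curv Γ i j := by
  simp only [curv]; abel

lemma cov_smul (Γ : κ → A) (i : κ) (f : R) (Y : A) :
    𝔇.cov Γ i (f • Y) = 𝔇.dR i f • Y + f • 𝔇.cov Γ i Y := by
  simp only [cov_apply, 𝔇.dA_smul, mul_smul_comm, smul_mul_assoc]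
  module

lemma cov_comm (Γ : κ → A) (i j : κ) (Y : A) :
    𝔇.cov Γ i (𝔇.cov Γ j Y) - 𝔇.cov Γ j (𝔇.cov Γ i Y) =
      𝔇.curv Γ i j * Y - Y * 𝔇.curv Γ i j := by
  simp only [cov_apply, curv, map_add, map_sub, 𝔇.dA_mul, 𝔇.dA_comm j i]
  noncomm_ring

variable [Fintype κ]

/-- The densitized curvature bivector `ρ F^{ab}`. -/
def flux (ρ : R) (P : κ → κ → R) (Γ : κ → A) (a b : κ) : A :=
  ∑ c, ∑ e, (ρ * P a c * P b e) • 𝔇.curv Γ c e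

/-- The densitized current `ρ j^b = σ D_a (ρ F^{ab}) - q ∂_a σ (ρ F^{ab})`. -/
def cur (s q ρ : R) (P : κ → κ → R) (Γ : κ → A) (b : κ) : A :=
  ∑ a, (s • 𝔇.cov Γ a (𝔇.flux ρ P Γ a b) - (q * 𝔇.dR a s) • 𝔇.flux ρ P Γ a b)

variable {ρ : R} {P : κ → κ → R}

lemma flux_swap (Γ : κ → A) (a b : κ) : 𝔇.flux ρ P Γ b a = -𝔇.flux ρ P Γ a b := by
  simp only [flux]
  rw [Finset.sum_comm, ← Finset.sum_neg_distrib]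
  refine Finset.sum_congr rfl fun c _ => ?_
  rw [← Finset.sum_neg_distrib]
  refine Finset.sum_congr rfl fun e _ => ?_
  rw [𝔇.curv_swap Γ c e, smul_neg]
  congr 2
  ring

/-- Two contractions with an antisymmetric object against a symmetric one cancel. -/
lemma sum_antisymm {B : Type*} [AddCommGroup B] (h2 : ∀ x : B, x + x = 0 → x = 0)
    (f : κ → κ → B) (hf : ∀ a b, f b a = -f a b) : ∑ a, ∑ b, f a b = 0 := by
  apply h2
  nth_rewrite 2 [Finset.sum_comm]
  simp only [← Finset.sum_add_distrib]
  refine Finset.sum_eq_zero fun a _ => Finset.sum_eq_zero fun b _ => ?_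
  rw [hf a b]; abel

omit [Fintype κ] in
lemma double_zero (h2 : IsUnit (2 : R)) (x : A) (hx : x + x = 0) : x = 0 := by
  have : (2 : R) • x = 0 := by rw [two_smul, hx]
  obtain ⟨u, hu⟩ := h2
  rw [← hu] at this
  exact (smul_eq_zero_iff_eq u).1 this

/-- `D_b D_a (ρ F^{ab}) = 0`. -/
lemma cov_cov_flux (h2 : IsUnit (2 : R)) (hP : ∀ a b, P a b = P b a) (Γ : κ → A) :
    ∑ b, ∑ a, 𝔇.cov Γ b (𝔇.cov Γ a (𝔇.flux ρ P Γ a b)) = 0 := by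
  apply double_zero h2
  have h1 : ∑ b, ∑ a, 𝔇.cov Γ b (𝔇.cov Γ a (𝔇.flux ρ P Γ a b)) =
      -∑ b, ∑ a, 𝔇.cov Γ a (𝔇.cov Γ b (𝔇.flux ρ P Γ a b)) := by
    rw [Finset.sum_comm, ← Finset.sum_neg_distrib]
    refine Finset.sum_congr rfl fun c _ => ?_
    rw [← Finset.sum_neg_distrib]
    refine Finset.sum_congr rfl fun e _ => ?_
    rw [𝔇.flux_swap Γ e c, map_neg, map_neg]
  nth_rewrite 2 [h1]
  rw [← sub_eq_add_neg, ← Finset.sum_sub_distrib]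
  simp only [← Finset.sum_sub_distrib, cov_comm]
  rw [Finset.sum_congr rfl fun b _ => Finset.sum_sub_distrib _ _, Finset.sum_sub_distrib, sub_eq_zero]
  simp only [flux, Finset.mul_sum, Finset.sum_mul, mul_smul_comm, smul_mul_assoc]
  -- relabel
  have e1 : ∀ f : κ → κ → κ → κ → A, ∑ b, ∑ a, ∑ c, ∑ e, f b a c e =
      ∑ b, ∑ a, ∑ c, ∑ e, f e c a b := by
    intro f
    calc ∑ b, ∑ a, ∑ c, ∑ e, f b a c e
        = ∑ x : κ × κ × κ × κ, f x.1 x.2.1 x.2.2.1 x.2.2.2 := by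
          simp only [Fintype.sum_prod_type]
      _ = ∑ x : κ × κ × κ × κ, f x.2.2.2 x.2.2.1 x.2.1 x.1 :=
          Fintype.sum_equiv ⟨fun x => (x.2.2.2, x.2.2.1, x.2.1, x.1),
            fun x => (x.2.2.2, x.2.2.1, x.2.1, x.1), fun _ => rfl, fun _ => rfl⟩ _ _ fun _ => rfl
      _ = _ := by simp only [Fintype.sum_prod_type]
  rw [e1]
  refine Finset.sum_congr rfl fun b _ => Finset.sum_congr rfl fun a _ =>
    Finset.sum_congr rfl fun c _ => Finset.sum_congr rfl fun e _ => ?_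
  rw [𝔇.curv_swap Γ c e, 𝔇.curv_swap Γ a b, hP a c, hP b e, mul_neg, neg_mul]

/-- The divergence identity `σ D_b (ρ j^b) = (q + 1) ∂_b σ (ρ j^b)`. -/
lemma div_cur (h2 : IsUnit (2 : R)) (hP : ∀ a b, P a b = P b a) (s : R) (q : ℕ) (Γ : κ → A) :
    ∑ b, s • 𝔇.cov Γ b (𝔇.cur s q ρ P Γ b) =
      ∑ b, (((q + 1 : ℕ) : R) * 𝔇.dR b s) • 𝔇.cur s q ρ P Γ b := by
  have hA : ∀ x : A, x + x = 0 → x = 0 := double_zero h2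
  set G := 𝔇.flux ρ P Γ with hG
  have z1 : ∑ b, ∑ a, (s * s) • 𝔇.cov Γ b (𝔇.cov Γ a (G a b)) = 0 := by
    simp only [← Finset.smul_sum]
    rw [hG, 𝔇.cov_cov_flux h2 hP, smul_zero]
  have z2 : ∑ b, ∑ a, (s * q * 𝔇.dR b (𝔇.dR a s)) • G a b = 0 :=
    sum_antisymm hA _ fun a b => by
      rw [hG, 𝔇.flux_swap Γ a b, 𝔇.dR_comm b a, smul_neg, neg_neg]
  have z3 : ∑ b, ∑ a, (((q + 1 : ℕ) : R) * q * 𝔇.dR a s * 𝔇.dR b s) • G a b = 0 :=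
    sum_antisymm hA _ fun a b => by
      rw [hG, 𝔇.flux_swap Γ a b, smul_neg, neg_neg]
      congr 1
      ring
  have z4 : ∑ b, ∑ a, (s * 𝔇.dR a s) • 𝔇.cov Γ b (G a b) =
      -∑ b, ∑ a, (s * 𝔇.dR b s) • 𝔇.cov Γ a (G a b) := by
    rw [Finset.sum_comm, ← Finset.sum_neg_distrib]
    refine Finset.sum_congr rfl fun a _ => ?_
    rw [← Finset.sum_neg_distrib]
    refine Finset.sum_congr rfl fun b _ => ?_
    rw [hG, 𝔇.flux_swap Γ b a, map_neg, smul_neg]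
  have lhs : ∑ b, s • 𝔇.cov Γ b (𝔇.cur s q ρ P Γ b) =
      ∑ b, ∑ a, (s * 𝔇.dR b s) • 𝔇.cov Γ a (G a b)
        + ∑ b, ∑ a, (s * s) • 𝔇.cov Γ b (𝔇.cov Γ a (G a b))
        - (∑ b, ∑ a, (s * q * 𝔇.dR b (𝔇.dR a s)) • G a b
          + (q : R) • ∑ b, ∑ a, (s * 𝔇.dR a s) • 𝔇.cov Γ b (G a b)) := by
    simp only [← Finset.sum_add_distrib, ← Finset.sum_sub_distrib, Finset.smul_sum, cur, map_sum,
      map_sub, cov_smul, 𝔇.dR_mul, ← hG]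
    refine Finset.sum_congr rfl fun b _ => Finset.sum_congr rfl fun a _ => ?_
    have : 𝔇.dR b (q : R) = 0 := by
      have := 𝔇.dR_one b
      rw [← nsmul_one, map_nsmul, this, smul_zero]
    rw [this]
    module
  have rhs : ∑ b, (((q + 1 : ℕ) : R) * 𝔇.dR b s) • 𝔇.cur s q ρ P Γ b =
      ((q + 1 : ℕ) : R) • ∑ b, ∑ a, (s * 𝔇.dR b s) • 𝔇.cov Γ a (G a b)
        - ∑ b, ∑ a, (((q + 1 : ℕ) : R) * q * 𝔇.dR a s * 𝔇.dR b s) • G a b := by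
    simp only [← Finset.sum_sub_distrib, Finset.smul_sum, cur, ← hG]
    refine Finset.sum_congr rfl fun b _ => Finset.sum_congr rfl fun a _ => ?_
    module
  rw [lhs, rhs, z1, z2, z3, z4]
  push_cast
  module

/-! #### Variation of the connection -/

omit [Fintype κ] in
lemma cov_add (Γ δ : κ → A) (i : κ) (Y : A) :
    𝔇.cov (fun j => Γ j + δ j) i Y = 𝔇.cov Γ i Y + (δ i * Y - Y * δ i) := by
  simp only [cov_apply, add_mul, mul_add]
  abel

/-- The remainder in the variation of the curvature. -/
def curvRem (s : R) (ℓ : ℕ) (Γ a : κ → A) (i j : κ) : A :=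
  𝔇.cov Γ i (a j) - 𝔇.cov Γ j (a i) + s ^ ℓ • (a i * a j - a j * a i)

omit [Fintype κ] in
lemma curv_add (s : R) (k : ℕ) (Γ a : κ → A) (i j : κ) :
    𝔇.curv (fun j => Γ j + s ^ (k + 1) • a j) i j = 𝔇.curv Γ i j
      + (((k + 1 : ℕ) : R) * s ^ k) • (𝔇.dR i s • a j - 𝔇.dR j s • a i)
      + s ^ (k + 1) • 𝔇.curvRem s (k + 1) Γ a i j := by
  simp only [curv, curvRem, cov_apply, map_add, 𝔇.dA_smul, dR_pow_succ, add_mul, mul_add,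
    mul_smul_comm, smul_mul_assoc]
  module

omit [Fintype κ] in
lemma curvRem_swap (s : R) (ℓ : ℕ) (Γ a : κ → A) (i j : κ) :
    𝔇.curvRem s ℓ Γ a j i = -𝔇.curvRem s ℓ Γ a i j := by
  simp only [curvRem, smul_sub]; abel

/-- Raising an index. -/
def raise (P : κ → κ → R) (a : κ → A) (b : κ) : A := ∑ e, P b e • a e

/-- Raising the index of the differential of a scalar. -/
def grad (P : κ → κ → R) (s : R) (b : κ) : R := ∑ e, P b e * 𝔇.dR e s

/-- `|dσ|²` -/
def normSq (P : κ → κ → R) (s : R) : R := ∑ b, 𝔇.dR b s * 𝔇.grad P s b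

/-- `n^b a_b` -/
def normalPart (P : κ → κ → R) (s : R) (a : κ → A) : A := ∑ b, 𝔇.dR b s • raise P a b

/-- The leading part of the variation of the densitized curvature. -/
def fluxLead (s ρ : R) (P : κ → κ → R) (a : κ → A) (i j : κ) : A :=
  ρ • (𝔇.grad P s i • raise P a j - 𝔇.grad P s j • raise P a i)

/-- The remainder in the variation of the densitized curvature. -/
def fluxRem (s ρ : R) (P : κ → κ → R) (ℓ : ℕ) (Γ a : κ → A) (i j : κ) : A :=
  ∑ c, ∑ e, (ρ * P i c * P j e) • 𝔇.curvRem s ℓ Γ a c e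

lemma flux_add (s : R) (k : ℕ) (Γ a : κ → A) (i j : κ) :
    𝔇.flux ρ P (fun j => Γ j + s ^ (k + 1) • a j) i j = 𝔇.flux ρ P Γ i j
      + (((k + 1 : ℕ) : R) * s ^ k) • 𝔇.fluxLead s ρ P a i j
      + s ^ (k + 1) • 𝔇.fluxRem s ρ P (k + 1) Γ a i j := by
  have h1 : 𝔇.fluxLead s ρ P a i j =
      ∑ c, ∑ e, (ρ * P i c * P j e) • (𝔇.dR c s • a e - 𝔇.dR e s • a c) := by
    simp only [fluxLead, raise, grad, smul_sub, Finset.sum_sub_distrib, Finset.sum_smul,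
      Finset.smul_sum]
    congr 1
    · rw [Finset.sum_comm]
      refine Finset.sum_congr rfl fun c _ => Finset.sum_congr rfl fun e _ => ?_
      module
    · refine Finset.sum_congr rfl fun c _ => Finset.sum_congr rfl fun e _ => ?_
      module
  simp only [h1, flux, fluxRem, curv_add, Finset.smul_sum, ← Finset.sum_add_distrib]
  refine Finset.sum_congr rfl fun c _ => Finset.sum_congr rfl fun e _ => ?_
  module

lemma fluxRem_swap (s : R) (ℓ : ℕ) (Γ a : κ → A) (i j : κ) :
    𝔇.fluxRem s ρ P ℓ Γ a j i = -𝔇.fluxRem s ρ P ℓ Γ a i j := by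
  simp only [fluxRem]
  rw [Finset.sum_comm, ← Finset.sum_neg_distrib]
  refine Finset.sum_congr rfl fun c _ => ?_
  rw [← Finset.sum_neg_distrib]
  refine Finset.sum_congr rfl fun e _ => ?_
  rw [𝔇.curvRem_swap s ℓ Γ a c e, smul_neg]
  congr 2
  ring

/-- First variation of the current along `σ^(k+1) a`: the leading part is algebraic in `a`. -/
lemma cur_add (s : R) (q k : ℕ) (Γ a : κ → A) (b : κ) : ∃ Y : A,
    𝔇.cur s q ρ P (fun j => Γ j + s ^ (k + 1) • a j) b = 𝔇.cur s q ρ P Γ b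
      + (((k + 1 : ℕ) : R) * ((k : R) - q) * s ^ k * ρ) •
          (𝔇.normSq P s • raise P a b - 𝔇.grad P s b • 𝔇.normalPart P s a)
      + s ^ (k + 1) • Y := by
  have key : ∀ i, ∃ Y : A,
      s • 𝔇.cov (fun j => Γ j + s ^ (k + 1) • a j) i
          (𝔇.flux ρ P (fun j => Γ j + s ^ (k + 1) • a j) i b)
        - ((q : R) * 𝔇.dR i s) • 𝔇.flux ρ P (fun j => Γ j + s ^ (k + 1) • a j) i b
      = (s • 𝔇.cov Γ i (𝔇.flux ρ P Γ i b) - ((q : R) * 𝔇.dR i s) • 𝔇.flux ρ P Γ i b)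
        + (((k + 1 : ℕ) : R) * ((k : R) - q) * s ^ k) • (𝔇.dR i s • 𝔇.fluxLead s ρ P a i b)
        + s ^ (k + 1) • Y := by
    intro i
    rw [cov_add, flux_add, map_add, map_add, cov_smul, cov_smul]
    have e1 : 𝔇.dR i (((k + 1 : ℕ) : R) * s ^ k) = ((k + 1 : ℕ) : R) * 𝔇.dR i (s ^ k) := by
      rw [← nsmul_eq_mul, map_nsmul, nsmul_eq_mul]
    have e2 := 𝔇.mul_dR_pow i s k
    set L := 𝔇.fluxLead s ρ P a i b
    set Q := 𝔇.fluxRem s ρ P (k + 1) Γ a i b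
    set G := 𝔇.flux ρ P Γ i b
    set G' := G + (((k + 1 : ℕ) : R) * s ^ k) • L + s ^ (k + 1) • Q
    refine ⟨s • (a i * G' - G' * a i) + ((k + 1 : ℕ) : R) • 𝔇.cov Γ i L
      + (((k + 1 : ℕ) : R) * 𝔇.dR i s) • Q + s • 𝔇.cov Γ i Q - ((q : R) * 𝔇.dR i s) • Q, ?_⟩
    rw [e1, dR_pow_succ, smul_mul_assoc, mul_smul_comm]
    have e3 : s • (((k + 1 : ℕ) : R) * 𝔇.dR i (s ^ k)) • L =
        (((k + 1 : ℕ) : R) * ((k : R) * s ^ k * 𝔇.dR i s)) • L := by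
      rw [← e2]; module
    simp only [smul_add]
    rw [e3]
    simp only [G']
    push_cast
    module
  choose Y hY using key
  refine ⟨∑ i, Y i, ?_⟩
  have e4 : ∑ i, 𝔇.dR i s • 𝔇.fluxLead s ρ P a i b =
      ρ • (𝔇.normSq P s • raise P a b - 𝔇.grad P s b • 𝔇.normalPart P s a) := by
    simp only [fluxLead, normSq, normalPart, Finset.sum_smul, Finset.smul_sum, smul_sub,
      Finset.sum_sub_distrib]
    congr 1 <;> refine Finset.sum_congr rfl fun i _ => ?_ <;> module
  simp only [cur]
  rw [Finset.sum_congr rfl fun i _ => hY i, Finset.sum_add_distrib, Finset.sum_add_distrib,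
    ← Finset.smul_sum, ← Finset.smul_sum, e4, smul_smul]

/-- The normal component of the current is `σ D_a (ρ F^{ab} n_b)`. -/
lemma normal_cur (h2 : IsUnit (2 : R)) (s : R) (q : ℕ) (Γ : κ → A) :
    ∑ b, 𝔇.dR b s • 𝔇.cur s q ρ P Γ b =
      ∑ i, s • 𝔇.cov Γ i (∑ b, 𝔇.dR b s • 𝔇.flux ρ P Γ i b) := by
  have hA : ∀ x : A, x + x = 0 → x = 0 := double_zero h2
  have z1 : ∑ b, ∑ i, ((q : R) * 𝔇.dR b s * 𝔇.dR i s) • 𝔇.flux ρ P Γ i b = 0 :=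
    sum_antisymm hA _ fun a b => by
      rw [𝔇.flux_swap Γ a b, smul_neg, neg_neg]; congr 1; ring
  have z2 : ∑ i, ∑ b, (s * 𝔇.dR i (𝔇.dR b s)) • 𝔇.flux ρ P Γ i b = 0 :=
    sum_antisymm hA _ fun a b => by
      rw [𝔇.flux_swap Γ a b, 𝔇.dR_comm b a, smul_neg]
  have lhs : ∑ b, 𝔇.dR b s • 𝔇.cur s q ρ P Γ b =
      ∑ i, ∑ b, (s * 𝔇.dR b s) • 𝔇.cov Γ i (𝔇.flux ρ P Γ i b)
        - ∑ b, ∑ i, ((q : R) * 𝔇.dR b s * 𝔇.dR i s) • 𝔇.flux ρ P Γ i b := by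
    rw [Finset.sum_comm]
    simp only [cur, Finset.smul_sum, ← Finset.sum_sub_distrib]
    refine Finset.sum_congr rfl fun b _ => Finset.sum_congr rfl fun i _ => ?_
    module
  have rhs : ∑ i, s • 𝔇.cov Γ i (∑ b, 𝔇.dR b s • 𝔇.flux ρ P Γ i b) =
      ∑ i, ∑ b, (s * 𝔇.dR i (𝔇.dR b s)) • 𝔇.flux ρ P Γ i b
        + ∑ i, ∑ b, (s * 𝔇.dR b s) • 𝔇.cov Γ i (𝔇.flux ρ P Γ i b) := by
    simp only [map_sum, cov_smul, Finset.smul_sum, ← Finset.sum_add_distrib]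
    refine Finset.sum_congr rfl fun b _ => Finset.sum_congr rfl fun i _ => ?_
    module
  rw [lhs, rhs, z1, z2, sub_zero, zero_add]

/-- First variation of the normal component of the current along `σ^(k+1) a`, to the next order. -/
lemma normal_cur_add (h2 : IsUnit (2 : R)) (s : R) (q k : ℕ) (Γ a : κ → A) :
    ∃ Y : A,
    ∑ b, 𝔇.dR b s • 𝔇.cur s q ρ P (fun j => Γ j + s ^ (k + 1) • a j) b =
      ∑ b, 𝔇.dR b s • 𝔇.cur s q ρ P Γ b
      + (((k + 1 : ℕ) : R) * s ^ (k + 1)) • ∑ i, 𝔇.cov Γ i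
          (ρ • (𝔇.grad P s i • 𝔇.normalPart P s a - 𝔇.normSq P s • raise P a i))
      + s ^ (k + 2) • Y := by
  have hA : ∀ x : A, x + x = 0 → x = 0 := double_zero h2
  rw [𝔇.normal_cur h2, 𝔇.normal_cur h2]
  set Γ' : κ → A := fun j => Γ j + s ^ (k + 1) • a j with hΓ'
  obtain ⟨L, hL⟩ : ∃ L : κ → A, L = fun i =>
    ρ • (𝔇.grad P s i • 𝔇.normalPart P s a - 𝔇.normSq P s • raise P a i) := ⟨_, rfl⟩
  have hL' : ∀ i, ρ • (𝔇.grad P s i • 𝔇.normalPart P s a - 𝔇.normSq P s • raise P a i) = L i :=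
    fun i => by rw [hL]
  simp only [hL']
  set Q : κ → A := fun i => ∑ b, 𝔇.dR b s • 𝔇.fluxRem s ρ P (k + 1) Γ a i b with hQ
  set m : κ → A := fun i => ∑ b, 𝔇.dR b s • 𝔇.flux ρ P Γ i b with hm
  have hm' : ∀ i, ∑ b, 𝔇.dR b s • 𝔇.flux ρ P Γ' i b =
      m i + (((k + 1 : ℕ) : R) * s ^ k) • L i + s ^ (k + 1) • Q i := by
    intro i
    have hLi : L i = ∑ b, 𝔇.dR b s • 𝔇.fluxLead s ρ P a i b := by
      simp only [hL, fluxLead, normSq, normalPart, Finset.sum_smul, Finset.smul_sum, smul_sub,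
        Finset.sum_sub_distrib]
      congr 1 <;> refine Finset.sum_congr rfl fun i _ => ?_ <;> module
    simp only [hLi, hm, hQ, Finset.smul_sum, ← Finset.sum_add_distrib]
    refine Finset.sum_congr rfl fun b _ => ?_
    rw [flux_add]
    module
  have zL : ∑ i, 𝔇.dR i s • L i = 0 := by
    simp only [hL, normSq, normalPart]
    have : ∀ i, 𝔇.dR i s • ρ • (𝔇.grad P s i • (∑ b, 𝔇.dR b s • raise P a b)
        - (∑ b, 𝔇.dR b s * 𝔇.grad P s b) • raise P a i) =
        (ρ * (𝔇.dR i s * 𝔇.grad P s i)) • (∑ b, 𝔇.dR b s • raise P a b) -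
        (ρ * (∑ b, 𝔇.dR b s * 𝔇.grad P s b)) • (𝔇.dR i s • raise P a i) := fun i => by module
    rw [Finset.sum_congr rfl fun i _ => this i, Finset.sum_sub_distrib, ← Finset.sum_smul,
      ← Finset.smul_sum, ← Finset.mul_sum, sub_self]
  have zQ : ∑ i, 𝔇.dR i s • Q i = 0 := by
    simp only [hQ, Finset.smul_sum, smul_smul]
    exact sum_antisymm hA _ fun a' b => by
      rw [𝔇.fluxRem_swap s (k + 1) Γ a a' b, smul_neg, mul_comm]
  refine ⟨∑ i, ((a i * (∑ b, 𝔇.dR b s • 𝔇.flux ρ P Γ' i b)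
      - (∑ b, 𝔇.dR b s • 𝔇.flux ρ P Γ' i b) * a i) + 𝔇.cov Γ i (Q i)), ?_⟩
  have key : ∀ i, s • 𝔇.cov Γ' i (∑ b, 𝔇.dR b s • 𝔇.flux ρ P Γ' i b) =
      s • 𝔇.cov Γ i (m i) + (((k + 1 : ℕ) : R) * s ^ (k + 1)) • 𝔇.cov Γ i (L i)
      + s ^ (k + 2) • ((a i * (∑ b, 𝔇.dR b s • 𝔇.flux ρ P Γ' i b)
      - (∑ b, 𝔇.dR b s • 𝔇.flux ρ P Γ' i b) * a i) + 𝔇.cov Γ i (Q i))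
      + (((k + 1 : ℕ) : R) * k * s ^ k) • 𝔇.dR i s • L i
      + (((k + 1 : ℕ) : R) * s ^ (k + 1)) • 𝔇.dR i s • Q i := by
    intro i
    rw [hΓ', cov_add, ← hΓ', hm']
    set G' := m i + (((k + 1 : ℕ) : R) * s ^ k) • L i + s ^ (k + 1) • Q i with hG'
    have : 𝔇.cov Γ i G' = 𝔇.cov Γ i (m i) + (((k + 1 : ℕ) : R) * 𝔇.dR i (s ^ k)) • L i +
        (((k + 1 : ℕ) : R) * s ^ k) • 𝔇.cov Γ i (L i) + (((k + 1 : ℕ) : R) * s ^ k * 𝔇.dR i s) • Q i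
        + s ^ (k + 1) • 𝔇.cov Γ i (Q i) := by
      have e1 : 𝔇.dR i (((k + 1 : ℕ) : R) * s ^ k) = ((k + 1 : ℕ) : R) * 𝔇.dR i (s ^ k) := by
        rw [← nsmul_eq_mul, map_nsmul, nsmul_eq_mul]
      rw [hG', map_add, map_add, cov_smul, cov_smul, e1, dR_pow_succ]
      module
    rw [this, smul_mul_assoc, mul_smul_comm]
    have e3 : s • (((k + 1 : ℕ) : R) * 𝔇.dR i (s ^ k)) • L i =
        (((k + 1 : ℕ) : R) * ((k : R) * s ^ k * 𝔇.dR i s)) • L i := by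
      rw [← 𝔇.mul_dR_pow]; module
    simp only [smul_add]
    rw [e3]
    module
  rw [Finset.sum_congr rfl fun i _ => key i]
  simp only [Finset.sum_add_distrib, ← Finset.smul_sum, zL, zQ, smul_zero, add_zero, hm]

/-! #### Conformal covariance and gauge covariance -/

/-- Conformal covariance of the densitized current. -/
lemma cur_conformal (s Ω ρ' : R) (P' : κ → κ → R) (q : ℕ) (Γ : κ → A)
    (h : ∀ a b c e, ρ' * P' a c * P' b e = Ω ^ q * (ρ * P a c * P b e)) (b : κ) :
    𝔇.cur (Ω * s) q ρ' P' Γ b = Ω ^ (q + 1) • 𝔇.cur s q ρ P Γ b := by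
  have hf : ∀ a, 𝔇.flux ρ' P' Γ a b = Ω ^ q • 𝔇.flux ρ P Γ a b := fun a => by
    simp only [flux, h, Finset.smul_sum, smul_smul]
  simp only [cur, hf, Finset.smul_sum]
  refine Finset.sum_congr rfl fun a _ => ?_
  rw [cov_smul, 𝔇.dR_mul]
  have e3 : (Ω * s) • 𝔇.dR a (Ω ^ q) • 𝔇.flux ρ P Γ a b =
        (s * ((q : R) * Ω ^ q * 𝔇.dR a Ω)) • 𝔇.flux ρ P Γ a b := by
      rw [← 𝔇.mul_dR_pow]; module
  rw [smul_add, e3]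
  module

/-- The gauge transform of a connection. -/
def gauge (h : Aˣ) (Γ : κ → A) (i : κ) : A := ↑h⁻¹ * Γ i * ↑h + ↑h⁻¹ * 𝔇.dA i ↑h

omit [Fintype κ] in
lemma dA_inv (h : Aˣ) (i : κ) : 𝔇.dA i (↑h⁻¹ : A) = -(↑h⁻¹ * 𝔇.dA i ↑h * ↑h⁻¹) := by
  have h1 := 𝔇.dA_mul i (↑h⁻¹ : A) ↑h
  rw [Units.inv_mul, dA_one] at h1
  have h2 := congrArg (· * (↑h⁻¹ : A)) h1
  simp only [zero_mul, add_mul, mul_assoc, Units.mul_inv, mul_one] at h2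
  rw [mul_assoc]
  exact eq_neg_of_add_eq_zero_left h2.symm

omit [Fintype κ] in
lemma cov_gauge (h : Aˣ) (Γ : κ → A) (i : κ) (Y : A) :
    𝔇.cov (𝔇.gauge h Γ) i (↑h⁻¹ * Y * ↑h) = ↑h⁻¹ * 𝔇.cov Γ i Y * ↑h := by
  simp only [cov_apply, gauge, 𝔇.dA_mul, dA_inv]
  have e : ∀ X : A, (h : A) * (↑h⁻¹ * X) = X := fun X => by rw [← mul_assoc, Units.mul_inv, one_mul]
  simp only [add_mul, mul_add, mul_sub, sub_mul, mul_assoc, neg_mul, e]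
  abel

omit [Fintype κ] in
lemma curv_gauge (h : Aˣ) (Γ : κ → A) (i j : κ) :
    𝔇.curv (𝔇.gauge h Γ) i j = ↑h⁻¹ * 𝔇.curv Γ i j * ↑h := by
  simp only [curv, gauge, 𝔇.dA_mul, dA_inv, map_add]
  have e : ∀ X : A, (h : A) * (↑h⁻¹ * X) = X := fun X => by rw [← mul_assoc, Units.mul_inv, one_mul]
  simp only [add_mul, mul_add, mul_sub, sub_mul, mul_assoc, neg_mul, e, 𝔇.dA_comm j i]
  abel

lemma flux_gauge (h : Aˣ) (Γ : κ → A) (i j : κ) :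
    𝔇.flux ρ P (𝔇.gauge h Γ) i j = ↑h⁻¹ * 𝔇.flux ρ P Γ i j * ↑h := by
  simp only [flux, curv_gauge, Finset.mul_sum, Finset.sum_mul, mul_smul_comm, smul_mul_assoc]

lemma cur_gauge (s q : R) (h : Aˣ) (Γ : κ → A) (b : κ) :
    𝔇.cur s q ρ P (𝔇.gauge h Γ) b = ↑h⁻¹ * 𝔇.cur s q ρ P Γ b * ↑h := by
  simp only [cur, flux_gauge, cov_gauge, Finset.mul_sum, Finset.sum_mul, mul_smul_comm,
    smul_mul_assoc, mul_sub, sub_mul]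

end DiffAlg

end YangMills

end

noncomputable section

namespace YangMills

namespace DiffAlg

variable {κ R A : Type*} [CommRing R] [Ring A] [Algebra R A] (𝔇 : DiffAlg κ R A)

/-! #### Orders of vanishing -/

lemma smul_pow_cancel {s : R} (hs : ∀ X : A, s • X = 0 → X = 0) (n : ℕ) {X Y : A}
    (h : s ^ n • X = s ^ n • Y) : X = Y := by
  induction n with
  | zero => simpa using h
  | succ n ih =>
    apply ih
    rw [pow_succ', mul_smul, mul_smul, ← sub_eq_zero, ← smul_sub] at h
    exact sub_eq_zero.1 (hs _ h)

lemma exists_smul_of_isUnit {s u : R} (hu : IsUnit u) {X : A} (h : ∃ Y : A, u • X = s • Y) :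
    ∃ Y : A, X = s • Y := by
  obtain ⟨u, rfl⟩ := hu
  obtain ⟨Y, hY⟩ := h
  refine ⟨(↑u⁻¹ : R) • Y, ?_⟩
  rw [smul_comm, ← hY, smul_smul, Units.inv_mul, one_smul]

lemma exists_sum_smul {ι : Type*} [Fintype ι] {s : R} {f : ι → A}
    (h : ∀ i, ∃ Y : A, f i = s • Y) : ∃ Y : A, ∑ i, f i = s • Y := by
  choose Y hY using h
  exact ⟨∑ i, Y i, by rw [Finset.smul_sum]; exact Finset.sum_congr rfl fun i _ => hY i⟩

variable [Fintype κ] {ρ : R} {P : κ → κ → R}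

/-- Away from the critical order the divergence identity forces the leading normal component
of the current to vanish. -/
lemma normalPart_of_cur (h2 : IsUnit (2 : R)) (hP : ∀ a b, P a b = P b a) {s : R}
    (hs : ∀ X : A, s • X = 0 → X = 0) (hρ : IsUnit ρ) {p q : ℕ}
    (hpq : IsUnit ((p : R) - (q + 1 : ℕ))) {Γ k : κ → A}
    (hk : ∀ b, 𝔇.cur s q ρ P Γ b = s ^ p • ρ • raise P k b) :
    ∃ N : A, 𝔇.normalPart P s k = s • N := by
  have h := 𝔇.div_cur (ρ := ρ) (P := P) h2 hP s q Γ
  simp only [hk] at h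
  have e : ∀ b, s • 𝔇.cov Γ b (s ^ p • ρ • raise P k b) =
      s ^ p • ((((p : R) * ρ) • 𝔇.dR b s • raise P k b) + s • 𝔇.cov Γ b (ρ • raise P k b)) := by
    intro b
    rw [cov_smul, smul_add, smul_smul, mul_dR_pow]
    module
  have e' : ∀ b, (((q + 1 : ℕ) : R) * 𝔇.dR b s) • s ^ p • ρ • raise P k b =
      s ^ p • (((q + 1 : ℕ) : R) * ρ) • 𝔇.dR b s • raise P k b := fun b => by module
  rw [Finset.sum_congr rfl fun b _ => e b, Finset.sum_congr rfl fun b _ => e' b,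
    ← Finset.smul_sum, ← Finset.smul_sum] at h
  have h' := smul_pow_cancel hs p h
  rw [Finset.sum_add_distrib, ← Finset.smul_sum, ← Finset.smul_sum, ← Finset.smul_sum] at h'
  refine exists_smul_of_isUnit (hpq.mul hρ) ⟨-∑ b, 𝔇.cov Γ b (ρ • raise P k b), ?_⟩
  rw [sub_mul, sub_smul, smul_neg, normalPart, ← h']
  abel

lemma raise_smul (f : R) (a : κ → A) (b : κ) : raise P (fun i => f • a i) b = f • raise P a b := by
  simp only [raise, Finset.smul_sum, smul_comm f]

/-- The order by order improvement of a solution away from the critical order. -/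
lemma cur_improve {s u c : R} {p q : ℕ} {Γ k : κ → A}
    (hk : ∀ b, 𝔇.cur s q ρ P Γ b = s ^ p • ρ • raise P k b)
    (hn : ∃ N : A, 𝔇.normalPart P s k = s • N)
    (hu : u * (𝔇.normSq P s + s) = 1) (hc : c * (((p + 1 : ℕ) : R) * ((p : R) - q)) = -1) (b : κ) :
    ∃ Y : A, 𝔇.cur s q ρ P (fun i => Γ i + s ^ (p + 1) • (c * u) • k i) b = s ^ (p + 1) • Y := by
  obtain ⟨N, hN⟩ := hn
  obtain ⟨Y, hY⟩ := 𝔇.cur_add (ρ := ρ) (P := P) s q p Γ (fun i => (c * u) • k i) b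
  have hn' : 𝔇.normalPart P s (fun i => (c * u) • k i) = (c * u) • s • N := by
    rw [← hN]
    simp only [normalPart, raise_smul, Finset.smul_sum, smul_comm (c * u)]
  refine ⟨Y + (ρ * u) • raise P k b + (ρ * u * 𝔇.grad P s b) • N, ?_⟩
  rw [hY, hk, raise_smul, hn']
  have e1 : (((p + 1 : ℕ) : R) * ((p : R) - q) * s ^ p * ρ) • (𝔇.normSq P s • (c * u) • raise P k b
      - 𝔇.grad P s b • (c * u) • s • N) =
      (c * (((p + 1 : ℕ) : R) * ((p : R) - q))) • (s ^ p * ρ) • ((u * 𝔇.normSq P s) • raise P k b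
      - (u * 𝔇.grad P s b * s) • N) := by
    module
  have e2 : u * 𝔇.normSq P s = 1 - u * s := by linear_combination hu
  rw [e1, hc, e2]
  module

/-- Variation of the current at the critical order. -/
lemma cur_add_critical {s : R} (q : ℕ) {Γ K : κ → A} (a : κ → A)
    (hk : ∀ b, 𝔇.cur s q ρ P Γ b = s ^ (q + 1) • K b) (b : κ) :
    ∃ Y : A, 𝔇.cur s q ρ P (fun i => Γ i + s ^ (q + 1) • a i) b = s ^ (q + 1) • Y := by
  obtain ⟨Y, hY⟩ := 𝔇.cur_add (ρ := ρ) (P := P) s q q Γ a b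
  refine ⟨K b + Y, ?_⟩
  rw [hY, hk, sub_self]
  module

/-- Variation of the normal component of the current at the critical order. -/
lemma normal_cur_add_critical (h2 : IsUnit (2 : R)) {s : R} (hs : ∀ X : A, s • X = 0 → X = 0)
    (q : ℕ) {Γ K K' a : κ → A}
    (hk : ∀ b, 𝔇.cur s q ρ P Γ b = s ^ (q + 1) • K b)
    (hk' : ∀ b, 𝔇.cur s q ρ P (fun i => Γ i + s ^ (q + 1) • a i) b = s ^ (q + 1) • K' b) :
    ∃ Y : A, ∑ b, 𝔇.dR b s • K' b = ∑ b, 𝔇.dR b s • K b + ((q + 1 : ℕ) : R) • ∑ i, 𝔇.cov Γ i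
          (ρ • (𝔇.grad P s i • 𝔇.normalPart P s a - 𝔇.normSq P s • raise P a i)) + s • Y := by
  obtain ⟨Y, hY⟩ := 𝔇.normal_cur_add (ρ := ρ) (P := P) h2 s q q Γ a
  refine ⟨Y, smul_pow_cancel hs (q + 1) ?_⟩
  simp only [hk, hk'] at hY
  have e : ∀ K : κ → A, s ^ (q + 1) • ∑ b, 𝔇.dR b s • K b =
      ∑ b, 𝔇.dR b s • s ^ (q + 1) • K b := fun K => by
    simp only [Finset.smul_sum, smul_comm (s ^ (q + 1))]
  rw [smul_add, smul_add, e, e, hY]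
  module

/-! #### Uniqueness of the obstruction -/

omit [Fintype κ] in
lemma gauge_mul (h h' : Aˣ) (Γ : κ → A) :
    𝔇.gauge h' (𝔇.gauge h Γ) = 𝔇.gauge (h * h') Γ := by
  ext i
  simp only [gauge, Units.val_mul, mul_inv_rev, 𝔇.dA_mul, mul_add, add_mul, mul_assoc]
  have e : ∀ X : A, (↑h⁻¹ : A) * (h * X) = X := fun X => by
    rw [← mul_assoc, Units.inv_mul, one_mul]
  rw [e]
  abel

omit [Fintype κ] in
/-- A gauge transformation removing the transverse component to one more order. -/
lemma exists_gauge_improve [DecidableEq κ] {s : R} {o : κ}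
    (hdo : ∀ i, 𝔇.dR i s = if i = o then 1 else 0)
    (hunit : ∀ v : A, IsUnit (1 + s • v)) (hQ : ∀ n : ℕ, IsUnit ((n + 1 : ℕ) : R))
    {Γ Γw a : κ → A} (ℓ : ℕ) (hΓ : ∀ i, Γ i = Γw i + s ^ ℓ • a i)
    (ha : ∀ i, i ≠ o → ∃ t : A, a i = s • t) :
    ∃ (h : Aˣ) (v : A) (a' : κ → A), (h : A) = 1 + s • v ∧
      ∀ i, 𝔇.gauge h Γ i = Γw i + s ^ (ℓ + 1) • a' i := by
  obtain ⟨c, hc⟩ := hQ ℓ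
  set u : A := -((↑c⁻¹ : R) • a o) with hu
  have hu' : ((ℓ + 1 : ℕ) : R) • u = -a o := by
    rw [hu, smul_neg, smul_smul, ← hc, Units.mul_inv, one_smul]
  obtain ⟨h, hh⟩ := hunit (s ^ ℓ • u)
  have key : ∀ i, ∃ Z : A, Γ i * h + 𝔇.dA i h - h * Γw i = s ^ (ℓ + 1) • Z := by
    intro i
    have e : Γ i * h + 𝔇.dA i h - h * Γw i =
        s ^ ℓ • (a i + 𝔇.dR i s • ((ℓ + 1 : ℕ) : R) • u)
        + s ^ (ℓ + 1) • (Γ i * u - u * Γw i + 𝔇.dA i u) := by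
      rw [hh, smul_smul, ← pow_succ', map_add, dA_one, 𝔇.dA_smul, dR_pow_succ, mul_add, add_mul,
        mul_one, one_mul, mul_smul_comm, smul_mul_assoc]
      nth_rewrite 1 [hΓ i]
      module
    by_cases hi : i = o
    · refine ⟨Γ i * u - u * Γw i + 𝔇.dA i u, e.trans ?_⟩
      rw [hdo, if_pos hi, one_smul, hu', hi, add_neg_cancel, smul_zero, zero_add]
    · obtain ⟨t, ht⟩ := ha i hi
      refine ⟨t + (Γ i * u - u * Γw i + 𝔇.dA i u), e.trans ?_⟩
      rw [hdo, if_neg hi, zero_smul, add_zero, ht, pow_succ]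
      module
  choose Z hZ using key
  refine ⟨h, s ^ ℓ • u, fun i => ↑h⁻¹ * Z i, hh, fun i => ?_⟩
  rw [← mul_smul_comm, ← hZ]
  simp only [gauge, mul_sub, mul_add, ← mul_assoc, Units.inv_mul, one_mul]
  abel

/-- Two connections with the same tangential boundary values whose currents vanish to the
critical order have currents with the same leading coefficients. -/
lemma leading_cur_eq [DecidableEq κ] {s : R} {o : κ}
    (hdo : ∀ i, 𝔇.dR i s = if i = o then 1 else 0) (hs : ∀ X : A, s • X = 0 → X = 0)
    (hunit : ∀ v : A, IsUnit (1 + s • v)) (hQ : ∀ n : ℕ, IsUnit ((n + 1 : ℕ) : R))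
    (hρ : IsUnit ρ) (hn : IsUnit (𝔇.normSq P s)) {G : κ → κ → R}
    (hG : ∀ e c, ∑ b, G e b * P b c = if e = c then 1 else 0)
    {q : ℕ} {Γ Γw K Kw : κ → A}
    (hk : ∀ b, 𝔇.cur s q ρ P Γ b = s ^ q • K b) (hkw : ∀ b, 𝔇.cur s q ρ P Γw b = s ^ q • Kw b)
    (ht : ∀ i, i ≠ o → ∃ t : A, Γ i - Γw i = s • t) (b : κ) :
    ∃ Y : A, K b - Kw b = s • Y := by
  have claim : ∀ k ≤ q, ∃ (h : Aˣ) (v : A) (a : κ → A), (h : A) = 1 + s • v ∧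
      ∀ i, 𝔇.gauge h Γ i = Γw i + s ^ (k + 1) • a i := by
    intro k
    induction k with
    | zero =>
      intro _
      exact 𝔇.exists_gauge_improve hdo hunit hQ (Γw := Γw) (a := fun i => Γ i - Γw i) 0
        (fun i => by simp) ht
    | succ k ih =>
      intro hkq
      obtain ⟨h, v, a, hv, ha⟩ := ih (by omega)
      have hga : 𝔇.gauge h Γ = fun i => Γw i + s ^ (k + 1) • a i := funext ha
      have tang : ∀ i, i ≠ o → ∃ t : A, a i = s • t := by
        have hT : ∀ b, ∃ Y : A, 𝔇.normSq P s • raise P a b - 𝔇.grad P s b • 𝔇.normalPart P s a =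
            s • Y := by
          intro b
          obtain ⟨Y, hY⟩ := 𝔇.cur_add (ρ := ρ) (P := P) s q k Γw a b
          rw [← hga, cur_gauge, hk, hkw] at hY
          obtain ⟨m, rfl⟩ : ∃ m, q = k + 1 + m := ⟨q - (k + 1), by omega⟩
          have hcoef : IsUnit (((k + 1 : ℕ) : R) * ((k : R) - (k + 1 + m : ℕ)) * ρ) := by
            refine ((hQ k).mul ?_).mul hρ
            have : (k : R) - (k + 1 + m : ℕ) = -((m + 1 : ℕ) : R) := by push_cast; ring
            rw [this]
            exact (hQ m).neg
          refine exists_smul_of_isUnit hcoef ⟨s ^ m • (↑h⁻¹ * K b * ↑h) - s ^ m • Kw b - Y, ?_⟩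
          apply smul_pow_cancel hs k
          rw [mul_smul_comm, smul_mul_assoc] at hY
          have e3 : (((k + 1 : ℕ) : R) * ((k : R) - (k + 1 + m : ℕ)) * s ^ k * ρ) •
              (𝔇.normSq P s • raise P a b - 𝔇.grad P s b • 𝔇.normalPart P s a) =
              s ^ (k + 1 + m) • (↑h⁻¹ * K b * ↑h) - s ^ (k + 1 + m) • Kw b - s ^ (k + 1) • Y := by
            rw [hY]; abel
          have e4 : ∀ X : A, s ^ k • (((k + 1 : ℕ) : R) * ((k : R) - (k + 1 + m : ℕ)) * ρ) • X =
              (((k + 1 : ℕ) : R) * ((k : R) - (k + 1 + m : ℕ)) * s ^ k * ρ) • X := fun X => by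
            rw [smul_smul]; congr 1; ring
          rw [e4, e3, pow_add, pow_succ]
          module
        intro i hi
        apply exists_smul_of_isUnit hn
        have e : 𝔇.normSq P s • a i = ∑ b, G i b •
            (𝔇.normSq P s • raise P a b - 𝔇.grad P s b • 𝔇.normalPart P s a) := by
          have e1 : ∑ b, G i b • raise P a b = a i := by
            simp only [raise, Finset.smul_sum, smul_smul]
            rw [Finset.sum_comm]
            simp only [← Finset.sum_smul, hG]
            simp
          have e2 : ∑ b, G i b * 𝔇.grad P s b = 0 := by
            simp only [grad, Finset.mul_sum, ← mul_assoc]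
            rw [Finset.sum_comm]
            simp only [← Finset.sum_mul, hG]
            simp [hdo, hi]
          simp only [smul_sub, Finset.sum_sub_distrib]
          rw [show ∑ b, G i b • 𝔇.grad P s b • 𝔇.normalPart P s a = 0 by
            simp only [smul_smul, ← Finset.sum_smul, e2, zero_smul], sub_zero]
          simp only [smul_comm _ (𝔇.normSq P s), ← Finset.smul_sum, e1]
        rw [e]
        refine exists_sum_smul fun b => ?_
        obtain ⟨Y, hY⟩ := hT b
        exact ⟨G i b • Y, by rw [hY, smul_comm]⟩
      obtain ⟨h', v', a', hv', ha'⟩ := 𝔇.exists_gauge_improve hdo hunit hQ (k + 1) ha tang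
      refine ⟨h * h', v + v' + s • (v * v'), a', ?_, fun i => ?_⟩
      · rw [Units.val_mul, hv, hv']
        simp only [mul_add, add_mul, mul_one, one_mul, smul_mul_smul_comm]
        module
      · rw [← gauge_mul]
        exact ha' i
  obtain ⟨h, v, a, hv, ha⟩ := claim q le_rfl
  obtain ⟨Y, hY⟩ := 𝔇.cur_add (ρ := ρ) (P := P) s q q Γw a b
  rw [← (funext ha : 𝔇.gauge h Γ = _), cur_gauge, hk, hkw, sub_self, mul_zero, zero_mul, zero_mul,
    zero_smul, add_zero, mul_smul_comm, smul_mul_assoc, pow_succ, mul_smul, ← smul_add] at hY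
  have hY' := smul_pow_cancel hs q hY
  have h3 : K b * ↑h = ↑h * (Kw b + s • Y) := by
    rw [← hY', ← mul_assoc, ← mul_assoc, Units.mul_inv, one_mul]
  rw [hv, mul_add, mul_one, mul_smul_comm, add_mul, one_mul, smul_mul_assoc] at h3
  refine ⟨Y + v * (Kw b + s • Y) - K b * v, ?_⟩
  have : K b = Kw b + s • Y + s • (v * (Kw b + s • Y)) - s • (K b * v) := by
    rw [← h3]; abel
  nth_rewrite 1 [this]
  module

/-- In a frame adapted to `s`, a one-form whose tangential and normal parts are divisible by `s`
is divisible by `s`. -/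
lemma exists_smul_of_tangential [DecidableEq κ] {s : R} {o : κ}
    (hdo : ∀ i, 𝔇.dR i s = if i = o then 1 else 0) (hn : IsUnit (𝔇.normSq P s)) {k : κ → A}
    (htan : ∀ i, i ≠ o → ∃ t : A, k i = s • t) (hnor : ∃ N : A, 𝔇.normalPart P s k = s • N)
    (i : κ) : ∃ t : A, k i = s • t := by
  by_cases hi : i = o
  · subst hi
    apply exists_smul_of_isUnit hn
    have e : 𝔇.normSq P s • k i = 𝔇.normalPart P s k - ∑ e, if e = i then 0 else P i e • k e := by
      have h1 : 𝔇.normSq P s = P i i := by simp [normSq, grad, hdo]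
      have h2 : 𝔇.normalPart P s k = ∑ e, P i e • k e := by simp [normalPart, raise, hdo]
      rw [h1, h2, ← Finset.sum_sub_distrib,
        Finset.sum_eq_single i (fun e _ he => by simp [he]) (by simp)]
      simp
    rw [e]
    obtain ⟨N, hN⟩ := hnor
    obtain ⟨Y, hY⟩ : ∃ Y : A, (∑ e, if e = i then 0 else P i e • k e) = s • Y := by
      refine exists_sum_smul fun e => ?_
      split_ifs with he
      · exact ⟨0, by simp⟩
      · obtain ⟨t, ht⟩ := htan e he
        exact ⟨P i e • t, by rw [ht, smul_comm]⟩
    exact ⟨N - Y, by rw [hN, hY, smul_sub]⟩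
  · exact htan i hi

end DiffAlg

end YangMills

end

noncomputable section

set_option linter.unusedSectionVars false

namespace YangMills

/-! ### Functions and vector fields that are smooth near a point -/

section Smooth

open Filter Topology VectorField

variable {E : Type*} [NormedAddCommGroup E] [NormedSpace ℝ E] [FiniteDimensional ℝ E]
  {H : Type*} [TopologicalSpace H] {I : ModelWithCorners ℝ E H}
  {M : Type*} [TopologicalSpace M] [ChartedSpace H M] [IsManifold I ∞ M]
  {W : Type*} [NormedAddCommGroup W] [NormedSpace ℝ W]
  {W' : Type*} [NormedAddCommGroup W'] [NormedSpace ℝ W']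

/-- `f` is smooth on a neighbourhood of `p`. -/
def SmoothNear (I : ModelWithCorners ℝ E H) (f : M → W) (p : M) : Prop :=
  ∀ᶠ x in 𝓝 p, ContMDiffAt I 𝓘(ℝ, W) ∞ f x

/-- The vector field `X` is smooth on a neighbourhood of `p`. -/
def SmoothFieldNear (X : Π x : M, TangentSpace I x) (p : M) : Prop :=
  ∀ᶠ x in 𝓝 p, ContMDiffAt I I.tangent ∞ (T% X) x

/-- The derivative `X f` of a function along a vector field. -/
def fieldDeriv (X : Π x : M, TangentSpace I x) (f : M → W) (x : M) : W := mvfderiv I f x (X x)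

namespace SmoothNear

variable {p : M} {f g : M → W}

lemma contMDiffAt (hf : SmoothNear I f p) : ContMDiffAt I 𝓘(ℝ, W) ∞ f p := hf.self_of_nhds

lemma mdiff (hf : SmoothNear I f p) : MDifferentiableAt I 𝓘(ℝ, W) f p :=
  hf.contMDiffAt.mdifferentiableAt (by simp)

lemma eventually (hf : SmoothNear I f p) : ∀ᶠ x in 𝓝 p, SmoothNear I f x :=
  eventually_eventually_nhds.2 hf

lemma congr (hf : SmoothNear I f p) (h : g =ᶠ[𝓝 p] f) : SmoothNear I g p := by
  filter_upwards [hf, h.eventuallyEq_nhds] with x hx hx'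
  exact hx.congr_of_eventuallyEq hx'

lemma const (c : W) : SmoothNear I (fun _ : M => c) p := .of_forall fun _ => contMDiffAt_const

lemma add (hf : SmoothNear I f p) (hg : SmoothNear I g p) : SmoothNear I (f + g) p := by
  filter_upwards [hf, hg] with x h1 h2 using h1.add h2

lemma neg (hf : SmoothNear I f p) : SmoothNear I (-f) p := by
  filter_upwards [hf] with x h1 using h1.neg

lemma sub (hf : SmoothNear I f p) (hg : SmoothNear I g p) : SmoothNear I (f - g) p := by
  filter_upwards [hf, hg] with x h1 h2 using h1.sub h2

lemma smul {a : M → ℝ} (ha : SmoothNear I a p) (hf : SmoothNear I f p) :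
    SmoothNear I (fun x => a x • f x) p := by
  filter_upwards [ha, hf] with x h1 h2 using h1.smul h2

lemma sum {ι : Type*} {s : Finset ι} {f : ι → M → W} (hf : ∀ i ∈ s, SmoothNear I (f i) p) :
    SmoothNear I (fun x => ∑ i ∈ s, f i x) p := by
  classical
  induction s using Finset.induction_on with
  | empty => simpa using const (0 : W)
  | insert i s hi ih =>
    simp only [Finset.sum_insert hi]
    exact (hf i (by simp)).add (ih fun j hj => hf j (by simp [hj]))

lemma comp {n : W → W'} (hn : ContDiff ℝ ∞ n) (hf : SmoothNear I f p) :
    SmoothNear I (fun x => n (f x)) p := by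
  filter_upwards [hf] with x h1 using hn.contDiffAt.contMDiffAt.comp x h1

lemma comp_at {n : W → W'} (hn : ∀ᶠ y in 𝓝 (f p), ContDiffAt ℝ ∞ n y) (hf : SmoothNear I f p) :
    SmoothNear I (fun x => n (f x)) p := by
  filter_upwards [hf, hf.contMDiffAt.continuousAt.eventually hn] with x h1 h2
  exact h2.contMDiffAt.comp x h1

lemma inv {f : M → ℝ} (hf : SmoothNear I f p) (h : f p ≠ 0) : SmoothNear I (fun x => (f x)⁻¹) p :=
  comp_at (n := fun y : ℝ => y⁻¹)
    ((isOpen_ne.eventually_mem h).mono fun _ hy => contDiffAt_inv ℝ hy) hf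

lemma mul {A : Type*} [NormedRing A] [NormedAlgebra ℝ A] {f g : M → A}
    (hf : SmoothNear I f p) (hg : SmoothNear I g p) : SmoothNear I (f * g) p := by
  filter_upwards [hf, hg] with x h1 h2
  exact (contDiff_mul (𝕜 := ℝ) (𝔸 := A)).contDiffAt.contMDiffAt.comp x (h1.prodMk_space h2)

lemma fieldDeriv {X : Π x : M, TangentSpace I x} (hf : SmoothNear I f p)
    (hX : SmoothFieldNear X p) : SmoothNear I (fieldDeriv X f) p := by
  filter_upwards [hf, hX] with x h1 h2
  have := h1.mfderiv_const (m := ∞) (by simp)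
  have h3 := ContMDiffAt.clm_apply_of_inCoordinates (b₁ := id) (b₂ := f) this h2 h1
  have h4 := (contMDiffAt_totalSpace.1 h3).2
  refine h4.congr_of_eventuallyEq (.of_forall fun y => ?_)
  simp [YangMills.fieldDeriv, mvfderiv]
  rfl

end SmoothNear

lemma fieldDeriv_congr {X : Π x : M, TangentSpace I x} {f g : M → W} {p : M}
    (h : f =ᶠ[𝓝 p] g) : fieldDeriv X f =ᶠ[𝓝 p] fieldDeriv X g := by
  filter_upwards [h.eventuallyEq_nhds] with x hx
  simp only [fieldDeriv, mvfderiv, hx.mfderiv_eq]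
  rfl

lemma fieldDeriv_clm {X : Π x : M, TangentSpace I x} {f : M → W} {p : M} (T : W →L[ℝ] W')
    (hf : MDifferentiableAt I 𝓘(ℝ, W) f p) :
    fieldDeriv X (fun x => T (f x)) p = T (fieldDeriv X f p) := by
  have h := T.hasMFDerivAt (x := f p) |>.comp p hf.hasMFDerivAt
  simp only [fieldDeriv, mvfderiv]
  have := h.mfderiv
  erw [this]
  rfl

lemma mdiff_field {X : Π x : M, TangentSpace I x} {p : M} (h : SmoothFieldNear X p) :
    MDifferentiableAt I I.tangent (T% X) p := h.self_of_nhds.mdifferentiableAt (by simp)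

/-- The Lie bracket acts on functions as the commutator of derivations. -/
lemma fieldDeriv_mlieBracket_real {X Y : Π x : M, TangentSpace I x} {f : M → ℝ} {p : M}
    (hX : SmoothFieldNear X p) (hY : SmoothFieldNear Y p) (hf : SmoothNear I f p)
    {Z : Π x : M, TangentSpace I x} (hZ : SmoothFieldNear Z p) (hZp : Z p ≠ 0) :
    fieldDeriv (mlieBracket I X Y) f p =
      fieldDeriv X (fieldDeriv Y f) p - fieldDeriv Y (fieldDeriv X f) p := by
  have : IsManifold I (minSmoothness ℝ 3) M := by
    simp only [minSmoothness_of_isRCLikeNormedField]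
    exact IsManifold.of_le (n := ∞) (WithTop.coe_le_coe.2 le_top : ((3 : ℕ∞) : WithTop ℕ∞) ≤ ∞)
  have : IsManifold I (((⊤ : ℕ∞) : WithTop ℕ∞) + 1) M := by simpa
  have hle : ((2 : ℕ∞) : WithTop ℕ∞) ≤ ∞ := WithTop.coe_le_coe.2 le_top
  have hfZ : ContMDiffAt I I.tangent ∞ (T% (f • Z)) p :=
    ContMDiffAt.smul_section hf.self_of_nhds hZ.self_of_nhds
  have jac : ∀ {W : Π x : M, TangentSpace I x}, ContMDiffAt I I.tangent ∞ (T% W) p →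
      mlieBracket I X (mlieBracket I Y W) p =
        mlieBracket I (mlieBracket I X Y) W p + mlieBracket I Y (mlieBracket I X W) p := fun hW =>
    leibniz_identity_mlieBracket_apply (by simpa using hX.self_of_nhds.of_le hle)
      (by simpa using hY.self_of_nhds.of_le hle) (by simpa using hW.of_le hle)
  have br : ∀ {X Z : Π x : M, TangentSpace I x}, SmoothFieldNear X p → SmoothFieldNear Z p →
      MDifferentiableAt I I.tangent (T% (mlieBracket I X Z)) p := fun h h' =>
    (ContMDiffAt.mlieBracket_vectorField (m := ⊤) (n := ⊤) h.self_of_nhds h'.self_of_nhds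
      (by simp)).mdifferentiableAt (by simp)
  have e1 : ∀ X : Π x : M, TangentSpace I x,
      mlieBracket I X (f • Z) =ᶠ[𝓝 p] fieldDeriv X f • Z + f • mlieBracket I X Z := by
    intro X
    filter_upwards [hf, hZ] with x h2 h3
    rw [mlieBracket_smul_right (h2.mdifferentiableAt (by simp)) (h3.mdifferentiableAt (by simp))]
    rfl
  have e2 : ∀ {X Y : Π x : M, TangentSpace I x}, SmoothFieldNear X p → SmoothFieldNear Y p →
      mlieBracket I X (mlieBracket I Y (f • Z)) p = fieldDeriv X (fieldDeriv Y f) p • Z p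
        + fieldDeriv Y f p • mlieBracket I X Z p + fieldDeriv X f p • mlieBracket I Y Z p
        + f p • mlieBracket I X (mlieBracket I Y Z) p := by
    intro X Y hX hY
    rw [(EventuallyEq.refl _ _).mlieBracket_vectorField_eq (e1 Y), mlieBracket_add_right,
      mlieBracket_smul_right (hf.fieldDeriv hY).mdiff (mdiff_field hZ),
      mlieBracket_smul_right hf.mdiff (br hY hZ)]
    · simp only [fieldDeriv]
      abel
    · exact MDifferentiableAt.smul_section (hf.fieldDeriv hY).mdiff (mdiff_field hZ)
    · exact MDifferentiableAt.smul_section hf.mdiff (br hY hZ)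
  have key := jac hfZ
  rw [e2 hX hY, e2 hY hX, jac hZ.self_of_nhds, mlieBracket_smul_right hf.mdiff (mdiff_field hZ)]
    at key
  refine smul_left_injective ℝ hZp ?_
  simp only [fieldDeriv, sub_smul] at key ⊢
  rw [smul_add] at key
  rw [eq_sub_iff_add_eq]
  have := congrArg (fun v => v - fieldDeriv X f p • mlieBracket I Y Z p
    - fieldDeriv Y f p • mlieBracket I X Z p
    - f p • mlieBracket I (mlieBracket I X Y) Z p - f p • mlieBracket I Y (mlieBracket I X Z) p) key
  simp only [fieldDeriv] at this
  refine Eq.trans ?_ (this.symm.trans ?_) <;> abel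

lemma fieldDeriv_mlieBracket [FiniteDimensional ℝ W] {X Y : Π x : M, TangentSpace I x} {f : M → W}
    {p : M} (hX : SmoothFieldNear X p) (hY : SmoothFieldNear Y p) (hf : SmoothNear I f p)
    {Z : Π x : M, TangentSpace I x} (hZ : SmoothFieldNear Z p) (hZp : Z p ≠ 0) :
    fieldDeriv (mlieBracket I X Y) f p =
      fieldDeriv X (fieldDeriv Y f) p - fieldDeriv Y (fieldDeriv X f) p := by
  refine (SeparatingDual.eq_iff_forall_dual_eq (R := ℝ)).2 fun T => ?_
  have e : ∀ {X Y : Π x : M, TangentSpace I x}, SmoothFieldNear Y p →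
      T (fieldDeriv X (fieldDeriv Y f) p) = fieldDeriv X (fieldDeriv Y fun x => T (f x)) p := by
    intro X Y hY
    rw [← fieldDeriv_clm T (hf.fieldDeriv hY).mdiff]
    refine (fieldDeriv_congr ?_).self_of_nhds
    filter_upwards [hf] with x hx
    rw [fieldDeriv_clm T (hx.mdifferentiableAt (by simp))]
  rw [map_sub, e hY, e hX, ← fieldDeriv_clm T hf.mdiff]
  exact fieldDeriv_mlieBracket_real hX hY (hf.comp T.contDiff) hZ hZp

end Smooth

/-! ### Coordinate frames -/

section Frame

open Filter Topology VectorField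

variable {E : Type*} [NormedAddCommGroup E] [NormedSpace ℝ E] [FiniteDimensional ℝ E]
  {H : Type*} [TopologicalSpace H] (I : ModelWithCorners ℝ E H)
  {M : Type*} [TopologicalSpace M] [ChartedSpace H M] [IsManifold I ∞ M]

/-- Coordinate functions near `p` together with their coordinate vector fields. -/
structure CoordFrame (p : M) (κ : Type*) [Fintype κ] [DecidableEq κ] where
  /-- the domain -/
  U : Set M
  isOpen : IsOpen U
  mem : p ∈ U
  /-- the coordinate functions -/
  coord : κ → M → ℝ
  /-- the coordinate vector fields -/
  X : κ → Π x : M, TangentSpace I x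
  coord_smooth : ∀ i, ∀ x ∈ U, ContMDiffAt I 𝓘(ℝ, ℝ) ∞ (coord i) x
  X_smooth : ∀ i, ∀ x ∈ U, ContMDiffAt I I.tangent ∞ (T% (X i)) x
  dual : ∀ x ∈ U, ∀ i j, mvfderiv I (coord i) x (X j x) = if i = j then 1 else 0
  expand : ∀ x ∈ U, ∀ u : TangentSpace I x, ∑ i, mvfderiv I (coord i) x u • X i x = u
  bracket : ∀ x ∈ U, ∀ i j, mlieBracket I (X i) (X j) x = 0

variable {I}

lemma mlieBracket_const {E' : Type*} [NormedAddCommGroup E'] [NormedSpace ℝ E'] (v w y : E') :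
    mlieBracket 𝓘(ℝ, E') (fun _ : E' => (v : E')) (fun _ => (w : E')) y = 0 := by
  have h := congrFun (mlieBracketWithin_eq_lieBracketWithin (𝕜 := ℝ) (V := fun _ : E' => (v : E'))
    (W := fun _ => (w : E')) (s := Set.univ)) y
  refine h.trans ?_
  simp [lieBracketWithin]
  rfl

/-- Some vector field with a prescribed value. -/
def extendAny {x : M} (u : TangentSpace I x) (y : M) : TangentSpace I y := (u : E)

lemma extendAny_self {x : M} (u : TangentSpace I x) : extendAny u x = u := rfl

/-- The coordinate frame of a local diffeomorphism to a coordinate space. -/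
def CoordFrame.ofMap {p : M} {κ : Type*} [Fintype κ] [DecidableEq κ] (U : Set M) (hU : IsOpen U)
    (hp : p ∈ U) (Φ : M → κ → ℝ) (hΦ : ∀ x ∈ U, ContMDiffAt I 𝓘(ℝ, κ → ℝ) ∞ Φ x)
    (hinv : ∀ x ∈ U, (mfderiv I 𝓘(ℝ, κ → ℝ) Φ x).IsInvertible) : CoordFrame I p κ where
  U := U
  isOpen := hU
  mem := hp
  coord i x := Φ x i
  X i := mpullback I 𝓘(ℝ, κ → ℝ) Φ fun _ => (Pi.single i 1 : κ → ℝ)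
  coord_smooth i x hx := by
    exact (ContinuousLinearMap.proj (R := ℝ) (φ := fun _ : κ => ℝ) i).contDiff.contMDiff.contMDiffAt.comp x (hΦ x hx)
  X_smooth i x hx := by
    have : ContMDiffAt 𝓘(ℝ, κ → ℝ) 𝓘(ℝ, κ → ℝ).tangent ∞ (fun y : κ → ℝ =>
        ((⟨y, (Pi.single i 1 : κ → ℝ)⟩ : TangentBundle 𝓘(ℝ, κ → ℝ) (κ → ℝ)))) (Φ x) := by
      exact (contMDiffAt_vectorSpace_iff_contDiffAt
        (V := fun _ : κ → ℝ => (Pi.single i 1 : κ → ℝ))).2 contDiffAt_const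
    rw [← contMDiffWithinAt_univ] at this
    simpa using! ContMDiffWithinAt.mpullback_vectorField_preimage (m := ∞) (t := Set.univ) this
      (hΦ x hx) (hinv x hx) (by simp)
  dual x hx i j := by
    have e := fieldDeriv_clm (X := mpullback I 𝓘(ℝ, κ → ℝ) Φ fun _ => (Pi.single j 1 : κ → ℝ))
      (ContinuousLinearMap.proj (R := ℝ) (φ := fun _ : κ => ℝ) i)
      ((hΦ x hx).mdifferentiableAt (by simp))
    refine e.trans ?_
    obtain ⟨L, hL⟩ := hinv x hx
    simp only [fieldDeriv, mvfderiv, mpullback, ← hL, ContinuousLinearMap.inverse_equiv]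
    change (L (L.symm _)) i = _
    exact (congrFun (L.apply_symm_apply _) i).trans (Pi.single_apply ..)
  expand x hx u := by
    obtain ⟨L, hL⟩ := hinv x hx
    have e : ∀ i, mvfderiv I (fun x => Φ x i) x u = L u i := fun i => by
      have e := fieldDeriv_clm (X := extendAny u)
        (ContinuousLinearMap.proj (R := ℝ) (φ := fun _ : κ => ℝ) i)
        ((hΦ x hx).mdifferentiableAt (by simp))
      simp only [fieldDeriv, extendAny_self] at e
      refine e.trans ?_
      simp only [mvfderiv, ← hL]
      rfl
    simp only [e, mpullback, ← hL, ContinuousLinearMap.inverse_equiv]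
    refine L.injective ?_
    simp only [map_sum, map_smul]
    refine (Finset.sum_congr rfl fun i _ => congrArg _ (L.apply_symm_apply _)).trans ?_
    exact (pi_eq_sum_univ' (L u)).symm
  bracket x hx i j := by
    have hc : ∀ i, MDifferentiableAt 𝓘(ℝ, κ → ℝ) 𝓘(ℝ, κ → ℝ).tangent (fun y : κ → ℝ =>
        ((⟨y, (Pi.single i 1 : κ → ℝ)⟩ : TangentBundle 𝓘(ℝ, κ → ℝ) (κ → ℝ)))) (Φ x) := fun i => by
      exact ((contMDiffAt_vectorSpace_iff_contDiffAt (n := 1)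
        (V := fun _ : κ → ℝ => (Pi.single i 1 : κ → ℝ))).2 contDiffAt_const).mdifferentiableAt
        one_ne_zero
    have hle : ((2 : ℕ∞) : WithTop ℕ∞) ≤ ∞ := WithTop.coe_le_coe.2 le_top
    have : IsManifold I (minSmoothness ℝ 2) M := by
      simp only [minSmoothness_of_isRCLikeNormedField]
      exact IsManifold.of_le (n := ∞) hle
    have h := mpullback_mlieBracket (I := I) (I' := 𝓘(ℝ, κ → ℝ)) (n := ∞) (hc i) (hc j) (hΦ x hx)
      (by simp only [minSmoothness_of_isRCLikeNormedField]; exact hle)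
    refine h.symm.trans ?_
    refine (congrArg _ (mlieBracket_const (Pi.single i 1 : κ → ℝ) (Pi.single j 1) (Φ x))).trans ?_
    exact map_zero _

end Frame

end YangMills

end

noncomputable section

set_option linter.unusedSectionVars false

namespace YangMills

/-! ### Germs of smooth functions -/

section Germs

open Filter Topology VectorField

variable {E : Type*} [NormedAddCommGroup E] [NormedSpace ℝ E] [FiniteDimensional ℝ E]
  {H : Type*} [TopologicalSpace H] {I : ModelWithCorners ℝ E H}
  {M : Type*} [TopologicalSpace M] [ChartedSpace H M] [IsManifold I ∞ M]
  {A : Type*} [NormedRing A] [NormedAlgebra ℝ A]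
  {W : Type*} [NormedAddCommGroup W] [NormedSpace ℝ W]

lemma fieldDeriv_add {X : Π x : M, TangentSpace I x} {f g : M → W} {p : M}
    (hf : MDifferentiableAt I 𝓘(ℝ, W) f p) (hg : MDifferentiableAt I 𝓘(ℝ, W) g p) :
    fieldDeriv X (f + g) p = fieldDeriv X f p + fieldDeriv X g p := by
  simp only [fieldDeriv, mvfderiv_add hf hg, add_apply]

lemma fieldDeriv_mul {X : Π x : M, TangentSpace I x} {f g : M → A} {p : M}
    (hf : MDifferentiableAt I 𝓘(ℝ, A) f p) (hg : MDifferentiableAt I 𝓘(ℝ, A) g p) :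
    fieldDeriv X (f * g) p = fieldDeriv X f p * g p + f p * fieldDeriv X g p := by
  have h := (hf.hasMFDerivAt.mul' hg.hasMFDerivAt).mfderiv
  simp only [fieldDeriv, mvfderiv]
  rw [h]
  exact add_comm _ _

lemma fieldDeriv_smul {X : Π x : M, TangentSpace I x} {a : M → ℝ} {f : M → W} {p : M}
    (ha : MDifferentiableAt I 𝓘(ℝ, ℝ) a p) (hf : MDifferentiableAt I 𝓘(ℝ, W) f p) :
    fieldDeriv X (fun x => a x • f x) p = fieldDeriv X a p • f p + a p • fieldDeriv X f p := by
  simp only [fieldDeriv, mvfderiv_fun_smul ha hf, add_apply,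
    smul_apply, ContinuousLinearMap.smulRight_apply]
  exact add_comm _ _

variable (I) in
/-- Germs at `p` of smooth functions with values in a normed algebra. -/
def smoothGerms (p : M) (A : Type*) [NormedRing A] [NormedAlgebra ℝ A] :
    Subring (Germ (𝓝 p) A) where
  carrier := {g | ∃ f : M → A, SmoothNear I f p ∧ (f : Germ (𝓝 p) A) = g}
  mul_mem' := by
    rintro _ _ ⟨f, hf, rfl⟩ ⟨g, hg, rfl⟩
    exact ⟨f * g, hf.mul hg, rfl⟩
  one_mem' := ⟨1, SmoothNear.const 1, rfl⟩
  add_mem' := by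
    rintro _ _ ⟨f, hf, rfl⟩ ⟨g, hg, rfl⟩
    exact ⟨f + g, hf.add hg, rfl⟩
  zero_mem' := ⟨0, SmoothNear.const 0, rfl⟩
  neg_mem' := by
    rintro _ ⟨f, hf, rfl⟩
    exact ⟨-f, hf.neg, rfl⟩

variable {p : M}

/-- The germ `a` is represented by the function `f`. -/
def IsRep (a : smoothGerms I p A) (f : M → A) : Prop := (a : Germ (𝓝 p) A) = (f : Germ (𝓝 p) A)

/-- The germ of a function that is smooth near `p`. -/
def toGerm (f : M → A) (hf : SmoothNear I f p) : smoothGerms I p A := ⟨f, f, hf, rfl⟩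

lemma isRep_toGerm (f : M → A) (hf : SmoothNear I f p) : IsRep (toGerm f hf) f := rfl

lemma exists_isRep (a : smoothGerms I p A) : ∃ f : M → A, SmoothNear I f p ∧ IsRep a f := by
  obtain ⟨_, f, hf, rfl⟩ := a
  exact ⟨f, hf, rfl⟩

namespace IsRep

variable {a b : smoothGerms I p A} {f g : M → A}

lemma eventuallyEq (hf : IsRep a f) (hg : IsRep a g) : f =ᶠ[𝓝 p] g :=
  Germ.coe_eq.1 (hf.symm.trans hg)

lemma smooth (hf : IsRep a f) : SmoothNear I f p := by
  obtain ⟨g, hg, hg'⟩ := exists_isRep a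
  exact hg.congr (hf.eventuallyEq hg')

lemma congr (hf : IsRep a f) (h : f =ᶠ[𝓝 p] g) : IsRep a g := hf.trans (Germ.coe_eq.2 h)

lemma eq_of (hf : IsRep a f) (hg : IsRep b g) (h : f =ᶠ[𝓝 p] g) : a = b :=
  Subtype.ext (hf.trans ((Germ.coe_eq.2 h).trans hg.symm))

lemma eq_iff (hf : IsRep a f) (hg : IsRep b g) : a = b ↔ f =ᶠ[𝓝 p] g :=
  ⟨fun h => hf.eventuallyEq (h ▸ hg), hf.eq_of hg⟩

lemma add (hf : IsRep a f) (hg : IsRep b g) : IsRep (a + b) (fun x => f x + g x) :=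
  congrArg₂ (· + ·) hf hg

lemma sub (hf : IsRep a f) (hg : IsRep b g) : IsRep (a - b) (fun x => f x - g x) :=
  congrArg₂ (· - ·) hf hg

lemma mul (hf : IsRep a f) (hg : IsRep b g) : IsRep (a * b) (fun x => f x * g x) :=
  congrArg₂ (· * ·) hf hg

lemma zero : IsRep (0 : smoothGerms I p A) (fun _ => 0) := rfl

lemma one : IsRep (1 : smoothGerms I p A) (fun _ => 1) := rfl

lemma sum {ι : Type*} {s : Finset ι} {a : ι → smoothGerms I p A} {f : ι → M → A}
    (h : ∀ i ∈ s, IsRep (a i) (f i)) : IsRep (∑ i ∈ s, a i) (fun x => ∑ i ∈ s, f i x) := by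
  classical
  induction s using Finset.induction_on with
  | empty => exact zero
  | insert i s hi ih =>
    simp only [Finset.sum_insert hi]
    exact (h i (by simp)).add (ih fun j hj => h j (by simp [hj]))

lemma pow (hf : IsRep a f) (n : ℕ) : IsRep (a ^ n) (fun x => f x ^ n) := by
  induction n with
  | zero => simpa using one
  | succ n ih => simpa [pow_succ] using ih.mul hf

lemma natCast (n : ℕ) : IsRep (n : smoothGerms I p A) (fun _ => (n : A)) := by
  induction n with
  | zero => simpa using zero
  | succ n ih => simpa using ih.add one

end IsRep

/-- Scalar germs as germs of endomorphisms. -/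
def scalarGerm : smoothGerms I p ℝ →+* smoothGerms I p A where
  toFun a := ⟨(a : Germ (𝓝 p) ℝ).map (algebraMap ℝ A), by
    obtain ⟨f, hf, h⟩ := exists_isRep a
    refine ⟨fun x => algebraMap ℝ A (f x), ?_, by rw [h]; rfl⟩
    exact hf.comp (n := algebraMap ℝ A) (Algebra.linearMap ℝ A |>.mkContinuous
      ‖(1 : A)‖ fun x => by simp [norm_algebraMap, mul_comm]).contDiff⟩
  map_one' := Subtype.ext (congrArg (Germ.ofFun : (M → A) → Germ (𝓝 p) A)
    (funext fun _ => map_one (algebraMap ℝ A)))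
  map_mul' a b := by
    obtain ⟨f, hf, h⟩ := exists_isRep a
    obtain ⟨g, hg, h'⟩ := exists_isRep b
    refine Subtype.ext ?_
    change ((a : Germ (𝓝 p) ℝ) * b).map _ = Germ.map _ (a : Germ (𝓝 p) ℝ) * Germ.map _ (b : Germ (𝓝 p) ℝ)
    rw [h, h']
    exact congrArg (Germ.ofFun : (M → A) → Germ (𝓝 p) A)
      (funext fun _ => map_mul (algebraMap ℝ A) _ _)
  map_zero' := Subtype.ext (congrArg (Germ.ofFun : (M → A) → Germ (𝓝 p) A)
    (funext fun _ => map_zero (algebraMap ℝ A)))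
  map_add' a b := by
    obtain ⟨f, hf, h⟩ := exists_isRep a
    obtain ⟨g, hg, h'⟩ := exists_isRep b
    refine Subtype.ext ?_
    change ((a : Germ (𝓝 p) ℝ) + b).map _ = Germ.map _ (a : Germ (𝓝 p) ℝ) + Germ.map _ (b : Germ (𝓝 p) ℝ)
    rw [h, h']
    exact congrArg (Germ.ofFun : (M → A) → Germ (𝓝 p) A)
      (funext fun _ => map_add (algebraMap ℝ A) _ _)

lemma IsRep.scalarGerm {a : smoothGerms I p ℝ} {f : M → ℝ} (hf : IsRep a f) :
    IsRep (scalarGerm a : smoothGerms I p A) (fun x => algebraMap ℝ A (f x)) := by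
  change Germ.map _ (a : Germ (𝓝 p) ℝ) = _
  rw [hf]
  rfl

instance : Algebra (smoothGerms I p ℝ) (smoothGerms I p A) :=
  scalarGerm.toAlgebra' fun a b => by
    obtain ⟨f, hf, h⟩ := exists_isRep a
    obtain ⟨g, hg, h'⟩ := exists_isRep b
    exact (h.scalarGerm.mul h').eq_of (h'.mul h.scalarGerm)
      (.of_forall fun x => Algebra.commutes _ _)

lemma IsRep.smul {a : smoothGerms I p ℝ} {f : M → ℝ} {b : smoothGerms I p A} {g : M → A}
    (hf : IsRep a f) (hg : IsRep b g) : IsRep (a • b) (fun x => f x • g x) :=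
  (hf.scalarGerm.mul hg).congr (.of_forall fun _ => (Algebra.smul_def _ _).symm)

/-- Differentiation of germs along a vector field. -/
def fieldDerivGerm (X : Π x : M, TangentSpace I x) : Germ (𝓝 p) A → Germ (𝓝 p) A :=
  Germ.map' (fieldDeriv X) fun _ _ h => fieldDeriv_congr h

/-- A derivation of smooth germs given by a vector field. -/
def germDeriv (X : Π x : M, TangentSpace I x) (hX : SmoothFieldNear X p) :
    smoothGerms I p A →+ smoothGerms I p A where
  toFun a := ⟨fieldDerivGerm X (a : Germ (𝓝 p) A), by
    obtain ⟨f, hf, h⟩ := exists_isRep a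
    exact ⟨fieldDeriv X f, hf.fieldDeriv hX, by rw [h]; rfl⟩⟩
  map_zero' := by
    refine Subtype.ext (congrArg (Germ.ofFun : (M → A) → Germ (𝓝 p) A) (funext fun x => ?_))
    change mvfderiv I (fun _ : M => (0 : A)) x (X x) = 0
    rw [mvfderiv_const]
    rfl
  map_add' a b := by
    obtain ⟨f, hf, h⟩ := exists_isRep a
    obtain ⟨g, hg, h'⟩ := exists_isRep b
    refine Subtype.ext ?_
    change fieldDerivGerm X ((a : Germ (𝓝 p) A) + (b : Germ (𝓝 p) A)) =
      fieldDerivGerm X (a : Germ (𝓝 p) A) + fieldDerivGerm X (b : Germ (𝓝 p) A)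
    rw [h, h']
    refine Germ.coe_eq.2 ?_
    filter_upwards [hf, hg] with x h1 h2
    exact fieldDeriv_add (h1.mdifferentiableAt (by simp)) (h2.mdifferentiableAt (by simp))

lemma IsRep.germDeriv {X : Π x : M, TangentSpace I x} (hX : SmoothFieldNear X p)
    {a : smoothGerms I p A} {f : M → A} (hf : IsRep a f) :
    IsRep (germDeriv X hX a) (fieldDeriv X f) := by
  change fieldDerivGerm X (a : Germ (𝓝 p) A) = _
  rw [hf]
  rfl

/-! #### Units and non-zero-divisors -/

lemma isUnit_germ [CompleteSpace A] {a : smoothGerms I p A} {f : M → A} (hf : IsRep a f)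
    (h : IsUnit (f p)) : IsUnit a := by
  have hu : ∀ᶠ x in 𝓝 p, IsUnit (f x) :=
    hf.smooth.contMDiffAt.continuousAt.eventually (Units.isOpen.mem_nhds h)
  have hi : SmoothNear I (fun x => Ring.inverse (f x)) p := by
    refine SmoothNear.comp_at ?_ hf.smooth
    filter_upwards [Units.isOpen.mem_nhds h] with y hy
    obtain ⟨u, rfl⟩ := hy
    exact contDiffAt_ringInverse ℝ u
  refine isUnit_iff_exists.2 ⟨toGerm _ hi, ?_, ?_⟩
  · refine (hf.mul (isRep_toGerm _ hi)).eq_of .one ?_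
    filter_upwards [hu] with x hx using Ring.mul_inverse_cancel _ hx
  · refine ((isRep_toGerm _ hi).mul hf).eq_of .one ?_
    filter_upwards [hu] with x hx using Ring.inverse_mul_cancel _ hx

lemma isUnit_germ_real {a : smoothGerms I p ℝ} {f : M → ℝ} (hf : IsRep a f) (h : f p ≠ 0) :
    IsUnit a := isUnit_germ hf (isUnit_iff_ne_zero.2 h)

lemma isUnit_one_add_smul [CompleteSpace A] {s : smoothGerms I p ℝ} {f : M → ℝ} (hf : IsRep s f)
    (h : f p = 0) (v : smoothGerms I p A) : IsUnit (1 + s • v) := by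
  obtain ⟨g, hg, hv⟩ := exists_isRep v
  exact isUnit_germ (IsRep.one.add (hf.smul hv)) (by simp [h])

lemma isUnit_natCast_germ (n : ℕ) : IsUnit ((n + 1 : ℕ) : smoothGerms I p ℝ) :=
  isUnit_germ_real (IsRep.natCast (n + 1)) (by positivity)

/-- A function with non-vanishing derivative along its zero set is not a zero divisor. -/
lemma smul_germ_eq_zero {s : smoothGerms I p ℝ} {f : M → ℝ} (hf : IsRep s f)
    (h : ∀ᶠ x in 𝓝 p, f x = 0 → mvfderiv I f x ≠ 0) (v : smoothGerms I p A) (hv : s • v = 0) :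
    v = 0 := by
  obtain ⟨g, hg, hv'⟩ := exists_isRep v
  have h0 := ((hf.smul hv').eq_iff .zero).1 hv
  refine hv'.eq_of .zero ?_
  filter_upwards [h0.eventuallyEq_nhds, h, hf.smooth, hg] with x h1 h2 h3 h4
  by_cases hx : f x = 0
  · by_contra hgx
    refine h2 hx (ContinuousLinearMap.ext fun u => ?_)
    have e := fieldDeriv_smul (X := extendAny u) (h3.mdifferentiableAt (by simp))
      (h4.mdifferentiableAt (by simp))
    rw [(fieldDeriv_congr h1).self_of_nhds, hx, zero_smul, add_zero] at e
    have e0 : fieldDeriv (extendAny u) (fun _ : M => (0 : A)) x = 0 := by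
      simp only [fieldDeriv, mvfderiv_const]; rfl
    rw [e0] at e
    exact (smul_eq_zero.1 e.symm).resolve_right hgx
  · exact (smul_eq_zero.1 h1.self_of_nhds).resolve_left hx

namespace CoordFrame

variable {κ : Type*} [Fintype κ] [DecidableEq κ] (𝔛 : CoordFrame I p κ)

lemma eventually_mem : ∀ᶠ x in 𝓝 p, x ∈ 𝔛.U := 𝔛.isOpen.mem_nhds 𝔛.mem

lemma field_near (i : κ) {x : M} (hx : x ∈ 𝔛.U) : SmoothFieldNear (𝔛.X i) x := by
  filter_upwards [𝔛.isOpen.mem_nhds hx] with y hy using 𝔛.X_smooth i y hy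

lemma coord_near (i : κ) {x : M} (hx : x ∈ 𝔛.U) : SmoothNear I (𝔛.coord i) x := by
  filter_upwards [𝔛.isOpen.mem_nhds hx] with y hy using 𝔛.coord_smooth i y hy

/-- The derivative along the `i`-th coordinate field. -/
abbrev D (i : κ) (f : M → W) : M → W := fieldDeriv (𝔛.X i) f

lemma X_ne_zero {x : M} (hx : x ∈ 𝔛.U) (i : κ) : 𝔛.X i x ≠ 0 := fun h0 => by
  have := 𝔛.dual x hx i i
  rw [h0, map_zero] at this
  simp at this

lemma D_comm [FiniteDimensional ℝ W] {x : M} (hx : x ∈ 𝔛.U) (i j : κ) {f : M → W}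
    (hf : SmoothNear I f x) : 𝔛.D i (𝔛.D j f) x = 𝔛.D j (𝔛.D i f) x := by
  have h := fieldDeriv_mlieBracket (Z := 𝔛.X i) (𝔛.field_near i hx) (𝔛.field_near j hx) hf
    (𝔛.field_near i hx) (𝔛.X_ne_zero hx i)
  rw [fieldDeriv, 𝔛.bracket x hx, map_zero] at h
  exact sub_eq_zero.1 h.symm

/-- The algebra of germs of smooth matrix valued functions with its coordinate derivations. -/
def diffAlg (A : Type*) [NormedRing A] [NormedAlgebra ℝ A] [FiniteDimensional ℝ A] :
    DiffAlg κ (smoothGerms I p ℝ) (smoothGerms I p A) where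
  dR i := germDeriv (𝔛.X i) (𝔛.field_near i 𝔛.mem)
  dA i := germDeriv (𝔛.X i) (𝔛.field_near i 𝔛.mem)
  dR_mul i a b := by
    obtain ⟨f, hf, h⟩ := exists_isRep a
    obtain ⟨g, hg, h'⟩ := exists_isRep b
    refine ((h.mul h').germDeriv _).eq_of (((h.germDeriv _).mul h').add (h.mul (h'.germDeriv _))) ?_
    filter_upwards [hf, hg] with x h1 h2
    exact fieldDeriv_mul (h1.mdifferentiableAt (by simp)) (h2.mdifferentiableAt (by simp))
  dA_mul i a b := by
    obtain ⟨f, hf, h⟩ := exists_isRep a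
    obtain ⟨g, hg, h'⟩ := exists_isRep b
    refine ((h.mul h').germDeriv _).eq_of (((h.germDeriv _).mul h').add (h.mul (h'.germDeriv _))) ?_
    filter_upwards [hf, hg] with x h1 h2
    exact fieldDeriv_mul (h1.mdifferentiableAt (by simp)) (h2.mdifferentiableAt (by simp))
  dA_smul i a b := by
    obtain ⟨f, hf, h⟩ := exists_isRep a
    obtain ⟨g, hg, h'⟩ := exists_isRep b
    refine ((h.smul h').germDeriv _).eq_of
      (((h.germDeriv _).smul h').add (h.smul (h'.germDeriv _))) ?_
    filter_upwards [hf, hg] with x h1 h2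
    exact fieldDeriv_smul (h1.mdifferentiableAt (by simp)) (h2.mdifferentiableAt (by simp))
  dR_comm i j a := by
    obtain ⟨f, hf, h⟩ := exists_isRep a
    refine ((h.germDeriv _).germDeriv _).eq_of ((h.germDeriv _).germDeriv _) ?_
    filter_upwards [hf.eventually, 𝔛.eventually_mem] with x h1 h2 using 𝔛.D_comm h2 i j h1
  dA_comm i j a := by
    obtain ⟨f, hf, h⟩ := exists_isRep a
    refine ((h.germDeriv _).germDeriv _).eq_of ((h.germDeriv _).germDeriv _) ?_
    filter_upwards [hf.eventually, 𝔛.eventually_mem] with x h1 h2 using 𝔛.D_comm h2 i j h1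

variable [FiniteDimensional ℝ A]

lemma isRep_dR (i : κ) {a : smoothGerms I p ℝ} {f : M → ℝ} (h : IsRep a f) :
    IsRep ((𝔛.diffAlg A).dR i a) (𝔛.D i f) := h.germDeriv (𝔛.field_near i 𝔛.mem)

lemma isRep_dA (i : κ) {a : smoothGerms I p A} {f : M → A} (h : IsRep a f) :
    IsRep ((𝔛.diffAlg A).dA i a) (𝔛.D i f) := h.germDeriv (𝔛.field_near i 𝔛.mem)

/-! #### The formulas of the algebraic model for functions -/

/-- The covariant derivative of an endomorphism valued function. -/
def covFun (γ : κ → M → A) (i : κ) (Y : M → A) (x : M) : A :=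
  𝔛.D i Y x + γ i x * Y x - Y x * γ i x

/-- The curvature components. -/
def curvFun (γ : κ → M → A) (i j : κ) (x : M) : A :=
  𝔛.D i (γ j) x - 𝔛.D j (γ i) x + γ i x * γ j x - γ j x * γ i x

/-- The densitized curvature with raised indices. -/
def fluxFun (ρ : M → ℝ) (P : κ → κ → M → ℝ) (γ : κ → M → A) (a b : κ) (x : M) : A :=
  ∑ c, ∑ e, (ρ x * P a c x * P b e x) • 𝔛.curvFun γ c e x

/-- The densitized current with raised index. -/
def curFun (s : M → ℝ) (q : ℕ) (ρ : M → ℝ) (P : κ → κ → M → ℝ) (γ : κ → M → A) (b : κ) (x : M) : A :=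
  ∑ a, (s x • 𝔛.covFun γ a (𝔛.fluxFun ρ P γ a b) x -
    ((q : ℝ) * 𝔛.D a s x) • 𝔛.fluxFun ρ P γ a b x)

variable {γ : κ → M → A} {Γ : κ → smoothGerms I p A}

lemma isRep_cov (hΓ : ∀ i, IsRep (Γ i) (γ i)) (i : κ) {Y : smoothGerms I p A} {y : M → A}
    (hY : IsRep Y y) : IsRep ((𝔛.diffAlg A).cov Γ i Y) (𝔛.covFun γ i y) :=
  ((𝔛.isRep_dA i hY).add ((hΓ i).mul hY)).sub (hY.mul (hΓ i))

lemma isRep_curv (hΓ : ∀ i, IsRep (Γ i) (γ i)) (i j : κ) :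
    IsRep ((𝔛.diffAlg A).curv Γ i j) (𝔛.curvFun γ i j) :=
  (((𝔛.isRep_dA i (hΓ j)).sub (𝔛.isRep_dA j (hΓ i))).add ((hΓ i).mul (hΓ j))).sub
    ((hΓ j).mul (hΓ i))

variable {ρ : smoothGerms I p ℝ} {ρf : M → ℝ} {P : κ → κ → smoothGerms I p ℝ}
  {Pf : κ → κ → M → ℝ} {s : smoothGerms I p ℝ} {sf : M → ℝ}

lemma isRep_flux (hρ : IsRep ρ ρf) (hP : ∀ i j, IsRep (P i j) (Pf i j))
    (hΓ : ∀ i, IsRep (Γ i) (γ i)) (a b : κ) :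
    IsRep ((𝔛.diffAlg A).flux ρ P Γ a b) (𝔛.fluxFun ρf Pf γ a b) :=
  .sum fun c _ => .sum fun e _ => ((hρ.mul (hP a c)).mul (hP b e)).smul (𝔛.isRep_curv hΓ c e)

lemma isRep_cur (hs : IsRep s sf) (q : ℕ) (hρ : IsRep ρ ρf) (hP : ∀ i j, IsRep (P i j) (Pf i j))
    (hΓ : ∀ i, IsRep (Γ i) (γ i)) (b : κ) :
    IsRep ((𝔛.diffAlg A).cur s q ρ P Γ b) (𝔛.curFun sf q ρf Pf γ b) :=
  .sum fun a _ => (hs.smul (𝔛.isRep_cov hΓ a (𝔛.isRep_flux hρ hP hΓ a b))).sub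
    (((IsRep.natCast q).mul (𝔛.isRep_dR a hs)).smul (𝔛.isRep_flux hρ hP hΓ a b))

end CoordFrame

end Germs

end YangMills

end

noncomputable section

set_option linter.unusedSectionVars false

namespace YangMills

/-! ### Connections in a local trivialization -/

section LocalConnection

open Filter Topology VectorField Module

variable {E : Type*} [NormedAddCommGroup E] [NormedSpace ℝ E] [FiniteDimensional ℝ E]
  {H : Type*} [TopologicalSpace H] {I : ModelWithCorners ℝ E H}
  {M : Type*} [TopologicalSpace M] [ChartedSpace H M] [IsManifold I ∞ M]
  {F : Type*} [NormedAddCommGroup F] [NormedSpace ℝ F] [FiniteDimensional ℝ F]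
  {V : M → Type*} [TopologicalSpace (TotalSpace F V)]
  [∀ x, AddCommGroup (V x)] [∀ x, Module ℝ (V x)] [∀ x, TopologicalSpace (V x)]
  [∀ x, IsTopologicalAddGroup (V x)] [∀ x, ContinuousSMul ℝ (V x)]
  [FiberBundle F V] [VectorBundle ℝ F V] [ContMDiffVectorBundle ∞ F V I]

variable (F) in
/-- The domain of the preferred trivialization at `p`. -/
abbrev trivSet (V : M → Type*) [TopologicalSpace (TotalSpace F V)] [∀ x, TopologicalSpace (V x)]
    [FiberBundle F V] (p : M) : Set M := (trivializationAt F V p).baseSet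

variable (F) in
/-- The preferred trivialization at `p`, on the fibre over `x`. -/
abbrev trivAt (p x : M) : V x →L[ℝ] F := (trivializationAt F V p).continuousLinearMapAt ℝ x

variable (F) in
/-- The inverse of the preferred trivialization at `p`, on the fibre over `x`. -/
abbrev symAt (p x : M) : F →L[ℝ] V x := (trivializationAt F V p).symmL ℝ x

variable (F) in
/-- The section `s` is smooth on a neighbourhood of `p`. -/
def SmoothSecNear (I : ModelWithCorners ℝ E H) (s : Π x : M, V x) (p : M) : Prop :=
  ∀ᶠ x in 𝓝 p, ContMDiffAt I (I.prod 𝓘(ℝ, F)) ∞ (fun x => TotalSpace.mk' F x (s x)) x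

variable (F) in
/-- The local representative of a section in the preferred trivialization at `p`. -/
def locRep (p : M) (s : Π x : M, V x) (x : M) : F := trivAt F p x (s x)

variable {p : M}

lemma trivSet_mem_nhds {x : M} (hx : x ∈ trivSet F V p) : trivSet F V p ∈ 𝓝 x :=
  (trivializationAt F V p).open_baseSet.mem_nhds hx

lemma mem_trivSet (p : M) : p ∈ trivSet F V p := FiberBundle.mem_baseSet_trivializationAt' p

lemma trivAt_symAt {x : M} (hx : x ∈ trivSet F V p) (f : F) :
    trivAt F p x (symAt F p x f : V x) = f :=
  (trivializationAt F V p).continuousLinearMapAt_symmL hx f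

lemma symAt_trivAt {x : M} (hx : x ∈ trivSet F V p) (z : V x) :
    symAt F p x (trivAt F p x z) = z :=
  (trivializationAt F V p).symmL_continuousLinearMapAt hx z

lemma trivAt_apply {x : M} (hx : x ∈ trivSet F V p) (z : V x) :
    trivAt F p x z = (trivializationAt F V p ⟨x, z⟩).2 := by
  have : trivAt F p x z = (trivializationAt F V p).linearMapAt ℝ x z := rfl
  rw [this, Trivialization.linearMapAt_apply, if_pos hx]

lemma trivAt_injective {x : M} (hx : x ∈ trivSet F V p) :
    Function.Injective (trivAt F p x : V x →L[ℝ] F) :=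
  Function.LeftInverse.injective (symAt_trivAt hx)

lemma locRep_eventuallyEq {x : M} (hx : x ∈ trivSet F V p) (s : Π x : M, V x) :
    locRep F p s =ᶠ[𝓝 x] fun y => (trivializationAt F V p ⟨y, s y⟩).2 := by
  filter_upwards [trivSet_mem_nhds hx] with y hy using trivAt_apply hy _

lemma contMDiffAt_locRep {x : M} (hx : x ∈ trivSet F V p) {s : Π x : M, V x} :
    ContMDiffAt I (I.prod 𝓘(ℝ, F)) ∞ (fun x => TotalSpace.mk' F x (s x)) x ↔
      ContMDiffAt I 𝓘(ℝ, F) ∞ (locRep F p s) x := by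
  rw [(trivializationAt F V p).contMDiffAt_section_iff hx]
  exact (locRep_eventuallyEq hx s).contMDiffAt_iff.symm

lemma smoothSecNear_iff {x : M} (hx : x ∈ trivSet F V p) {s : Π x : M, V x} :
    SmoothSecNear F I s x ↔ SmoothNear I (locRep F p s) x := by
  refine eventually_congr ?_
  filter_upwards [trivSet_mem_nhds hx] with y hy using contMDiffAt_locRep hy

lemma SmoothSecNear.mdiff {x : M} {s : Π x : M, V x} (h : SmoothSecNear F I s x) :
    MDifferentiableAt I (I.prod 𝓘(ℝ, F)) (T% s) x := h.self_of_nhds.mdifferentiableAt (by simp)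

lemma smoothSecNear_extend {x : M} (z : V x) : SmoothSecNear F I (FiberBundle.extend F z) x := by
  obtain ⟨u, hu, h⟩ := FiberBundle.exists_contMDiffOn_extend (k := ∞) I F z
  filter_upwards [eventually_mem_nhds_iff.2 hu] with y hy
  exact (h y (mem_of_mem_nhds hy)).contMDiffAt hy

lemma smoothFieldNear_extend {x : M} (v : TangentSpace I x) :
    SmoothFieldNear (FiberBundle.extend E v : Π y : M, TangentSpace I y) x :=
  smoothSecNear_extend (F := E) (V := fun y : M => TangentSpace I y) v

/-- The local section that is constant in the preferred trivialization at `p`. -/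
def constSec (p : M) (f : F) (x : M) : V x := symAt F p x f

lemma locRep_constSec {x : M} (hx : x ∈ trivSet F V p) (f : F) :
    locRep F p (constSec p f : Π x : M, V x) =ᶠ[𝓝 x] fun _ => f := by
  filter_upwards [trivSet_mem_nhds hx] with y hy using trivAt_symAt hy f

lemma smoothSecNear_constSec {x : M} (hx : x ∈ trivSet F V p) (f : F) :
    SmoothSecNear F I (constSec p f : Π x : M, V x) x :=
  (smoothSecNear_iff hx).2 ((SmoothNear.const f).congr (locRep_constSec hx f))

/-- The connection form in the preferred trivialization at `p`. -/
def connForm (A : CovariantDerivative I F V) (p x : M) : TangentSpace I x →L[ℝ] F →L[ℝ] F :=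
  ∑ k, ContinuousLinearMap.smulRightL ℝ F F
    (LinearMap.toContinuousLinearMap ((finBasis ℝ F).coord k)) ∘L (trivAt F p x) ∘L
      A (constSec p (finBasis ℝ F k)) x

lemma connForm_apply (A : CovariantDerivative I F V) (p x : M) (u : TangentSpace I x) (f : F) :
    connForm A p x u f = ∑ k, (finBasis ℝ F).repr f k •
      trivAt F p x (A (constSec p (finBasis ℝ F k)) x u) := by
  simp only [connForm, sum_apply, ContinuousLinearMap.comp_apply]
  rfl

lemma cov_sum (A : CovariantDerivative I F V) {ι : Type*} (t : Finset ι) (s : ι → Π x : M, V x)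
    {x : M} (hs : ∀ i ∈ t, MDifferentiableAt I (I.prod 𝓘(ℝ, F)) (T% (s i)) x) :
    A (∑ i ∈ t, s i) x = ∑ i ∈ t, A (s i) x := by
  classical
  induction t using Finset.induction_on with
  | empty => simp
  | insert i t hi ih =>
    have h := MDifferentiableAt.sum_section (I := I) (F := F) (E := V) (s := t) (t := s) (x₀ := x)
      (fun j hj => hs j (by simp [hj]))
    rw [Finset.sum_insert hi, Finset.sum_insert hi,
      A.isCovariantDerivativeOnUniv.add (hs i (by simp)) (by simpa using! h),
      ih fun j hj => hs j (by simp [hj])]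

/-- The covariant derivative in a local trivialization. -/
lemma trivAt_cov (A : CovariantDerivative I F V) {s : Π x : M, V x} {x : M}
    (hx : x ∈ trivSet F V p) (hs : SmoothSecNear F I s x) (u : TangentSpace I x) :
    trivAt F p x (A s x u) = mvfderiv I (locRep F p s) x u + connForm A p x u (locRep F p s x) := by
  set b := finBasis ℝ F
  have hl := (smoothSecNear_iff hx).1 hs
  set c : Fin (finrank ℝ F) → M → ℝ := fun k y => b.repr (locRep F p s y) k with hc
  have hcs : ∀ k, SmoothNear I (c k) x := fun k =>
    hl.comp (LinearMap.toContinuousLinearMap (b.coord k)).contDiff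
  have hcd : ∀ k, MDifferentiableAt I (I.prod 𝓘(ℝ, F))
      (T% (constSec p (b k) : Π x : M, V x)) x := fun k => (smoothSecNear_constSec hx (b k)).mdiff
  have hsum : ∀ᶠ y in 𝓝 x, s y = (∑ k, c k • (constSec p (b k) : Π x : M, V x)) y := by
    filter_upwards [trivSet_mem_nhds hx] with y hy
    apply trivAt_injective hy
    simp only [Finset.sum_apply, Pi.smul_apply', map_sum, map_smul, constSec]
    simp only [trivAt_symAt hy]
    exact (b.sum_repr _).symm
  have hkd : ∀ k, MDifferentiableAt I (I.prod 𝓘(ℝ, F))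
      (T% (c k • (constSec p (b k) : Π x : M, V x))) x := fun k =>
    MDifferentiableAt.smul_section (hcs k).mdiff (hcd k)
  have hS : MDifferentiableAt I (I.prod 𝓘(ℝ, F))
      (T% (∑ k, c k • (constSec p (b k) : Π x : M, V x))) x := by
    have h := MDifferentiableAt.sum_section (I := I) (F := F) (E := V) (s := Finset.univ)
      (t := fun k => c k • (constSec p (b k) : Π x : M, V x)) (x₀ := x) (fun j _ => hkd j)
    simpa using! h
  rw [A.isCovariantDerivativeOnUniv.congr_of_eventuallyEq hs.mdiff hS univ_mem hsum,
    cov_sum A _ _ fun k _ => hkd k]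
  have e : ∀ k, A (c k • (constSec p (b k) : Π x : M, V x)) x = c k x • A (constSec p (b k)) x
      + (mvfderiv I (c k) x).smulRight (constSec p (b k) x) := fun k =>
    A.isCovariantDerivativeOnUniv.leibniz (hcd k) (hcs k).mdiff
  simp only [e, sum_apply, map_sum, add_apply, smul_apply, map_add, map_smul,
    Finset.sum_add_distrib, ContinuousLinearMap.smulRight_apply]
  rw [connForm_apply, add_comm]
  congr 1
  have e2 : ∀ k, mvfderiv I (c k) x u = b.repr (mvfderiv I (locRep F p s) x u) k := fun k =>
    fieldDeriv_clm (X := extendAny u) (LinearMap.toContinuousLinearMap (b.coord k)) hl.mdiff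
  simp only [e2, constSec, trivAt_symAt hx]
  exact b.sum_repr _

/-- A smooth connection maps local smooth sections to local smooth sections. -/
lemma smoothSecNear_cov [T2Space M] {A : CovariantDerivative I F V}
    (hA : A.ContMDiffCovariantDerivative ∞) {s : Π x : M, V x} {x : M}
    (hs : SmoothSecNear F I s x) {X : Π y : M, TangentSpace I y} (hX : SmoothFieldNear X x) :
    SmoothSecNear F I (fun y => A s y (X y)) x := by
  obtain ⟨U, hU, hUo, hxU⟩ := eventually_nhds_iff.1 hs
  obtain ⟨f, -, hf⟩ := (SmoothBumpFunction.nhds_basis_tsupport (I := I) x).mem_iff.1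
    (hUo.mem_nhds hxU)
  have hsm : ContMDiff I (I.prod 𝓘(ℝ, F)) ∞ (T% ((f : M → ℝ) • s)) :=
    ContMDiffOn.smul_section_of_tsupport f.contMDiff.contMDiffOn hUo hf
      fun y hy => (hU y hy).contMDiffWithinAt
  have h1 := (hA.contMDiff).contMDiff (σ := (f : M → ℝ) • s) (hsm.of_le (by simp)).contMDiffOn
  filter_upwards [f.eventuallyEq_one.eventuallyEq_nhds, hUo.mem_nhds hxU, hX] with y hy hyU hXy
  have h2 : ContMDiffAt I (I.prod 𝓘(ℝ, F)) ∞
      (fun y => TotalSpace.mk' F y (A ((f : M → ℝ) • s) y (X y))) y :=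
    ContMDiffAt.clm_bundle_apply (b := fun y => y) ((h1 y trivial).contMDiffAt univ_mem) hXy
  refine h2.congr_of_eventuallyEq ?_
  filter_upwards [hy.eventuallyEq_nhds, hUo.mem_nhds hyU] with w hw hwU
  congr 2
  refine A.isCovariantDerivativeOnUniv.congr_of_eventuallyEq ?_ ?_ univ_mem ?_
  · exact (hU w hwU).mdifferentiableAt (by simp)
  · exact (hsm w).mdifferentiableAt (by simp)
  · filter_upwards [hw] with v hv
    simp [hv]

/-- The components of the connection form are smooth. -/
lemma smoothNear_connForm [T2Space M] {A : CovariantDerivative I F V}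
    (hA : A.ContMDiffCovariantDerivative ∞) {x : M} (hx : x ∈ trivSet F V p)
    {X : Π y : M, TangentSpace I y} (hX : SmoothFieldNear X x) :
    SmoothNear I (fun y => connForm A p y (X y)) x := by
  have h : ∀ k, SmoothNear I (fun y => ContinuousLinearMap.smulRightL ℝ F F
      (LinearMap.toContinuousLinearMap ((finBasis ℝ F).coord k))
      (locRep F p (fun y => A (constSec p (finBasis ℝ F k)) y (X y)) y)) x := fun k =>
    SmoothNear.comp (ContinuousLinearMap.contDiff _)
      ((smoothSecNear_iff hx).1 (smoothSecNear_cov hA (smoothSecNear_constSec hx _) hX))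
  refine (SmoothNear.sum (s := Finset.univ) fun k _ => h k).congr (.of_forall fun y => ?_)
  simp only [connForm, sum_apply, ContinuousLinearMap.comp_apply]
  rfl

end LocalConnection

end YangMills

end

noncomputable section

set_option linter.unusedSectionVars false

namespace YangMills

/-! ### Curvature in a coordinate frame -/

section FrameCalculus

open Filter Topology VectorField Module

variable {m : ℕ} {H : Type*} [TopologicalSpace H]
  {I : ModelWithCorners ℝ (EuclideanSpace ℝ (Fin m)) H}
  {M : Type*} [TopologicalSpace M] [ChartedSpace H M] [IsManifold I ∞ M]
  {W : Type*} [NormedAddCommGroup W] [NormedSpace ℝ W]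
  {W' : Type*} [NormedAddCommGroup W'] [NormedSpace ℝ W']

lemma fieldDeriv_sum {ι : Type*} {X : Π x : M, TangentSpace I x} {s : Finset ι} {f : ι → M → W}
    {x : M} (hf : ∀ i ∈ s, SmoothNear I (f i) x) :
    fieldDeriv X (fun y => ∑ i ∈ s, f i y) x = ∑ i ∈ s, fieldDeriv X (f i) x := by
  classical
  induction s using Finset.induction_on with
  | empty => simp [fieldDeriv, mvfderiv_const]
  | insert i s hi ih =>
    simp only [Finset.sum_insert hi]
    rw [← ih fun j hj => hf j (by simp [hj])]
    exact fieldDeriv_add (hf i (by simp)).mdiff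
      (SmoothNear.sum fun j hj => hf j (by simp [hj])).mdiff

lemma fieldDeriv_clm_apply {X : Π x : M, TangentSpace I x} {T : M → W →L[ℝ] W'} {f : M → W} {x : M}
    (hT : MDifferentiableAt I 𝓘(ℝ, W →L[ℝ] W') T x) (hf : MDifferentiableAt I 𝓘(ℝ, W) f x) :
    fieldDeriv X (fun y => T y (f y)) x = fieldDeriv X T x (f x) + T x (fieldDeriv X f x) := by
  have hB := (isBoundedBilinearMap_apply (𝕜 := ℝ) (E := W) (F := W')).hasFDerivAt (T x, f x)
  have hp : HasMFDerivAt I 𝓘(ℝ, (W →L[ℝ] W') × W) (fun y => (T y, f y)) x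
      ((mfderiv I 𝓘(ℝ, W →L[ℝ] W') T x).prod (mfderiv I 𝓘(ℝ, W) f x)) :=
    ⟨hT.continuousAt.prodMk hf.continuousAt, hT.hasMFDerivAt.2.prodMk hf.hasMFDerivAt.2⟩
  have h := HasMFDerivAt.comp (g := fun q : (W →L[ℝ] W') × W => q.1 q.2) x hB.hasMFDerivAt hp
  simp only [fieldDeriv, mvfderiv]
  refine (congrArg (fun L => L (X x)) h.mfderiv).trans ?_
  exact add_comm _ _

variable {p : M} {κ : Type*} [Fintype κ] [DecidableEq κ]

namespace CoordFrame

variable (𝔛 : CoordFrame I p κ)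

/-- The components of a vector field. -/
abbrev comp (X : Π x : M, TangentSpace I x) (i : κ) : M → ℝ := fieldDeriv X (𝔛.coord i)

variable {𝔛} {x : M} (hx : x ∈ 𝔛.U) {X Y Z : Π x : M, TangentSpace I x}
include hx

lemma sum_comp (X : Π x : M, TangentSpace I x) : ∑ i, 𝔛.comp X i x • 𝔛.X i x = X x :=
  𝔛.expand x hx _

lemma fieldDeriv_eq_sum (X : Π x : M, TangentSpace I x) (f : M → W) :
    fieldDeriv X f x = ∑ i, 𝔛.comp X i x • 𝔛.D i f x := by
  conv_lhs => rw [fieldDeriv, ← 𝔛.sum_comp hx X, map_sum]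
  simp only [map_smul]
  rfl

lemma comp_near (hX : SmoothFieldNear X x) (i : κ) : SmoothNear I (𝔛.comp X i) x :=
  (𝔛.coord_near i hx).fieldDeriv hX

lemma fieldDeriv_bracket [FiniteDimensional ℝ W] {f : M → W} (hX : SmoothFieldNear X x)
    (hY : SmoothFieldNear Y x) (hf : SmoothNear I f x) :
    fieldDeriv (mlieBracket I X Y) f x =
      fieldDeriv X (fieldDeriv Y f) x - fieldDeriv Y (fieldDeriv X f) x := by
  rcases isEmpty_or_nonempty κ with h | ⟨⟨i⟩⟩
  · have h0 : ∀ (X : Π x : M, TangentSpace I x) (f : M → W), fieldDeriv X f x = 0 := fun X f => by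
      rw [𝔛.fieldDeriv_eq_sum hx, Finset.univ_eq_empty, Finset.sum_empty]
    simp only [h0, sub_self]
  · exact fieldDeriv_mlieBracket hX hY hf (𝔛.field_near i hx) (𝔛.X_ne_zero hx i)

lemma comp_bracket (hX : SmoothFieldNear X x) (hY : SmoothFieldNear Y x) (i : κ) :
    𝔛.comp (mlieBracket I X Y) i x =
      fieldDeriv X (𝔛.comp Y i) x - fieldDeriv Y (𝔛.comp X i) x :=
  𝔛.fieldDeriv_bracket hx hX hY (𝔛.coord_near i hx)

end CoordFrame

variable {F : Type*} [NormedAddCommGroup F] [NormedSpace ℝ F] [FiniteDimensional ℝ F]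
  {V : M → Type*} [TopologicalSpace (TotalSpace F V)]
  [∀ x, AddCommGroup (V x)] [∀ x, Module ℝ (V x)] [∀ x, TopologicalSpace (V x)]
  [∀ x, IsTopologicalAddGroup (V x)] [∀ x, ContinuousSMul ℝ (V x)]
  [FiberBundle F V] [VectorBundle ℝ F V] [ContMDiffVectorBundle ∞ F V I] [T2Space M]
  {A : CovariantDerivative I F V}

/-- The coefficients of a connection. -/
def CoordFrame.connCoef (𝔛 : CoordFrame I p κ) (A : CovariantDerivative I F V) (i : κ) (x : M) :
    F →L[ℝ] F := connForm A p x (𝔛.X i x)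

namespace CoordFrame

variable {𝔛 : CoordFrame I p κ} {x : M} (hx : x ∈ 𝔛.U) (hx' : x ∈ trivSet F V p)
  {X Y : Π x : M, TangentSpace I x} {s : Π x : M, V x}

lemma connCoef_near (hA : A.ContMDiffCovariantDerivative ∞) (hx : x ∈ 𝔛.U)
    (hx' : x ∈ trivSet F V p) (i : κ) : SmoothNear I (𝔛.connCoef A i) x :=
  smoothNear_connForm hA hx' (𝔛.field_near i hx)

lemma connForm_eq_sum (hx : x ∈ 𝔛.U) (X : Π x : M, TangentSpace I x) :
    connForm A p x (X x) = ∑ i, 𝔛.comp X i x • 𝔛.connCoef A i x := by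
  conv_lhs => rw [← 𝔛.sum_comp hx X, map_sum]
  simp only [map_smul]
  rfl

include hx hx'

lemma trivAt_covField (hs : SmoothSecNear F I s x)
    (X : Π x : M, TangentSpace I x) :
    trivAt F p x (A s x (X x)) = fieldDeriv X (locRep F p s) x +
      connForm A p x (X x) (locRep F p s x) := trivAt_cov A hx' hs _

/-- The curvature of a connection in a coordinate frame. -/
lemma trivAt_curvatureOp (hA : A.ContMDiffCovariantDerivative ∞) (hX : SmoothFieldNear X x)
    (hY : SmoothFieldNear Y x) (hs : SmoothSecNear F I s x) :
    trivAt F p x (curvatureOp A X Y s x) = (∑ a, ∑ b, (𝔛.comp X a x * 𝔛.comp Y b x) •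
      𝔛.curvFun (𝔛.connCoef A) a b x) (locRep F p s x) := by
  set f := locRep F p s
  have hf : SmoothNear I f x := (smoothSecNear_iff hx').1 hs
  have hγ := 𝔛.connCoef_near hA hx hx'
  have hc : ∀ {Y}, SmoothFieldNear Y x → SmoothNear I (fun y => connForm A p y (Y y)) x :=
    fun h => smoothNear_connForm hA hx' h
  have e1 : ∀ {X Y : Π x : M, TangentSpace I x}, SmoothFieldNear Y x →
      trivAt F p x (A (fun y => A s y (Y y)) x (X x)) =
        fieldDeriv X (fieldDeriv Y f) x + fieldDeriv X (fun y => connForm A p y (Y y)) x (f x)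
        + connForm A p x (Y x) (fieldDeriv X f x)
        + connForm A p x (X x) (fieldDeriv Y f x + connForm A p x (Y x) (f x)) := by
    intro X Y hY
    have h : locRep F p (fun y => A s y (Y y)) =ᶠ[𝓝 x]
        (fieldDeriv Y f) + fun y => connForm A p y (Y y) (f y) := by
      filter_upwards [trivSet_mem_nhds hx', eventually_eventually_nhds.2 hs] with y hy hy'
      exact trivAt_cov A hy hy' _
    rw [trivAt_cov A hx' (smoothSecNear_cov hA hs hY), h.self_of_nhds]
    have h2 := (fieldDeriv_congr (X := X) h).self_of_nhds
    rw [fieldDeriv_add (hf.fieldDeriv hY).mdiff, fieldDeriv_clm_apply (hc hY).mdiff hf.mdiff] at h2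
    · rw [fieldDeriv] at h2
      rw [h2]
      simp only [Pi.add_apply]
      abel
    · exact ((hc hY).self_of_nhds.clm_apply hf.self_of_nhds).mdifferentiableAt (by simp)
  have e2 : ∀ {X Y : Π x : M, TangentSpace I x}, SmoothFieldNear Y x →
      fieldDeriv X (fun y => connForm A p y (Y y)) x =
        ∑ b, fieldDeriv X (𝔛.comp Y b) x • 𝔛.connCoef A b x
        + ∑ b, ∑ a, (𝔛.comp X a x * 𝔛.comp Y b x) • 𝔛.D a (𝔛.connCoef A b) x := by
    intro X Y hY
    have h : (fun y => connForm A p y (Y y)) =ᶠ[𝓝 x]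
        fun y => ∑ b, 𝔛.comp Y b y • 𝔛.connCoef A b y := by
      filter_upwards [𝔛.isOpen.mem_nhds hx] with y hy using connForm_eq_sum hy Y
    rw [(fieldDeriv_congr h).self_of_nhds, fieldDeriv_sum fun b _ =>
      (𝔛.comp_near hx hY b).smul (hγ b), ← Finset.sum_add_distrib]
    refine Finset.sum_congr rfl fun b _ => ?_
    rw [fieldDeriv_smul (𝔛.comp_near hx hY b).mdiff (hγ b).mdiff,
      𝔛.fieldDeriv_eq_sum hx X (𝔛.connCoef A b), Finset.smul_sum]
    simp only [smul_smul, mul_comm]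
  have e3 : trivAt F p x (A s x (mlieBracket I X Y x)) =
      fieldDeriv X (fieldDeriv Y f) x - fieldDeriv Y (fieldDeriv X f) x +
      (∑ b, (fieldDeriv X (𝔛.comp Y b) x - fieldDeriv Y (𝔛.comp X b) x) • 𝔛.connCoef A b x) (f x) := by
    rw [trivAt_covField hx hx' hs, 𝔛.connForm_eq_sum hx, 𝔛.fieldDeriv_bracket hx hX hY hf]
    simp only [𝔛.comp_bracket hx hX hY]
    rfl
  rw [curvatureOp, map_sub, map_sub, e1 hY, e1 hX, e3, e2 hX, e2 hY, connForm_eq_sum hx X,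
    connForm_eq_sum hx Y]
  simp only [curvFun, smul_add, smul_sub, Finset.sum_add_distrib, Finset.sum_sub_distrib, sub_smul]
  have c1 : ∑ b, ∑ a, (𝔛.comp X a x * 𝔛.comp Y b x) • 𝔛.D a (𝔛.connCoef A b) x =
      ∑ a, ∑ b, (𝔛.comp X a x * 𝔛.comp Y b x) • 𝔛.D a (𝔛.connCoef A b) x := Finset.sum_comm
  have c2 : ∑ b, ∑ a, (𝔛.comp Y a x * 𝔛.comp X b x) • 𝔛.D a (𝔛.connCoef A b) x =
      ∑ a, ∑ b, (𝔛.comp X a x * 𝔛.comp Y b x) • 𝔛.D b (𝔛.connCoef A a) x :=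
    Finset.sum_congr rfl fun b _ => Finset.sum_congr rfl fun a _ => by rw [mul_comm]
  have c3 : (∑ a, 𝔛.comp X a x • 𝔛.connCoef A a x) * (∑ a, 𝔛.comp Y a x • 𝔛.connCoef A a x) =
      ∑ a, ∑ b, (𝔛.comp X a x * 𝔛.comp Y b x) • (𝔛.connCoef A a x * 𝔛.connCoef A b x) := by
    simp only [Finset.sum_mul_sum, smul_mul_smul_comm]
  have c4 : (∑ a, 𝔛.comp Y a x • 𝔛.connCoef A a x) * (∑ a, 𝔛.comp X a x • 𝔛.connCoef A a x) =
      ∑ a, ∑ b, (𝔛.comp X a x * 𝔛.comp Y b x) • (𝔛.connCoef A b x * 𝔛.connCoef A a x) := by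
    simp only [Finset.sum_mul_sum, smul_mul_smul_comm]
    rw [Finset.sum_comm]
    simp only [mul_comm]
  rw [← c3, ← c4, c1, c2]
  simp only [map_add, add_apply, sub_apply, mul_apply_eq_comp]
  abel

end CoordFrame

end FrameCalculus

end YangMills

end

noncomputable section

set_option linter.unusedSectionVars false

namespace YangMills

/-! ### Metrics in a coordinate frame -/

section MetricFrame

open Filter Topology VectorField Module Matrix

variable {m : ℕ} {H : Type*} [TopologicalSpace H]
  {I : ModelWithCorners ℝ (EuclideanSpace ℝ (Fin m)) H}
  {M : Type*} [TopologicalSpace M] [ChartedSpace H M] [IsManifold I ∞ M]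

/-- A smooth field of positive definite symmetric bilinear forms. -/
structure IsSmoothMetric (g : Π x : M, TangentSpace I x → TangentSpace I x → ℝ) : Prop where
  add_left : ∀ x u u' v, g x (u + u') v = g x u v + g x u' v
  smul_left : ∀ x (r : ℝ) u v, g x (r • u) v = r * g x u v
  symm : ∀ x u v, g x u v = g x v u
  pos : ∀ x u, u ≠ 0 → 0 < g x u u
  smooth : ∀ x (X Y : Π x : M, TangentSpace I x), SmoothFieldNear X x → SmoothFieldNear Y x →
    SmoothNear I (fun y => g y (X y) (Y y)) x

namespace IsSmoothMetric

variable {g : Π x : M, TangentSpace I x → TangentSpace I x → ℝ} (hg : IsSmoothMetric g)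
include hg

/-- The metric at a point as a bilinear map. -/
def bilin (x : M) : TangentSpace I x →ₗ[ℝ] TangentSpace I x →ₗ[ℝ] ℝ :=
  LinearMap.mk₂ ℝ (g x) (hg.add_left x) (hg.smul_left x)
    (fun u v v' => by rw [hg.symm, hg.add_left, hg.symm x v, hg.symm x v'])
    (fun r u v => by rw [hg.symm, hg.smul_left, hg.symm x v]; rfl)

lemma apply_sum {κ κ' : Type*} (x : M) (s : Finset κ) (t : Finset κ') (a : κ → ℝ) (b : κ' → ℝ)
    (u : κ → TangentSpace I x) (v : κ' → TangentSpace I x) :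
    g x (∑ i ∈ s, a i • u i) (∑ j ∈ t, b j • v j) =
      ∑ i ∈ s, ∑ j ∈ t, a i * b j * g x (u i) (v j) := by
  change hg.bilin x _ _ = _
  simp only [map_sum, map_smul, LinearMap.sum_apply, LinearMap.smul_apply, smul_eq_mul,
    Finset.mul_sum]
  rw [Finset.sum_comm]
  refine Finset.sum_congr rfl fun i _ => Finset.sum_congr rfl fun j _ => ?_
  rw [← mul_assoc, mul_comm (b j)]
  rfl

lemma posDef_gram {κ : Type*} [Fintype κ] (x : M) (b : Basis κ ℝ (TangentSpace I x)) :
    (Matrix.of fun i j => g x (b i) (b j)).PosDef := by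
  refine Matrix.PosDef.of_dotProduct_mulVec_pos ?_ fun v hv => ?_
  · refine Matrix.IsHermitian.ext fun i j => ?_
    exact hg.symm x (b j) (b i)
  · have h := hg.pos x (∑ i, v i • b i) fun h0 => hv ?_
    · refine (h.trans_eq (hg.apply_sum ..)).trans_eq ?_
      simp only [dotProduct, mulVec, Finset.mul_sum, Matrix.of_apply, Pi.star_apply, star_trivial]
      refine Finset.sum_congr rfl fun i _ => Finset.sum_congr rfl fun j _ => ?_
      rw [mul_assoc, mul_comm (v j)]
    · funext i
      exact Fintype.linearIndependent_iff.1 b.linearIndependent v h0 i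

end IsSmoothMetric

/-! #### Determinants of matrices of smooth functions -/

lemma SmoothNear.prod {ι : Type*} {s : Finset ι} {f : ι → M → ℝ} {p : M}
    (hf : ∀ i ∈ s, SmoothNear I (f i) p) : SmoothNear I (fun x => ∏ i ∈ s, f i x) p := by
  classical
  induction s using Finset.induction_on with
  | empty => simpa using const (1 : ℝ)
  | insert i s hi ih =>
    simp only [Finset.prod_insert hi]
    exact (hf i (by simp)).mul (ih fun j hj => hf j (by simp [hj]))

lemma fieldDeriv_prod {ι : Type*} [DecidableEq ι] {X : Π x : M, TangentSpace I x} {s : Finset ι}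
    {f : ι → M → ℝ} {x : M} (hf : ∀ i ∈ s, SmoothNear I (f i) x) :
    fieldDeriv X (fun y => ∏ i ∈ s, f i y) x =
      ∑ i ∈ s, fieldDeriv X (f i) x * ∏ j ∈ s.erase i, f j x := by
  induction s using Finset.induction_on with
  | empty => simp [fieldDeriv, mvfderiv_const]
  | insert i s hi ih =>
    simp only [Finset.prod_insert hi]
    have h1 : fieldDeriv X ((f i) * fun y => ∏ i ∈ s, f i y) x = _ :=
      fieldDeriv_mul (hf i (by simp)).mdiff
        (SmoothNear.prod fun j hj => hf j (Finset.mem_insert_of_mem hj)).mdiff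
    refine h1.trans ?_
    rw [ih fun j hj => hf j (by simp [hj]), Finset.sum_insert hi, Finset.erase_insert hi,
      Finset.mul_sum]
    congr 1
    refine Finset.sum_congr rfl fun j hj => ?_
    have hij : i ≠ j := fun h => hi (h ▸ hj)
    rw [Finset.erase_insert_of_ne hij, Finset.prod_insert (by simp [hi])]
    ring

variable {κ : Type*} [Fintype κ] [DecidableEq κ]

lemma smoothNear_det {N : κ → κ → M → ℝ} {x : M} (hN : ∀ i j, SmoothNear I (N i j) x) :
    SmoothNear I (fun y => (Matrix.of fun i j => N i j y).det) x := by
  simp only [Matrix.det_apply', Matrix.of_apply]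
  exact SmoothNear.sum fun σ _ => (SmoothNear.const _).mul (SmoothNear.prod fun i _ => hN _ _)

lemma smoothNear_adjugate {N : κ → κ → M → ℝ} {x : M} (hN : ∀ i j, SmoothNear I (N i j) x)
    (a b : κ) : SmoothNear I (fun y => (Matrix.of fun i j => N i j y).adjugate a b) x := by
  have h := smoothNear_det (I := I) (x := x)
    (N := fun i j y => if i = b then (Pi.single a 1 : κ → ℝ) j else N i j y) fun i j => by
      by_cases hi : i = b
      · simpa [hi] using SmoothNear.const _
      · simpa [hi] using hN i j
  refine h.congr (.of_forall fun y => ?_)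
  refine (Matrix.adjugate_apply _ _ _).trans (congrArg Matrix.det ?_)
  refine Matrix.ext fun i j => ?_
  by_cases hi : i = b
  · subst hi
    simp
  · simp [hi]

/-- Jacobi's formula. -/
lemma fieldDeriv_det {X : Π x : M, TangentSpace I x} {N : κ → κ → M → ℝ} {x : M}
    (hN : ∀ i j, SmoothNear I (N i j) x) :
    fieldDeriv X (fun y => (Matrix.of fun i j => N i j y).det) x =
      ∑ i, ∑ j, (Matrix.of fun i j => N i j x).adjugate i j * fieldDeriv X (N j i) x := by
  have h1 : ∀ i, ∑ j, (Matrix.of fun i j => N i j x).adjugate i j * fieldDeriv X (N j i) x =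
      ((Matrix.of fun i j => N i j x).updateCol i fun j => fieldDeriv X (N j i) x).det := fun i => by
    rw [← Matrix.cramer_apply, Matrix.cramer_eq_adjugate_mulVec]
    rfl
  have h0 : fieldDeriv X (fun y => (Matrix.of fun i j => N i j y).det) x =
      ∑ σ : Equiv.Perm κ, fieldDeriv X (fun y => ((Equiv.Perm.sign σ : ℤ) : ℝ) *
        ∏ i, N (σ i) i y) x := by
    simp only [Matrix.det_apply']
    exact fieldDeriv_sum (f := fun σ y => ((Equiv.Perm.sign σ : ℤ) : ℝ) * ∏ i, N (σ i) i y)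
      fun σ _ => (SmoothNear.const _).mul (SmoothNear.prod fun i _ => hN _ _)
  rw [h0]
  simp only [h1, Matrix.det_apply']
  rw [Finset.sum_comm]
  refine Finset.sum_congr rfl fun σ _ => ?_
  have h2 := fieldDeriv_smul (X := X) (p := x)
    (a := fun _ : M => (((Equiv.Perm.sign σ : ℤ) : ℝ))) (f := fun y => ∏ i, N (σ i) i y)
    (SmoothNear.const _).mdiff (SmoothNear.prod fun i _ => hN _ _).mdiff
  simp only [smul_eq_mul] at h2
  rw [h2, fieldDeriv_prod fun i _ => hN _ _]
  have h3 : fieldDeriv X (fun _ : M => (((Equiv.Perm.sign σ : ℤ) : ℝ))) x = 0 := by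
    simp [fieldDeriv, mvfderiv_const]
  rw [h3, zero_mul, zero_add, Finset.mul_sum]
  refine Finset.sum_congr rfl fun i _ => ?_
  congr 1
  rw [← Finset.mul_prod_erase _ _ (Finset.mem_univ i)]
  congr 1
  · simp
  · refine Finset.prod_congr rfl fun j hj => ?_
    rw [Matrix.updateCol_ne (Finset.ne_of_mem_erase hj)]
    rfl

namespace CoordFrame

variable {p : M} (𝔛 : CoordFrame I p κ) (g : Π x : M, TangentSpace I x → TangentSpace I x → ℝ)

/-- The components `g_{ab}` of the metric. -/
def G (a b : κ) (x : M) : ℝ := g x (𝔛.X a x) (𝔛.X b x)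

/-- The matrix of the components of the metric. -/
def GMat (x : M) : Matrix κ κ ℝ := Matrix.of fun a b => 𝔛.G g a b x

/-- The components `g^{ab}` of the inverse metric. -/
def P (a b : κ) (x : M) : ℝ := (𝔛.GMat g x)⁻¹ a b

/-- The volume density. -/
def vol (x : M) : ℝ := Real.sqrt (𝔛.GMat g x).det

/-- The coordinate vector fields form a basis. -/
def basis {x : M} (hx : x ∈ 𝔛.U) : Basis κ ℝ (TangentSpace I x) :=
  Basis.ofEquivFun (LinearEquiv.ofLinearMap
    (LinearMap.pi fun i => (mvfderiv I (𝔛.coord i) x : TangentSpace I x →ₗ[ℝ] ℝ))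
    (Fintype.linearCombination ℝ fun i => 𝔛.X i x)
    (by
      refine LinearMap.ext fun v => funext fun i => ?_
      simp [Fintype.linearCombination_apply, 𝔛.dual x hx])
    (by
      refine LinearMap.ext fun u => ?_
      exact 𝔛.expand x hx u))

lemma basis_apply {x : M} (hx : x ∈ 𝔛.U) (i : κ) : 𝔛.basis hx i = 𝔛.X i x := by
  simp [basis, Fintype.linearCombination_apply, Pi.single_apply]

variable {𝔛 g} {x : M}

lemma posDef_GMat (hg : IsSmoothMetric g) (hx : x ∈ 𝔛.U) : (𝔛.GMat g x).PosDef := by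
  have h := hg.posDef_gram x (𝔛.basis hx)
  have e : (Matrix.of fun i j => g x (𝔛.basis hx i) (𝔛.basis hx j)) = 𝔛.GMat g x :=
    Matrix.ext fun i j => by simp [GMat, G, basis_apply]
  rwa [e] at h

lemma det_pos (hg : IsSmoothMetric g) (hx : x ∈ 𝔛.U) : 0 < (𝔛.GMat g x).det :=
  (posDef_GMat hg hx).det_pos

lemma vol_pos (hg : IsSmoothMetric g) (hx : x ∈ 𝔛.U) : 0 < 𝔛.vol g x :=
  Real.sqrt_pos.2 (det_pos hg hx)

lemma G_symm (hg : IsSmoothMetric g) (a b : κ) : 𝔛.G g a b = 𝔛.G g b a :=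
  funext fun _ => hg.symm _ _ _

lemma P_symm (hg : IsSmoothMetric g) (a b : κ) : 𝔛.P g a b = 𝔛.P g b a := by
  funext x
  have h : (𝔛.GMat g x)ᵀ = 𝔛.GMat g x := by
    ext a b
    exact hg.symm _ _ _
  rw [P, P, ← Matrix.transpose_apply (𝔛.GMat g x)⁻¹, Matrix.transpose_nonsing_inv, h]

lemma sum_P_G (hg : IsSmoothMetric g) (hx : x ∈ 𝔛.U) (a c : κ) :
    ∑ b, 𝔛.P g a b x * 𝔛.G g b c x = if a = c then 1 else 0 := by
  have h := congrFun (congrFun (Matrix.nonsing_inv_mul _ (det_pos hg hx).ne'.isUnit) a) c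
  rw [Matrix.mul_apply, Matrix.one_apply] at h
  exact h

lemma sum_G_P (hg : IsSmoothMetric g) (hx : x ∈ 𝔛.U) (a c : κ) :
    ∑ b, 𝔛.G g a b x * 𝔛.P g b c x = if a = c then 1 else 0 := by
  have h := congrFun (congrFun (Matrix.mul_nonsing_inv _ (det_pos hg hx).ne'.isUnit) a) c
  rw [Matrix.mul_apply, Matrix.one_apply] at h
  exact h

lemma G_near (hg : IsSmoothMetric g) (hx : x ∈ 𝔛.U) (a b : κ) : SmoothNear I (𝔛.G g a b) x :=
  hg.smooth x _ _ (𝔛.field_near a hx) (𝔛.field_near b hx)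

lemma det_near (hg : IsSmoothMetric g) (hx : x ∈ 𝔛.U) :
    SmoothNear I (fun y => (𝔛.GMat g y).det) x := smoothNear_det (G_near hg hx)

lemma vol_near (hg : IsSmoothMetric g) (hx : x ∈ 𝔛.U) : SmoothNear I (𝔛.vol g) x :=
  SmoothNear.comp_at (n := Real.sqrt) (f := fun y => (𝔛.GMat g y).det)
    ((isOpen_ne.eventually_mem (det_pos hg hx).ne').mono fun _ hy => Real.contDiffAt_sqrt hy)
    (det_near hg hx)

lemma P_near (hg : IsSmoothMetric g) (hx : x ∈ 𝔛.U) (a b : κ) : SmoothNear I (𝔛.P g a b) x := by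
  refine (((det_near hg hx).inv (det_pos hg hx).ne').mul
    (smoothNear_adjugate (G_near hg hx) a b)).congr (.of_forall fun y => ?_)
  rw [P, Matrix.inv_def, Ring.inverse_eq_inv']
  rfl

lemma fieldDeriv_P (hg : IsSmoothMetric g) (hx : x ∈ 𝔛.U) (X : Π x : M, TangentSpace I x) (b c : κ) :
    fieldDeriv X (𝔛.P g b c) x =
      -∑ k, ∑ l, 𝔛.P g b k x * fieldDeriv X (𝔛.G g k l) x * 𝔛.P g l c x := by
  have h : ∀ l, ∑ k, (fieldDeriv X (𝔛.P g b k) x * 𝔛.G g k l x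
      + 𝔛.P g b k x * fieldDeriv X (𝔛.G g k l) x) = 0 := by
    intro l
    have h1 : (fun y => ∑ k, (𝔛.P g b k * 𝔛.G g k l) y) =ᶠ[𝓝 x]
        fun _ => if b = l then 1 else 0 := by
      filter_upwards [𝔛.isOpen.mem_nhds hx] with y hy using sum_P_G hg hy b l
    have h2 := (fieldDeriv_congr (X := X) h1).self_of_nhds
    rw [fieldDeriv_sum fun k _ => (P_near hg hx b k).mul (G_near hg hx k l)] at h2
    simp only [fieldDeriv_mul (P_near hg hx b _).mdiff (G_near hg hx _ l).mdiff] at h2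
    rw [h2]
    simp [fieldDeriv, mvfderiv_const]
  have h3 : ∑ l, (∑ k, (fieldDeriv X (𝔛.P g b k) x * 𝔛.G g k l x
      + 𝔛.P g b k x * fieldDeriv X (𝔛.G g k l) x)) * 𝔛.P g l c x = 0 := by simp [h]
  simp only [Finset.sum_add_distrib, add_mul, Finset.sum_mul] at h3
  have h4 : ∑ l, ∑ k, fieldDeriv X (𝔛.P g b k) x * 𝔛.G g k l x * 𝔛.P g l c x =
      fieldDeriv X (𝔛.P g b c) x := by
    rw [Finset.sum_comm]
    simp only [mul_assoc, ← Finset.mul_sum, sum_G_P hg hx]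
    simp
  rw [h4, Finset.sum_comm] at h3
  exact eq_neg_of_add_eq_zero_left h3

lemma fieldDeriv_vol (hg : IsSmoothMetric g) (hx : x ∈ 𝔛.U) (X : Π x : M, TangentSpace I x) :
    fieldDeriv X (𝔛.vol g) x =
      1 / 2 * 𝔛.vol g x * ∑ k, ∑ l, 𝔛.P g k l x * fieldDeriv X (𝔛.G g k l) x := by
  have h1 : (fun y => (𝔛.GMat g y).det) =ᶠ[𝓝 x] 𝔛.vol g * 𝔛.vol g := by
    filter_upwards [𝔛.isOpen.mem_nhds hx] with y hy
    exact (Real.mul_self_sqrt (det_pos hg hy).le).symm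
  have h2 := (fieldDeriv_congr (X := X) h1).self_of_nhds
  rw [fieldDeriv_mul (vol_near hg hx).mdiff (vol_near hg hx).mdiff] at h2
  have h3 := fieldDeriv_det (X := X) (G_near (𝔛 := 𝔛) hg hx)
  have h4 : fieldDeriv X (fun y => (𝔛.GMat g y).det) x = _ := h3
  have hd := det_pos (𝔛 := 𝔛) hg hx
  have hv := vol_pos (𝔛 := 𝔛) hg hx
  have h5 : ∀ i j, (Matrix.of fun i j => 𝔛.G g i j x).adjugate i j =
      𝔛.vol g x * 𝔛.vol g x * 𝔛.P g i j x := by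
    intro i j
    have e : 𝔛.vol g x * 𝔛.vol g x = (𝔛.GMat g x).det := Real.mul_self_sqrt hd.le
    rw [e, P, Matrix.inv_def, Ring.inverse_eq_inv', Matrix.smul_apply, smul_eq_mul,
      mul_inv_cancel_left₀ hd.ne']
    rfl
  rw [h4] at h2
  simp only [h5, mul_assoc, ← Finset.mul_sum] at h2
  have h6 : ∑ i, ∑ j, 𝔛.P g i j x * fieldDeriv X (𝔛.G g j i) x =
      ∑ i, ∑ j, 𝔛.P g i j x * fieldDeriv X (𝔛.G g i j) x := by
    refine Finset.sum_congr rfl fun i _ => Finset.sum_congr rfl fun j _ => ?_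
    rw [G_symm hg i j]
  rw [h6] at h2
  have h7 : 2 * 𝔛.vol g x * fieldDeriv X (𝔛.vol g) x = 2 * 𝔛.vol g x *
      (1 / 2 * 𝔛.vol g x * ∑ k, ∑ l, 𝔛.P g k l x * fieldDeriv X (𝔛.G g k l) x) := by
    linear_combination -h2
  exact mul_left_cancel₀ (by positivity) h7

end CoordFrame

end MetricFrame

end YangMills

end

noncomputable section

set_option linter.unusedSectionVars false

namespace YangMills

/-! ### The Levi-Civita connection in a coordinate frame -/

section LeviCivitaFrame

open Filter Topology VectorField Module Matrix

variable {m : ℕ} {H : Type*} [TopologicalSpace H]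
  {I : ModelWithCorners ℝ (EuclideanSpace ℝ (Fin m)) H}
  {M : Type*} [TopologicalSpace M] [ChartedSpace H M] [IsManifold I ∞ M]
  {κ : Type*} [Fintype κ] [DecidableEq κ]
  {g : Π x : M, TangentSpace I x → TangentSpace I x → ℝ}

/-- The components of a tangent vector in the standard basis. -/
def stdCoord {x : M} (v : TangentSpace I x) (i : Fin m) : ℝ :=
  (EuclideanSpace.proj i : EuclideanSpace ℝ (Fin m) →L[ℝ] ℝ) v

lemma sum_coordVec {x : M} (v : TangentSpace I x) : ∑ i, stdCoord v i • coordVec I x i = v := by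
  have h := (EuclideanSpace.basisFun (Fin m) ℝ).sum_repr v
  simp only [EuclideanSpace.basisFun_apply] at h
  exact h

lemma extendVec_self {x : M} (v : TangentSpace I x) : extendVec v x = v :=
  FiberBundle.extend_apply_self _ _

lemma smoothFieldNear_extendVec {x : M} (v : TangentSpace I x) :
    SmoothFieldNear (extendVec v : Π y : M, TangentSpace I y) x := smoothFieldNear_extend v

namespace CoordFrame

variable {p : M} {𝔛 : CoordFrame I p κ} {x : M}

lemma posDef_gram (hg : IsSmoothMetric g) (x : M) : (gram g x).PosDef := by
  have h := hg.posDef_gram x (EuclideanSpace.basisFun (Fin m) ℝ).toBasis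
  have e : (Matrix.of fun i j => g x ((EuclideanSpace.basisFun (Fin m) ℝ).toBasis i)
      ((EuclideanSpace.basisFun (Fin m) ℝ).toBasis j)) = gram g x :=
    Matrix.ext fun i j => by simp [gram, coordVec]
  exact Eq.mp (congrArg Matrix.PosDef e) h

variable (𝔛) in
/-- The components `θ_a(e_i)` of the standard basis. -/
def stdComp (x : M) : Matrix κ (Fin m) ℝ :=
  Matrix.of fun a i => mvfderiv I (𝔛.coord a) x (coordVec I x i)

lemma stdComp_mul (hg : IsSmoothMetric g) (hx : x ∈ 𝔛.U) :
    𝔛.stdComp x * (gram g x)⁻¹ * (𝔛.stdComp x)ᵀ = (𝔛.GMat g x)⁻¹ := by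
  set C := 𝔛.stdComp x with hC
  let C' : Matrix (Fin m) κ ℝ := Matrix.of fun i a => stdCoord (𝔛.X a x) i
  have h1 : C * C' = 1 := by
    refine Matrix.ext fun a b => ?_
    rw [Matrix.mul_apply, Matrix.one_apply, ← 𝔛.dual x hx a b]
    conv_rhs => rw [← sum_coordVec (𝔛.X b x), map_sum]
    refine Finset.sum_congr rfl fun i _ => ?_
    rw [map_smul, smul_eq_mul, mul_comm]
    rfl
  have h2 : gram g x = Cᵀ * 𝔛.GMat g x * C := by
    refine Matrix.ext fun i j => ?_
    have e : gram g x i j = g x (∑ a, C a i • 𝔛.X a x) (∑ b, C b j • 𝔛.X b x) := by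
      rw [gram, Matrix.of_apply]
      congr 1
      · exact (𝔛.expand x hx _).symm
      · exact (𝔛.expand x hx _).symm
    rw [e, hg.apply_sum]
    simp only [Matrix.mul_apply, Matrix.transpose_apply, Finset.sum_mul]
    rw [Finset.sum_comm]
    refine Finset.sum_congr rfl fun a _ => Finset.sum_congr rfl fun b _ => ?_
    change _ = C _ i * 𝔛.G g _ _ x * C _ j
    rw [G]
    ring
  have h3 : (gram g x)⁻¹ * gram g x = 1 :=
    Matrix.nonsing_inv_mul _ (posDef_gram hg x).det_pos.ne'.isUnit
  refine (Matrix.inv_eq_left_inv ?_).symm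
  calc C * (gram g x)⁻¹ * Cᵀ * 𝔛.GMat g x
      = C * (gram g x)⁻¹ * Cᵀ * 𝔛.GMat g x * (C * C') := by rw [h1, Matrix.mul_one]
    _ = C * ((gram g x)⁻¹ * (Cᵀ * 𝔛.GMat g x * C)) * C' := by simp only [Matrix.mul_assoc]
    _ = 1 := by rw [← h2, h3, Matrix.mul_one, h1]

lemma metricTrace_eq (hg : IsSmoothMetric g) (hx : x ∈ 𝔛.U) {W : Type*} [AddCommGroup W]
    [Module ℝ W] {T : TangentSpace I x → TangentSpace I x → W} {t : κ → κ → W}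
    (hT : ∀ u v, T u v = ∑ a, ∑ b, (mvfderiv I (𝔛.coord a) x u * mvfderiv I (𝔛.coord b) x v) •
      t a b) :
    metricTrace g x T = ∑ a, ∑ b, 𝔛.P g a b x • t a b := by
  have h : ∀ a b, 𝔛.P g a b x = ∑ i, ∑ j, (gram g x)⁻¹ i j *
      (mvfderiv I (𝔛.coord a) x (coordVec I x i) * mvfderiv I (𝔛.coord b) x (coordVec I x j)) := by
    intro a b
    rw [P, ← stdComp_mul hg hx, Matrix.mul_apply, Finset.sum_comm]
    refine Finset.sum_congr rfl fun j _ => ?_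
    rw [Matrix.mul_apply, Finset.sum_mul]
    refine Finset.sum_congr rfl fun i _ => ?_
    change _ * _ * mvfderiv I (𝔛.coord b) x (coordVec I x j) = _
    change mvfderiv I (𝔛.coord a) x (coordVec I x i) * _ * _ = _
    ring
  simp only [metricTrace, hT, h, Finset.sum_smul, Finset.smul_sum, smul_smul]
  rw [Finset.sum_congr rfl fun i _ => Finset.sum_comm, Finset.sum_comm]
  refine Finset.sum_congr rfl fun a _ => ?_
  rw [Finset.sum_congr rfl fun i _ => Finset.sum_comm, Finset.sum_comm]

lemma sharp_eq (hg : IsSmoothMetric g) (hx : x ∈ 𝔛.U) {θ : TangentSpace I x → ℝ} {t : κ → ℝ}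
    (hθ : ∀ v, θ v = ∑ b, mvfderiv I (𝔛.coord b) x v * t b) :
    sharp g x θ = ∑ a, (∑ b, 𝔛.P g a b x * t b) • 𝔛.X a x := by
  rw [sharp, metricTrace_eq hg hx (t := fun a b => t b • 𝔛.X a x)]
  · simp only [smul_smul, Finset.sum_smul]
  · intro u v
    conv_lhs => rw [← 𝔛.expand x hx u, hθ]
    simp only [Finset.smul_sum, smul_smul]
    refine Finset.sum_congr rfl fun i _ => ?_
    rw [Finset.sum_mul, Finset.sum_smul]
    refine Finset.sum_congr rfl fun j _ => ?_
    congr 1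
    ring

lemma coord_sum (hx : x ∈ 𝔛.U) (t : κ → ℝ) (a : κ) :
    mvfderiv I (𝔛.coord a) x (∑ b, t b • 𝔛.X b x) = t a := by
  rw [map_sum]
  simp [𝔛.dual x hx]

variable (𝔛 g) in
/-- The Christoffel symbols of the first kind. -/
def K (a b c : κ) (x : M) : ℝ :=
  1 / 2 * (𝔛.D a (𝔛.G g b c) x + 𝔛.D b (𝔛.G g c a) x - 𝔛.D c (𝔛.G g a b) x)

variable (𝔛 g) in
/-- The Christoffel symbols `Γ^e_{ab}`. -/
def Chr (e a b : κ) (x : M) : ℝ := ∑ c, 𝔛.P g e c x * 𝔛.K g a b c x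

lemma K_symm (hg : IsSmoothMetric g) (a b c : κ) : 𝔛.K g a b c x = 𝔛.K g b a c x := by
  simp only [K, G_symm hg b a, G_symm hg a c, G_symm hg c b]
  ring

lemma Chr_symm (hg : IsSmoothMetric g) (e a b : κ) : 𝔛.Chr g e a b x = 𝔛.Chr g e b a x := by
  simp only [Chr, K_symm hg a b]

variable (𝔛 g) in
/-- The metric pairing of two tuples of components. -/
def pair (x : M) (v w : κ → ℝ) : ℝ := ∑ b, ∑ c, v b * w c * 𝔛.G g b c x

lemma pair_symm (hg : IsSmoothMetric g) (v w : κ → ℝ) : 𝔛.pair g x v w = 𝔛.pair g x w v := by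
  rw [pair, Finset.sum_comm]
  refine Finset.sum_congr rfl fun a _ => Finset.sum_congr rfl fun b _ => ?_
  rw [G_symm hg]
  ring

lemma pair_sub (u v w : κ → ℝ) :
    𝔛.pair g x (fun i => u i - v i) w = 𝔛.pair g x u w - 𝔛.pair g x v w := by
  simp only [pair, ← Finset.sum_sub_distrib]
  refine Finset.sum_congr rfl fun a _ => Finset.sum_congr rfl fun b _ => by ring

lemma apply_eq_pair (hg : IsSmoothMetric g) (hx : x ∈ 𝔛.U) (X Y : Π x : M, TangentSpace I x) :
    g x (X x) (Y x) = 𝔛.pair g x (fun b => 𝔛.comp X b x) (fun c => 𝔛.comp Y c x) := by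
  conv_lhs => rw [← 𝔛.sum_comp hx X, ← 𝔛.sum_comp hx Y, hg.apply_sum]
  rfl

variable {X Y Z : Π x : M, TangentSpace I x}

lemma fieldDeriv_apply (hg : IsSmoothMetric g) (hx : x ∈ 𝔛.U) (hY : SmoothFieldNear Y x)
    (hZ : SmoothFieldNear Z x) :
    fieldDeriv X (fun y => g y (Y y) (Z y)) x =
      𝔛.pair g x (fun b => fieldDeriv X (𝔛.comp Y b) x) (fun c => 𝔛.comp Z c x) +
      𝔛.pair g x (fun b => fieldDeriv X (𝔛.comp Z b) x) (fun c => 𝔛.comp Y c x) +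
      ∑ a, ∑ b, ∑ c, 𝔛.comp X a x * 𝔛.comp Y b x * 𝔛.comp Z c x * 𝔛.D a (𝔛.G g b c) x := by
  have h1 : (fun y => g y (Y y) (Z y)) =ᶠ[𝓝 x]
      fun y => ∑ b, ∑ c, (𝔛.comp Y b * 𝔛.comp Z c * 𝔛.G g b c) y := by
    filter_upwards [𝔛.isOpen.mem_nhds hx] with y hy using apply_eq_pair hg hy Y Z
  have hn : ∀ b c, SmoothNear I (𝔛.comp Y b * 𝔛.comp Z c * 𝔛.G g b c) x := fun b c =>
    ((𝔛.comp_near hx hY b).mul (𝔛.comp_near hx hZ c)).mul (G_near hg hx b c)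
  have h2 := (fieldDeriv_congr (X := X) h1).self_of_nhds
  have h3 : fieldDeriv X (fun y => ∑ b, ∑ c, (𝔛.comp Y b * 𝔛.comp Z c * 𝔛.G g b c) y) x =
      ∑ b, ∑ c, fieldDeriv X (𝔛.comp Y b * 𝔛.comp Z c * 𝔛.G g b c) x := by
    rw [fieldDeriv_sum (f := fun b y => ∑ c, (𝔛.comp Y b * 𝔛.comp Z c * 𝔛.G g b c) y)
      fun b _ => SmoothNear.sum fun c _ => hn b c]
    exact Finset.sum_congr rfl fun b _ => fieldDeriv_sum fun c _ => hn b c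
  have h4 : ∀ b c, fieldDeriv X (𝔛.comp Y b * 𝔛.comp Z c * 𝔛.G g b c) x =
      fieldDeriv X (𝔛.comp Y b) x * 𝔛.comp Z c x * 𝔛.G g b c x +
      fieldDeriv X (𝔛.comp Z c) x * 𝔛.comp Y b x * 𝔛.G g b c x +
      ∑ a, 𝔛.comp X a x * 𝔛.comp Y b x * 𝔛.comp Z c x * 𝔛.D a (𝔛.G g b c) x := by
    intro b c
    rw [fieldDeriv_mul ((𝔛.comp_near hx hY b).mul (𝔛.comp_near hx hZ c)).mdiff
      (G_near hg hx b c).mdiff, fieldDeriv_mul (𝔛.comp_near hx hY b).mdiff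
      (𝔛.comp_near hx hZ c).mdiff, 𝔛.fieldDeriv_eq_sum hx X (𝔛.G g b c)]
    simp only [smul_eq_mul, Finset.mul_sum, Pi.mul_apply, add_mul]
    congr 1
    · ring
    · exact Finset.sum_congr rfl fun a _ => by ring
  rw [h2, h3]
  simp only [h4, Finset.sum_add_distrib]
  congr 1
  · congr 1
    rw [pair_symm hg, pair]
    exact Finset.sum_congr rfl fun b _ => Finset.sum_congr rfl fun c _ => by ring
  · rw [Finset.sum_congr rfl fun b _ => Finset.sum_comm, Finset.sum_comm]

lemma koszul_eq (hg : IsSmoothMetric g) (hx : x ∈ 𝔛.U) (hX : SmoothFieldNear X x)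
    (hY : SmoothFieldNear Y x) (hZ : SmoothFieldNear Z x) :
    koszul g X Y Z x = ∑ c, 𝔛.comp Z c x * ((∑ b, fieldDeriv X (𝔛.comp Y b) x * 𝔛.G g b c x) +
      ∑ a, ∑ b, 𝔛.comp X a x * 𝔛.comp Y b x * 𝔛.K g a b c x) := by
  have hb : ∀ (X Y Z : Π x : M, TangentSpace I x), SmoothFieldNear X x → SmoothFieldNear Y x →
      g x (mlieBracket I X Y x) (Z x) =
        𝔛.pair g x (fun b => fieldDeriv X (𝔛.comp Y b) x) (fun c => 𝔛.comp Z c x) -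
        𝔛.pair g x (fun b => fieldDeriv Y (𝔛.comp X b) x) (fun c => 𝔛.comp Z c x) := by
    intro X Y Z hX hY
    rw [apply_eq_pair hg hx (mlieBracket I X Y) Z, ← pair_sub]
    simp only [𝔛.comp_bracket hx hX hY]
  have e1 := fieldDeriv_apply (X := X) hg hx hY hZ
  have e2 := fieldDeriv_apply (X := Y) hg hx hZ hX
  have e3 := fieldDeriv_apply (X := Z) hg hx hX hY
  have hK : koszul g X Y Z x = 𝔛.pair g x (fun b => fieldDeriv X (𝔛.comp Y b) x)
      (fun c => 𝔛.comp Z c x) + 1 / 2 *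
      ((∑ a, ∑ b, ∑ c, 𝔛.comp X a x * 𝔛.comp Y b x * 𝔛.comp Z c x * 𝔛.D a (𝔛.G g b c) x) +
      (∑ a, ∑ b, ∑ c, 𝔛.comp Y a x * 𝔛.comp Z b x * 𝔛.comp X c x * 𝔛.D a (𝔛.G g b c) x) -
      (∑ a, ∑ b, ∑ c, 𝔛.comp Z a x * 𝔛.comp X b x * 𝔛.comp Y c x * 𝔛.D a (𝔛.G g b c) x)) := by
    rw [koszul, hb X Y Z hX hY, hb Y Z X hY hZ, hb Z X Y hZ hX]
    simp only [fieldDeriv] at e1 e2 e3 ⊢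
    rw [e1, e2, e3]
    ring
  rw [hK]
  have s2 : (∑ a, ∑ b, ∑ c, 𝔛.comp Y a x * 𝔛.comp Z b x * 𝔛.comp X c x * 𝔛.D a (𝔛.G g b c) x) =
      ∑ a, ∑ b, ∑ c, 𝔛.comp X a x * 𝔛.comp Y b x * 𝔛.comp Z c x * 𝔛.D b (𝔛.G g c a) x := by
    rw [Finset.sum_congr rfl fun b _ => Finset.sum_comm, Finset.sum_comm]
    exact Finset.sum_congr rfl fun a _ => Finset.sum_congr rfl fun b _ =>
      Finset.sum_congr rfl fun c _ => by ring
  have s3 : (∑ a, ∑ b, ∑ c, 𝔛.comp Z a x * 𝔛.comp X b x * 𝔛.comp Y c x * 𝔛.D a (𝔛.G g b c) x) =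
      ∑ a, ∑ b, ∑ c, 𝔛.comp X a x * 𝔛.comp Y b x * 𝔛.comp Z c x * 𝔛.D c (𝔛.G g a b) x := by
    rw [Finset.sum_comm]
    refine Finset.sum_congr rfl fun a _ => ?_
    rw [Finset.sum_comm]
    exact Finset.sum_congr rfl fun b _ => Finset.sum_congr rfl fun c _ => by ring
  have s4 : ∑ c, 𝔛.comp Z c x * (∑ a, ∑ b, 𝔛.comp X a x * 𝔛.comp Y b x * 𝔛.K g a b c x) =
      ∑ a, ∑ b, ∑ c, 𝔛.comp X a x * 𝔛.comp Y b x * 𝔛.comp Z c x * 𝔛.K g a b c x := by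
    simp only [Finset.mul_sum]
    rw [Finset.sum_comm]
    refine Finset.sum_congr rfl fun a _ => ?_
    rw [Finset.sum_comm]
    exact Finset.sum_congr rfl fun b _ => Finset.sum_congr rfl fun c _ => by ring
  have s5 : ∑ c, 𝔛.comp Z c x * (∑ b, fieldDeriv X (𝔛.comp Y b) x * 𝔛.G g b c x) =
      𝔛.pair g x (fun b => fieldDeriv X (𝔛.comp Y b) x) (fun c => 𝔛.comp Z c x) := by
    simp only [Finset.mul_sum]
    rw [pair, Finset.sum_comm]
    exact Finset.sum_congr rfl fun b _ => Finset.sum_congr rfl fun c _ => by ring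
  simp only [mul_add, Finset.sum_add_distrib, s4, s5, s2, s3]
  congr 1
  simp only [← Finset.sum_add_distrib, ← Finset.sum_sub_distrib, Finset.mul_sum]
  refine Finset.sum_congr rfl fun a _ => Finset.sum_congr rfl fun b _ =>
      Finset.sum_congr rfl fun c _ => ?_
  rw [K]
  ring

/-- The components of the Levi-Civita derivative. -/
lemma coord_leviCivita (hg : IsSmoothMetric g) (hx : x ∈ 𝔛.U) (hX : SmoothFieldNear X x)
    (hY : SmoothFieldNear Y x) (e : κ) :
    mvfderiv I (𝔛.coord e) x (leviCivita g X Y x) = fieldDeriv X (𝔛.comp Y e) x +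
      ∑ a, ∑ b, 𝔛.comp X a x * 𝔛.comp Y b x * 𝔛.Chr g e a b x := by
  rw [leviCivita, sharp_eq hg hx (t := fun c =>
    ((∑ b, fieldDeriv X (𝔛.comp Y b) x * 𝔛.G g b c x) +
      ∑ a, ∑ b, 𝔛.comp X a x * 𝔛.comp Y b x * 𝔛.K g a b c x)), coord_sum hx]
  · simp only [mul_add, Finset.sum_add_distrib]
    congr 1
    · have h : ∀ b, ∑ c, 𝔛.P g e c x * 𝔛.G g c b x = if e = b then 1 else 0 := sum_P_G hg hx e
      simp only [Finset.mul_sum]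
      rw [Finset.sum_comm]
      have h' : ∀ b, ∑ c, 𝔛.P g e c x * (fieldDeriv X (𝔛.comp Y b) x * 𝔛.G g b c x) =
          fieldDeriv X (𝔛.comp Y b) x * if e = b then 1 else 0 := fun b => by
        rw [← h b, Finset.mul_sum]
        exact Finset.sum_congr rfl fun c _ => by rw [G_symm hg b c]; ring
      simp [h']
    · simp only [Chr, Finset.mul_sum]
      rw [Finset.sum_comm]
      refine Finset.sum_congr rfl fun a _ => ?_
      rw [Finset.sum_comm]
      exact Finset.sum_congr rfl fun b _ => Finset.sum_congr rfl fun c _ => by ring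
  · intro v
    rw [koszul_eq hg hx hX hY (smoothFieldNear_extendVec v)]
    simp only [comp, fieldDeriv, extendVec_self]

end CoordFrame

end LeviCivitaFrame

end YangMills

end

noncomputable section

set_option linter.unusedSectionVars false

namespace YangMills

/-! ### Coupled derivatives and the current in a coordinate frame -/

section CoupledFrame

open Filter Topology VectorField Module Matrix

variable {m : ℕ} {H : Type*} [TopologicalSpace H]
  {I : ModelWithCorners ℝ (EuclideanSpace ℝ (Fin m)) H}
  {M : Type*} [TopologicalSpace M] [ChartedSpace H M] [IsManifold I ∞ M]
  {κ : Type*} [Fintype κ] [DecidableEq κ]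
  {g : Π x : M, TangentSpace I x → TangentSpace I x → ℝ}

lemma SmoothNear.clm_apply {W W' : Type*} [NormedAddCommGroup W] [NormedSpace ℝ W]
    [NormedAddCommGroup W'] [NormedSpace ℝ W'] {T : M → W →L[ℝ] W'} {f : M → W} {x : M}
    (hT : SmoothNear I T x) (hf : SmoothNear I f x) : SmoothNear I (fun y => T y (f y)) x :=
  (Filter.Eventually.and hT hf).mono fun _ h => h.1.clm_apply h.2

namespace CoordFrame

variable {p : M} {𝔛 : CoordFrame I p κ} {x : M}

/-! #### Derivatives of the inverse metric and of the volume density -/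

lemma D_G_eq (hg : IsSmoothMetric g) (a k l : κ) :
    𝔛.D a (𝔛.G g k l) x = 𝔛.K g a k l x + 𝔛.K g a l k x := by
  simp only [K, G_symm hg l k, G_symm hg l a, G_symm hg a k]
  ring

lemma D_P_eq (hg : IsSmoothMetric g) (hx : x ∈ 𝔛.U) (a b c : κ) :
    𝔛.D a (𝔛.P g b c) x = -(∑ k, 𝔛.P g b k x * 𝔛.Chr g c a k x)
      - ∑ k, 𝔛.P g c k x * 𝔛.Chr g b a k x := by
  have hD : ∀ k l, fieldDeriv (𝔛.X a) (𝔛.G g k l) x = _ := D_G_eq hg a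
  rw [D, fieldDeriv_P hg hx, neg_sub_left, neg_inj]
  simp only [hD, Chr, Finset.mul_sum, mul_add, add_mul, Finset.sum_add_distrib]
  rw [add_comm]
  congr 1
  · rw [Finset.sum_comm]
    refine Finset.sum_congr rfl fun k _ => Finset.sum_congr rfl fun l _ => ?_
    rw [P_symm hg k c]
    ring
  · refine Finset.sum_congr rfl fun k _ => Finset.sum_congr rfl fun l _ => ?_
    rw [P_symm hg l c]
    ring

lemma D_vol_eq (hg : IsSmoothMetric g) (hx : x ∈ 𝔛.U) (a : κ) :
    𝔛.D a (𝔛.vol g) x = 𝔛.vol g x * ∑ k, 𝔛.Chr g k a k x := by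
  have hD : ∀ k l, fieldDeriv (𝔛.X a) (𝔛.G g k l) x = _ := D_G_eq hg a
  rw [D, fieldDeriv_vol hg hx]
  simp only [hD, Chr, mul_add, Finset.sum_add_distrib]
  have h : ∑ k, ∑ l, 𝔛.P g k l x * 𝔛.K g a l k x = ∑ k, ∑ l, 𝔛.P g k l x * 𝔛.K g a k l x := by
    rw [Finset.sum_comm]
    exact Finset.sum_congr rfl fun k _ => Finset.sum_congr rfl fun l _ => by rw [P_symm hg l k]
  rw [h]
  ring

/-- The contracted derivative of the densitized inverse metric. -/
lemma sum_D_vol_P (hg : IsSmoothMetric g) (hx : x ∈ 𝔛.U) (c : κ) :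
    ∑ a, 𝔛.D a (𝔛.vol g * 𝔛.P g a c) x =
      -(𝔛.vol g x * ∑ a, ∑ k, 𝔛.P g a k x * 𝔛.Chr g c a k x) := by
  have h : ∀ a, 𝔛.D a (𝔛.vol g * 𝔛.P g a c) x =
      𝔛.vol g x * ((∑ k, 𝔛.Chr g k a k x * 𝔛.P g a c x) - (∑ k, 𝔛.P g a k x * 𝔛.Chr g c a k x)
      - ∑ k, 𝔛.P g c k x * 𝔛.Chr g a a k x) := fun a => by
    have h1 : 𝔛.D a (𝔛.vol g * 𝔛.P g a c) x = 𝔛.D a (𝔛.vol g) x * 𝔛.P g a c x +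
        𝔛.vol g x * 𝔛.D a (𝔛.P g a c) x :=
      fieldDeriv_mul (vol_near hg hx).mdiff (P_near hg hx a c).mdiff
    rw [h1, D_vol_eq hg hx, D_P_eq hg hx, ← Finset.sum_mul]
    ring
  simp only [h, ← Finset.mul_sum, Finset.sum_sub_distrib]
  rw [Finset.sum_comm (f := fun a k => 𝔛.Chr g k a k x * 𝔛.P g a c x)]
  have h2 : ∑ k, ∑ a, 𝔛.Chr g k a k x * 𝔛.P g a c x = ∑ a, ∑ k, 𝔛.P g c k x * 𝔛.Chr g a a k x :=
    Finset.sum_congr rfl fun k _ => Finset.sum_congr rfl fun a _ => by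
      rw [P_symm hg a c, Chr_symm hg]
      ring
  rw [h2]
  ring

variable {F : Type*} [NormedAddCommGroup F] [NormedSpace ℝ F] [FiniteDimensional ℝ F]
  {V : M → Type*} [TopologicalSpace (TotalSpace F V)]
  [∀ x, AddCommGroup (V x)] [∀ x, Module ℝ (V x)] [∀ x, TopologicalSpace (V x)]
  [∀ x, IsTopologicalAddGroup (V x)] [∀ x, ContinuousSMul ℝ (V x)]
  [FiberBundle F V] [VectorBundle ℝ F V] [ContMDiffVectorBundle ∞ F V I] [T2Space M]
  {A : CovariantDerivative I F V}

lemma comp_extendVec (v : TangentSpace I x) (b : κ) :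
    𝔛.comp (extendVec v) b x = mvfderiv I (𝔛.coord b) x v := by
  rw [comp, fieldDeriv, extendVec_self]

lemma trivAt_curvature (hA : A.ContMDiffCovariantDerivative ∞) (hx : x ∈ 𝔛.U)
    (hx' : x ∈ trivSet F V p) (u v : TangentSpace I x) (z : V x) :
    trivAt F p x (curvature A x u v z) = (∑ a, ∑ b, (mvfderiv I (𝔛.coord a) x u *
      mvfderiv I (𝔛.coord b) x v) • 𝔛.curvFun (𝔛.connCoef A) a b x) (trivAt F p x z) := by
  rw [curvature, 𝔛.trivAt_curvatureOp hx hx' hA (smoothFieldNear_extendVec u)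
    (smoothFieldNear_extendVec v) (smoothSecNear_extend z)]
  simp only [comp_extendVec, locRep, FiberBundle.extend_apply_self]

lemma covFun_smul {a : M → ℝ} {t : M → F →L[ℝ] F} {γ : κ → M → F →L[ℝ] F} (i : κ)
    (ha : MDifferentiableAt I 𝓘(ℝ, ℝ) a x) (ht : MDifferentiableAt I 𝓘(ℝ, F →L[ℝ] F) t x) :
    𝔛.covFun γ i (fun y => a y • t y) x = 𝔛.D i a x • t x + a x • 𝔛.covFun γ i t x := by
  have h : 𝔛.D i (fun y => a y • t y) x = 𝔛.D i a x • t x + a x • 𝔛.D i t x :=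
    fieldDeriv_smul ha ht
  simp only [covFun, h, mul_smul_comm, smul_mul_assoc]
  module

lemma covFun_sum {ι : Type*} {s : Finset ι} {t : ι → M → F →L[ℝ] F} {γ : κ → M → F →L[ℝ] F} (i : κ)
    (ht : ∀ j ∈ s, SmoothNear I (t j) x) :
    𝔛.covFun γ i (fun y => ∑ j ∈ s, t j y) x = ∑ j ∈ s, 𝔛.covFun γ i (t j) x := by
  have h : 𝔛.D i (fun y => ∑ j ∈ s, t j y) x = ∑ j ∈ s, 𝔛.D i (t j) x := fieldDeriv_sum ht
  simp only [covFun, h, Finset.mul_sum, Finset.sum_mul, Finset.sum_add_distrib,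
    Finset.sum_sub_distrib]

/-- The covariant derivative of an endomorphism valued one-form in a coordinate frame. -/
lemma trivAt_covDerivOneForm (hg : IsSmoothMetric g) (hx : x ∈ 𝔛.U) (hx' : x ∈ trivSet F V p)
    {θ : Π x : M, TangentSpace I x → V x → V x} {t : κ → M → F →L[ℝ] F}
    (ht : ∀ b, SmoothNear I (t b) x)
    (hθ : ∀ᶠ y in 𝓝 x, ∀ v z, trivAt F p y (θ y v z) =
      (∑ b, mvfderiv I (𝔛.coord b) y v • t b y) (trivAt F p y z))
    (u v : TangentSpace I x) (z : V x) :
    trivAt F p x (covDerivOneForm A g θ x u v z) =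
      (∑ a, ∑ b, (mvfderiv I (𝔛.coord a) x u * mvfderiv I (𝔛.coord b) x v) •
        (𝔛.covFun (𝔛.connCoef A) a (t b) x - ∑ e, 𝔛.Chr g e a b x • t e x)) (trivAt F p x z) := by
  set U : Π y : M, TangentSpace I y := extendVec u with hU
  set Y : Π y : M, TangentSpace I y := extendVec v with hY
  set Z : Π y : M, V y := FiberBundle.extend F z with hZ
  have hUs : SmoothFieldNear U x := smoothFieldNear_extendVec u
  have hYs : SmoothFieldNear Y x := smoothFieldNear_extendVec v
  have hZs : SmoothSecNear F I Z x := smoothSecNear_extend z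
  have hUx : U x = u := extendVec_self u
  have hYx : Y x = v := extendVec_self v
  have hZx : Z x = z := FiberBundle.extend_apply_self _ _
  set ζ := locRep F p Z with hζ
  have hζs : SmoothNear I ζ x := (smoothSecNear_iff hx').1 hZs
  have hζx : ζ x = trivAt F p x z := by rw [hζ, locRep, hZx]
  set T : M → F →L[ℝ] F := fun y => ∑ b, 𝔛.comp Y b y • t b y with hT
  have hTb : ∀ b, SmoothNear I (fun y => 𝔛.comp Y b y • t b y) x := fun b =>
    (𝔛.comp_near hx hYs b).smul (ht b)
  have hTs : SmoothNear I T x := SmoothNear.sum fun b _ => hTb b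
  set s : Π y : M, V y := fun y => θ y (Y y) (Z y) with hs
  have hsT : locRep F p s =ᶠ[𝓝 x] fun y => T y (ζ y) := hθ.mono fun y hy => hy _ _
  have hss : SmoothSecNear F I s x := (smoothSecNear_iff hx').2 ((hTs.clm_apply hζs).congr hsT)
  have e1 : trivAt F p x (A s x u) = fieldDeriv U T x (ζ x) + T x (fieldDeriv U ζ x) +
      connForm A p x u (T x (ζ x)) := by
    rw [← hUx, trivAt_covField hx hx' hss, (fieldDeriv_congr hsT).self_of_nhds,
      fieldDeriv_clm_apply hTs.mdiff hζs.mdiff, hsT.self_of_nhds]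
  have e2 : trivAt F p x (A Z x u) = fieldDeriv U ζ x + connForm A p x u (ζ x) := by
    rw [← hUx, trivAt_covField hx hx' hZs]
  have e3 : trivAt F p x (θ x v (A Z x u)) = T x (fieldDeriv U ζ x + connForm A p x u (ζ x)) := by
    rw [hθ.self_of_nhds, e2, hT]
    simp only [comp, fieldDeriv, hYx]
  have e4 := hθ.self_of_nhds (leviCivita g U Y x) z
  simp only [𝔛.coord_leviCivita hg hx hUs hYs] at e4
  have e5 : fieldDeriv U T x = ∑ b, (fieldDeriv U (𝔛.comp Y b) x • t b x +
      𝔛.comp Y b x • ∑ a, 𝔛.comp U a x • 𝔛.D a (t b) x) := by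
    rw [hT, fieldDeriv_sum fun b _ => hTb b]
    refine Finset.sum_congr rfl fun b _ => ?_
    rw [fieldDeriv_smul (𝔛.comp_near hx hYs b).mdiff (ht b).mdiff, 𝔛.fieldDeriv_eq_sum hx U (t b)]
  have e6 : connForm A p x u = ∑ a, 𝔛.comp U a x • 𝔛.connCoef A a x := by
    rw [← hUx, 𝔛.connForm_eq_sum hx U]
  have hop : fieldDeriv U T x + connForm A p x u * T x - T x * connForm A p x u -
      (∑ e, (fieldDeriv U (𝔛.comp Y e) x + ∑ a, ∑ b, 𝔛.comp U a x * 𝔛.comp Y b x *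
        𝔛.Chr g e a b x) • t e x) =
      ∑ a, ∑ b, (𝔛.comp U a x * 𝔛.comp Y b x) •
        (𝔛.covFun (𝔛.connCoef A) a (t b) x - ∑ e, 𝔛.Chr g e a b x • t e x) := by
    rw [e5, e6, hT]
    have h1 : ∑ a, ∑ b, (𝔛.comp U a x * 𝔛.comp Y b x) • ∑ e, 𝔛.Chr g e a b x • t e x =
        ∑ e, (∑ a, ∑ b, 𝔛.comp U a x * 𝔛.comp Y b x * 𝔛.Chr g e a b x) • t e x := by
      simp only [Finset.sum_smul, Finset.smul_sum, smul_smul]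
      rw [Finset.sum_congr rfl fun a _ => Finset.sum_comm, Finset.sum_comm]
    have h2 : (∑ a, 𝔛.comp U a x • 𝔛.connCoef A a x) * (∑ b, 𝔛.comp Y b x • t b x) =
        ∑ a, ∑ b, (𝔛.comp U a x * 𝔛.comp Y b x) • (𝔛.connCoef A a x * t b x) := by
      simp only [Finset.sum_mul, Finset.mul_sum, smul_mul_smul_comm]
      exact Finset.sum_comm
    have h3 : (∑ b, 𝔛.comp Y b x • t b x) * (∑ a, 𝔛.comp U a x • 𝔛.connCoef A a x) =
        ∑ a, ∑ b, (𝔛.comp U a x * 𝔛.comp Y b x) • (t b x * 𝔛.connCoef A a x) := by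
      simp only [Finset.sum_mul, Finset.mul_sum, smul_mul_smul_comm]
      refine Finset.sum_congr rfl fun a _ => Finset.sum_congr rfl fun b _ => ?_
      rw [mul_comm]
    have h4 : ∑ b, 𝔛.comp Y b x • ∑ a, 𝔛.comp U a x • 𝔛.D a (t b) x =
        ∑ a, ∑ b, (𝔛.comp U a x * 𝔛.comp Y b x) • 𝔛.D a (t b) x := by
      simp only [Finset.smul_sum, smul_smul]
      rw [Finset.sum_comm]
      refine Finset.sum_congr rfl fun a _ => Finset.sum_congr rfl fun b _ => ?_
      rw [mul_comm]
    simp only [covFun, smul_sub, smul_add, Finset.sum_add_distrib, Finset.sum_sub_distrib, add_smul,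
      h1, h2, h3, h4]
    abel
  have hc : ∀ a, 𝔛.comp U a x = mvfderiv I (𝔛.coord a) x u := comp_extendVec u
  have hc' : ∀ a, 𝔛.comp Y a x = mvfderiv I (𝔛.coord a) x v := comp_extendVec v
  simp only [hc, hc'] at hop e4
  rw [← hop, covDerivOneForm]
  change trivAt F p x (A s x u - θ x (leviCivita g U Y x) z - θ x v (A Z x u)) = _
  rw [map_sub, map_sub, e1, e3, e4, ← hζx]
  simp only [_root_.sub_apply, _root_.add_apply, mul_apply_eq_comp, map_add]
  abel

/-- The covariant derivative of an endomorphism valued two-form in a coordinate frame. -/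
lemma trivAt_covDerivTwoForm (hg : IsSmoothMetric g) (hx : x ∈ 𝔛.U) (hx' : x ∈ trivSet F V p)
    {θ : Π x : M, TangentSpace I x → TangentSpace I x → V x → V x} {t : κ → κ → M → F →L[ℝ] F}
    (ht : ∀ b c, SmoothNear I (t b c) x)
    (hθ : ∀ᶠ y in 𝓝 x, ∀ v w z, trivAt F p y (θ y v w z) =
      (∑ b, ∑ c, (mvfderiv I (𝔛.coord b) y v * mvfderiv I (𝔛.coord c) y w) • t b c y)
        (trivAt F p y z))
    (u v w : TangentSpace I x) (z : V x) :
    trivAt F p x (covDerivTwoForm A g θ x u v w z) =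
      (∑ a, ∑ b, (mvfderiv I (𝔛.coord a) x u * mvfderiv I (𝔛.coord b) x v) •
        ∑ c, mvfderiv I (𝔛.coord c) x w • (𝔛.covFun (𝔛.connCoef A) a (t b c) x
          - ∑ e, 𝔛.Chr g e a b x • t e c x - ∑ e, 𝔛.Chr g e a c x • t b e x))
            (trivAt F p x z) := by
  set U : Π y : M, TangentSpace I y := extendVec u with hU
  set Y : Π y : M, TangentSpace I y := extendVec w with hY
  have hUs : SmoothFieldNear U x := smoothFieldNear_extendVec u
  have hYs : SmoothFieldNear Y x := smoothFieldNear_extendVec w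
  have hUx : U x = u := extendVec_self u
  have hYx : Y x = w := extendVec_self w
  have hc : ∀ a, 𝔛.comp U a x = mvfderiv I (𝔛.coord a) x u := comp_extendVec u
  have hc' : ∀ a, 𝔛.comp Y a x = mvfderiv I (𝔛.coord a) x w := comp_extendVec w
  have hts : ∀ b c, SmoothNear I (fun y => 𝔛.comp Y c y • t b c y) x := fun b c =>
    (𝔛.comp_near hx hYs c).smul (ht b c)
  have h1 := trivAt_covDerivOneForm (A := A) hg hx hx' (θ := fun y v z => θ y v (Y y) z)
    (t := fun b y => ∑ c, 𝔛.comp Y c y • t b c y) (fun b => SmoothNear.sum fun c _ => hts b c)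
    (hθ.mono fun y hy v z => by
      rw [hy]
      simp only [Finset.smul_sum, smul_smul]
      rfl) u v z
  have h2 : covDerivTwoForm A g θ x u v w z =
      covDerivOneForm A g (fun y v z => θ y v (Y y) z) x u v z - θ x v (leviCivita g U Y x) z := by
    simp only [covDerivTwoForm, covDerivOneForm, hYx]
    change _ - _ - θ x v (leviCivita g U Y x) z - _ = _
    abel
  have h3 := hθ.self_of_nhds v (leviCivita g U Y x) z
  have h4 : ∀ c, mvfderiv I (𝔛.coord c) x (leviCivita g U Y x) =
      ∑ a, mvfderiv I (𝔛.coord a) x u * (𝔛.D a (𝔛.comp Y c) x +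
        ∑ e, mvfderiv I (𝔛.coord e) x w * 𝔛.Chr g c a e x) := fun c => by
    rw [𝔛.coord_leviCivita hg hx hUs hYs, 𝔛.fieldDeriv_eq_sum hx U, ← Finset.sum_add_distrib]
    refine Finset.sum_congr rfl fun a _ => ?_
    simp only [hc, hc', mul_add, smul_eq_mul, Finset.mul_sum, mul_assoc]
  rw [h2, map_sub, h1, h3, ← _root_.sub_apply]
  congr 1
  have h5 : ∀ a b, 𝔛.covFun (𝔛.connCoef A) a (fun y => ∑ c, 𝔛.comp Y c y • t b c y) x =
      ∑ c, (𝔛.D a (𝔛.comp Y c) x • t b c x +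
        mvfderiv I (𝔛.coord c) x w • 𝔛.covFun (𝔛.connCoef A) a (t b c) x) := fun a b => by
    rw [covFun_sum a fun c _ => hts b c]
    refine Finset.sum_congr rfl fun c _ => ?_
    rw [covFun_smul a (𝔛.comp_near hx hYs c).mdiff (ht b c).mdiff, hc']
  have h6 : ∑ b, ∑ c, (mvfderiv I (𝔛.coord b) x v *
      mvfderiv I (𝔛.coord c) x (leviCivita g U Y x)) • t b c x =
      ∑ a, ∑ b, (mvfderiv I (𝔛.coord a) x u * mvfderiv I (𝔛.coord b) x v) •
        ∑ c, (𝔛.D a (𝔛.comp Y c) x +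
          ∑ e, mvfderiv I (𝔛.coord e) x w * 𝔛.Chr g c a e x) • t b c x := by
    simp only [h4, Finset.smul_sum, smul_smul, Finset.mul_sum, Finset.sum_smul (s := Finset.univ)]
    rw [Finset.sum_congr rfl fun b _ => Finset.sum_comm, Finset.sum_comm]
    refine Finset.sum_congr rfl fun a _ => Finset.sum_congr rfl fun b _ =>
      Finset.sum_congr rfl fun c _ => ?_
    rw [← mul_assoc, mul_comm (mvfderiv I (𝔛.coord b) x v)]
  rw [h6]
  simp only [h5, ← Finset.sum_sub_distrib, ← smul_sub]
  refine Finset.sum_congr rfl fun a _ => Finset.sum_congr rfl fun b _ => ?_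
  congr 1
  have h7 : ∑ e, 𝔛.Chr g e a b x • ∑ c, 𝔛.comp Y c x • t e c x =
      ∑ c, mvfderiv I (𝔛.coord c) x w • ∑ e, 𝔛.Chr g e a b x • t e c x := by
    simp only [Finset.smul_sum, hc']
    rw [Finset.sum_comm]
    exact Finset.sum_congr rfl fun c _ => Finset.sum_congr rfl fun e _ => smul_comm _ _ _
  have h8 : ∑ c, (∑ e, mvfderiv I (𝔛.coord e) x w * 𝔛.Chr g c a e x) • t b c x =
      ∑ c, mvfderiv I (𝔛.coord c) x w • ∑ e, 𝔛.Chr g e a c x • t b e x := by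
    simp only [Finset.smul_sum, Finset.sum_smul, smul_smul]
    exact Finset.sum_comm
  simp only [smul_sub, Finset.sum_sub_distrib, Finset.sum_add_distrib, add_smul, h7, h8]
  abel

end CoordFrame

end CoupledFrame

end YangMills

end

noncomputable section

set_option linter.unusedSectionVars false

namespace YangMills

/-! ### Divergences and the current in a coordinate frame -/

section CurrentFrame

open Filter Topology VectorField Module Matrix

variable {m : ℕ} {H : Type*} [TopologicalSpace H]
  {I : ModelWithCorners ℝ (EuclideanSpace ℝ (Fin m)) H}
  {M : Type*} [TopologicalSpace M] [ChartedSpace H M] [IsManifold I ∞ M]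
  {κ : Type*} [Fintype κ] [DecidableEq κ]
  {g : Π x : M, TangentSpace I x → TangentSpace I x → ℝ}

lemma map_metricTrace {x : M} {W W' : Type*} [AddCommGroup W] [Module ℝ W] [AddCommGroup W']
    [Module ℝ W'] (L : W →ₗ[ℝ] W') (T : TangentSpace I x → TangentSpace I x → W) :
    L (metricTrace g x T) = metricTrace g x fun u v => L (T u v) := by
  simp only [metricTrace, map_sum, map_smul]

/-- The algebraic identity behind the divergence formula for two-forms: `P` is the inverse metric,
`C e a b = Γ^e_{ab}` and `N a c` is the curvature. -/
lemma sum_christoffel_cancel {W : Type*} [AddCommGroup W] [Module ℝ W] (P : κ → κ → ℝ)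
    (C : κ → κ → κ → ℝ) (N : κ → κ → W) (hP : ∀ a b, P a b = P b a)
    (hC : ∀ e a b, C e a b = C e b a) (hN : ∀ a b, N a b = -N b a) (d : κ) :
    (∑ c, ∑ e, (-(∑ a, ∑ k, P a k * C c a k) * P d e) • N c e) +
      (∑ a, ∑ c, ∑ e, (P a c * (-(∑ k, P d k * C e a k) - ∑ k, P e k * C d a k)) • N c e) =
    -∑ b, P d b • ∑ a, ∑ c, P a c • ((∑ e, C e a c • N e b) + ∑ e, C e a b • N c e) := by
  have h5 : ∑ a, ∑ c, ∑ e, (P a c * ∑ k, P e k * C d a k) • N c e = 0 := by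
    set S : W := ∑ a, ∑ c, ∑ e, ∑ k, (P a c * (P e k * C d a k)) • N c e with hS
    have hS' : ∑ a, ∑ c, ∑ e, (P a c * ∑ k, P e k * C d a k) • N c e = S := by
      simp only [hS, Finset.mul_sum, Finset.sum_smul]
    have e1 : S = ∑ k, ∑ e, ∑ c, ∑ a, (P a c * (P e k * C d a k)) • N c e := by
      rw [hS]
      rw [Finset.sum_congr rfl fun a _ => Finset.sum_congr rfl fun c _ => Finset.sum_comm]
      rw [Finset.sum_congr rfl fun a _ => Finset.sum_comm, Finset.sum_comm]
      refine Finset.sum_congr rfl fun k _ => ?_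
      rw [Finset.sum_congr rfl fun a _ => Finset.sum_comm, Finset.sum_comm]
      refine Finset.sum_congr rfl fun e _ => ?_
      rw [Finset.sum_comm]
    have e2 : S = -S := by
      conv_lhs => rw [e1]
      rw [hS]
      simp only [← Finset.sum_neg_distrib]
      refine Finset.sum_congr rfl fun a _ => Finset.sum_congr rfl fun c _ =>
        Finset.sum_congr rfl fun e _ => Finset.sum_congr rfl fun k _ => ?_
      rw [hN e c, hP k e, hP c a, hC d k a, smul_neg]
      congr 2
      ring
    rw [hS']
    have e3 : (2 : ℝ) • S = 0 := by rw [two_smul]; nth_rewrite 2 [e2]; exact add_neg_cancel S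
    exact (smul_eq_zero.1 e3).resolve_left two_ne_zero
  have h4 : ∑ a, ∑ c, ∑ e, (P a c * ∑ k, P d k * C e a k) • N c e =
      ∑ b, P d b • ∑ a, ∑ c, P a c • ∑ e, C e a b • N c e := by
    simp only [Finset.mul_sum, Finset.sum_smul, Finset.smul_sum, smul_smul]
    rw [Finset.sum_congr rfl fun a _ => Finset.sum_congr rfl fun c _ => Finset.sum_comm]
    rw [Finset.sum_congr rfl fun a _ => Finset.sum_comm, Finset.sum_comm]
    refine Finset.sum_congr rfl fun b _ => Finset.sum_congr rfl fun a _ =>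
      Finset.sum_congr rfl fun c _ => Finset.sum_congr rfl fun e _ => ?_
    congr 1
    ring
  have h2 : ∑ c, ∑ e, ((∑ a, ∑ k, P a k * C c a k) * P d e) • N c e =
      ∑ b, P d b • ∑ a, ∑ c, P a c • ∑ e, C e a c • N e b := by
    simp only [Finset.sum_mul, Finset.sum_smul, Finset.smul_sum, smul_smul]
    rw [Finset.sum_comm]
    refine Finset.sum_congr rfl fun b _ => ?_
    rw [Finset.sum_comm]
    refine Finset.sum_congr rfl fun a _ => ?_
    rw [Finset.sum_comm]
    refine Finset.sum_congr rfl fun c _ => Finset.sum_congr rfl fun e _ => ?_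
    congr 1
    ring
  simp only [smul_add, Finset.sum_add_distrib, ← h4, ← h2, neg_mul, neg_smul, mul_sub, sub_smul,
    mul_neg, Finset.sum_neg_distrib, Finset.sum_sub_distrib, h5]
  abel

namespace CoordFrame

variable {p : M} {𝔛 : CoordFrame I p κ} {x : M}
  {F : Type*} [NormedAddCommGroup F] [NormedSpace ℝ F] [FiniteDimensional ℝ F]
  {V : M → Type*} [TopologicalSpace (TotalSpace F V)]
  [∀ x, AddCommGroup (V x)] [∀ x, Module ℝ (V x)] [∀ x, TopologicalSpace (V x)]
  [∀ x, IsTopologicalAddGroup (V x)] [∀ x, ContinuousSMul ℝ (V x)]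
  [FiberBundle F V] [VectorBundle ℝ F V] [ContMDiffVectorBundle ∞ F V I] [T2Space M]
  {A : CovariantDerivative I F V}

/-- The divergence of a one-form in a coordinate frame. -/
lemma trivAt_divOneForm (hg : IsSmoothMetric g) (hx : x ∈ 𝔛.U) (hx' : x ∈ trivSet F V p)
    {θ : Π x : M, TangentSpace I x → V x → V x} {t : κ → M → F →L[ℝ] F}
    (ht : ∀ b, SmoothNear I (t b) x)
    (hθ : ∀ᶠ y in 𝓝 x, ∀ v z, trivAt F p y (θ y v z) =
      (∑ b, mvfderiv I (𝔛.coord b) y v • t b y) (trivAt F p y z)) (z : V x) :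
    𝔛.vol g x • trivAt F p x (divOneForm A g θ x z) =
      (∑ a, 𝔛.covFun (𝔛.connCoef A) a (fun y => ∑ e, (𝔛.vol g * 𝔛.P g a e) y • t e y) x)
        (trivAt F p x z) := by
  have h1 : trivAt F p x (divOneForm A g θ x z) = ∑ a, ∑ b, 𝔛.P g a b x •
      (𝔛.covFun (𝔛.connCoef A) a (t b) x - ∑ e, 𝔛.Chr g e a b x • t e x) (trivAt F p x z) := by
    refine (map_metricTrace (trivAt F p x : V x →L[ℝ] F).toLinearMap _).trans (metricTrace_eq hg hx ?_)
    intro u v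
    refine (trivAt_covDerivOneForm hg hx hx' ht hθ u v z).trans ?_
    simp only [_root_.sum_apply, _root_.smul_apply]
  have hn : ∀ a e, SmoothNear I (𝔛.vol g * 𝔛.P g a e) x := fun a e =>
    (vol_near hg hx).mul (P_near hg hx a e)
  have h2 : ∑ a, 𝔛.covFun (𝔛.connCoef A) a (fun y => ∑ e, (𝔛.vol g * 𝔛.P g a e) y • t e y) x =
      (∑ e, (∑ a, 𝔛.D a (𝔛.vol g * 𝔛.P g a e) x) • t e x) + ∑ a, ∑ e,
        (𝔛.vol g x * 𝔛.P g a e x) • 𝔛.covFun (𝔛.connCoef A) a (t e) x := by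
    simp only [Finset.sum_smul]
    rw [Finset.sum_comm, ← Finset.sum_add_distrib]
    refine Finset.sum_congr rfl fun a _ => ?_
    rw [covFun_sum a fun e _ => (hn a e).smul (ht e), ← Finset.sum_add_distrib]
    exact Finset.sum_congr rfl fun e _ => covFun_smul a (hn a e).mdiff (ht e).mdiff
  have h3 : ∑ e, (∑ a, 𝔛.D a (𝔛.vol g * 𝔛.P g a e) x) • t e x =
      -∑ a, ∑ b, (𝔛.vol g x * 𝔛.P g a b x) • ∑ e, 𝔛.Chr g e a b x • t e x := by
    simp only [sum_D_vol_P hg hx, neg_smul, Finset.sum_neg_distrib, Finset.mul_sum,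
      Finset.sum_smul, Finset.smul_sum, smul_smul]
    rw [Finset.sum_comm]
    congr 1
    refine Finset.sum_congr rfl fun a _ => ?_
    rw [Finset.sum_comm]
    exact Finset.sum_congr rfl fun b _ => Finset.sum_congr rfl fun e _ => by rw [mul_assoc]
  rw [h1, h2, h3]
  simp only [_root_.add_apply, _root_.neg_apply, _root_.sum_apply, _root_.smul_apply,
    Finset.smul_sum, smul_smul, _root_.sub_apply, smul_sub, Finset.sum_sub_distrib, mul_assoc]
  abel

lemma curvFun_near (hA : A.ContMDiffCovariantDerivative ∞) (hx : x ∈ 𝔛.U)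
    (hx' : x ∈ trivSet F V p) (a b : κ) :
    SmoothNear I (𝔛.curvFun (𝔛.connCoef A) a b) x := by
  have h := fun i => connCoef_near hA hx hx' i
  exact ((((h b).fieldDeriv (𝔛.field_near a hx)).sub ((h a).fieldDeriv (𝔛.field_near b hx))).add
    ((h a).mul (h b))).sub ((h b).mul (h a))

lemma curvFun_antisymm (γ : κ → M → F →L[ℝ] F) (a b : κ) :
    𝔛.curvFun γ a b x = -𝔛.curvFun γ b a x := by
  simp only [curvFun]
  abel

variable (𝔛 g A) in
/-- The components of the divergence of the curvature. -/
def divComp (b : κ) (x : M) : F →L[ℝ] F :=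
  ∑ a, ∑ c, 𝔛.P g a c x • (𝔛.covFun (𝔛.connCoef A) a (𝔛.curvFun (𝔛.connCoef A) c b) x
    - ∑ e, 𝔛.Chr g e a c x • 𝔛.curvFun (𝔛.connCoef A) e b x
    - ∑ e, 𝔛.Chr g e a b x • 𝔛.curvFun (𝔛.connCoef A) c e x)

lemma trivAt_divCurvature (hg : IsSmoothMetric g) (hA : A.ContMDiffCovariantDerivative ∞)
    (hx : x ∈ 𝔛.U) (hx' : x ∈ trivSet F V p) (w : TangentSpace I x) (z : V x) :
    trivAt F p x (divCurvature A g x w z) =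
      (∑ b, mvfderiv I (𝔛.coord b) x w • 𝔛.divComp g A b x) (trivAt F p x z) := by
  have hθ : ∀ᶠ y in 𝓝 x, ∀ v w z, trivAt F p y (curvature A y v w z) =
      (∑ b, ∑ c, (mvfderiv I (𝔛.coord b) y v * mvfderiv I (𝔛.coord c) y w) •
        𝔛.curvFun (𝔛.connCoef A) b c y) (trivAt F p y z) := by
    filter_upwards [𝔛.isOpen.mem_nhds hx, trivSet_mem_nhds hx'] with y hy hy' v w z
      using trivAt_curvature hA hy hy' v w z
  have h1 : trivAt F p x (divCurvature A g x w z) = ∑ a, ∑ b, 𝔛.P g a b x •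
      (∑ c, mvfderiv I (𝔛.coord c) x w • (𝔛.covFun (𝔛.connCoef A) a
        (𝔛.curvFun (𝔛.connCoef A) b c) x
          - ∑ e, 𝔛.Chr g e a b x • 𝔛.curvFun (𝔛.connCoef A) e c x
          - ∑ e, 𝔛.Chr g e a c x • 𝔛.curvFun (𝔛.connCoef A) b e x)) (trivAt F p x z) := by
    refine (map_metricTrace (trivAt F p x : V x →L[ℝ] F).toLinearMap _).trans (metricTrace_eq hg hx ?_)
    intro u v
    refine (trivAt_covDerivTwoForm hg hx hx' (curvFun_near hA hx hx') hθ u v w z).trans ?_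
    simp only [_root_.sum_apply, _root_.smul_apply]
  rw [h1]
  simp only [← _root_.smul_apply, ← _root_.sum_apply, divComp]
  congr 1
  simp only [Finset.smul_sum]
  rw [Finset.sum_congr rfl fun a _ => Finset.sum_comm, Finset.sum_comm]
  refine Finset.sum_congr rfl fun b _ => Finset.sum_congr rfl fun a _ =>
    Finset.sum_congr rfl fun c _ => ?_
  rw [smul_comm]

lemma sum_covFun_flux (hg : IsSmoothMetric g) (hA : A.ContMDiffCovariantDerivative ∞)
    (hx : x ∈ 𝔛.U) (hx' : x ∈ trivSet F V p) (d : κ) :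
    ∑ a, 𝔛.covFun (𝔛.connCoef A) a (𝔛.fluxFun (𝔛.vol g) (𝔛.P g) (𝔛.connCoef A) a d) x =
      𝔛.vol g x • ∑ b, 𝔛.P g d b x • 𝔛.divComp g A b x := by
  set N := 𝔛.curvFun (𝔛.connCoef A) with hN
  have hn : ∀ a c, SmoothNear I (𝔛.vol g * 𝔛.P g a c) x := fun a c =>
    (vol_near hg hx).mul (P_near hg hx a c)
  have hN' := curvFun_near (𝔛 := 𝔛) hA hx hx'
  have hf : ∀ a c e, SmoothNear I
      (fun y => (𝔛.vol g y * 𝔛.P g a c y * 𝔛.P g d e y) • N c e y) x := fun a c e =>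
    ((hn a c).mul (P_near hg hx d e)).smul (hN' c e)
  have h1 : ∀ a c e, 𝔛.covFun (𝔛.connCoef A) a
      (fun y => (𝔛.vol g y * 𝔛.P g a c y * 𝔛.P g d e y) • N c e y) x =
      (𝔛.D a (𝔛.vol g * 𝔛.P g a c) x * 𝔛.P g d e x) • N c e x +
      (𝔛.vol g x * 𝔛.P g a c x * 𝔛.D a (𝔛.P g d e) x) • N c e x +
      (𝔛.vol g x * 𝔛.P g a c x * 𝔛.P g d e x) • 𝔛.covFun (𝔛.connCoef A) a (N c e) x := by
    intro a c e
    have h := covFun_smul (𝔛 := 𝔛) (γ := 𝔛.connCoef A) a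
      ((hn a c).mul (P_near hg hx d e)).mdiff (hN' c e).mdiff
    have h' : 𝔛.D a (𝔛.vol g * 𝔛.P g a c * 𝔛.P g d e) x = 𝔛.D a (𝔛.vol g * 𝔛.P g a c) x *
        𝔛.P g d e x + 𝔛.vol g x * 𝔛.P g a c x * 𝔛.D a (𝔛.P g d e) x :=
      fieldDeriv_mul (hn a c).mdiff (P_near hg hx d e).mdiff
    rw [h', add_smul] at h
    exact h
  have h2 : ∀ a, 𝔛.covFun (𝔛.connCoef A) a
      (𝔛.fluxFun (𝔛.vol g) (𝔛.P g) (𝔛.connCoef A) a d) x = ∑ c, ∑ e,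
      𝔛.covFun (𝔛.connCoef A) a
        (fun y => (𝔛.vol g y * 𝔛.P g a c y * 𝔛.P g d e y) • N c e y) x := by
    intro a
    refine (covFun_sum (t := fun c y => ∑ e, (𝔛.vol g y * 𝔛.P g a c y * 𝔛.P g d e y) • N c e y) a
      fun c _ => SmoothNear.sum fun e _ => hf a c e).trans ?_
    exact Finset.sum_congr rfl fun c _ => covFun_sum a fun e _ => hf a c e
  have h3 := sum_christoffel_cancel (fun a b => 𝔛.P g a b x) (fun e a b => 𝔛.Chr g e a b x)
    (fun a b => N a b x) (fun a b => by rw [P_symm hg]) (Chr_symm hg)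
    (curvFun_antisymm (𝔛.connCoef A)) d
  have h4 : ∑ a, ∑ c, ∑ e, (𝔛.D a (𝔛.vol g * 𝔛.P g a c) x * 𝔛.P g d e x) • N c e x =
      𝔛.vol g x • ∑ c, ∑ e,
        (-(∑ a, ∑ k, 𝔛.P g a k x * 𝔛.Chr g c a k x) * 𝔛.P g d e x) • N c e x := by
    rw [Finset.sum_comm, Finset.smul_sum]
    refine Finset.sum_congr rfl fun c _ => ?_
    rw [Finset.sum_comm, Finset.smul_sum]
    refine Finset.sum_congr rfl fun e _ => ?_
    rw [← Finset.sum_smul, ← Finset.sum_mul, sum_D_vol_P hg hx, smul_smul]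
    congr 1
    ring
  have h5 : ∑ a, ∑ c, ∑ e, (𝔛.vol g x * 𝔛.P g a c x * 𝔛.D a (𝔛.P g d e) x) • N c e x =
      𝔛.vol g x • ∑ a, ∑ c, ∑ e, (𝔛.P g a c x * (-(∑ k, 𝔛.P g d k x * 𝔛.Chr g e a k x)
        - ∑ k, 𝔛.P g e k x * 𝔛.Chr g d a k x)) • N c e x := by
    simp only [Finset.smul_sum, smul_smul, D_P_eq hg hx, mul_assoc]
  have h6 : ∑ a, ∑ c, ∑ e, (𝔛.vol g x * 𝔛.P g a c x * 𝔛.P g d e x) •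
        𝔛.covFun (𝔛.connCoef A) a (N c e) x =
      𝔛.vol g x • ∑ b, 𝔛.P g d b x • ∑ a, ∑ c, 𝔛.P g a c x •
        𝔛.covFun (𝔛.connCoef A) a (N c b) x := by
    simp only [Finset.smul_sum, smul_smul]
    rw [Finset.sum_congr rfl fun a _ => Finset.sum_comm, Finset.sum_comm]
    refine Finset.sum_congr rfl fun b _ => Finset.sum_congr rfl fun a _ =>
      Finset.sum_congr rfl fun c _ => ?_
    congr 1
    ring
  simp only [h2, h1, Finset.sum_add_distrib]
  rw [h4, h5, h6, ← smul_add, ← smul_add]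
  congr 1
  rw [h3]
  simp only [divComp, smul_sub, Finset.sum_sub_distrib, smul_add, Finset.sum_add_distrib, ← hN]
  abel

lemma coord_gradient (hg : IsSmoothMetric g) (hx : x ∈ 𝔛.U) (r : M → ℝ) (a : κ) :
    mvfderiv I (𝔛.coord a) x (gradient g r x) = ∑ b, 𝔛.P g a b x * 𝔛.D b r x := by
  rw [gradient, sharp_eq hg hx (t := fun b => 𝔛.D b r x), coord_sum hx]
  intro v
  conv_lhs => rw [← 𝔛.expand x hx v, map_sum]
  simp only [map_smul, smul_eq_mul]
  rfl

/-- The Yang-Mills current in a coordinate frame. -/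
theorem trivAt_current (hg : IsSmoothMetric g) (hA : A.ContMDiffCovariantDerivative ∞)
    (hx : x ∈ 𝔛.U) (hx' : x ∈ trivSet F V p) (r : M → ℝ) {q : ℕ} (hq : (m : ℝ) - 4 = q)
    (w : TangentSpace I x) (z : V x) :
    trivAt F p x (current A g r x w z) =
      (∑ b, mvfderiv I (𝔛.coord b) x w • ((𝔛.vol g x)⁻¹ • ∑ d, 𝔛.G g b d x •
        𝔛.curFun r q (𝔛.vol g) (𝔛.P g) (𝔛.connCoef A) d x)) (trivAt F p x z) := by
  have hv := (vol_pos (𝔛 := 𝔛) hg hx).ne'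
  set J : κ → F →L[ℝ] F := fun b => r x • 𝔛.divComp g A b x -
    (q : ℝ) • ∑ a, (∑ e, 𝔛.P g a e x * 𝔛.D e r x) • 𝔛.curvFun (𝔛.connCoef A) a b x with hJ
  have h1 : ∀ d, 𝔛.curFun r q (𝔛.vol g) (𝔛.P g) (𝔛.connCoef A) d x =
      𝔛.vol g x • ∑ b, 𝔛.P g d b x • J b := by
    intro d
    rw [curFun, Finset.sum_sub_distrib, ← Finset.smul_sum, sum_covFun_flux hg hA hx hx', hJ]
    simp only [smul_sub, Finset.sum_sub_distrib]
    congr 1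
    · simp only [Finset.smul_sum, smul_smul]
      refine Finset.sum_congr rfl fun b _ => ?_
      congr 1
      ring
    · simp only [fluxFun, Finset.smul_sum, Finset.sum_smul, smul_smul]
      rw [Finset.sum_congr rfl fun a _ => Finset.sum_comm, Finset.sum_comm]
      refine Finset.sum_congr rfl fun b _ => ?_
      rw [Finset.sum_comm]
      refine Finset.sum_congr rfl fun a _ => Finset.sum_congr rfl fun c _ => ?_
      rw [P_symm hg a c]
      congr 1
      ring
  have h2 : ∀ b, (𝔛.vol g x)⁻¹ • ∑ d, 𝔛.G g b d x •
      𝔛.curFun r q (𝔛.vol g) (𝔛.P g) (𝔛.connCoef A) d x = J b := by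
    intro b
    simp only [h1]
    have h3 : ∑ d, 𝔛.G g b d x • 𝔛.vol g x • ∑ c, 𝔛.P g d c x • J c =
        𝔛.vol g x • ∑ c, (∑ d, 𝔛.G g b d x * 𝔛.P g d c x) • J c := by
      simp only [Finset.smul_sum, Finset.sum_smul, smul_smul]
      rw [Finset.sum_comm]
      refine Finset.sum_congr rfl fun c _ => Finset.sum_congr rfl fun d _ => ?_
      congr 1
      ring
    rw [h3, inv_smul_smul₀ hv]
    simp [sum_G_P hg hx]
  simp only [h2]
  rw [current, map_sub, map_smul, map_smul, trivAt_divCurvature hg hA hx hx',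
    trivAt_curvature hA hx hx', hq]
  simp only [coord_gradient hg hx, ← _root_.smul_apply, ← _root_.sub_apply]
  congr 1
  simp only [hJ, smul_sub, Finset.sum_sub_distrib, Finset.smul_sum, smul_smul]
  congr 1
  · exact Finset.sum_congr rfl fun b _ => by rw [mul_comm]
  · rw [Finset.sum_comm]
    refine Finset.sum_congr rfl fun b _ => Finset.sum_congr rfl fun a _ => ?_
    congr 1
    ring

end CoordFrame

end CurrentFrame

end YangMills

end

noncomputable section

set_option linter.unusedSectionVars false

namespace YangMills

/-! ### Division by a defining function on a convex set -/

section Hadamard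

open Filter Topology Set MeasureTheory

variable {E : Type} [NormedAddCommGroup E] [NormedSpace ℝ E] (ℓ : E →L[ℝ] ℝ) (e : E)

/-- The linear map multiplying the coordinate `ℓ` by `t`. -/
def scale (t : ℝ) : E →L[ℝ] E := ContinuousLinearMap.id ℝ E - (1 - t) • ℓ.smulRight e

lemma scale_apply (t : ℝ) (x : E) : scale ℓ e t x = x - ((1 - t) * ℓ x) • e := by
  simp [scale, mul_smul]

lemma scale_one (x : E) : scale ℓ e 1 x = x := by simp [scale_apply]

lemma scale_eq (t : ℝ) : scale ℓ e t = scale ℓ e 0 + t • ℓ.smulRight e := by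
  simp only [scale]
  module

lemma continuous_scale : Continuous fun t : ℝ => scale ℓ e t := by
  simp only [scale]
  fun_prop

variable {W : Type*} [NormedAddCommGroup W] [NormedSpace ℝ W]

/-- The weighted mean of a function along the segments `t ↦ scale t x`. -/
def scaleMean (k : ℕ) (f : E → W) (x : E) : W := ∫ t in (0 : ℝ)..1, t ^ k • f (scale ℓ e t x)

variable {ℓ e} {K : Set E} (hK : Convex ℝ K) (hU : UniqueDiffOn ℝ K)
  (hs : ∀ x ∈ K, ∀ t ∈ Icc (0 : ℝ) 1, scale ℓ e t x ∈ K)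

include hs in
lemma continuousOn_scale_comp {f : E → W} (hf : ContinuousOn f K) :
    ContinuousOn (fun p : E × ℝ => f (scale ℓ e p.2 p.1)) (K ×ˢ Icc 0 1) := by
  refine hf.comp (Continuous.continuousOn ?_) fun p hp => hs _ hp.1 _ hp.2
  simp only [scale_apply]
  fun_prop

include hs in
lemma intervalIntegrable_scale {f : E → W} (hf : ContinuousOn f K) {x : E} (hx : x ∈ K) (k : ℕ) :
    IntervalIntegrable (fun t => t ^ k • f (scale ℓ e t x)) volume 0 1 := by
  refine ContinuousOn.intervalIntegrable ?_
  rw [uIcc_of_le zero_le_one]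
  refine (continuousOn_id.pow k).smul ((continuousOn_scale_comp hs hf).comp
    (f := fun t : ℝ => (x, t)) (by fun_prop) fun t ht => ⟨hx, ht⟩)

variable [CompleteSpace W]

include hK hs in
lemma hasFDerivWithinAt_scaleMean {f : E → W} {f' : E → E →L[ℝ] W} (hf' : ContinuousOn f' K)
    (hf : ∀ x ∈ K, HasFDerivWithinAt f (f' x) K x) (k : ℕ) {x : E} (hx : x ∈ K) :
    HasFDerivWithinAt (scaleMean ℓ e k f)
      ((scaleMean ℓ e k f' x).comp (scale ℓ e 0) +
        (scaleMean ℓ e (k + 1) f' x).comp (ℓ.smulRight e)) K x := by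
  have hfc : ContinuousOn f K := fun y hy => (hf y hy).continuousWithinAt
  have hI0 := intervalIntegrable_scale hs hf' hx k
  have hI1 := intervalIntegrable_scale hs hf' hx (k + 1)
  have hL : ∀ v, ((scaleMean ℓ e k f' x).comp (scale ℓ e 0) +
        (scaleMean ℓ e (k + 1) f' x).comp (ℓ.smulRight e)) v =
      ∫ t in (0 : ℝ)..1, t ^ k • f' (scale ℓ e t x) (scale ℓ e t v) := by
    intro v
    rw [_root_.add_apply, ContinuousLinearMap.comp_apply, ContinuousLinearMap.comp_apply, scaleMean,
      scaleMean, ContinuousLinearMap.intervalIntegral_apply hI0,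
      ContinuousLinearMap.intervalIntegral_apply hI1, ← intervalIntegral.integral_add]
    · refine intervalIntegral.integral_congr fun t _ => ?_
      simp only [scale_eq ℓ e t, _root_.add_apply, _root_.smul_apply, map_add, map_smul, smul_add,
        smul_smul, pow_succ]
    · exact ⟨(ContinuousLinearMap.apply ℝ W (scale ℓ e 0 v)).integrable_comp hI0.1,
        (ContinuousLinearMap.apply ℝ W (scale ℓ e 0 v)).integrable_comp hI0.2⟩
    · exact ⟨(ContinuousLinearMap.apply ℝ W (ℓ.smulRight e v)).integrable_comp hI1.1,
        (ContinuousLinearMap.apply ℝ W (ℓ.smulRight e v)).integrable_comp hI1.2⟩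
  rw [hasFDerivWithinAt_iff_isLittleO, Asymptotics.isLittleO_iff]
  intro c hc
  obtain ⟨C, hC0, hC⟩ : ∃ C > 0, ∀ t ∈ Icc (0 : ℝ) 1, ‖scale ℓ e t‖ ≤ C := by
    obtain ⟨C, hC⟩ := isCompact_Icc.exists_bound_of_continuousOn
      (continuous_scale ℓ e).continuousOn (s := Icc (0 : ℝ) 1)
    exact ⟨max C 1, by positivity, fun t ht => (hC t ht).trans (le_max_left _ _)⟩
  obtain ⟨v, hv, hvu⟩ := isCompact_Icc.mem_uniformity_of_prod
    (f := fun y t => f' (scale ℓ e t y)) (s := K) (k := Icc (0 : ℝ) 1) (q := x)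
    (continuousOn_scale_comp hs hf') hx (Metric.dist_mem_uniformity (div_pos hc hC0))
  obtain ⟨δ, hδ, hδv⟩ := Metric.mem_nhdsWithin_iff.1 hv
  filter_upwards [inter_mem_nhdsWithin K (Metric.ball_mem_nhds x hδ)] with y hy
  have key : ∀ t ∈ Icc (0 : ℝ) 1, ‖f (scale ℓ e t y) - f (scale ℓ e t x) -
      f' (scale ℓ e t x) (scale ℓ e t (y - x))‖ ≤ c * ‖y - x‖ := by
    intro t ht
    have hd : ∀ z ∈ K ∩ Metric.ball x δ, HasFDerivWithinAt (fun z => f (scale ℓ e t z))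
        ((f' (scale ℓ e t z)).comp (scale ℓ e t)) (K ∩ Metric.ball x δ) z := fun z hz =>
      (hf _ (hs z hz.1 t ht)).comp z (scale ℓ e t).hasFDerivWithinAt fun w hw => hs w hw.1 t ht
    have hb : ∀ z ∈ K ∩ Metric.ball x δ, ‖(f' (scale ℓ e t z)).comp (scale ℓ e t) -
        (f' (scale ℓ e t x)).comp (scale ℓ e t)‖ ≤ c := by
      intro z hz
      rw [← ContinuousLinearMap.sub_comp]
      refine (ContinuousLinearMap.opNorm_comp_le _ _).trans ?_
      have h1 : dist (f' (scale ℓ e t z)) (f' (scale ℓ e t x)) < c / C := hvu z (hδv hz.symm) t ht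
      rw [dist_eq_norm] at h1
      calc _ ≤ c / C * C := mul_le_mul h1.le (hC t ht) (norm_nonneg _) (by positivity)
        _ = c := div_mul_cancel₀ _ hC0.ne'
    exact (hK.inter (convex_ball x δ)).norm_image_sub_le_of_norm_hasFDerivWithin_le' hd hb
      ⟨hx, Metric.mem_ball_self hδ⟩ hy
  have hIx := intervalIntegrable_scale hs hfc hx k
  have hIy := intervalIntegrable_scale hs hfc hy.1 k
  have hI2 : IntervalIntegrable (fun t => t ^ k • f' (scale ℓ e t x) (scale ℓ e t (y - x)))
      volume 0 1 := by
    refine ContinuousOn.intervalIntegrable ?_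
    rw [uIcc_of_le zero_le_one]
    refine (continuousOn_id.pow k).smul (ContinuousOn.clm_apply ((continuousOn_scale_comp hs hf').comp
      (f := fun t : ℝ => (x, t)) (by fun_prop) fun t ht => ⟨hx, ht⟩) (Continuous.continuousOn ?_))
    simp only [scale_apply]
    fun_prop
  rw [hL, scaleMean, scaleMean, ← intervalIntegral.integral_sub hIy hIx,
    ← intervalIntegral.integral_sub (hIy.sub hIx) hI2]
  refine (intervalIntegral.norm_integral_le_of_norm_le_const (C := c * ‖y - x‖) ?_).trans
    (by simp)
  intro t ht
  rw [uIoc_of_le zero_le_one] at ht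
  have ht' : t ∈ Icc (0 : ℝ) 1 := ⟨ht.1.le, ht.2⟩
  rw [← smul_sub, ← smul_sub, norm_smul]
  have h2 : ‖t ^ k‖ ≤ 1 := by
    rw [norm_pow, Real.norm_of_nonneg ht'.1]
    exact pow_le_one₀ ht'.1 ht'.2
  calc _ ≤ 1 * (c * ‖y - x‖) := mul_le_mul h2 (key t ht') (norm_nonneg _) zero_le_one
    _ = _ := one_mul _

end Hadamard

section Hadamard'

open Filter Topology Set MeasureTheory

universe u

variable {E : Type} [NormedAddCommGroup E] [NormedSpace ℝ E] {ℓ : E →L[ℝ] ℝ} {e : E}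
  {K : Set E} (hK : Convex ℝ K) (hU : UniqueDiffOn ℝ K)
  (hs : ∀ x ∈ K, ∀ t ∈ Icc (0 : ℝ) 1, scale ℓ e t x ∈ K)

include hK hU hs

lemma contDiffOn_scaleMean_nat (n : ℕ) : ∀ {W : Type u} [NormedAddCommGroup W] [NormedSpace ℝ W]
    [CompleteSpace W] {f : E → W} (_ : ContDiffOn ℝ ∞ f K) (k : ℕ),
    ContDiffOn ℝ n (scaleMean ℓ e k f) K := by
  induction n with
  | zero =>
    intro W _ _ _ f hf k
    rw [Nat.cast_zero, contDiffOn_zero]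
    intro x hx
    have hf' := (contDiffOn_infty_iff_fderivWithin hU).1 hf
    exact (hasFDerivWithinAt_scaleMean hK hs hf'.2.continuousOn
      (fun y hy => (hf'.1 y hy).hasFDerivWithinAt) k hx).continuousWithinAt
  | succ n ih =>
    intro W _ _ _ f hf k
    have hf' := (contDiffOn_infty_iff_fderivWithin hU).1 hf
    rw [Nat.cast_succ, contDiffOn_succ_iff_hasFDerivWithinAt_of_uniqueDiffOn hU]
    refine ⟨by simp, _, ?_, fun x hx => hasFDerivWithinAt_scaleMean hK hs hf'.2.continuousOn
      (fun y hy => (hf'.1 y hy).hasFDerivWithinAt) k hx⟩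
    exact ((ih hf'.2 k).clm_comp contDiffOn_const).add ((ih hf'.2 (k + 1)).clm_comp contDiffOn_const)

lemma contDiffOn_scaleMean {W : Type u} [NormedAddCommGroup W] [NormedSpace ℝ W]
    [CompleteSpace W] {f : E → W} (hf : ContDiffOn ℝ ∞ f K) (k : ℕ) :
    ContDiffOn ℝ ∞ (scaleMean ℓ e k f) K :=
  contDiffOn_infty.2 fun n => contDiffOn_scaleMean_nat hK hU hs n hf k

/-- Hadamard's lemma. -/
lemma exists_contDiffOn_eq_add_smul {W : Type u} [NormedAddCommGroup W] [NormedSpace ℝ W]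
    [CompleteSpace W] {f : E → W} (hf : ContDiffOn ℝ ∞ f K) :
    ∃ h : E → W, ContDiffOn ℝ ∞ h K ∧ ∀ x ∈ K, f x = f (scale ℓ e 0 x) + ℓ x • h x := by
  have hf' := (contDiffOn_infty_iff_fderivWithin hU).1 hf
  have hg : ContDiffOn ℝ ∞ (fun x => fderivWithin ℝ f K x e) K := hf'.2.clm_apply contDiffOn_const
  refine ⟨_, contDiffOn_scaleMean hK hU hs hg 0, fun x hx => ?_⟩
  have hcont : ContinuousOn (fun t : ℝ => f (scale ℓ e t x)) (Icc 0 1) :=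
    (continuousOn_scale_comp hs hf.continuousOn).comp (f := fun t : ℝ => (x, t)) (by fun_prop)
      fun t ht => ⟨hx, ht⟩
  have hc : ∀ t, HasDerivAt (fun t : ℝ => scale ℓ e t x) (ℓ x • e) t := fun t => by
    have h := (((hasDerivAt_id t).const_sub 1).mul_const (ℓ x)).smul_const e |>.const_sub x
    simp only [scale_apply]
    simpa using h
  have hd : ∀ t ∈ Ioo (0 : ℝ) 1, HasDerivAt (fun t : ℝ => f (scale ℓ e t x))
      (ℓ x • fderivWithin ℝ f K (scale ℓ e t x) e) t := by
    intro t ht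
    have h := (hf'.1 _ (hs x hx t ⟨ht.1.le, ht.2.le⟩)).hasFDerivWithinAt.comp_hasDerivWithinAt t
      (hc t).hasDerivWithinAt (s := Icc 0 1) fun u hu => hs x hx u hu
    rw [map_smul] at h
    exact h.hasDerivAt (Icc_mem_nhds ht.1 ht.2)
  have hI : IntervalIntegrable (fun t => ℓ x • fderivWithin ℝ f K (scale ℓ e t x) e) volume 0 1 := by
    have h := (intervalIntegrable_scale hs hg.continuousOn hx 0).smul (ℓ x)
    simp only [pow_zero, one_smul] at h
    exact h
  have h := intervalIntegral.integral_eq_sub_of_hasDerivAt_of_le zero_le_one hcont hd hI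
  rw [intervalIntegral.integral_smul, scale_one] at h
  simp only [scaleMean, pow_zero, one_smul]
  rw [h]
  abel

end Hadamard'

end YangMills

end

noncomputable section

set_option linter.unusedSectionVars false

namespace YangMills

/-! ### Borel's lemma along a hyperplane -/

section Borel

open Filter Topology Set

variable {E : Type} [NormedAddCommGroup E] [NormedSpace ℝ E] {ℓ : E →L[ℝ] ℝ} {e : E}
  {W : Type*} [NormedAddCommGroup W] [NormedSpace ℝ W]

/-- A cutoff on the real line. -/
def lineCutoff : ContDiffBump (0 : ℝ) := ⟨1, 2, one_pos, one_lt_two⟩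

lemma lineCutoff_of_abs_le {u : ℝ} (hu : |u| ≤ 1) : lineCutoff u = 1 :=
  lineCutoff.one_of_mem_closedBall (by simpa [lineCutoff] using hu)

lemma exists_bound_iteratedFDeriv {f : E → W} (hf : ContDiff ℝ ∞ f) (hc : HasCompactSupport f)
    (k : ℕ) : ∃ C, 0 ≤ C ∧ ∀ x, ‖iteratedFDeriv ℝ k f x‖ ≤ C := by
  obtain ⟨C, hC⟩ := (hc.iteratedFDeriv (𝕜 := ℝ) k).exists_bound_of_continuous
    (hf.continuous_iteratedFDeriv (by exact_mod_cast le_top))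
  exact ⟨C, (norm_nonneg _).trans (hC 0), hC⟩

/-- The localized monomial `ψ(ℓ/ε) ℓ^j`. -/
def cutMonomial (ℓ : E →L[ℝ] ℝ) (ε : ℝ) (j : ℕ) (x : E) : ℝ := lineCutoff (ε⁻¹ * ℓ x) * ℓ x ^ j

lemma contDiff_cutMonomial (ε : ℝ) (j : ℕ) : ContDiff ℝ ∞ (cutMonomial ℓ ε j) :=
  (lineCutoff.contDiff.comp (contDiff_const.mul ℓ.contDiff)).mul (ℓ.contDiff.pow j)

lemma exists_bound_cutMonomial (j i : ℕ) (hij : i < j) : ∃ C, 0 ≤ C ∧ ∀ ε : ℝ, 0 < ε → ε ≤ 1 →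
    ∀ x, ‖iteratedFDeriv ℝ i (cutMonomial ℓ ε j) x‖ ≤ C * ε := by
  set Ψ : ℝ → ℝ := fun u => lineCutoff u * u ^ j with hΨ
  have hΨs : ContDiff ℝ ∞ Ψ := lineCutoff.contDiff.mul (contDiff_id.pow j)
  obtain ⟨C, hC0, hC⟩ := exists_bound_iteratedFDeriv hΨs lineCutoff.hasCompactSupport.mul_right i
  refine ⟨C * ‖ℓ‖ ^ i, by positivity, fun ε hε hε1 x => ?_⟩
  have h1 : cutMonomial ℓ ε j = fun y => ε ^ j • (Ψ ∘ (ε⁻¹ • ℓ : E →L[ℝ] ℝ)) y := by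
    funext y
    simp only [cutMonomial, hΨ, Function.comp, _root_.smul_apply, smul_eq_mul, mul_pow, inv_pow]
    field_simp
  have h2 : ContDiff ℝ ∞ (Ψ ∘ (ε⁻¹ • ℓ : E →L[ℝ] ℝ)) := hΨs.comp (ContinuousLinearMap.contDiff _)
  rw [h1, iteratedFDeriv_const_smul_apply' (h2.contDiffAt.of_le (by exact_mod_cast le_top)),
    norm_smul, ContinuousLinearMap.iteratedFDeriv_comp_right _ hΨs _ (by exact_mod_cast le_top)]
  have h3 : ‖(iteratedFDeriv ℝ i Ψ ((ε⁻¹ • ℓ : E →L[ℝ] ℝ) x)).compContinuousLinearMap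
      fun _ => (ε⁻¹ • ℓ : E →L[ℝ] ℝ)‖ ≤ C * (ε⁻¹ * ‖ℓ‖) ^ i := by
    refine (ContinuousMultilinearMap.norm_compContinuousLinearMap_le _ _).trans ?_
    rw [Finset.prod_const, Finset.card_univ, Fintype.card_fin, norm_smul, norm_inv,
      Real.norm_of_nonneg hε.le]
    gcongr
    exact hC _
  rw [norm_pow, Real.norm_of_nonneg hε.le]
  calc _ ≤ ε ^ j * (C * (ε⁻¹ * ‖ℓ‖) ^ i) := by gcongr
    _ = C * ‖ℓ‖ ^ i * ε ^ (j - i) := by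
      rw [mul_pow, inv_pow, ← Nat.add_sub_of_le hij.le, pow_add, Nat.add_sub_cancel_left]
      field_simp
    _ ≤ C * ‖ℓ‖ ^ i * ε := by
      gcongr
      exact pow_le_of_le_one hε.le hε1 (Nat.sub_ne_zero_of_lt hij)

lemma exists_bound_cutMonomial_smul {b : E → W} (hb : ContDiff ℝ ∞ b) (hc : HasCompactSupport b)
    (j k : ℕ) (hkj : k < j) : ∃ C, 0 ≤ C ∧ ∀ ε : ℝ, 0 < ε → ε ≤ 1 →
    ∀ x, ‖iteratedFDeriv ℝ k (fun x => cutMonomial ℓ ε j x • b x) x‖ ≤ C * ε := by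
  have h1 : ∀ i : ℕ, ∃ C, 0 ≤ C ∧ (i ≤ k → ∀ ε : ℝ, 0 < ε → ε ≤ 1 →
      ∀ x, ‖iteratedFDeriv ℝ i (cutMonomial ℓ ε j) x‖ ≤ C * ε) := fun i => by
    by_cases hi : i ≤ k
    · obtain ⟨C, h0, hC⟩ := exists_bound_cutMonomial (ℓ := ℓ) j i (hi.trans_lt hkj)
      exact ⟨C, h0, fun _ => hC⟩
    · exact ⟨0, le_rfl, fun h => absurd h hi⟩
  choose C hC0 hC using h1
  choose B hB0 hB using exists_bound_iteratedFDeriv hb hc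
  refine ⟨∑ i ∈ Finset.range (k + 1), (k.choose i : ℝ) * C i * B (k - i),
    Finset.sum_nonneg fun i _ => mul_nonneg (mul_nonneg (Nat.cast_nonneg _) (hC0 i)) (hB0 _),
    fun ε hε hε1 x => ?_⟩
  refine (norm_iteratedFDeriv_smul_le (contDiff_cutMonomial ε j) hb x
    (by exact_mod_cast le_top)).trans ?_
  rw [Finset.sum_mul]
  refine Finset.sum_le_sum fun i hi => ?_
  have := hC i (Nat.lt_succ_iff.1 (Finset.mem_range.1 hi)) ε hε hε1 x
  calc _ ≤ (k.choose i : ℝ) * (C i * ε) * B (k - i) := by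
        gcongr
        exacts [mul_nonneg (Nat.cast_nonneg _) (mul_nonneg (hC0 i) hε.le), hB _ _]
    _ = _ := by ring

lemma exists_cutoff_scale {b : E → W} (hb : ContDiff ℝ ∞ b) (hc : HasCompactSupport b) (n : ℕ)
    {η : ℝ} (hη : 0 < η) : ∃ ε : ℝ, 0 < ε ∧ ∀ j ≤ n, ∀ k < j, ∀ x,
      ‖iteratedFDeriv ℝ k (fun x => cutMonomial ℓ ε j x • b x) x‖ ≤ η := by
  have h1 : ∀ j k : ℕ, ∃ C, 0 ≤ C ∧ (k < j → ∀ ε : ℝ, 0 < ε → ε ≤ 1 →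
      ∀ x, ‖iteratedFDeriv ℝ k (fun x => cutMonomial ℓ ε j x • b x) x‖ ≤ C * ε) := fun j k => by
    by_cases hk : k < j
    · obtain ⟨C, h0, hC⟩ := exists_bound_cutMonomial_smul (ℓ := ℓ) hb hc j k hk
      exact ⟨C, h0, fun _ => hC⟩
    · exact ⟨0, le_rfl, fun h => absurd h hk⟩
  choose C hC0 hC using h1
  set S := ∑ j ∈ Finset.range (n + 1), ∑ k ∈ Finset.range (n + 1), C j k with hS
  have hS0 : 0 ≤ S := Finset.sum_nonneg fun j _ => Finset.sum_nonneg fun k _ => hC0 j k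
  refine ⟨min 1 (η / (S + 1)), by positivity, fun j hj k hk x => ?_⟩
  refine (hC j k hk _ (by positivity) (min_le_left _ _) x).trans ?_
  have h2 : C j k ≤ S := by
    refine le_trans ?_ (Finset.single_le_sum (f := fun j => ∑ k ∈ Finset.range (n + 1), C j k)
      (fun j _ => Finset.sum_nonneg fun k _ => hC0 j k) (Finset.mem_range.2 (Nat.lt_succ_of_le hj)))
    exact Finset.single_le_sum (f := C j) (fun k _ => hC0 j k)
      (Finset.mem_range.2 (Nat.lt_succ_of_le (hk.le.trans hj)))
  calc C j k * min 1 (η / (S + 1)) ≤ (S + 1) * (η / (S + 1)) := by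
        gcongr
        · linarith
        · exact min_le_right _ _
    _ = η := by field_simp

variable [CompleteSpace W]

/-- A smooth function with prescribed expansion in powers of `ℓ`, together with its tails. -/
lemma exists_tails {b : ℕ → E → W} (hb : ∀ n, ContDiff ℝ ∞ (b n))
    (hc : ∀ n, HasCompactSupport (b n)) : ∃ (ε : ℕ → ℝ) (T : ℕ → E → W),
      (∀ n, ContDiff ℝ ∞ (T n)) ∧
      ∀ n x, T n x = lineCutoff ((ε n)⁻¹ * ℓ x) • b n x + ℓ x • T (n + 1) x := by
  choose ε _ hεb using fun n => exists_cutoff_scale (ℓ := ℓ) (hb n) (hc n) n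
    (η := (1 / 2 : ℝ) ^ n) (by positivity)
  set f : ℕ → ℕ → E → W := fun m i x => cutMonomial ℓ (ε (m + i)) i x • b (m + i) x with hf
  have hfs : ∀ m i, ContDiff ℝ ∞ (f m i) := fun m i => (contDiff_cutMonomial _ _).smul (hb _)
  have hfb : ∀ m i k, k < i → ∀ x, ‖iteratedFDeriv ℝ k (f m i) x‖ ≤ (1 / 2 : ℝ) ^ i := by
    intro m i k hki x
    refine (hεb (m + i) i (Nat.le_add_left _ _) k hki x).trans ?_
    exact pow_le_pow_of_le_one (by norm_num) (by norm_num) (Nat.le_add_left _ _)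
  have hsum : Summable fun i : ℕ => (1 / 2 : ℝ) ^ i := summable_geometric_two
  have hev : ∀ m k, ∀ᶠ i in (cofinite : Filter ℕ), ∀ x,
      ‖iteratedFDeriv ℝ k (f m i) x‖ ≤ (1 / 2 : ℝ) ^ i := fun m k => by
    rw [Nat.cofinite_eq_atTop]
    filter_upwards [eventually_gt_atTop k] with i hi x using hfb m i k hi x
  refine ⟨ε, fun m x => ∑' i, f m i x, fun m => contDiff_tsum_of_eventually (hfs m)
    (v := fun _ i => (1 / 2 : ℝ) ^ i) (fun _ _ => hsum) fun k _ => hev m k, fun m x => ?_⟩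
  have hs : Summable fun i => f m i x := by
    refine Summable.of_norm_bounded_eventually hsum ?_
    filter_upwards [hev m 0] with i hi
    simpa using hi x
  refine hs.tsum_eq_zero_add.trans ?_
  congr 1
  · simp [hf, cutMonomial]
  · rw [← tsum_const_smul'']
    refine tsum_congr fun i => ?_
    simp only [hf, cutMonomial, smul_smul]
    rw [show m + (i + 1) = m + 1 + i by ring, pow_succ]
    congr 1
    ring

lemma contDiff_cutoff_div (ε : ℝ) (i n : ℕ) : ∃ θ : E → ℝ, ContDiff ℝ ∞ θ ∧
    ∀ x, lineCutoff (ε⁻¹ * ℓ x) * ℓ x ^ i = ℓ x ^ i + ℓ x ^ n * θ x := by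
  refine ⟨fun x => (lineCutoff (ε⁻¹ * ℓ x) - 1) * ℓ x ^ i / ℓ x ^ n, ?_, fun x => ?_⟩
  · rw [contDiff_iff_contDiffAt]
    intro x
    by_cases hx : ℓ x = 0
    · have h : (fun x => (lineCutoff (ε⁻¹ * ℓ x) - 1) * ℓ x ^ i / ℓ x ^ n) =ᶠ[𝓝 x] fun _ => 0 := by
        have h' : ∀ᶠ y in 𝓝 x, |ε⁻¹ * ℓ y| < 1 := by
          refine ContinuousAt.eventually_lt (by fun_prop) continuousAt_const ?_
          simp [hx]
        filter_upwards [h'] with y hy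
        simp [lineCutoff_of_abs_le hy.le]
      exact contDiffAt_const.congr_of_eventuallyEq h
    · refine ContDiffAt.div ?_ (ℓ.contDiff.pow n).contDiffAt (pow_ne_zero _ hx)
      exact (((lineCutoff.contDiff.comp (contDiff_const.mul ℓ.contDiff)).sub contDiff_const).mul
        (ℓ.contDiff.pow i)).contDiffAt
  · by_cases hx : ℓ x ^ n = 0
    · have hx' : ℓ x = 0 := eq_zero_of_pow_eq_zero hx
      simp [hx, lineCutoff_of_abs_le (u := ε⁻¹ * ℓ x) (by simp [hx'])]
    · field_simp
      ring

end Borel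

section Borel'

open Filter Topology Set

universe u

variable {E : Type} [NormedAddCommGroup E] [NormedSpace ℝ E] [FiniteDimensional ℝ E]
  {ℓ : E →L[ℝ] ℝ} {e : E} {K : Set E} (hK : Convex ℝ K) (hU : UniqueDiffOn ℝ K)
  (hs : ∀ x ∈ K, ∀ t ∈ Icc (0 : ℝ) 1, scale ℓ e t x ∈ K)
  {W : Type u} [NormedAddCommGroup W] [NormedSpace ℝ W] [CompleteSpace W]

include hK hU hs

/-- Borel's lemma on a half space. -/
theorem exists_contDiff_expansion {O : Set E} (hO : IsOpen O)
    (hOK : ∀ x ∈ O, scale ℓ e 0 x ∈ K) {c : E} (hc : c ∈ O) {f : ℕ → E → W}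
    (hf : ∀ n, ContDiffOn ℝ ∞ (f n) K) :
    ∃ (G : E → W) (O' : Set E), ContDiff ℝ ∞ G ∧ IsOpen O' ∧ c ∈ O' ∧
      ∀ n, ∃ h : E → W, ContDiffOn ℝ ∞ h (K ∩ O') ∧ ∀ x ∈ K ∩ O',
        G x = ∑ i ∈ Finset.range n, ℓ x ^ i • f i x + ℓ x ^ n • h x := by
  classical
  choose! H hHs hH using fun (f : E → W) (hf : ContDiffOn ℝ ∞ f K) =>
    exists_contDiffOn_eq_add_smul hK hU hs hf
  let r : ℕ → E → W := fun n => Nat.rec (fun _ => 0) (fun n r => H fun x => r x + f n x) n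
  have hr0 : r 0 = fun _ => 0 := rfl
  have hrs : ∀ n, r (n + 1) = H fun x => r n x + f n x := fun n => rfl
  have hrd : ∀ n, ContDiffOn ℝ ∞ (r n) K := by
    intro n
    induction n with
    | zero => rw [hr0]; exact contDiffOn_const
    | succ n ih => rw [hrs]; exact hHs _ (ih.add (hf n))
  set β : ℕ → E → W := fun n x => r n (scale ℓ e 0 x) + f n (scale ℓ e 0 x) with hβ
  have hβd : ∀ n, ContDiffOn ℝ ∞ (β n) O := fun n =>
    ((hrd n).add (hf n)).comp (scale ℓ e 0).contDiff.contDiffOn hOK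
  obtain ⟨δ, hδ, hδO⟩ := Metric.isOpen_iff.1 hO c hc
  let χ : ContDiffBump c := ⟨δ / 4, δ / 2, by positivity, by linarith⟩
  have hχO : tsupport χ ⊆ O := by
    rw [χ.tsupport_eq]
    exact (Metric.closedBall_subset_ball (show δ / 2 < δ by linarith)).trans hδO
  set b : ℕ → E → W := fun n x => χ x • β n x with hb
  have hbd : ∀ n, ContDiff ℝ ∞ (b n) := by
    intro n
    rw [contDiff_iff_contDiffAt]
    intro x
    by_cases hx : x ∈ O
    · exact χ.contDiffAt.smul ((hβd n).contDiffAt (hO.mem_nhds hx))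
    · have h : b n =ᶠ[𝓝 x] fun _ => 0 := by
        filter_upwards [(isClosed_tsupport χ).isOpen_compl.mem_nhds fun h => hx (hχO h)] with y hy
        simp [hb, image_eq_zero_of_notMem_tsupport hy]
      exact contDiffAt_const.congr_of_eventuallyEq h
  have hbc : ∀ n, HasCompactSupport (b n) := fun n => χ.hasCompactSupport.smul_right
  obtain ⟨ε, T, hT, hTn⟩ := exists_tails (ℓ := ℓ) hbd hbc
  refine ⟨T 0, Metric.ball c (δ / 4), hT 0, Metric.isOpen_ball, Metric.mem_ball_self (by positivity),
    fun n => ?_⟩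
  choose θ hθd hθ using fun i => contDiff_cutoff_div (ℓ := ℓ) (ε i) i n
  have h1 : ∀ x, T 0 x = ∑ i ∈ Finset.range n, (ℓ x ^ i + ℓ x ^ n * θ i x) • b i x +
      ℓ x ^ n • T n x := by
    intro x
    simp only [← hθ]
    clear * - hTn
    induction n with
    | zero => simp
    | succ n ih =>
      rw [ih, hTn n, Finset.sum_range_succ]
      module
  have h2 : ∀ x ∈ K, ∑ i ∈ Finset.range n, ℓ x ^ i • f i x =
      ∑ i ∈ Finset.range n, ℓ x ^ i • β i x + ℓ x ^ n • r n x := by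
    intro x hx
    clear h1 hθ hθd θ
    induction n with
    | zero => simp [hr0]
    | succ n ih =>
      have h := hH _ ((hrd n).add (hf n)) x hx
      have h' : f n x = β n x + ℓ x • r (n + 1) x - r n x := by
        rw [hrs, hβ, ← h]
        abel
      rw [Finset.sum_range_succ, Finset.sum_range_succ, ih, h', pow_succ]
      module
  have hχ1 : ∀ x ∈ Metric.ball c (δ / 4), ∀ i, b i x = β i x := fun x hx i => by
    rw [hb]
    simp only
    rw [χ.one_of_mem_closedBall (Metric.ball_subset_closedBall hx), one_smul]
  refine ⟨fun x => (∑ i ∈ Finset.range n, θ i x • b i x) + T n x - r n x, ?_, fun x hx => ?_⟩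
  · refine ContDiffOn.sub (ContDiff.contDiffOn (ContDiff.add (ContDiff.sum fun i _ =>
      (hθd i).smul (hbd i)) (hT n))) ((hrd n).mono inter_subset_left)
  · rw [h1, h2 x hx.1]
    simp only [hχ1 x hx.2, add_smul, Finset.sum_add_distrib, smul_sub, smul_add, Finset.smul_sum,
      smul_smul]
    abel

end Borel'

end YangMills

end

noncomputable section

set_option linter.unusedSectionVars false

namespace YangMills

/-! ### Boundary charts -/

section BoundaryChart

open Filter Topology Set

/-- The tangential indices. -/
def tail {d : ℕ} [NeZero d] (i : Fin (d - 1)) : Fin d :=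
  ⟨i + 1, by have := NeZero.pos d; omega⟩

variable {d : ℕ} [NeZero d]

lemma tail_ne_zero (i : Fin (d - 1)) : tail i ≠ 0 := by
  simp [tail, Fin.ext_iff]

lemma tail_injective : Function.Injective (tail (d := d)) := fun i j h => by
  simpa [tail, Fin.ext_iff] using h

lemma exists_tail_eq {i : Fin d} (hi : i ≠ 0) : ∃ j, tail j = i := by
  have h0 : (i : ℕ) ≠ 0 := fun h => hi (Fin.ext h)
  exact ⟨⟨i - 1, by omega⟩, Fin.ext (by simp [tail]; omega)⟩

lemma sum_eq_zero_add_tail {W : Type*} [AddCommMonoid W] (f : Fin d → W) :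
    ∑ i, f i = f 0 + ∑ i, f (tail i) := by
  obtain ⟨m, rfl⟩ : ∃ m, d = m + 1 := ⟨d - 1, by have := NeZero.pos d; omega⟩
  rw [Fin.sum_univ_succ]
  rfl

/-- The transverse coordinate. -/
def normalCoord (d : ℕ) [NeZero d] : EuclideanSpace ℝ (Fin d) →L[ℝ] ℝ := EuclideanSpace.proj 0

/-- The inward unit vector of the half space. -/
def normalVec (d : ℕ) [NeZero d] : EuclideanSpace ℝ (Fin d) := EuclideanSpace.single 0 1

lemma normalCoord_apply (x : EuclideanSpace ℝ (Fin d)) : normalCoord d x = x 0 := rfl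

lemma scale_zero_apply (x : EuclideanSpace ℝ (Fin d)) (i : Fin d) :
    scale (normalCoord d) (normalVec d) 0 x i = if i = 0 then 0 else x i := by
  rw [scale_apply]
  by_cases hi : i = 0
  · subst hi; simp [normalVec, normalCoord]
  · simp [normalVec, hi]

lemma norm_scale_zero_le (x : EuclideanSpace ℝ (Fin d)) :
    ‖scale (normalCoord d) (normalVec d) 0 x‖ ≤ ‖x‖ := by
  rw [EuclideanSpace.norm_eq, EuclideanSpace.norm_eq]
  refine Real.sqrt_le_sqrt (Finset.sum_le_sum fun i _ => ?_)
  rw [scale_zero_apply]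
  split_ifs
  · simpa using sq_nonneg (x i)
  · exact le_rfl

lemma scale_eq_convex (t : ℝ) (x : EuclideanSpace ℝ (Fin d)) :
    scale (normalCoord d) (normalVec d) t x =
      (1 - t) • scale (normalCoord d) (normalVec d) 0 x + t • x := by
  simp only [scale_apply]
  module

/-- A half ball centred on the boundary of the half space. -/
def halfBall (c : EuclideanSpace ℝ (Fin d)) (ε : ℝ) : Set (EuclideanSpace ℝ (Fin d)) :=
  range (𝓡∂ d) ∩ Metric.ball c ε

lemma convex_halfBall (c : EuclideanSpace ℝ (Fin d)) (ε : ℝ) : Convex ℝ (halfBall c ε) :=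
  (𝓡∂ d).convex_range.inter (convex_ball c ε)

lemma uniqueDiffOn_halfBall (c : EuclideanSpace ℝ (Fin d)) (ε : ℝ) :
    UniqueDiffOn ℝ (halfBall c ε) := (𝓡∂ d).uniqueDiffOn.inter Metric.isOpen_ball

lemma scale_zero_mem_range (x : EuclideanSpace ℝ (Fin d)) :
    scale (normalCoord d) (normalVec d) 0 x ∈ range (𝓡∂ d) := by
  rw [range_modelWithCornersEuclideanHalfSpace]
  change 0 ≤ scale (normalCoord d) (normalVec d) 0 x 0
  rw [scale_zero_apply, if_pos rfl]

lemma scale_zero_fix {c : EuclideanSpace ℝ (Fin d)} (hc : c 0 = 0) :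
    scale (normalCoord d) (normalVec d) 0 c = c := by
  simp [scale_apply, normalCoord_apply, hc]

lemma scale_zero_mem_halfBall {c : EuclideanSpace ℝ (Fin d)} (hc : c 0 = 0) {ε : ℝ}
    {x : EuclideanSpace ℝ (Fin d)} (hx : x ∈ Metric.ball c ε) :
    scale (normalCoord d) (normalVec d) 0 x ∈ halfBall c ε := by
  refine ⟨scale_zero_mem_range x, ?_⟩
  rw [mem_ball_iff_norm] at hx ⊢
  calc _ = ‖scale (normalCoord d) (normalVec d) 0 (x - c)‖ := by
        rw [map_sub, scale_zero_fix hc]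
    _ ≤ ‖x - c‖ := norm_scale_zero_le _
    _ < ε := hx

lemma scale_mem_halfBall {c : EuclideanSpace ℝ (Fin d)} (hc : c 0 = 0) (ε : ℝ) :
    ∀ x ∈ halfBall c ε, ∀ t ∈ Icc (0 : ℝ) 1,
      scale (normalCoord d) (normalVec d) t x ∈ halfBall c ε := by
  intro x hx t ht
  rw [scale_eq_convex]
  exact convex_halfBall c ε (scale_zero_mem_halfBall hc hx.2) hx (by linarith [ht.2]) ht.1 (by ring)

variable {M : Type*} [TopologicalSpace M] [ChartedSpace (EuclideanHalfSpace d) M]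
  [IsManifold (𝓡∂ d) ∞ M]

variable (d) in
/-- The transverse coordinate in the preferred chart at `p`. -/
def bdef (p x : M) : ℝ := extChartAt (𝓡∂ d) p x 0

lemma bdef_nonneg (p x : M) : 0 ≤ bdef d p x := by
  have h : extChartAt (𝓡∂ d) p x ∈ range (𝓡∂ d) := mem_range_self _
  rw [range_modelWithCornersEuclideanHalfSpace] at h
  exact h

lemma mem_boundary_iff {p x : M} (hx : x ∈ (chartAt (EuclideanHalfSpace d) p).source) :
    x ∈ (𝓡∂ d).boundary M ↔ bdef d p x = 0 := by
  have h1 : x ∈ (𝓡∂ d).boundary M ↔ ¬ (𝓡∂ d).IsInteriorPoint x :=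
    ((not_congr ((𝓡∂ d).isInteriorPoint_iff_not_isBoundaryPoint x)).trans not_not).symm
  have : IsManifold (𝓡∂ d) 1 M := .of_le (n := ∞) (by exact_mod_cast le_top)
  rw [h1, (𝓡∂ d).isInteriorPoint_iff_of_mem_atlas one_ne_zero (chart_mem_atlas _ p) hx]
  have h2 : ((chartAt (EuclideanHalfSpace d) p).extend (𝓡∂ d) x ∈
      interior ((chartAt (EuclideanHalfSpace d) p).extend (𝓡∂ d)).target) ↔
      0 < bdef d p x := by
    constructor
    · intro h
      have h' := OpenPartialHomeomorph.interior_extend_target_subset_interior_range _ h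
      rw [interior_range_modelWithCornersEuclideanHalfSpace] at h'
      exact h'
    · intro h
      refine (chartAt _ p).mem_interior_extend_target ((chartAt _ p).map_source hx) ?_
      rw [interior_range_modelWithCornersEuclideanHalfSpace]
      exact h
  rw [h2, not_lt]
  exact ⟨fun h => le_antisymm h (bdef_nonneg p x), fun h => h.le⟩

/-- A coordinate half ball in a boundary chart. -/
lemma exists_halfBall {p : M} {N : Set M} (hN : N ∈ 𝓝 p) : ∃ ε > 0,
    halfBall (extChartAt (𝓡∂ d) p p) ε ⊆ (extChartAt (𝓡∂ d) p).target ∧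
    ∀ x ∈ halfBall (extChartAt (𝓡∂ d) p p) ε, (extChartAt (𝓡∂ d) p).symm x ∈ N := by
  have h1 := extChartAt_target_mem_nhdsWithin (I := 𝓡∂ d) p
  have h2 : (extChartAt (𝓡∂ d) p).symm ⁻¹' N ∈ 𝓝[range (𝓡∂ d)] (extChartAt (𝓡∂ d) p p) :=
    mem_nhdsWithin_of_mem_nhds ((continuousAt_extChartAt_symm p).preimage_mem_nhds (by
      rwa [extChartAt_to_inv]))
  obtain ⟨ε, hε, h⟩ := Metric.mem_nhdsWithin_iff.1 (inter_mem h1 h2)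
  refine ⟨ε, hε, fun x hx => (h ⟨hx.2, hx.1⟩).1, fun x hx => (h ⟨hx.2, hx.1⟩).2⟩

/-- The coordinate half ball as an open subset of the manifold. -/
def chartBall (p : M) (O : Set (EuclideanSpace ℝ (Fin d))) : Set M :=
  (extChartAt (𝓡∂ d) p).source ∩ extChartAt (𝓡∂ d) p ⁻¹' O

lemma isOpen_chartBall (p : M) {O : Set (EuclideanSpace ℝ (Fin d))} (hO : IsOpen O) :
    IsOpen (chartBall p O) :=
  (continuousOn_extChartAt p).isOpen_inter_preimage (isOpen_extChartAt_source p) hO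

variable {W : Type*} [NormedAddCommGroup W] [NormedSpace ℝ W]

lemma contDiffOn_comp_symm {p : M} {N : Set M} {f : M → W}
    (hf : ∀ x ∈ N, ContMDiffAt (𝓡∂ d) 𝓘(ℝ, W) ∞ f x) {K : Set (EuclideanSpace ℝ (Fin d))}
    (hK : K ⊆ (extChartAt (𝓡∂ d) p).target) (hKN : ∀ x ∈ K, (extChartAt (𝓡∂ d) p).symm x ∈ N) :
    ContDiffOn ℝ ∞ (f ∘ (extChartAt (𝓡∂ d) p).symm) K := by
  rw [← contMDiffOn_iff_contDiffOn]
  intro x hx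
  exact (hf _ (hKN x hx)).comp_contMDiffWithinAt x ((contMDiffOn_extChartAt_symm p x (hK hx)).mono hK)

lemma contMDiffAt_comp_chart {p : M} {O : Set (EuclideanSpace ℝ (Fin d))} (hO : IsOpen O)
    {h : EuclideanSpace ℝ (Fin d) → W} (hh : ContDiffOn ℝ ∞ h (range (𝓡∂ d) ∩ O)) {x : M}
    (hx : x ∈ chartBall p O) : ContMDiffAt (𝓡∂ d) 𝓘(ℝ, W) ∞ (h ∘ extChartAt (𝓡∂ d) p) x := by
  have h0 : ContMDiffOn (𝓡∂ d) 𝓘(ℝ, EuclideanSpace ℝ (Fin d)) ∞ (extChartAt (𝓡∂ d) p)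
      (chartBall p O) := contMDiffOn_extChartAt.mono fun y hy => by simpa using hy.1
  have h1 := (contMDiffOn_iff_contDiffOn.2 hh).comp h0 fun y hy => ⟨mem_range_self _, hy.2⟩
  exact h1.contMDiffAt ((isOpen_chartBall p hO).mem_nhds hx)

lemma contMDiffAt_bdef {p x : M} (hx : x ∈ (chartAt (EuclideanHalfSpace d) p).source) :
    ContMDiffAt (𝓡∂ d) 𝓘(ℝ, ℝ) ∞ (bdef d p) x :=
  (normalCoord d).contDiff.contMDiff.contMDiffAt.comp x (contMDiffAt_extChartAt' hx)

lemma smoothNear_bdef (p : M) : SmoothNear (𝓡∂ d) (bdef d p) p := by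
  filter_upwards [(chartAt (EuclideanHalfSpace d) p).open_source.mem_nhds (mem_chart_source _ p)]
    with x hx using contMDiffAt_bdef hx

variable [CompleteSpace W]

/-- Hadamard's lemma at a boundary point. -/
lemma exists_eq_bdef_smul {p : M} (hp : p ∈ (𝓡∂ d).boundary M) {f : M → W}
    (hf : SmoothNear (𝓡∂ d) f p) (h0 : ∀ᶠ x in 𝓝 p, x ∈ (𝓡∂ d).boundary M → f x = 0) :
    ∃ h : M → W, SmoothNear (𝓡∂ d) h p ∧ ∀ᶠ x in 𝓝 p, f x = bdef d p x • h x := by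
  obtain ⟨ε, hε, hK, hKN⟩ := exists_halfBall (d := d) (Filter.inter_mem hf h0)
  set c := extChartAt (𝓡∂ d) p p with hc
  have hc0 : c 0 = 0 := (mem_boundary_iff (mem_chart_source _ p)).1 hp
  obtain ⟨h, hh, hfh⟩ := exists_contDiffOn_eq_add_smul (convex_halfBall c ε)
    (uniqueDiffOn_halfBall c ε) (scale_mem_halfBall hc0 ε)
    (contDiffOn_comp_symm (f := f) (N := {x | ContMDiffAt (𝓡∂ d) 𝓘(ℝ, W) ∞ f x})
      (fun x hx => hx) hK fun x hx => (hKN x hx).1)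
  have hV : chartBall p (Metric.ball c ε) ∈ 𝓝 p :=
    (isOpen_chartBall p Metric.isOpen_ball).mem_nhds
      ⟨mem_extChartAt_source p, Metric.mem_ball_self hε⟩
  refine ⟨h ∘ extChartAt (𝓡∂ d) p, ?_, ?_⟩
  · filter_upwards [hV] with x hx using contMDiffAt_comp_chart Metric.isOpen_ball hh hx
  · filter_upwards [hV] with x hx
    have hxK : extChartAt (𝓡∂ d) p x ∈ halfBall c ε := ⟨mem_range_self _, hx.2⟩
    have h1 := hfh _ hxK
    have h2 := scale_zero_mem_halfBall hc0 hxK.2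
    have h3 : (f ∘ (extChartAt (𝓡∂ d) p).symm)
        (scale (normalCoord d) (normalVec d) 0 (extChartAt (𝓡∂ d) p x)) = 0 := by
      refine (hKN _ h2).2 ((mem_boundary_iff (p := p) ?_).2 ?_)
      · simpa using (extChartAt (𝓡∂ d) p).map_target (hK h2)
      · rw [bdef, (extChartAt (𝓡∂ d) p).right_inv (hK h2), scale_zero_apply, if_pos rfl]
    rw [h3, zero_add, Function.comp, (extChartAt (𝓡∂ d) p).left_inv hx.1] at h1
    exact h1

/-- Borel's lemma at a boundary point. -/
lemma exists_bdef_expansion {p : M} (hp : p ∈ (𝓡∂ d).boundary M) {N : Set M} (hN : N ∈ 𝓝 p)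
    {f : ℕ → M → W} (hf : ∀ n, ∀ x ∈ N, ContMDiffAt (𝓡∂ d) 𝓘(ℝ, W) ∞ (f n) x) :
    ∃ (G : M → W) (V : Set M), IsOpen V ∧ p ∈ V ∧
      (∀ x ∈ V, ContMDiffAt (𝓡∂ d) 𝓘(ℝ, W) ∞ G x) ∧
      ∀ n, ∃ h : M → W, (∀ x ∈ V, ContMDiffAt (𝓡∂ d) 𝓘(ℝ, W) ∞ h x) ∧
        ∀ x ∈ V, G x = ∑ i ∈ Finset.range n, bdef d p x ^ i • f i x + bdef d p x ^ n • h x := by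
  obtain ⟨ε, hε, hK, hKN⟩ := exists_halfBall (d := d) hN
  set c := extChartAt (𝓡∂ d) p p with hc
  have hc0 : c 0 = 0 := (mem_boundary_iff (mem_chart_source _ p)).1 hp
  obtain ⟨G, O, hG, hO, hcO, hGn⟩ := exists_contDiff_expansion (convex_halfBall c ε)
    (uniqueDiffOn_halfBall c ε) (scale_mem_halfBall hc0 ε) (O := Metric.ball c ε) Metric.isOpen_ball
    (fun x hx => scale_zero_mem_halfBall hc0 hx) (Metric.mem_ball_self hε)
    (fun n => contDiffOn_comp_symm (f := f n) (hf n) hK hKN)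
  have hO' : IsOpen (Metric.ball c ε ∩ O) := Metric.isOpen_ball.inter hO
  refine ⟨G ∘ extChartAt (𝓡∂ d) p, chartBall p (Metric.ball c ε ∩ O), isOpen_chartBall p hO',
    ⟨mem_extChartAt_source p, Metric.mem_ball_self hε, hcO⟩,
    fun x hx => contMDiffAt_comp_chart hO' hG.contDiffOn hx, fun n => ?_⟩
  obtain ⟨h, hh, hhG⟩ := hGn n
  refine ⟨h ∘ extChartAt (𝓡∂ d) p, fun x hx => contMDiffAt_comp_chart hO' ?_ hx, fun x hx => ?_⟩
  · rwa [← inter_assoc]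
  · have h1 := hhG (extChartAt (𝓡∂ d) p x) ⟨⟨mem_range_self _, hx.2.1⟩, hx.2.2⟩
    simp only [Function.comp, (extChartAt (𝓡∂ d) p).left_inv hx.1] at h1 ⊢
    exact h1

/-- The frame of the preferred chart at `p`. -/
def chartFrame (p : M) : CoordFrame (𝓡∂ d) p (Fin d) :=
  .ofMap (chartAt (EuclideanHalfSpace d) p).source (chartAt _ p).open_source (mem_chart_source _ p)
    (fun x i => extChartAt (𝓡∂ d) p x i)
    (fun _ hx => (EuclideanSpace.equiv (Fin d) ℝ).contDiff.contMDiff.contMDiffAt.comp _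
      (contMDiffAt_extChartAt' hx))
    (fun x hx => by
      have : IsManifold (𝓡∂ d) 1 M := .of_le (n := ∞) (by exact_mod_cast le_top)
      have h1 : x ∈ (extChartAt (𝓡∂ d) p).source := by simpa using hx
      have h2 := isInvertible_mfderiv_extChartAt (I := 𝓡∂ d) h1
      have h3 : mfderiv (𝓡∂ d) 𝓘(ℝ, Fin d → ℝ) (fun x i => extChartAt (𝓡∂ d) p x i) x =
          ((EuclideanSpace.equiv (Fin d) ℝ : EuclideanSpace ℝ (Fin d) →L[ℝ] Fin d → ℝ)).comp
            (mfderiv (𝓡∂ d) 𝓘(ℝ, EuclideanSpace ℝ (Fin d)) (extChartAt (𝓡∂ d) p) x) := by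
        have h4 := mfderiv_comp x
          (g := (EuclideanSpace.equiv (Fin d) ℝ : EuclideanSpace ℝ (Fin d) →L[ℝ] Fin d → ℝ))
          (I' := 𝓘(ℝ, EuclideanSpace ℝ (Fin d))) (I'' := 𝓘(ℝ, Fin d → ℝ))
          ((ContinuousLinearMap.contMDiff (n := 1) _).contMDiffAt.mdifferentiableAt one_ne_zero)
          ((contMDiffAt_extChartAt' (I := 𝓡∂ d) (n := 1) hx).mdifferentiableAt one_ne_zero)
        rw [mfderiv_eq_fderiv, ContinuousLinearMap.fderiv] at h4
        exact h4
      rw [h3]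
      obtain ⟨L, hL⟩ := h2
      exact ⟨L.trans (EuclideanSpace.equiv (Fin d) ℝ), by rw [← hL]; rfl⟩)

end BoundaryChart

end YangMills

end

noncomputable section

set_option linter.unusedSectionVars false

namespace YangMills

/-! ### Sections of homomorphism bundles -/

section HomSections

open Filter Topology Module

variable {E : Type*} [NormedAddCommGroup E] [NormedSpace ℝ E] [FiniteDimensional ℝ E]
  {H : Type*} [TopologicalSpace H] {I : ModelWithCorners ℝ E H}
  {M : Type*} [TopologicalSpace M] [ChartedSpace H M] [IsManifold I ∞ M]
  {F₁ : Type*} [NormedAddCommGroup F₁] [NormedSpace ℝ F₁] [FiniteDimensional ℝ F₁]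
  {V₁ : M → Type*} [TopologicalSpace (TotalSpace F₁ V₁)]
  [∀ x, AddCommGroup (V₁ x)] [∀ x, Module ℝ (V₁ x)] [∀ x, TopologicalSpace (V₁ x)]
  [∀ x, IsTopologicalAddGroup (V₁ x)] [∀ x, ContinuousSMul ℝ (V₁ x)]
  [FiberBundle F₁ V₁] [VectorBundle ℝ F₁ V₁] [ContMDiffVectorBundle ∞ F₁ V₁ I]
  {F₂ : Type*} [NormedAddCommGroup F₂] [NormedSpace ℝ F₂] [FiniteDimensional ℝ F₂]
  {V₂ : M → Type*} [TopologicalSpace (TotalSpace F₂ V₂)]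
  [∀ x, AddCommGroup (V₂ x)] [∀ x, Module ℝ (V₂ x)] [∀ x, TopologicalSpace (V₂ x)]
  [∀ x, IsTopologicalAddGroup (V₂ x)] [∀ x, ContinuousSMul ℝ (V₂ x)]
  [FiberBundle F₂ V₂] [VectorBundle ℝ F₂ V₂] [ContMDiffVectorBundle ∞ F₂ V₂ I]
  {p : M} {x : M}

lemma mem_trivSet_hom (h1 : x ∈ trivSet F₁ V₁ p) (h2 : x ∈ trivSet F₂ V₂ p) :
    x ∈ trivSet (F₁ →L[ℝ] F₂) (fun y => V₁ y →L[ℝ] V₂ y) p := ⟨h1, h2⟩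

lemma locRep_hom (h1 : x ∈ trivSet F₁ V₁ p) (h2 : x ∈ trivSet F₂ V₂ p)
    (L : Π y : M, V₁ y →L[ℝ] V₂ y) :
    locRep (F₁ →L[ℝ] F₂) p L x =
      (trivAt F₂ p x : V₂ x →L[ℝ] F₂) ∘L L x ∘L (symAt F₁ p x : F₁ →L[ℝ] V₁ x) := by
  rw [locRep, trivAt_apply (mem_trivSet_hom h1 h2)]
  rfl

lemma smoothNear_clm {T : M → F₁ →L[ℝ] F₂} (h : ∀ u, SmoothNear I (fun y => T y u) x) :
    SmoothNear I T x := by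
  have h2 : SmoothNear I (fun y => ∑ k, ContinuousLinearMap.smulRightL ℝ F₁ F₂
      (LinearMap.toContinuousLinearMap ((finBasis ℝ F₁).coord k)) (T y (finBasis ℝ F₁ k))) x :=
    SmoothNear.sum fun k _ => SmoothNear.comp (ContinuousLinearMap.contDiff _) (h _)
  refine h2.congr (.of_forall fun y => ?_)
  ext u
  simp only [sum_apply]
  conv_lhs => rw [← (finBasis ℝ F₁).sum_repr u, map_sum]
  exact Finset.sum_congr rfl fun k _ => (T y).map_smul _ _

/-- A section of a homomorphism bundle is smooth if its matrix coefficients are. -/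
lemma smoothSecNear_hom_iff (h1 : x ∈ trivSet F₁ V₁ p) (h2 : x ∈ trivSet F₂ V₂ p)
    {L : Π y : M, V₁ y →L[ℝ] V₂ y} :
    SmoothSecNear (F₁ →L[ℝ] F₂) I L x ↔
      ∀ u : F₁, SmoothSecNear F₂ I (fun y => L y (constSec p u y)) x := by
  have e : ∀ u : F₁, (fun y => locRep (F₁ →L[ℝ] F₂) p L y u) =ᶠ[𝓝 x]
      locRep F₂ p (fun y => L y (constSec p u y)) := fun u => by
    filter_upwards [trivSet_mem_nhds h1, trivSet_mem_nhds h2] with y hy1 hy2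
    rw [locRep_hom hy1 hy2]
    rfl
  rw [smoothSecNear_iff (mem_trivSet_hom h1 h2)]
  constructor
  · intro h u
    exact (smoothSecNear_iff h2).2 ((h.comp (ContinuousLinearMap.apply ℝ F₂ u).contDiff).congr (e u).symm)
  · intro h
    exact smoothNear_clm fun u => ((smoothSecNear_iff h2).1 (h u)).congr (e u)

lemma SmoothSecNear.clm_apply {L : Π y : M, V₁ y →L[ℝ] V₂ y} {s : Π y : M, V₁ y}
    (hL : SmoothSecNear (F₁ →L[ℝ] F₂) I L x) (hs : SmoothSecNear F₁ I s x) :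
    SmoothSecNear F₂ I (fun y => L y (s y)) x := by
  filter_upwards [hL, hs] with y h1 h2
  exact ContMDiffAt.clm_bundle_apply (b := fun y => y) h1 h2

end HomSections

/-! ### Endomorphism-valued one-forms -/

section Forms

open Filter Topology Module

variable {m : ℕ} {H : Type*} [TopologicalSpace H]
  {I : ModelWithCorners ℝ (EuclideanSpace ℝ (Fin m)) H}
  {M : Type*} [TopologicalSpace M] [ChartedSpace H M] [IsManifold I ∞ M]
  {F : Type*} [NormedAddCommGroup F] [NormedSpace ℝ F] [FiniteDimensional ℝ F]
  {V : M → Type*} [TopologicalSpace (TotalSpace F V)]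
  [∀ x, AddCommGroup (V x)] [∀ x, Module ℝ (V x)] [∀ x, TopologicalSpace (V x)]
  [∀ x, IsTopologicalAddGroup (V x)] [∀ x, ContinuousSMul ℝ (V x)]
  [FiberBundle F V] [VectorBundle ℝ F V] [ContMDiffVectorBundle ∞ F V I]
  {p : M} {κ : Type*} [Fintype κ] [DecidableEq κ]

/-- Endomorphism-valued one-forms. -/
abbrev EndForm (I : ModelWithCorners ℝ (EuclideanSpace ℝ (Fin m)) H) (V : M → Type*)
    [∀ x, AddCommGroup (V x)] [∀ x, Module ℝ (V x)] [∀ x, TopologicalSpace (V x)]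
    [∀ x, IsTopologicalAddGroup (V x)] [∀ x, ContinuousSMul ℝ (V x)] : Type _ :=
  (x : M) → TangentSpace I x →L[ℝ] V x →L[ℝ] V x

variable (F) in
/-- The one-form `K` is smooth near `x`. -/
abbrev SmoothFormNear (K : EndForm I V) (x : M) : Prop :=
  SmoothSecNear (EuclideanSpace ℝ (Fin m) →L[ℝ] F →L[ℝ] F) I K x

/-- The components of an endomorphism-valued one-form. -/
def CoordFrame.formComp (𝔛 : CoordFrame I p κ) (F : Type*) [NormedAddCommGroup F]
    [NormedSpace ℝ F] {V : M → Type*} [TopologicalSpace (TotalSpace F V)]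
    [∀ x, AddCommGroup (V x)] [∀ x, Module ℝ (V x)] [∀ x, TopologicalSpace (V x)]
    [∀ x, IsTopologicalAddGroup (V x)] [∀ x, ContinuousSMul ℝ (V x)]
    [FiberBundle F V] [VectorBundle ℝ F V] (K : EndForm I V) (b : κ) (x : M) : F →L[ℝ] F :=
  trivAt F p x ∘L K x (𝔛.X b x) ∘L symAt F p x

/-- The endomorphism-valued one-form with given components. -/
def CoordFrame.formOf (𝔛 : CoordFrame I p κ) (V : M → Type*) [TopologicalSpace (TotalSpace F V)]
    [∀ x, AddCommGroup (V x)] [∀ x, Module ℝ (V x)] [∀ x, TopologicalSpace (V x)]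
    [∀ x, IsTopologicalAddGroup (V x)] [∀ x, ContinuousSMul ℝ (V x)]
    [FiberBundle F V] [VectorBundle ℝ F V] (t : κ → M → F →L[ℝ] F) : EndForm I V := fun x =>
  ∑ b, (mvfderiv I (𝔛.coord b) x).smulRight (symAt F p x ∘L t b x ∘L trivAt F p x)

lemma contMDiff_iff_smoothFormNear {L : EndForm I V} :
    (∀ x, SmoothFormNear F L x) ↔ ContMDiff I
      (I.prod 𝓘(ℝ, EuclideanSpace ℝ (Fin m) →L[ℝ] F →L[ℝ] F)) ∞
      (fun x => TotalSpace.mk' (EuclideanSpace ℝ (Fin m) →L[ℝ] F →L[ℝ] F)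
        (E := fun x : M => TangentSpace I x →L[ℝ] V x →L[ℝ] V x) x (L x)) :=
  ⟨fun h x => (h x).self_of_nhds, fun h _ => .of_forall fun y => h y⟩

lemma SmoothFormNear.apply {K : EndForm I V} {x : M} (hK : SmoothFormNear F K x)
    {X : Π y : M, TangentSpace I y} (hX : SmoothFieldNear X x) {s : Π y : M, V y}
    (hs : SmoothSecNear F I s x) : SmoothSecNear F I (fun y => K y (X y) (s y)) x := by
  have h1 : SmoothSecNear (F →L[ℝ] F) I (fun y => K y (X y)) x :=
    SmoothSecNear.clm_apply (V₁ := fun y : M => TangentSpace I y)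
      (V₂ := fun y : M => V y →L[ℝ] V y) hK hX
  exact h1.clm_apply hs

namespace CoordFrame

variable {𝔛 : CoordFrame I p κ} {x : M}

lemma formComp_near {K : EndForm I V} (hx : x ∈ 𝔛.U) (hx' : x ∈ trivSet F V p)
    (hK : SmoothFormNear F K x) (b : κ) : SmoothNear I (𝔛.formComp F K b) x := by
  refine smoothNear_clm fun u => ?_
  exact (smoothSecNear_iff hx').1 (hK.apply (𝔛.field_near b hx) (smoothSecNear_constSec hx' u))

lemma trivAt_form {K : EndForm I V} (hx : x ∈ 𝔛.U) (hx' : x ∈ trivSet F V p)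
    (v : TangentSpace I x) (z : V x) :
    trivAt F p x (K x v z) =
      (∑ b, mvfderiv I (𝔛.coord b) x v • 𝔛.formComp F K b x) (trivAt F p x z) := by
  conv_lhs => rw [← 𝔛.expand x hx v, map_sum]
  simp only [sum_apply, map_sum, map_smul, smul_apply]
  refine Finset.sum_congr rfl fun b _ => congrArg _ ?_
  exact congrArg (fun z => trivAt F p x (K x (𝔛.X b x) z)) (symAt_trivAt hx' z).symm

lemma form_ext {K L : EndForm I V} (hx : x ∈ 𝔛.U) (hx' : x ∈ trivSet F V p)
    (h : ∀ b, 𝔛.formComp F K b x = 𝔛.formComp F L b x) : K x = L x := by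
  ext v z
  apply trivAt_injective hx'
  rw [𝔛.trivAt_form hx hx', 𝔛.trivAt_form hx hx']
  simp only [h]

lemma formComp_formOf (hx : x ∈ 𝔛.U) (hx' : x ∈ trivSet F V p) (t : κ → M → F →L[ℝ] F) (b : κ) :
    𝔛.formComp F (𝔛.formOf V t) b x = t b x := by
  ext f
  have h : 𝔛.formOf V t x (𝔛.X b x) = symAt F p x ∘L t b x ∘L trivAt F p x := by
    rw [formOf, sum_apply]
    have : ∀ c, (mvfderiv I (𝔛.coord c) x).smulRight
        (symAt F p x ∘L t c x ∘L trivAt F p x : V x →L[ℝ] V x) (𝔛.X b x) =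
        if c = b then (symAt F p x ∘L t c x ∘L trivAt F p x : V x →L[ℝ] V x) else 0 := fun c => by
      rw [ContinuousLinearMap.smulRight_apply, 𝔛.dual x hx]
      split_ifs <;> simp
    simp only [this, Finset.sum_ite_eq', Finset.mem_univ, if_true]
  have h2 : 𝔛.formComp F (𝔛.formOf V t) b x f =
      trivAt F p x (𝔛.formOf V t x (𝔛.X b x) (symAt F p x f)) := rfl
  rw [h2, h]
  change trivAt F p x (symAt F p x (t b x (trivAt F p x (symAt F p x f)))) = _
  rw [trivAt_symAt hx', trivAt_symAt hx']

lemma smoothFormNear_of_comp {K : EndForm I V} (hx : x ∈ 𝔛.U) (hx' : x ∈ trivSet F V p)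
    (hK : ∀ b, SmoothNear I (𝔛.formComp F K b) x) : SmoothFormNear F K x := by
  have hE : x ∈ trivSet (EuclideanSpace ℝ (Fin m)) (fun y : M => TangentSpace I y) x :=
    mem_trivSet x
  refine (smoothSecNear_hom_iff (V₁ := fun y : M => TangentSpace I y)
    (V₂ := fun y : M => V y →L[ℝ] V y) hE (mem_trivSet_hom (mem_trivSet x) (mem_trivSet x))).2
    fun u => ?_
  have hu : SmoothFieldNear (constSec x u : Π y : M, TangentSpace I y) x :=
    smoothSecNear_constSec (F := EuclideanSpace ℝ (Fin m)) hE u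
  refine (smoothSecNear_iff (F := F →L[ℝ] F) (mem_trivSet_hom hx' hx')).2 ?_
  have h : SmoothNear I (fun y => ∑ b, 𝔛.comp (constSec x u) b y • 𝔛.formComp F K b y) x :=
    SmoothNear.sum fun b _ => (𝔛.comp_near hx hu b).smul (hK b)
  refine h.congr ?_
  filter_upwards [𝔛.isOpen.mem_nhds hx, trivSet_mem_nhds hx'] with y hy hy'
  rw [locRep_hom hy' hy']
  ext f
  have := 𝔛.trivAt_form (K := K) hy hy' (constSec x u y) (symAt F p y f)
  rw [trivAt_symAt hy'] at this
  exact this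

lemma formOf_near {t : κ → M → F →L[ℝ] F} (hx : x ∈ 𝔛.U) (hx' : x ∈ trivSet F V p)
    (ht : ∀ b, SmoothNear I (t b) x) : SmoothFormNear F (𝔛.formOf V t) x := by
  refine 𝔛.smoothFormNear_of_comp hx hx' fun b => (ht b).congr ?_
  filter_upwards [𝔛.isOpen.mem_nhds hx, trivSet_mem_nhds hx'] with y hy hy'
  exact formComp_formOf hy hy' t b

end CoordFrame

/-! ### Adding a one-form to a connection -/

/-- The connection `A + K`. -/
def addForm (A : CovariantDerivative I F V) (K : EndForm I V) : CovariantDerivative I F V where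
  toFun s x := A s x + LinearMap.toContinuousLinearMap (E := EuclideanSpace ℝ (Fin m))
    { toFun := fun v => K x v (s x)
      map_add' := fun u v => by
        have : K x (u + v) = K x u + K x v := (K x).map_add u v
        rw [this]; rfl
      map_smul' := fun c v => by
        have : K x (c • v) = c • K x v := (K x).map_smul c v
        rw [this]; rfl }
  isCovariantDerivativeOnUniv :=
    { add := fun {s s' x} hs hs' hx => by
        rw [A.isCovariantDerivativeOnUniv.add hs hs' hx]
        ext v
        have : K x v (s x + s' x) = K x v (s x) + K x v (s' x) := map_add _ _ _
        change A s x v + A s' x v + K x v (s x + s' x) =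
          A s x v + K x v (s x) + (A s' x v + K x v (s' x))
        rw [this]
        abel
      leibniz := fun {s f x} hs hf hx => by
        rw [A.isCovariantDerivativeOnUniv.leibniz hs hf hx]
        ext v
        have : K x v (f x • s x) = f x • K x v (s x) := map_smul _ _ _
        change f x • A s x v + mvfderiv I f x v • s x + K x v (f x • s x) =
          f x • (A s x v + K x v (s x)) + mvfderiv I f x v • s x
        rw [this, smul_add]
        abel }

lemma addForm_apply (A : CovariantDerivative I F V) (K : EndForm I V) (s : Π x : M, V x) (x : M)
    (v : TangentSpace I x) : addForm A K s x v = A s x v + K x v (s x) := rfl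

lemma addForm_contMDiff [T2Space M] {A : CovariantDerivative I F V}
    (hA : A.ContMDiffCovariantDerivative ∞) {K : EndForm I V} (hK : ∀ x, SmoothFormNear F K x) :
    (addForm A K).ContMDiffCovariantDerivative ∞ := by
  refine ⟨⟨fun {s} hs x _ => ContMDiffAt.contMDiffWithinAt ?_⟩⟩
  have hs' : SmoothSecNear F I s x := .of_forall fun y =>
    ((hs y trivial).contMDiffAt univ_mem).of_le (by simp)
  have hE : x ∈ trivSet (EuclideanSpace ℝ (Fin m)) (fun y : M => TangentSpace I y) x :=
    mem_trivSet x
  refine Filter.Eventually.self_of_nhds ((smoothSecNear_hom_iff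
    (V₁ := fun y : M => TangentSpace I y) hE (mem_trivSet x)).2 fun u => ?_)
  have hu : SmoothFieldNear (constSec x u : Π y : M, TangentSpace I y) x :=
    smoothSecNear_constSec (F := EuclideanSpace ℝ (Fin m)) hE u
  filter_upwards [smoothSecNear_cov hA hs' hu, (hK x).apply hu hs'] with y h1 h2
  exact h1.add_section h2

lemma CoordFrame.connCoef_addForm [T2Space M] {𝔛 : CoordFrame I p κ} (A : CovariantDerivative I F V)
    (K : EndForm I V) {x : M} (hx' : x ∈ trivSet F V p) (b : κ) :
    𝔛.connCoef (addForm A K) b x = 𝔛.connCoef A b x + 𝔛.formComp F K b x := by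
  ext f
  have h1 := trivAt_cov (addForm A K) hx' (smoothSecNear_constSec (I := I) hx' f) (𝔛.X b x)
  have h2 := trivAt_cov A hx' (smoothSecNear_constSec (I := I) hx' f) (𝔛.X b x)
  rw [addForm_apply, map_add, h2, add_assoc] at h1
  have h3 := (add_left_cancel h1).symm
  rw [(locRep_constSec hx' f).self_of_nhds] at h3
  exact h3

end Forms

end YangMills

end

noncomputable section

set_option linter.unusedSectionVars false

namespace YangMills

/-! ### The current equation in a coordinate frame -/

section CurrentEquation

open Filter Topology Module

variable {m : ℕ} {H : Type*} [TopologicalSpace H]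
  {I : ModelWithCorners ℝ (EuclideanSpace ℝ (Fin m)) H}
  {M : Type*} [TopologicalSpace M] [ChartedSpace H M] [IsManifold I ∞ M]
  {F : Type*} [NormedAddCommGroup F] [NormedSpace ℝ F] [FiniteDimensional ℝ F]
  {V : M → Type*} [TopologicalSpace (TotalSpace F V)]
  [∀ x, AddCommGroup (V x)] [∀ x, Module ℝ (V x)] [∀ x, TopologicalSpace (V x)]
  [∀ x, IsTopologicalAddGroup (V x)] [∀ x, ContinuousSMul ℝ (V x)]
  [FiberBundle F V] [VectorBundle ℝ F V] [ContMDiffVectorBundle ∞ F V I] [T2Space M]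
  {A : CovariantDerivative I F V} {g : Π x : M, TangentSpace I x → TangentSpace I x → ℝ}
  {p : M} {κ : Type*} [Fintype κ] [DecidableEq κ] {𝔛 : CoordFrame I p κ} {x : M}

namespace CoordFrame

lemma sum_G_sum_P (hg : IsSmoothMetric g) (hx : x ∈ 𝔛.U) (J : κ → F →L[ℝ] F) (b : κ) :
    ∑ c, 𝔛.G g b c x • ∑ e, 𝔛.P g c e x • J e = J b := by
  have h3 : ∑ d, 𝔛.G g b d x • ∑ c, 𝔛.P g d c x • J c =
      ∑ c, (∑ d, 𝔛.G g b d x * 𝔛.P g d c x) • J c := by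
    simp only [Finset.smul_sum, Finset.sum_smul, smul_smul]
    exact Finset.sum_comm
  rw [h3]
  simp [sum_G_P hg hx]

lemma sum_P_sum_G (hg : IsSmoothMetric g) (hx : x ∈ 𝔛.U) (J : κ → F →L[ℝ] F) (b : κ) :
    ∑ c, 𝔛.P g b c x • ∑ e, 𝔛.G g c e x • J e = J b := by
  have h3 : ∑ d, 𝔛.P g b d x • ∑ c, 𝔛.G g d c x • J c =
      ∑ c, (∑ d, 𝔛.P g b d x * 𝔛.G g d c x) • J c := by
    simp only [Finset.smul_sum, Finset.sum_smul, smul_smul]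
    exact Finset.sum_comm
  rw [h3]
  simp [sum_P_G hg hx]

lemma current_eq_iff (hg : IsSmoothMetric g) (hA : A.ContMDiffCovariantDerivative ∞)
    (hx : x ∈ 𝔛.U) (hx' : x ∈ trivSet F V p) (r : M → ℝ) {q : ℕ} (hq : (m : ℝ) - 4 = q)
    (K : EndForm I V) (a : ℝ) :
    (∀ w z, current A g r x w z = a • K x w z) ↔
      ∀ b, 𝔛.curFun r q (𝔛.vol g) (𝔛.P g) (𝔛.connCoef A) b x =
        (a * 𝔛.vol g x) • ∑ c, 𝔛.P g b c x • 𝔛.formComp F K c x := by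
  have hv := (vol_pos (𝔛 := 𝔛) hg hx).ne'
  set N := fun d => 𝔛.curFun r q (𝔛.vol g) (𝔛.P g) (𝔛.connCoef A) d x with hN
  set J : κ → F →L[ℝ] F := fun b => (𝔛.vol g x)⁻¹ • ∑ d, 𝔛.G g b d x • N d with hJ
  have hNJ : ∀ b, N b = 𝔛.vol g x • ∑ c, 𝔛.P g b c x • J c := fun b => by
    have : ∀ c, 𝔛.P g b c x • J c =
        (𝔛.vol g x)⁻¹ • 𝔛.P g b c x • ∑ d, 𝔛.G g c d x • N d := fun c => smul_comm _ _ _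
    simp only [this]
    rw [← Finset.smul_sum, sum_P_sum_G hg hx, smul_inv_smul₀ hv]
  have h1 : (∀ w z, current A g r x w z = a • K x w z) ↔ ∀ c, J c = a • 𝔛.formComp F K c x := by
    constructor
    · intro h c
      ext f
      have h2 := trivAt_current hg hA hx hx' r hq (𝔛.X c x) (symAt F p x f)
      rw [h, map_smul, 𝔛.trivAt_form hx hx', trivAt_symAt hx'] at h2
      simp only [𝔛.dual x hx, ite_smul, one_smul, zero_smul, Finset.sum_ite_eq', Finset.mem_univ,
        if_true] at h2
      exact h2.symm
    · intro h w z
      apply trivAt_injective hx'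
      rw [trivAt_current hg hA hx hx' r hq w z, map_smul, 𝔛.trivAt_form hx hx']
      have : ∀ b, ((𝔛.vol g x)⁻¹ • ∑ d, 𝔛.G g b d x • N d) = a • 𝔛.formComp F K b x := h
      simp only [hN] at this
      simp only [this, smul_comm _ a, ← Finset.smul_sum]
      rfl
  rw [h1]
  change _ ↔ ∀ b, N b = _
  constructor
  · intro h b
    rw [hNJ]
    simp only [h, smul_comm _ a, ← Finset.smul_sum]
    rw [mul_smul, smul_comm]
  · intro h c
    rw [hJ]
    simp only [h, smul_comm _ (a * 𝔛.vol g x), ← Finset.smul_sum]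
    rw [sum_G_sum_P hg hx, smul_smul]
    congr 1
    field_simp

variable {g' : Π x : M, TangentSpace I x → TangentSpace I x → ℝ} {Ω : ℝ}

lemma GMat_conformal (h : ∀ u v, g' x u v = Ω ^ 2 * g x u v) :
    𝔛.GMat g' x = Ω ^ 2 • 𝔛.GMat g x := Matrix.ext fun _ _ => h _ _

lemma P_conformal (hg : IsSmoothMetric g) (hx : x ∈ 𝔛.U) (hΩ : 0 < Ω)
    (h : ∀ u v, g' x u v = Ω ^ 2 * g x u v) (a b : κ) :
    𝔛.P g' a b x = (Ω ^ 2)⁻¹ * 𝔛.P g a b x := by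
  have h2 : (𝔛.GMat g' x)⁻¹ = (Ω ^ 2)⁻¹ • (𝔛.GMat g x)⁻¹ := by
    refine Matrix.inv_eq_left_inv ?_
    rw [GMat_conformal h, Matrix.smul_mul, Matrix.mul_smul, smul_smul,
      inv_mul_cancel₀ (by positivity), one_smul,
      Matrix.nonsing_inv_mul _ (det_pos hg hx).ne'.isUnit]
  simp [P, h2]

lemma vol_conformal (hΩ : 0 < Ω) (h : ∀ u v, g' x u v = Ω ^ 2 * g x u v) :
    𝔛.vol g' x = Ω ^ Fintype.card κ * 𝔛.vol g x := by
  rw [vol, GMat_conformal h, Matrix.det_smul, ← pow_mul, mul_comm 2, pow_mul,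
    Real.sqrt_mul (by positivity), Real.sqrt_sq (by positivity), vol]

end CoordFrame

/-- Conformal covariance of the current. -/
lemma current_conformal {g' : Π x : M, TangentSpace I x → TangentSpace I x → ℝ}
    (hg : IsSmoothMetric g) (hg' : IsSmoothMetric g')
    (hA : A.ContMDiffCovariantDerivative ∞) (𝔛 : CoordFrame I p (Fin m)) {q : ℕ}
    (hq : (m : ℝ) - 4 = q) {r Ω : M → ℝ} (hr : SmoothNear I r p) (hΩ : SmoothNear I Ω p)
    (hpos : ∀ x, 0 < Ω x) (h : ∀ x u v, g' x u v = Ω x ^ 2 * g x u v) {K : EndForm I V} {a : ℝ}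
    (hK : ∀ w z, current A g r p w z = a • K p w z) (w : TangentSpace I p) (z : V p) :
    current A g' (fun x => Ω x * r x) p w z = ((Ω p)⁻¹ * a) • K p w z := by
  have hx := 𝔛.mem
  have hx' := mem_trivSet (F := F) (V := V) p
  refine (𝔛.current_eq_iff hg' hA hx hx' _ hq K _).2 (fun b => ?_) w z
  have hK' := (𝔛.current_eq_iff hg hA hx hx' _ hq K _).1 hK b
  have hqm : m = q + 4 := by
    have : (m : ℝ) = ((q + 4 : ℕ) : ℝ) := by push_cast; linarith
    exact_mod_cast this
  have hpow : ∀ y : ℝ, y ^ m = y ^ q * y ^ 4 := fun y => by rw [← pow_add, ← hqm]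
  have hc : ∀ x ∈ 𝔛.U, ∀ a b c e, 𝔛.vol g' x * 𝔛.P g' a c x * 𝔛.P g' b e x =
      Ω x ^ q * (𝔛.vol g x * 𝔛.P g a c x * 𝔛.P g b e x) := by
    intro x hx a b c e
    have := (hpos x).ne'
    rw [CoordFrame.P_conformal hg hx (hpos x) (h x), CoordFrame.P_conformal hg hx (hpos x) (h x),
      CoordFrame.vol_conformal (hpos x) (h x), Fintype.card_fin, hpow]
    field_simp
  have e := 𝔛.diffAlg (F →L[ℝ] F) |>.cur_conformal (toGerm r hr) (toGerm Ω hΩ)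
    (ρ := toGerm _ (CoordFrame.vol_near (𝔛 := 𝔛) hg hx))
    (P := fun a b => toGerm _ (CoordFrame.P_near (𝔛 := 𝔛) hg hx a b))
    (toGerm _ (CoordFrame.vol_near (𝔛 := 𝔛) hg' hx))
    (fun a b => toGerm _ (CoordFrame.P_near (𝔛 := 𝔛) hg' hx a b)) q
    (fun i => toGerm _ (CoordFrame.connCoef_near hA hx hx' i)) (fun a b c e => by
      refine ((((isRep_toGerm _ _).mul (isRep_toGerm _ _)).mul (isRep_toGerm _ _)).eq_iff
        (((isRep_toGerm _ _).pow q).mul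
        (((isRep_toGerm _ _).mul (isRep_toGerm _ _)).mul (isRep_toGerm _ _)))).2 ?_
      filter_upwards [𝔛.eventually_mem] with x hx using hc x hx a b c e) b
  have e2 := ((𝔛.isRep_cur ((isRep_toGerm _ _).mul (isRep_toGerm _ _)) q (isRep_toGerm _ _)
    (fun _ _ => isRep_toGerm _ _) (fun _ => isRep_toGerm _ _) b).eq_iff
    (((isRep_toGerm _ _).pow (q + 1)).smul (𝔛.isRep_cur (isRep_toGerm _ _) q (isRep_toGerm _ _)
    (fun _ _ => isRep_toGerm _ _) (fun _ => isRep_toGerm _ _) b))).1 e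
  refine e2.self_of_nhds.trans ?_
  simp only [CoordFrame.P_conformal hg hx (hpos p) (h p),
      CoordFrame.vol_conformal (𝔛 := 𝔛) (hpos p) (h p), Fintype.card_fin]
  rw [hK', smul_smul]
  simp only [mul_smul, ← Finset.smul_sum]
  simp only [smul_smul]
  congr 1
  have := (hpos p).ne'
  rw [hpow, pow_succ]
  field_simp

end CurrentEquation

end YangMills

end

noncomputable section

set_option linter.unusedSectionVars false

namespace YangMills

/-! ### Densities from a single scale -/

section Densities

open Filter Topology Module

variable {d : ℕ} [NeZero d] {M : Type*} [TopologicalSpace M] [ChartedSpace (EuclideanHalfSpace d) M]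
  [IsManifold (𝓡∂ d) ∞ M]

lemma Metric.isSmoothMetric (g : Metric d M) : IsSmoothMetric (m := d) (I := 𝓡∂ d) g.form where
  add_left x u u' v := by
    have : g.inner x (u + u') = g.inner x u + g.inner x u' := map_add _ _ _
    exact congrArg (fun L => L v) this
  smul_left x r u v := by
    have : g.inner x (r • u) = r • g.inner x u := map_smul _ _ _
    exact congrArg (fun L => L v) this
  symm x u v := g.symm x u v
  pos x u hu := g.pos x u hu
  smooth x X Y hX hY := by
    filter_upwards [hX, hY] with y hX hY
    have h : ContMDiffAt (𝓡∂ d) ((𝓡∂ d).prod 𝓘(ℝ)) ∞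
        (fun y => TotalSpace.mk' ℝ (E := Bundle.Trivial M ℝ) y (g.inner y (X y) (Y y))) y :=
      ContMDiffAt.clm_bundle_apply₂ (b := fun y => y) (F₁ := EuclideanSpace ℝ (Fin d))
        (F₂ := EuclideanSpace ℝ (Fin d)) (g.contMDiff y) hX hY
    simp only [contMDiffAt_totalSpace] at h
    exact h.2

lemma IsRescaling.unique {g g' g'' : Metric d M} {Ω Ω' Ω'' : M → ℝ} (h : IsRescaling Ω g g')
    (h' : IsRescaling Ω' g' g'') (h'' : IsRescaling Ω'' g g'') (x : M) :
    Ω'' x = Ω' x * Ω x := by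
  set u : TangentSpace (𝓡∂ d) x := coordVec (𝓡∂ d) x 0 with hu
  have hu0 : u ≠ 0 := by
    have : (EuclideanSpace.single (0 : Fin d) (1 : ℝ)) ≠ 0 := by simp
    exact this
  have hp := g.pos x u hu0
  have e : Ω'' x ^ 2 * g.inner x u u = (Ω' x * Ω x) ^ 2 * g.inner x u u := by
    rw [← h''.2.2, h'.2.2, h.2.2]; ring
  have e2 := mul_right_cancel₀ hp.ne' e
  exact (pow_left_inj₀ (h''.2.1 x).le (mul_pos (h'.2.1 x) (h.2.1 x)).le two_ne_zero).1 e2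

variable {F : Type*} [NormedAddCommGroup F] [NormedSpace ℝ F] [FiniteDimensional ℝ F]
  {V : M → Type*} [TopologicalSpace (TotalSpace F V)]
  [∀ x, AddCommGroup (V x)] [∀ x, Module ℝ (V x)] [∀ x, TopologicalSpace (V x)]
  [∀ x, IsTopologicalAddGroup (V x)] [∀ x, ContinuousSMul ℝ (V x)]
  [FiberBundle F V] [VectorBundle ℝ F V] [ContMDiffVectorBundle ∞ F V (𝓡∂ d)] [T2Space M]
  {A : CovariantDerivative (𝓡∂ d) F V} {c : ConformallyCompact d M}

lemma SmoothNear.of_contMDiff {W : Type*} [NormedAddCommGroup W] [NormedSpace ℝ W] {f : M → W}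
    (h : ContMDiff (𝓡∂ d) 𝓘(ℝ, W) ∞ f) (x : M) : SmoothNear (𝓡∂ d) f x := .of_forall h

lemma CurrentDensity.smoothFormNear {w : ℤ} (k : CurrentDensity F V c w) (g : c.metrics) (x : M) :
    SmoothFormNear F (k.toFun g) x := contMDiff_iff_smoothFormNear.2 (k.smooth g) x

/-- A solution of the current equation in one scale gives a density solving it in all scales. -/
lemma exists_currentEq {q : ℕ} (hq : (d : ℝ) - 4 = q) (hA : A.ContMDiffCovariantDerivative ∞)
    (g : c.metrics) {ℓ : ℕ} {w : ℤ} (hw : w = -1 - ℓ) {K : EndForm (𝓡∂ d) V}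
    (hK : ∀ x, SmoothFormNear F K x)
    (h : ∀ x v z, current A g.1.form (c.σ g) x v z = c.σ g x ^ ℓ • K x v z) :
    ∃ k : CurrentDensity F V c w, CurrentEq c A ℓ k := by
  choose Ω hΩ using fun g' : c.metrics => (c.conformal g.1 g.2 g'.1).1 g'.2
  refine ⟨⟨fun g' x => Ω g' x ^ w • K x, fun g' => ?_, fun g₁ g₂ Ω' h' x => ?_⟩, ?_⟩
  · refine contMDiff_iff_smoothFormNear.1 fun x => .of_forall fun y => ?_
    refine ContMDiffAt.smul_section ?_ (hK y).self_of_nhds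
    refine ((SmoothNear.of_contMDiff (hΩ g').1 y).comp_at (n := fun t : ℝ => t ^ w)
      ((isOpen_ne.eventually_mem ((hΩ g').2.1 y).ne').mono fun t ht => ?_)).self_of_nhds
    have e : (fun t : ℝ => t ^ w) = fun t => (t ^ (1 + ℓ))⁻¹ := funext fun t => by
      rw [hw, show -1 - (ℓ : ℤ) = -((1 + ℓ : ℕ) : ℤ) by push_cast; ring, zpow_neg, zpow_natCast]
    rw [e]
    exact (contDiffAt_id.pow _).inv (pow_ne_zero _ ht)
  · rw [smul_smul, (hΩ g₁).unique h' (hΩ g₂) x, mul_zpow]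
  · intro g' x v z
    have e : (c.σ g') = fun x => Ω g' x * c.σ g x := funext fun x => c.weight g g' _ (hΩ g') x
    rw [e]
    refine (current_conformal (p := x) g.1.isSmoothMetric g'.1.isSmoothMetric hA (chartFrame x) hq
      (.of_contMDiff (c.smooth g) x) (.of_contMDiff (hΩ g').1 x) (hΩ g').2.1 (hΩ g').2.2
      (h x) v z).trans ?_
    have hp := ((hΩ g').2.1 x).ne'
    have : ((Ω g' x ^ w • K x) v) z = Ω g' x ^ w • K x v z := rfl
    rw [this, smul_smul]
    congr 1
    rw [mul_pow, mul_right_comm, ← zpow_natCast (Ω g' x) ℓ, ← zpow_add₀ hp, hw]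
    congr 1
    rw [← zpow_neg_one]
    congr 1
    ring

end Densities

end YangMills

end

noncomputable section

set_option linter.unusedSectionVars false

namespace YangMills

/-! ### Defining functions of the boundary -/

section DefiningFunction

open Filter Topology Set

variable {d : ℕ} [NeZero d] {M : Type*} [TopologicalSpace M] [ChartedSpace (EuclideanHalfSpace d) M]
  [IsManifold (𝓡∂ d) ∞ M] {W : Type*} [NormedAddCommGroup W] [NormedSpace ℝ W] [CompleteSpace W]

/-- A smooth function vanishing exactly on the boundary, with non-vanishing derivative there. -/
structure IsDefining (σ : M → ℝ) : Prop where
  smooth : ContMDiff (𝓡∂ d) 𝓘(ℝ, ℝ) ∞ σ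
  zero_iff : ∀ x, σ x = 0 ↔ x ∈ (𝓡∂ d).boundary M
  deriv_ne_zero : ∀ x ∈ (𝓡∂ d).boundary M, mvfderiv (𝓡∂ d) σ x ≠ 0

/-- The coordinates of a map into a coordinate space determine whether its derivative is
invertible. -/
lemma isInvertible_mfderiv_pi {E : Type*} [NormedAddCommGroup E] [NormedSpace ℝ E]
    [FiniteDimensional ℝ E] {H : Type*} [TopologicalSpace H] {I : ModelWithCorners ℝ E H}
    {N : Type*} [TopologicalSpace N] [ChartedSpace H N] [IsManifold I ∞ N] {κ : Type*} [Fintype κ]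
    {Φ : N → κ → ℝ} {x : N} (hΦ : ContMDiffAt I 𝓘(ℝ, κ → ℝ) ∞ Φ x)
    (hdim : Module.finrank ℝ E = Fintype.card κ)
    (h : ∀ u : TangentSpace I x, (∀ i, mvfderiv I (fun x => Φ x i) x u = 0) → u = 0) :
    (mfderiv I 𝓘(ℝ, κ → ℝ) Φ x).IsInvertible := by
  set L : E →L[ℝ] (κ → ℝ) := mfderiv I 𝓘(ℝ, κ → ℝ) Φ x with hL
  have e : ∀ (u : TangentSpace I x) i, mvfderiv I (fun x => Φ x i) x u = L u i :=
    fun u i => fieldDeriv_clm (X := extendAny u)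
      (ContinuousLinearMap.proj (R := ℝ) (φ := fun _ : κ => ℝ) i)
      (hΦ.mdifferentiableAt (by simp))
  have hinj : Function.Injective (L : E →ₗ[ℝ] (κ → ℝ)) := by
    refine (injective_iff_map_eq_zero (L : E →ₗ[ℝ] (κ → ℝ))).2 fun u hu => ?_
    refine h u fun i => (e u i).trans ?_
    exact congrFun hu i
  exact ⟨((L : E →ₗ[ℝ] (κ → ℝ)).linearEquivOfInjective hinj
    (by rw [hdim, Module.finrank_fintype_fun_eq_card])).toContinuousLinearEquiv, rfl⟩

lemma ConformallyCompact.isDefining (c : ConformallyCompact d M) (g : c.metrics) :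
    IsDefining (d := d) (c.σ g) := ⟨c.smooth g, c.zero_iff g, c.deriv_ne_zero g⟩

namespace IsDefining

variable {σ : M → ℝ} (hσ : IsDefining (d := d) σ) {p : M}
include hσ

lemma near (p : M) : SmoothNear (𝓡∂ d) σ p := .of_forall hσ.smooth

lemma exists_eq_bdef_mul (hp : p ∈ (𝓡∂ d).boundary M) : ∃ Ω : M → ℝ, SmoothNear (𝓡∂ d) Ω p ∧
    Ω p ≠ 0 ∧ ∀ᶠ x in 𝓝 p, σ x = bdef d p x * Ω x := by
  obtain ⟨Ω, hΩ, h⟩ := exists_eq_bdef_smul hp (hσ.near p)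
    (.of_forall fun x hx => (hσ.zero_iff x).2 hx)
  refine ⟨Ω, hΩ, fun h0 => hσ.deriv_ne_zero p hp ?_, h⟩
  have hb : bdef d p p = 0 := (mem_boundary_iff (mem_chart_source _ p)).1 hp
  ext v
  have h1 : fieldDeriv (extendAny v) σ p = fieldDeriv (extendAny v) (bdef d p * Ω) p :=
    (fieldDeriv_congr h).self_of_nhds
  rw [fieldDeriv_mul (smoothNear_bdef p).mdiff hΩ.mdiff, h0, hb] at h1
  rw [zero_mul, mul_zero, add_zero] at h1
  exact h1

/-- A function vanishing on the boundary is a multiple of the defining function. -/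
lemma exists_eq_smul (hp : p ∈ (𝓡∂ d).boundary M) {f : M → W} (hf : SmoothNear (𝓡∂ d) f p)
    (h0 : ∀ᶠ x in 𝓝 p, x ∈ (𝓡∂ d).boundary M → f x = 0) :
    ∃ h : M → W, SmoothNear (𝓡∂ d) h p ∧ ∀ᶠ x in 𝓝 p, f x = σ x • h x := by
  obtain ⟨Ω, hΩ, hΩ0, hσΩ⟩ := hσ.exists_eq_bdef_mul hp
  obtain ⟨h, hh, hfh⟩ := exists_eq_bdef_smul hp hf h0
  refine ⟨fun x => (Ω x)⁻¹ • h x, (hΩ.inv hΩ0).smul hh, ?_⟩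
  filter_upwards [hσΩ, hfh, hΩ.contMDiffAt.continuousAt.eventually_ne hΩ0] with x h1 h2 h3
  rw [h1, h2, smul_smul, mul_assoc, mul_inv_cancel₀ h3, mul_one]

/-- A coordinate frame whose transverse coordinate is the defining function. -/
lemma exists_frame (hp : p ∈ (𝓡∂ d).boundary M) :
    ∃ 𝔛 : CoordFrame (𝓡∂ d) p (Fin d), 𝔛.coord 0 = σ := by
  set 𝔠 := chartFrame (d := d) p with h𝔠
  obtain ⟨Ω, hΩ, hΩ0, hσΩ⟩ := hσ.exists_eq_bdef_mul hp
  have hb : bdef d p p = 0 := (mem_boundary_iff (mem_chart_source _ p)).1 hp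
  have hD : 𝔠.D 0 σ p ≠ 0 := by
    have h1 : 𝔠.D 0 σ p = 𝔠.D 0 (bdef d p * Ω) p := (fieldDeriv_congr hσΩ).self_of_nhds
    have h2 : 𝔠.D 0 (bdef d p) p = 1 := (𝔠.dual p 𝔠.mem 0 0).trans (if_pos rfl)
    have h3 : 𝔠.D 0 (bdef d p * Ω) p = _ := fieldDeriv_mul (smoothNear_bdef p).mdiff hΩ.mdiff
    have h4 : fieldDeriv (𝔠.X 0) (bdef d p) p = 1 := h2
    rw [h1, h3, hb, h4, zero_mul, add_zero, one_mul]
    exact hΩ0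
  have hDc : ∀ x ∈ 𝔠.U, ContinuousAt (𝔠.D 0 σ) x := fun x hx =>
    ((hσ.near x).fieldDeriv (𝔠.field_near 0 hx)).contMDiffAt.continuousAt
  have hopen : IsOpen (𝔠.U ∩ {x | 𝔠.D 0 σ x ≠ 0}) := by
    refine isOpen_iff_mem_nhds.2 fun x hx => ?_
    filter_upwards [𝔠.isOpen.mem_nhds hx.1, (hDc x hx.1).eventually_ne hx.2] with y h1 h2
    exact ⟨h1, h2⟩
  set Φ : M → Fin d → ℝ := fun x i => if i = 0 then σ x else 𝔠.coord i x with hΦ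
  have hΦs : ∀ x ∈ 𝔠.U, ContMDiffAt (𝓡∂ d) 𝓘(ℝ, Fin d → ℝ) ∞ Φ x := fun x hx => by
    refine contMDiffAt_pi_space.2 fun i => ?_
    by_cases hi : i = 0
    · simpa only [hΦ, hi, if_true] using hσ.smooth x
    · simpa only [hΦ, hi, if_false] using 𝔠.coord_smooth i x hx
  refine ⟨.ofMap (𝔠.U ∩ {x | 𝔠.D 0 σ x ≠ 0}) hopen ⟨𝔠.mem, hD⟩ Φ (fun x hx => hΦs x hx.1)
    fun x hx => ?_, show (fun x => Φ x 0) = σ by simp [hΦ]⟩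
  refine isInvertible_mfderiv_pi (hΦs x hx.1) (by simp) fun u hu => ?_
  have h2 : ∀ i, i ≠ 0 → mvfderiv (𝓡∂ d) (𝔠.coord i) x u = 0 := fun i hi => by
    have := hu i
    simp only [hΦ, hi, if_false] at this
    exact this
  have h3 : mvfderiv (𝓡∂ d) σ x u = 0 := by simpa only [hΦ, if_true] using hu 0
  have h4 : mvfderiv (𝓡∂ d) (𝔠.coord 0) x u • 𝔠.X 0 x = u := by
    have := 𝔠.expand x hx.1 u
    rwa [Finset.sum_eq_single 0 (fun i _ hi => by rw [h2 i hi, zero_smul]) (by simp)] at this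
  have h5 : mvfderiv (𝓡∂ d) (𝔠.coord 0) x u * 𝔠.D 0 σ x = 0 := by
    rw [← h3]
    nth_rewrite 2 [← h4]
    rw [map_smul]
    rfl
  have h6 := (mul_eq_zero.1 h5).resolve_right hx.2
  rw [h6] at h4
  exact h4.symm.trans (zero_smul ℝ _)

end IsDefining

end DefiningFunction

/-! ### The boundary as a manifold -/

section BoundaryManifold

open Filter Topology Set

variable {d : ℕ} [NeZero d]
  {M : Type*} [TopologicalSpace M] [ChartedSpace (EuclideanHalfSpace d) M]
  [IsManifold (𝓡∂ d) ∞ M]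
  {S : Type*} [TopologicalSpace S] [ChartedSpace (EuclideanSpace ℝ (Fin (d - 1))) S]
  [IsManifold (𝓡 (d - 1)) ∞ S] {ι : C^∞⟮𝓡 (d - 1), S; 𝓡∂ d, M⟯} (hι : IsBoundaryInclusion ι)
include hι

lemma IsBoundaryInclusion.t2Space [T2Space M] : T2Space S := hι.1.isEmbedding.t2Space

lemma IsBoundaryInclusion.mem (y : S) : ι y ∈ (𝓡∂ d).boundary M := hι.2 ▸ mem_range_self y

/-- A smooth local retraction onto the boundary. -/
lemma IsBoundaryInclusion.exists_retraction (y : S) : ∃ r : M → S,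
    (∀ᶠ x in 𝓝 (ι y), ContMDiffAt (𝓡∂ d) (𝓡 (d - 1)) ∞ r x) ∧ ∀ᶠ y' in 𝓝 y, r (ι y') = y' := by
  have h := hι.1.isImmersion.isImmersionAt y
  set e := h.domChart.extend (𝓡 (d - 1)) with he
  set e' := h.codChart.extend (𝓡∂ d) with he'
  have hmem : y ∈ h.domChart.source := h.mem_domChart_source
  have hmem' : ι y ∈ h.codChart.source := h.mem_codChart_source
  have key : ∀ y' ∈ h.domChart.source, (h.equiv.symm (e' (ι y'))).1 = e y' := fun y' hy' => by
    have h1 : y' ∈ e.source := by rwa [he, h.domChart.extend_source]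
    have h2 := h.writtenInCharts (e.map_source h1)
    simp only [Function.comp] at h2
    rw [← he, ← he', e.left_inv h1] at h2
    rw [h2, ContinuousLinearEquiv.symm_apply_apply]
  have htar : (𝓡 (d - 1)) '' h.domChart.target ∈ 𝓝 (e y) := by
    have : IsOpen ((𝓡 (d - 1)) '' h.domChart.target) := by
      simpa using h.domChart.open_target
    exact this.mem_nhds ⟨_, h.domChart.map_source hmem, rfl⟩
  have hsm : ∀ x ∈ h.codChart.source, ContMDiffAt (𝓡∂ d) (𝓡 (d - 1)) ∞
      (fun x => (h.equiv.symm (e' x)).1) x := fun x hx =>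
    (contDiff_fst.comp h.equiv.symm.contDiff).contMDiff.contMDiffAt.comp x
      (h.codChart.contMDiffAt_extend h.codChart_mem_maximalAtlas hx)
  refine ⟨fun x => e.symm (h.equiv.symm (e' x)).1, ?_, ?_⟩
  · have hc := (hsm _ hmem').continuousAt
    have h3 : (𝓡 (d - 1)) '' h.domChart.target ∈ 𝓝 ((h.equiv.symm (e' (ι y))).1) := by
      rw [key y hmem]; exact htar
    filter_upwards [h.codChart.open_source.mem_nhds hmem', hc (eventually_mem_nhds_iff.2 h3)]
      with x hx hx'
    exact ((contMDiffOn_extend_symm h.domChart_mem_maximalAtlas).contMDiffAt hx').comp x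
      (hsm x hx)
  · filter_upwards [h.domChart.open_source.mem_nhds hmem] with y' hy'
    rw [key y' hy']
    exact e.left_inv (by rwa [he, h.domChart.extend_source])

lemma IsBoundaryInclusion.pushVec_injective (y : S) {v : TangentSpace (𝓡 (d - 1)) y}
    (hv : pushVec ι v = 0) : v = 0 := by
  obtain ⟨r, hr, hri⟩ := hι.exists_retraction y
  have h1 : MDifferentiableAt (𝓡∂ d) (𝓡 (d - 1)) r (ι y) :=
    hr.self_of_nhds.mdifferentiableAt (by simp)
  have h2 : MDifferentiableAt (𝓡 (d - 1)) (𝓡∂ d) ι y := (ι.contMDiff y).mdifferentiableAt (by simp)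
  have h3 := mfderiv_comp y h1 h2
  have h4 : mfderiv (𝓡 (d - 1)) (𝓡 (d - 1)) (r ∘ ι) y = mfderiv (𝓡 (d - 1)) (𝓡 (d - 1)) id y :=
    Filter.EventuallyEq.mfderiv_eq hri
  have h5 := congrArg (fun L => L v) (h4.symm.trans h3)
  have h6 : (mfderiv (𝓡∂ d) (𝓡 (d - 1)) r (ι y)) (pushVec ι v) = 0 := by rw [hv, map_zero]
  have h7 : (mfderiv (𝓡 (d - 1)) (𝓡 (d - 1)) id y) v = v := congrArg (fun L => L v) mfderiv_id
  exact h7.symm.trans (h5.trans h6)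

omit hι in
/-- The derivative of the restriction of a function to the boundary. -/
lemma mvfderiv_comp_inclusion {W : Type*} [NormedAddCommGroup W] [NormedSpace ℝ W] {f : M → W}
    {y : S} (hf : MDifferentiableAt (𝓡∂ d) 𝓘(ℝ, W) f (ι y)) (v : TangentSpace (𝓡 (d - 1)) y) :
    mvfderiv (𝓡 (d - 1)) (fun y' => f (ι y')) y v = mvfderiv (𝓡∂ d) f (ι y) (pushVec ι v) := by
  have h2 : MDifferentiableAt (𝓡 (d - 1)) (𝓡∂ d) ι y := (ι.contMDiff y).mdifferentiableAt (by simp)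
  exact congrArg (fun L => L v) (mfderiv_comp y hf h2)

omit hι in
lemma SmoothNear.comp_inclusion {W : Type*} [NormedAddCommGroup W] [NormedSpace ℝ W] {f : M → W}
    {y : S} (hf : SmoothNear (𝓡∂ d) f (ι y)) :
    SmoothNear (𝓡 (d - 1)) (fun y' => f (ι y')) y := by
  filter_upwards [(ι.contMDiff y).continuousAt.eventually hf] with y' hy'
  exact hy'.comp y' (ι.contMDiff y')

/-- The frame on the boundary induced by a frame adapted to a defining function. -/
lemma IsBoundaryInclusion.exists_frame {σ : M → ℝ} (hσ : IsDefining (d := d) σ) {y : S}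
    (𝔛 : CoordFrame (𝓡∂ d) (ι y) (Fin d)) (h0 : 𝔛.coord 0 = σ) :
    ∃ 𝔶 : CoordFrame (𝓡 (d - 1)) y (Fin (d - 1)),
      (∀ i, 𝔶.coord i = fun y' => 𝔛.coord (tail i) (ι y')) ∧
      (∀ y' ∈ 𝔶.U, ι y' ∈ 𝔛.U) ∧
      ∀ y' ∈ 𝔶.U, ∀ i, pushVec ι (𝔶.X i y') = 𝔛.X (tail i) (ι y') := by
  have hc : ∀ y', ι y' ∈ 𝔛.U → ∀ i (u : TangentSpace (𝓡 (d - 1)) y'),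
      mvfderiv (𝓡 (d - 1)) (fun y' => 𝔛.coord i (ι y')) y' u =
        mvfderiv (𝓡∂ d) (𝔛.coord i) (ι y') (pushVec ι u) := fun y' hy' i u =>
    mvfderiv_comp_inclusion ((𝔛.coord_smooth i _ hy').mdifferentiableAt (by simp)) u
  have hc0 : ∀ y', ι y' ∈ 𝔛.U → ∀ u : TangentSpace (𝓡 (d - 1)) y',
      mvfderiv (𝓡∂ d) (𝔛.coord 0) (ι y') (pushVec ι u) = 0 := fun y' hy' u => by
    rw [← hc y' hy', h0, show (fun y' => σ (ι y')) = fun _ => 0 from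
      funext fun y' => (hσ.zero_iff _).2 (hι.mem y')]
    simp [mvfderiv_const]
  let 𝔶 : CoordFrame (𝓡 (d - 1)) y (Fin (d - 1)) :=
    .ofMap (ι ⁻¹' 𝔛.U) (𝔛.isOpen.preimage ι.contMDiff.continuous) 𝔛.mem
      (fun y' i => 𝔛.coord (tail i) (ι y'))
      (fun y' hy' => contMDiffAt_pi_space.2 fun i =>
        (𝔛.coord_smooth (tail i) _ hy').comp y' (ι.contMDiff y'))
      (fun y' hy' => isInvertible_mfderiv_pi (contMDiffAt_pi_space.2 fun i =>
        (𝔛.coord_smooth (tail i) _ hy').comp y' (ι.contMDiff y')) (by simp) fun u hu => by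
          apply hι.pushVec_injective y'
          rw [← 𝔛.expand _ hy' (pushVec ι u), sum_eq_zero_add_tail, hc0 y' hy', zero_smul, zero_add]
          refine Finset.sum_eq_zero fun i _ => ?_
          rw [← hc y' hy', hu i, zero_smul])
  refine ⟨𝔶, fun i => rfl, fun y' hy' => hy', fun y' hy' i => ?_⟩
  have hy : ι y' ∈ 𝔛.U := hy'
  rw [← 𝔛.expand _ hy (pushVec ι (𝔶.X i y')), sum_eq_zero_add_tail, hc0 y' hy, zero_smul, zero_add]
  have : ∀ j, mvfderiv (𝓡∂ d) (𝔛.coord (tail j)) (ι y') (pushVec ι (𝔶.X i y')) =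
      if j = i then 1 else 0 := fun j => by
    rw [← hc y' hy]
    exact 𝔶.dual y' hy' j i
  simp only [this, ite_smul, one_smul, zero_smul, Finset.sum_ite_eq', Finset.mem_univ, if_true]

end BoundaryManifold

end YangMills

end

noncomputable section

set_option linter.unusedSectionVars false

namespace YangMills

/-! ### Global sections and boundary connections -/

section GlobalSections

open Filter Topology Module

variable {E : Type*} [NormedAddCommGroup E] [NormedSpace ℝ E] [FiniteDimensional ℝ E]
  {H : Type*} [TopologicalSpace H] {I : ModelWithCorners ℝ E H}
  {M : Type*} [TopologicalSpace M] [ChartedSpace H M] [IsManifold I ∞ M]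
  {F : Type*} [NormedAddCommGroup F] [NormedSpace ℝ F] [FiniteDimensional ℝ F]
  {V : M → Type*} [TopologicalSpace (TotalSpace F V)]
  [∀ x, AddCommGroup (V x)] [∀ x, Module ℝ (V x)] [∀ x, TopologicalSpace (V x)]
  [∀ x, IsTopologicalAddGroup (V x)] [∀ x, ContinuousSMul ℝ (V x)]
  [FiberBundle F V] [VectorBundle ℝ F V] [ContMDiffVectorBundle ∞ F V I] [T2Space M] {p : M}

/-- A local section that is constant in a trivialization extends, near a point, to a smooth global
section. -/
lemma exists_section_eq_constSec {x : M} (hx : x ∈ trivSet F V p) (f : F) :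
    ∃ s : Π x : M, V x, ContMDiff I (I.prod 𝓘(ℝ, F)) ∞ (fun x => TotalSpace.mk' F x (s x)) ∧
      ∀ᶠ y in 𝓝 x, s y = constSec p f y := by
  obtain ⟨b, -, hb⟩ := (SmoothBumpFunction.nhds_basis_tsupport (I := I) x).mem_iff.1
    (trivSet_mem_nhds hx)
  refine ⟨(b : M → ℝ) • constSec p f, ContMDiffOn.smul_section_of_tsupport b.contMDiff.contMDiffOn
    (trivializationAt F V p).open_baseSet hb
    fun y hy => (smoothSecNear_constSec hy f).self_of_nhds.contMDiffWithinAt, ?_⟩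
  filter_upwards [b.eventuallyEq_one] with y hy
  simp [hy]

lemma cov_constSec_congr (A : CovariantDerivative I F V) {x : M} (hx : x ∈ trivSet F V p) {f : F}
    {s : Π x : M, V x}
    (hs : ContMDiff I (I.prod 𝓘(ℝ, F)) ∞ (fun x => TotalSpace.mk' F x (s x)))
    (h : ∀ᶠ y in 𝓝 x, s y = constSec p f y) : A (constSec p f) x = A s x :=
  (A.isCovariantDerivativeOnUniv.congr_of_eventuallyEq ((hs x).mdifferentiableAt (by simp))
    (smoothSecNear_constSec hx f).mdiff univ_mem h).symm

end GlobalSections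

section BoundaryConnection

open Filter Topology Module

variable {d : ℕ} [NeZero d]
  {M : Type*} [TopologicalSpace M] [ChartedSpace (EuclideanHalfSpace d) M]
  [IsManifold (𝓡∂ d) ∞ M] [T2Space M]
  {S : Type*} [TopologicalSpace S] [ChartedSpace (EuclideanSpace ℝ (Fin (d - 1))) S]
  [IsManifold (𝓡 (d - 1)) ∞ S] [T2Space S] {ι : C^∞⟮𝓡 (d - 1), S; 𝓡∂ d, M⟯}
  {F : Type*} [NormedAddCommGroup F] [NormedSpace ℝ F] [FiniteDimensional ℝ F]
  {V : M → Type*} [TopologicalSpace (TotalSpace F V)]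
  [∀ x, AddCommGroup (V x)] [∀ x, Module ℝ (V x)] [∀ x, TopologicalSpace (V x)]
  [∀ x, IsTopologicalAddGroup (V x)] [∀ x, ContinuousSMul ℝ (V x)]
  [FiberBundle F V] [VectorBundle ℝ F V] [ContMDiffVectorBundle ∞ F V (𝓡∂ d)]

instance contMDiffVectorBundle_pullback :
    ContMDiffVectorBundle ∞ F (ι *ᵖ V) (𝓡 (d - 1)) := inferInstance

lemma mem_trivSet_pullback {y y' : S} (h : ι y' ∈ trivSet F V (ι y)) :
    y' ∈ trivSet F (ι *ᵖ V) y := h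

lemma symAt_pullback {y y' : S} (h : ι y' ∈ trivSet F V (ι y)) (f : F) :
    (symAt F y y' f : (ι *ᵖ V) y') = (symAt F (ι y) (ι y') f : V (ι y')) :=
  trivAt_injective (V := ι *ᵖ V) (mem_trivSet_pullback h)
    ((trivAt_symAt (V := ι *ᵖ V) (mem_trivSet_pullback h) f).trans (trivAt_symAt h f).symm)

lemma smoothSecNear_pullback {s : Π x : M, V x} {y : S} (hs : SmoothSecNear F (𝓡∂ d) s (ι y)) :
    SmoothSecNear F (𝓡 (d - 1)) (V := ι *ᵖ V) (fun y' => s (ι y')) y :=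
  (smoothSecNear_iff (V := ι *ᵖ V) (mem_trivSet y)).2
    (SmoothNear.comp_inclusion ((smoothSecNear_iff (mem_trivSet (ι y))).1 hs))

/-- The connection form of the boundary condition of a connection. -/
lemma connForm_boundary {A : CovariantDerivative (𝓡∂ d) F V}
    {Abar : CovariantDerivative (𝓡 (d - 1)) F (ι *ᵖ V)} (h : HasBoundaryCondition ι A Abar)
    {y y' : S} (hy : ι y' ∈ trivSet F V (ι y)) (v : TangentSpace (𝓡 (d - 1)) y') :
    connForm Abar y y' v = connForm A (ι y) (ι y') (pushVec ι v) := by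
  ext f
  rw [connForm_apply, connForm_apply]
  refine Finset.sum_congr rfl fun k _ => congrArg _ ?_
  obtain ⟨s, hs, hs'⟩ := exists_section_eq_constSec (I := 𝓡∂ d) hy (finBasis ℝ F k)
  have h1 := cov_constSec_congr A hy hs hs'
  have hsb := smoothSecNear_pullback (ι := ι) (y := y') (s := s) (.of_forall hs)
  have h2 : Abar (constSec y (finBasis ℝ F k)) y' = Abar (fun y => s (ι y)) y' := by
    refine (Abar.isCovariantDerivativeOnUniv.congr_of_eventuallyEq hsb.mdiff
      (smoothSecNear_constSec (mem_trivSet_pullback hy) _).mdiff univ_mem ?_).symm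
    filter_upwards [(ι.contMDiff y').continuousAt.eventually hs',
      trivSet_mem_nhds (mem_trivSet_pullback hy)] with z hz hz'
    exact hz.trans (symAt_pullback hz' _).symm
  rw [h1, h2]
  exact congrArg _ (h s hs y' v)

/-- The coefficients of the boundary condition of a connection. -/
lemma connCoef_boundary {A : CovariantDerivative (𝓡∂ d) F V}
    {Abar : CovariantDerivative (𝓡 (d - 1)) F (ι *ᵖ V)} (h : HasBoundaryCondition ι A Abar)
    {y y' : S} (hy : ι y' ∈ trivSet F V (ι y)) {𝔛 : CoordFrame (𝓡∂ d) (ι y) (Fin d)}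
    {𝔶 : CoordFrame (𝓡 (d - 1)) y (Fin (d - 1))} {i : Fin (d - 1)}
    (hX : pushVec ι (𝔶.X i y') = 𝔛.X (tail i) (ι y')) :
    𝔶.connCoef Abar i y' = 𝔛.connCoef A (tail i) (ι y') :=
  (connForm_boundary h hy _).trans (by rw [hX]; rfl)

end BoundaryConnection

end YangMills

end

noncomputable section

set_option linter.unusedSectionVars false

namespace YangMills

/-! ### The current equation for germs -/

section CurrentGerms

open Filter Topology Module DiffAlg

variable {m : ℕ} {H : Type*} [TopologicalSpace H]
  {I : ModelWithCorners ℝ (EuclideanSpace ℝ (Fin m)) H}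
  {M : Type*} [TopologicalSpace M] [ChartedSpace H M] [IsManifold I ∞ M]
  {F : Type*} [NormedAddCommGroup F] [NormedSpace ℝ F] [FiniteDimensional ℝ F]
  {V : M → Type*} [TopologicalSpace (TotalSpace F V)]
  [∀ x, AddCommGroup (V x)] [∀ x, Module ℝ (V x)] [∀ x, TopologicalSpace (V x)]
  [∀ x, IsTopologicalAddGroup (V x)] [∀ x, ContinuousSMul ℝ (V x)]
  [FiberBundle F V] [VectorBundle ℝ F V] [ContMDiffVectorBundle ∞ F V I] [T2Space M]
  {A : CovariantDerivative I F V} {g : Π x : M, TangentSpace I x → TangentSpace I x → ℝ}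
  {p : M} {κ : Type*} [Fintype κ] [DecidableEq κ] (𝔛 : CoordFrame I p κ)

namespace CoordFrame

/-- The germs of the components of the metric. -/
def GGerm (hg : IsSmoothMetric g) (a b : κ) : smoothGerms I p ℝ :=
  toGerm _ (G_near (𝔛 := 𝔛) hg 𝔛.mem a b)

/-- The germs of the components of the inverse metric. -/
def PGerm (hg : IsSmoothMetric g) (a b : κ) : smoothGerms I p ℝ :=
  toGerm _ (P_near (𝔛 := 𝔛) hg 𝔛.mem a b)

/-- The germ of the volume density. -/
def volGerm (hg : IsSmoothMetric g) : smoothGerms I p ℝ := toGerm _ (vol_near (𝔛 := 𝔛) hg 𝔛.mem)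

/-- The germs of the coefficients of a connection. -/
def connGerm (hA : A.ContMDiffCovariantDerivative ∞) (i : κ) : smoothGerms I p (F →L[ℝ] F) :=
  toGerm _ (connCoef_near (𝔛 := 𝔛) hA 𝔛.mem (mem_trivSet p) i)

/-- The germs of the components of a one-form. -/
def formGerm {K : EndForm I V} (hK : SmoothFormNear F K p) (i : κ) : smoothGerms I p (F →L[ℝ] F) :=
  toGerm _ (formComp_near (𝔛 := 𝔛) 𝔛.mem (mem_trivSet p) hK i)

/-- The germs of the components of the current. -/
def curGerm (hg : IsSmoothMetric g) (hA : A.ContMDiffCovariantDerivative ∞) {r : M → ℝ}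
    (hr : SmoothNear I r p) (q : ℕ) (b : κ) : smoothGerms I p (F →L[ℝ] F) :=
  (𝔛.diffAlg (F →L[ℝ] F)).cur (toGerm r hr) q (𝔛.volGerm hg) (𝔛.PGerm hg) (𝔛.connGerm hA) b

variable {𝔛}

lemma PGerm_symm (hg : IsSmoothMetric g) (a b : κ) : 𝔛.PGerm hg a b = 𝔛.PGerm hg b a :=
  (isRep_toGerm _ _).eq_of (isRep_toGerm _ _) (by rw [P_symm hg])

lemma isUnit_volGerm (hg : IsSmoothMetric g) : IsUnit (𝔛.volGerm hg) :=
  isUnit_germ_real (isRep_toGerm _ _) (vol_pos hg 𝔛.mem).ne'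

lemma sum_GGerm_PGerm (hg : IsSmoothMetric g) (e c : κ) :
    ∑ b, 𝔛.GGerm hg e b * 𝔛.PGerm hg b c = if e = c then 1 else 0 := by
  refine (IsRep.sum (fun b _ => (isRep_toGerm _ _).mul (isRep_toGerm _ _))).eq_of
    (g := fun _ => if e = c then 1 else 0) ?_ ?_
  · split_ifs
    · exact IsRep.one
    · exact IsRep.zero
  · filter_upwards [𝔛.eventually_mem] with x hx using sum_G_P hg hx e c

lemma sum_PGerm_GGerm (hg : IsSmoothMetric g) (e c : κ) :
    ∑ b, 𝔛.PGerm hg e b * 𝔛.GGerm hg b c = if e = c then 1 else 0 := by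
  refine (IsRep.sum (fun b _ => (isRep_toGerm _ _).mul (isRep_toGerm _ _))).eq_of
    (g := fun _ => if e = c then 1 else 0) ?_ ?_
  · split_ifs
    · exact IsRep.one
    · exact IsRep.zero
  · filter_upwards [𝔛.eventually_mem] with x hx using sum_P_G hg hx e c

lemma isRep_raise {P : κ → κ → smoothGerms I p ℝ} {Pf : κ → κ → M → ℝ}
    {k : κ → smoothGerms I p (F →L[ℝ] F)} {kf : κ → M → F →L[ℝ] F}
    (hP : ∀ a b, IsRep (P a b) (Pf a b)) (hk : ∀ b, IsRep (k b) (kf b)) (b : κ) :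
    IsRep (raise P k b) (fun x => ∑ c, Pf b c x • kf c x) :=
  IsRep.sum fun c _ => (hP b c).smul (hk c)

/-- The current equation as an identity of germs. -/
lemma current_germ_iff (hg : IsSmoothMetric g) (hA : A.ContMDiffCovariantDerivative ∞) {r : M → ℝ}
    (hr : SmoothNear I r p) {q : ℕ} (hq : (m : ℝ) - 4 = q) {K : EndForm I V}
    (hK : SmoothFormNear F K p) (ℓ : ℕ) :
    (∀ᶠ x in 𝓝 p, ∀ w z, current A g r x w z = r x ^ ℓ • K x w z) ↔
      ∀ b, 𝔛.curGerm hg hA hr q b =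
        toGerm r hr ^ ℓ • 𝔛.volGerm hg • raise (𝔛.PGerm hg) (𝔛.formGerm hK) b := by
  have h : ∀ b, 𝔛.curGerm hg hA hr q b =
      toGerm r hr ^ ℓ • 𝔛.volGerm hg • raise (𝔛.PGerm hg) (𝔛.formGerm hK) b ↔
      ∀ᶠ x in 𝓝 p, 𝔛.curFun r q (𝔛.vol g) (𝔛.P g) (𝔛.connCoef A) b x =
        r x ^ ℓ • 𝔛.vol g x • ∑ c, 𝔛.P g b c x • 𝔛.formComp F K c x := fun b =>
    (𝔛.isRep_cur (isRep_toGerm _ _) q (isRep_toGerm _ _) (fun _ _ => isRep_toGerm _ _)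
      (fun _ => isRep_toGerm _ _) b).eq_iff
      (((isRep_toGerm _ _).pow ℓ).smul ((isRep_toGerm _ _).smul
        (isRep_raise (fun _ _ => isRep_toGerm _ _) (fun _ => isRep_toGerm _ _) b)))
  simp only [h]
  rw [← eventually_all]
  refine eventually_congr ?_
  filter_upwards [𝔛.eventually_mem, trivSet_mem_nhds (mem_trivSet (F := F) (V := V) p)]
    with x hx hx'
  rw [𝔛.current_eq_iff hg hA hx hx' r hq]
  simp only [mul_smul]

/-- A local solution of the current equation from a factorization of the germs of the current. -/
lemma exists_form_of_curGerm (hg : IsSmoothMetric g) (hA : A.ContMDiffCovariantDerivative ∞)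
    {r : M → ℝ} (hr : SmoothNear I r p) {q : ℕ} (hq : (m : ℝ) - 4 = q) {ℓ : ℕ}
    (h : ∀ b, ∃ Y, 𝔛.curGerm hg hA hr q b = toGerm r hr ^ ℓ • Y) :
    ∃ K : EndForm I V, SmoothFormNear F K p ∧
      ∀ᶠ x in 𝓝 p, ∀ w z, current A g r x w z = r x ^ ℓ • K x w z := by
  choose Y hY using h
  obtain ⟨u, hu⟩ := 𝔛.isUnit_volGerm hg
  choose t ht ht' using fun c => exists_isRep ((↑u⁻¹ : smoothGerms I p ℝ) • ∑ b, 𝔛.GGerm hg c b • Y b)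
  have hK : SmoothFormNear F (𝔛.formOf V t) p := formOf_near 𝔛.mem (mem_trivSet p) ht
  refine ⟨𝔛.formOf V t, hK, (𝔛.current_germ_iff hg hA hr hq hK ℓ).2 fun b => ?_⟩
  rw [hY]
  congr 1
  have e : ∀ c, 𝔛.formGerm hK c = (↑u⁻¹ : smoothGerms I p ℝ) • ∑ b, 𝔛.GGerm hg c b • Y b :=
    fun c => (isRep_toGerm _ _).eq_of (ht' c) (by
      filter_upwards [𝔛.eventually_mem, trivSet_mem_nhds (mem_trivSet (F := F) (V := V) p)]
        with x hx hx' using formComp_formOf hx hx' t c)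
  simp only [raise, e, smul_comm _ (↑u⁻¹ : smoothGerms I p ℝ), ← Finset.smul_sum]
  rw [← hu, smul_smul]
  rw [show (↑u⁻¹ * ↑u : smoothGerms I p ℝ) = 1 from Units.inv_mul u, one_smul]
  simp only [Finset.smul_sum, smul_smul]
  rw [Finset.sum_comm]
  simp only [← Finset.sum_smul, sum_PGerm_GGerm]
  simp

end CoordFrame

set_option synthInstance.maxHeartbeats 400000 in
/-- Global solutions of the current equation from local ones. -/
lemma exists_form_of_local [SigmaCompactSpace M] {r : M → ℝ} {ℓ : ℕ}
    (h : ∀ p, ∃ K : EndForm I V, SmoothFormNear F K p ∧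
      ∀ᶠ x in 𝓝 p, ∀ w z, current A g r x w z = r x ^ ℓ • K x w z) :
    ∃ K : EndForm I V, (∀ x, SmoothFormNear F K x) ∧
      ∀ x w z, current A g r x w z = r x ^ ℓ • K x w z := by
  obtain ⟨s, hs⟩ := exists_contMDiffSection_forall_mem_convex_of_local (I := I) (n := ⊤)
    (F_fiber := EuclideanSpace ℝ (Fin m) →L[ℝ] F →L[ℝ] F)
    (fun x : M => TangentSpace I x →L[ℝ] V x →L[ℝ] V x)
    (fun x => {k | ∀ w z, current A g r x w z = r x ^ ℓ • k w z})
    (fun x k hk k' hk' a b ha hb hab w z => by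
      have e : (a • k + b • k') w z = a • k w z + b • k' w z := rfl
      rw [e, smul_add, smul_comm, smul_comm _ b, ← hk, ← hk', ← add_smul, hab, one_smul])
    (fun p => by
      obtain ⟨K, hK, hK'⟩ := h p
      exact ⟨_, hK.and hK', K, fun y hy => hy.1.contMDiffWithinAt, fun y hy => hy.2⟩)
  exact ⟨fun x => s x, contMDiff_iff_smoothFormNear.2 s.contMDiff, hs⟩

end CurrentGerms

end YangMills

end

noncomputable section

set_option linter.unusedSectionVars false

namespace YangMills

/-! ### Germs at the boundary -/

section BoundaryGerms

open Filter Topology Module DiffAlg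

variable {d : ℕ} [NeZero d]
  {M : Type*} [TopologicalSpace M] [ChartedSpace (EuclideanHalfSpace d) M]
  [IsManifold (𝓡∂ d) ∞ M]
  {F : Type*} [NormedAddCommGroup F] [NormedSpace ℝ F] [FiniteDimensional ℝ F]
  {g : Π x : M, TangentSpace (𝓡∂ d) x → TangentSpace (𝓡∂ d) x → ℝ}
  {σ : M → ℝ} (hσ : IsDefining (d := d) σ) {p : M}
  {B : Type*} [NormedRing B] [NormedAlgebra ℝ B] [FiniteDimensional ℝ B]

/-- The germ of the defining function. -/
abbrev IsDefining.germ (p : M) : smoothGerms (𝓡∂ d) p ℝ := toGerm σ (hσ.near p)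

include hσ

lemma IsDefining.smul_germ_eq_zero (X : smoothGerms (𝓡∂ d) p B) (h : hσ.germ p • X = 0) : X = 0 :=
  YangMills.smul_germ_eq_zero (isRep_toGerm _ _) (.of_forall fun x hx =>
    hσ.deriv_ne_zero x ((hσ.zero_iff x).1 hx)) X h

lemma IsDefining.exists_germ_eq_smul (hp : p ∈ (𝓡∂ d).boundary M) {X : smoothGerms (𝓡∂ d) p B}
    {f : M → B} (hf : IsRep X f) (h0 : ∀ᶠ x in 𝓝 p, x ∈ (𝓡∂ d).boundary M → f x = 0) :
    ∃ Y, X = hσ.germ p • Y := by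
  have : CompleteSpace B := FiniteDimensional.complete ℝ B
  obtain ⟨h, hh, hfh⟩ := hσ.exists_eq_smul hp hf.smooth h0
  exact ⟨toGerm h hh, hf.eq_of ((isRep_toGerm _ _).smul (isRep_toGerm _ _)) hfh⟩

lemma IsDefining.eq_zero_of_germ_eq_smul {X Y : smoothGerms (𝓡∂ d) p B} {f : M → B}
    (hf : IsRep X f) (h : X = hσ.germ p • Y) :
    ∀ᶠ x in 𝓝 p, x ∈ (𝓡∂ d).boundary M → f x = 0 := by
  obtain ⟨y, -, hy⟩ := exists_isRep Y
  filter_upwards [(hf.eq_iff ((isRep_toGerm _ _).smul hy)).1 h] with x hx hx'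
  rw [hx, (hσ.zero_iff x).2 hx', zero_smul]

variable {𝔛 : CoordFrame (𝓡∂ d) p (Fin d)} (h0 : 𝔛.coord 0 = σ)
include h0

omit hσ in
lemma CoordFrame.D_defining {x : M} (hx : x ∈ 𝔛.U) (i : Fin d) :
    𝔛.D i σ x = if i = 0 then 1 else 0 := by
  have := 𝔛.dual x hx 0 i
  rw [h0] at this
  exact this.trans (if_congr eq_comm rfl rfl)

lemma IsDefining.dR_germ (i : Fin d) :
    (𝔛.diffAlg B).dR i (hσ.germ p) = if i = 0 then 1 else 0 := by
  refine (𝔛.isRep_dR i (isRep_toGerm _ _)).eq_of (g := fun _ => if i = 0 then 1 else 0) ?_ ?_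
  · split_ifs
    · exact IsRep.one
    · exact IsRep.zero
  · filter_upwards [𝔛.eventually_mem] with x hx using CoordFrame.D_defining h0 hx i

lemma IsDefining.normSq_germ (hg : IsSmoothMetric g) :
    (𝔛.diffAlg B).normSq (𝔛.PGerm hg) (hσ.germ p) = 𝔛.PGerm hg 0 0 := by
  simp [normSq, grad, hσ.dR_germ h0]

omit hσ h0 in
lemma CoordFrame.P_pos {κ : Type*} [Fintype κ] [DecidableEq κ] {𝔛 : CoordFrame (𝓡∂ d) p κ}
    (hg : IsSmoothMetric g) {x : M} (hx : x ∈ 𝔛.U) (i : κ) :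
    0 < 𝔛.P g i i x := ((CoordFrame.posDef_GMat hg hx).inv).diag_pos

lemma IsDefining.isUnit_normSq_germ (hg : IsSmoothMetric g) :
    IsUnit ((𝔛.diffAlg B).normSq (𝔛.PGerm hg) (hσ.germ p)) := by
  rw [hσ.normSq_germ h0 hg]
  exact isUnit_germ_real (isRep_toGerm _ _) (CoordFrame.P_pos hg 𝔛.mem 0).ne'

omit hσ h0 in
lemma isUnit_two_germ : IsUnit (2 : smoothGerms (𝓡∂ d) p ℝ) := by
  have := isUnit_natCast_germ (I := 𝓡∂ d) (p := p) 1
  norm_num at this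
  exact this

omit hσ h0 in
lemma isUnit_natCast_sub_germ {a b : ℕ} (h : a ≠ b) :
    IsUnit ((a : smoothGerms (𝓡∂ d) p ℝ) - (b : ℕ)) :=
  isUnit_germ_real ((IsRep.natCast a).sub (IsRep.natCast b))
    (sub_ne_zero.2 (Nat.cast_injective.ne h))

end BoundaryGerms

section FirstOrder

open Filter Topology Module DiffAlg

variable {d : ℕ} [NeZero d]
  {M : Type*} [TopologicalSpace M] [ChartedSpace (EuclideanHalfSpace d) M]
  [IsManifold (𝓡∂ d) ∞ M] [T2Space M]
  {S : Type*} [TopologicalSpace S] [ChartedSpace (EuclideanSpace ℝ (Fin (d - 1))) S]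
  [IsManifold (𝓡 (d - 1)) ∞ S] {ι : C^∞⟮𝓡 (d - 1), S; 𝓡∂ d, M⟯}
  {F : Type*} [NormedAddCommGroup F] [NormedSpace ℝ F] [FiniteDimensional ℝ F]
  {V : M → Type*} [TopologicalSpace (TotalSpace F V)]
  [∀ x, AddCommGroup (V x)] [∀ x, Module ℝ (V x)] [∀ x, TopologicalSpace (V x)]
  [∀ x, IsTopologicalAddGroup (V x)] [∀ x, ContinuousSMul ℝ (V x)]
  [FiberBundle F V] [VectorBundle ℝ F V] [ContMDiffVectorBundle ∞ F V (𝓡∂ d)]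
  {g : Π x : M, TangentSpace (𝓡∂ d) x → TangentSpace (𝓡∂ d) x → ℝ}
  {σ : M → ℝ} {A Aw : CovariantDerivative (𝓡∂ d) F V}
  {Abar : CovariantDerivative (𝓡 (d - 1)) F (ι *ᵖ V)}

lemma IsBoundaryInclusion.eventually_boundary (hι : IsBoundaryInclusion ι) {y : S} {Q : M → Prop}
    (h : ∀ᶠ y' in 𝓝 y, Q (ι y')) : ∀ᶠ x in 𝓝 (ι y), x ∈ (𝓡∂ d).boundary M → Q x := by
  rw [hι.1.isEmbedding.nhds_eq_comap, eventually_comap] at h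
  filter_upwards [h] with x hx hx'
  obtain ⟨y', rfl⟩ := hι.2 ▸ hx'
  exact hx y' rfl

lemma exists_form_of_ne_zero (hg : IsSmoothMetric g) (hA : A.ContMDiffCovariantDerivative ∞)
    {q : ℕ} (hq : (d : ℝ) - 4 = q) {p : M} {r : M → ℝ} (hr : SmoothNear (𝓡∂ d) r p) (hp : r p ≠ 0)
    (ℓ : ℕ) : ∃ K : EndForm (𝓡∂ d) V, SmoothFormNear F K p ∧
      ∀ᶠ x in 𝓝 p, ∀ w z, current A g r x w z = r x ^ ℓ • K x w z := by
  refine (chartFrame p).exists_form_of_curGerm hg hA hr hq fun b => ?_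
  obtain ⟨u, hu⟩ := (isUnit_germ_real (isRep_toGerm r hr) hp).pow ℓ
  refine ⟨(↑u⁻¹ : smoothGerms (𝓡∂ d) p ℝ) • (chartFrame p).curGerm hg hA hr q b, ?_⟩
  rw [← hu, smul_smul]
  exact ((congrArg (· • _) (Units.mul_inv u)).trans (one_smul _ _)).symm

set_option maxHeartbeats 1000000 in
/-- A connection whose current vanishes to the critical order, with leading coefficient vanishing
tangentially along the boundary for another connection with the same boundary condition. -/
theorem exists_form_succ (hι : IsBoundaryInclusion ι) (hg : IsSmoothMetric g)
    (hσ : IsDefining (d := d) σ) (hA : A.ContMDiffCovariantDerivative ∞)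
    (hAw : Aw.ContMDiffCovariantDerivative ∞) (hAbar : HasBoundaryCondition ι A Abar)
    (hAwbar : HasBoundaryCondition ι Aw Abar) {q : ℕ} (hq : (d : ℝ) - 4 = q)
    {K Kw : EndForm (𝓡∂ d) V} (hK : ∀ x, SmoothFormNear F K x) (hKw : ∀ x, SmoothFormNear F Kw x)
    (hAK : ∀ x v z, current A g σ x v z = σ x ^ q • K x v z)
    (hAKw : ∀ x v z, current Aw g σ x v z = σ x ^ q • Kw x v z)
    (hKw0 : ∀ (y : S) (v : TangentSpace (𝓡 (d - 1)) y), Kw (ι y) (pushVec ι v) = 0) (p : M) :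
    ∃ K' : EndForm (𝓡∂ d) V, SmoothFormNear F K' p ∧
      ∀ᶠ x in 𝓝 p, ∀ w z, current A g σ x w z = σ x ^ (q + 1) • K' x w z := by
  by_cases hp : σ p = 0
  swap
  · exact exists_form_of_ne_zero hg hA hq (hσ.near p) hp _
  have := hι.t2Space
  have hpb := (hσ.zero_iff p).1 hp
  obtain ⟨y, rfl⟩ := hι.2 ▸ hpb
  obtain ⟨𝔛, h0⟩ := hσ.exists_frame hpb
  obtain ⟨𝔶, h𝔶, h𝔶U, hpush⟩ := hι.exists_frame hσ 𝔛 h0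
  set s := hσ.germ (ι y)
  set D := 𝔛.diffAlg (F →L[ℝ] F)
  have hs : ∀ X : smoothGerms (𝓡∂ d) (ι y) (F →L[ℝ] F), s • X = 0 → X = 0 :=
    hσ.smul_germ_eq_zero
  have hdo : ∀ i, D.dR i s = if i = 0 then 1 else 0 := hσ.dR_germ h0
  have hn : IsUnit (D.normSq (𝔛.PGerm hg) s) := hσ.isUnit_normSq_germ h0 hg
  have hk := (𝔛.current_germ_iff hg hA (hσ.near _) hq (hK _) q).1 (.of_forall hAK)
  have hkw := (𝔛.current_germ_iff hg hAw (hσ.near _) hq (hKw _) q).1 (.of_forall hAKw)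
  have hρ := 𝔛.isUnit_volGerm hg
  have hlead := D.leading_cur_eq hdo hs (isUnit_one_add_smul (isRep_toGerm _ _) hp)
    isUnit_natCast_germ hρ hn (𝔛.sum_GGerm_PGerm hg) hk hkw (by
      intro i hi
      obtain ⟨j, rfl⟩ := exists_tail_eq hi
      refine hσ.exists_germ_eq_smul hpb ((isRep_toGerm _ _).sub (isRep_toGerm _ _))
        (hι.eventually_boundary ?_)
      filter_upwards [𝔶.eventually_mem, (ι.contMDiff y).continuousAt.eventually
        (trivSet_mem_nhds (mem_trivSet (F := F) (V := V) (ι y)))] with y' hy' hy''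
      rw [← connCoef_boundary hAbar hy'' (hpush y' hy' j),
        ← connCoef_boundary hAwbar hy'' (hpush y' hy' j), sub_self])
  have htan : ∀ i, i ≠ 0 → ∃ t, 𝔛.formGerm (hK _) i = s • t := by
    intro i hi
    obtain ⟨t, ht⟩ : ∃ t, 𝔛.formGerm (hKw _) i = s • t := by
      obtain ⟨j, rfl⟩ := exists_tail_eq hi
      refine hσ.exists_germ_eq_smul hpb (isRep_toGerm _ _) (hι.eventually_boundary ?_)
      filter_upwards [𝔶.eventually_mem] with y' hy'
      rw [CoordFrame.formComp, ← hpush y' hy', hKw0]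
      ext f
      exact (trivAt F (ι y) (ι y') : V (ι y') →L[ℝ] F).map_zero
    obtain ⟨t', ht'⟩ : ∃ t', 𝔛.formGerm (hK _) i - 𝔛.formGerm (hKw _) i = s • t' := by
      have e : ∀ k : Fin d → smoothGerms (𝓡∂ d) (ι y) (F →L[ℝ] F),
          ∑ b, 𝔛.GGerm hg i b • raise (𝔛.PGerm hg) k b = k i := fun k => by
        simp only [raise, Finset.smul_sum, smul_smul]
        rw [Finset.sum_comm]
        simp only [← Finset.sum_smul, CoordFrame.sum_GGerm_PGerm]
        simp
      rw [← e (𝔛.formGerm (hK _)), ← e (𝔛.formGerm (hKw _)), ← Finset.sum_sub_distrib]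
      refine exists_sum_smul fun b => ?_
      obtain ⟨Y, hY⟩ := hlead b
      obtain ⟨Z, hZ⟩ := exists_smul_of_isUnit hρ ⟨Y, (smul_sub _ _ _).trans hY⟩
      exact ⟨𝔛.GGerm hg i b • Z, by rw [← smul_sub, hZ, smul_comm]⟩
    exact ⟨t' + t, by rw [smul_add, ← ht', ← ht, sub_add_cancel]⟩
  have hnor : ∃ N, D.normalPart (𝔛.PGerm hg) s (𝔛.formGerm (hK _)) = s • N :=
    D.normalPart_of_cur isUnit_two_germ (CoordFrame.PGerm_symm hg) hs hρ
      (isUnit_natCast_sub_germ (by omega)) hk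
  choose t ht using D.exists_smul_of_tangential hdo hn htan hnor
  refine 𝔛.exists_form_of_curGerm hg hA (hσ.near _) hq fun b =>
    ⟨𝔛.volGerm hg • raise (𝔛.PGerm hg) t b, ?_⟩
  rw [hk, show 𝔛.formGerm (hK (ι y)) = fun i => s • t i from funext ht, raise_smul, pow_succ,
    mul_smul, smul_comm s]

end FirstOrder

end YangMills

end

noncomputable section

set_option linter.unusedSectionVars false

namespace YangMills

/-! ### The induced metric on the boundary -/

section TailMatrix

variable {d : ℕ} [NeZero d] {A : Matrix (Fin d) (Fin d) ℝ}

lemma inv_submatrix_tail (hA : A.det ≠ 0) (h0 : A⁻¹ 0 0 ≠ 0) (i j : Fin (d - 1)) :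
    (A.submatrix tail tail)⁻¹ i j =
      A⁻¹ (tail i) (tail j) - A⁻¹ (tail i) 0 * A⁻¹ 0 (tail j) / A⁻¹ 0 0 := by
  have h1 : ∀ a c, A⁻¹ a 0 * A 0 c + ∑ j, A⁻¹ a (tail j) * A (tail j) c = if a = c then 1 else 0 := by
    intro a c
    have := congrFun (congrFun (Matrix.nonsing_inv_mul A hA.isUnit) a) c
    rwa [Matrix.mul_apply, Matrix.one_apply, sum_eq_zero_add_tail] at this
  have h2 : (Matrix.of fun i j => A⁻¹ (tail i) (tail j) - A⁻¹ (tail i) 0 * A⁻¹ 0 (tail j) / A⁻¹ 0 0) *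
      A.submatrix tail tail = 1 := by
    ext i k
    rw [Matrix.mul_apply, Matrix.one_apply]
    simp only [Matrix.of_apply, Matrix.submatrix_apply, sub_mul, Finset.sum_sub_distrib]
    have e1 := h1 (tail i) (tail k)
    have e2 := h1 0 (tail k)
    rw [if_neg (tail_ne_zero k).symm] at e2
    simp only [tail_injective.eq_iff] at e1
    have e3 : ∑ j, A⁻¹ (tail i) 0 * A⁻¹ 0 (tail j) / A⁻¹ 0 0 * A (tail j) (tail k) =
        A⁻¹ (tail i) 0 / A⁻¹ 0 0 * ∑ j, A⁻¹ 0 (tail j) * A (tail j) (tail k) := by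
      rw [Finset.mul_sum]
      exact Finset.sum_congr rfl fun j _ => by ring
    rw [e3, eq_neg_of_add_eq_zero_right e2, ← e1]
    field_simp
    ring
  rw [Matrix.inv_eq_left_inv h2]
  rfl

lemma det_submatrix_tail (hA : A.det ≠ 0) : (A.submatrix tail tail).det = A⁻¹ 0 0 * A.det := by
  obtain ⟨n, rfl⟩ : ∃ n, d = n + 1 := ⟨d - 1, by have := NeZero.pos d; omega⟩
  have h := Matrix.adjugate_fin_succ_eq_det_submatrix A 0 0
  rw [Matrix.inv_def, Matrix.smul_apply, h, Ring.inverse_eq_inv', smul_eq_mul]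
  have e : A.submatrix (Fin.succAbove 0) (Fin.succAbove 0) =
      A.submatrix (tail (d := n + 1)) (tail (d := n + 1)) := rfl
  rw [e]
  simp only [Fin.val_zero, add_zero, pow_zero, one_mul]
  field_simp

end TailMatrix

section BoundaryMetric

open Filter Topology Module

variable {d : ℕ} [NeZero d]
  {M : Type*} [TopologicalSpace M] [ChartedSpace (EuclideanHalfSpace d) M]
  [IsManifold (𝓡∂ d) ∞ M]
  {S : Type*} [TopologicalSpace S] [ChartedSpace (EuclideanSpace ℝ (Fin (d - 1))) S]
  [IsManifold (𝓡 (d - 1)) ∞ S] {ι : C^∞⟮𝓡 (d - 1), S; 𝓡∂ d, M⟯}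
  {σ : M → ℝ} (g : Metric d M)

lemma pushVec_sum {κ : Type*} (s : Finset κ) {y : S} (a : κ → ℝ)
    (v : κ → TangentSpace (𝓡 (d - 1)) y) :
    pushVec ι (∑ i ∈ s, a i • v i) = ∑ i ∈ s, a i • pushVec ι (v i) := by
  have h := map_sum (mfderiv (𝓡 (d - 1)) (𝓡∂ d) ι y) (fun i => a i • v i) s
  simp only [map_smul] at h
  exact h

lemma isSmoothMetric_boundaryForm (hι : IsBoundaryInclusion ι) (hσ : IsDefining (d := d) σ) :
    IsSmoothMetric (m := d - 1) (I := 𝓡 (d - 1)) (boundaryForm ι g) where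
  add_left y u u' v := by
    have : pushVec ι (u + u') = pushVec ι u + pushVec ι u' :=
      map_add (mfderiv (𝓡 (d - 1)) (𝓡∂ d) ι y) u u'
    exact (congrArg (fun w => g.form (ι y) w (pushVec ι v)) this).trans
      (g.isSmoothMetric.add_left _ _ _ _)
  smul_left y r u v := by
    have : pushVec ι (r • u) = r • pushVec ι u :=
      map_smul (mfderiv (𝓡 (d - 1)) (𝓡∂ d) ι y) r u
    exact (congrArg (fun w => g.form (ι y) w (pushVec ι v)) this).trans
      (g.isSmoothMetric.smul_left _ _ _ _)
  symm y u v := g.symm _ _ _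
  pos y u hu := g.pos _ _ fun h => hu (hι.pushVec_injective y h)
  smooth y X Y hX hY := by
    obtain ⟨𝔛, h0⟩ := hσ.exists_frame (hι.mem y)
    obtain ⟨𝔶, -, hU, hpush⟩ := hι.exists_frame hσ 𝔛 h0
    have h : SmoothNear (𝓡 (d - 1)) (fun y' => ∑ i, ∑ j, 𝔶.comp X i y' • 𝔶.comp Y j y' •
        𝔛.G g.form (tail i) (tail j) (ι y')) y :=
      SmoothNear.sum fun i _ => SmoothNear.sum fun j _ => (𝔶.comp_near 𝔶.mem hX i).smul
        ((𝔶.comp_near 𝔶.mem hY j).smul (CoordFrame.G_near g.isSmoothMetric 𝔛.mem _ _).comp_inclusion)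
    refine h.congr ?_
    filter_upwards [𝔶.eventually_mem] with y' hy'
    rw [← 𝔶.sum_comp hy' X, ← 𝔶.sum_comp hy' Y]
    change g.form (ι y') (pushVec ι _) (pushVec ι _) = _
    rw [pushVec_sum, pushVec_sum, g.isSmoothMetric.apply_sum]
    simp only [hpush y' hy', smul_eq_mul, mul_assoc]
    rfl

variable {g} {y : S} {𝔛 : CoordFrame (𝓡∂ d) (ι y) (Fin d)}
  {𝔶 : CoordFrame (𝓡 (d - 1)) y (Fin (d - 1))} {y' : S} (hx : ι y' ∈ 𝔛.U)
  (hX : ∀ i, pushVec ι (𝔶.X i y') = 𝔛.X (tail i) (ι y'))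
include hX

lemma GMat_boundaryForm :
    𝔶.GMat (boundaryForm ι g) y' = (𝔛.GMat g.form (ι y')).submatrix tail tail := by
  ext i j
  change g.form (ι y') (pushVec ι (𝔶.X i y')) (pushVec ι (𝔶.X j y')) = _
  rw [hX, hX]
  rfl

include hx

lemma P_boundaryForm (i j : Fin (d - 1)) :
    𝔶.P (boundaryForm ι g) i j y' = 𝔛.P g.form (tail i) (tail j) (ι y') -
      𝔛.P g.form (tail i) 0 (ι y') * 𝔛.P g.form 0 (tail j) (ι y') / 𝔛.P g.form 0 0 (ι y') := by
  rw [CoordFrame.P, GMat_boundaryForm hX]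
  exact inv_submatrix_tail (CoordFrame.det_pos g.isSmoothMetric hx).ne'
    (CoordFrame.P_pos g.isSmoothMetric hx 0).ne' i j

lemma vol_boundaryForm : 𝔶.vol (boundaryForm ι g) y' =
    𝔛.vol g.form (ι y') * Real.sqrt (𝔛.P g.form 0 0 (ι y')) := by
  rw [CoordFrame.vol, GMat_boundaryForm hX,
    det_submatrix_tail (CoordFrame.det_pos g.isSmoothMetric hx).ne', mul_comm,
    Real.sqrt_mul (CoordFrame.det_pos g.isSmoothMetric hx).le]
  rfl

end BoundaryMetric

/-! ### The norm of the gradient -/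

section GradientNorm

open Filter Topology Module DiffAlg

variable {m : ℕ} {H : Type*} [TopologicalSpace H]
  {I : ModelWithCorners ℝ (EuclideanSpace ℝ (Fin m)) H}
  {M : Type*} [TopologicalSpace M] [ChartedSpace H M] [IsManifold I ∞ M] [T2Space M]
  {g : Π x : M, TangentSpace I x → TangentSpace I x → ℝ} {r : M → ℝ}
  {p : M} {κ : Type*} [Fintype κ] [DecidableEq κ] {𝔛 : CoordFrame I p κ} {x : M}

/-- The squared norm of the gradient. -/
def gradSq (g : Π x : M, TangentSpace I x → TangentSpace I x → ℝ) (r : M → ℝ) (x : M) : ℝ :=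
  g x (gradient g r x) (gradient g r x)

lemma CoordFrame.gradSq_eq (hg : IsSmoothMetric g) (hx : x ∈ 𝔛.U) :
    gradSq g r x = ∑ b, 𝔛.D b r x * ∑ e, 𝔛.P g b e x * 𝔛.D e r x := by
  set u : κ → ℝ := fun b => ∑ e, 𝔛.P g b e x * 𝔛.D e r x with hu
  have h1 : gradient g r x = ∑ b, u b • 𝔛.X b x := by
    rw [← 𝔛.expand x hx (gradient g r x)]
    simp only [coord_gradient hg hx]
    rfl
  have h2 : ∀ a, ∑ b, 𝔛.G g a b x * u b = 𝔛.D a r x := fun a => by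
    simp only [hu, Finset.mul_sum, ← mul_assoc]
    rw [Finset.sum_comm]
    simp only [← Finset.sum_mul, sum_G_P hg hx]
    simp
  rw [gradSq, h1, hg.apply_sum]
  refine Finset.sum_congr rfl fun a _ => ?_
  rw [← h2 a, Finset.sum_mul]
  refine Finset.sum_congr rfl fun b _ => ?_
  change u a * u b * 𝔛.G g a b x = _
  ring

lemma gradSq_near (hg : IsSmoothMetric g) (hr : SmoothNear I r p) (𝔛 : CoordFrame I p κ) :
    SmoothNear I (gradSq g r) p := by
  have hD : ∀ b, SmoothNear I (𝔛.D b r) p := fun b => hr.fieldDeriv (𝔛.field_near b 𝔛.mem)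
  have h : SmoothNear I (fun x => ∑ b, 𝔛.D b r x • ∑ e, 𝔛.P g b e x • 𝔛.D e r x) p :=
    SmoothNear.sum fun b _ => (hD b).smul (SmoothNear.sum fun e _ =>
      (CoordFrame.P_near hg 𝔛.mem b e).smul (hD e))
  refine h.congr ?_
  filter_upwards [𝔛.eventually_mem] with x hx using CoordFrame.gradSq_eq hg hx

lemma gradSq_nonneg (hg : IsSmoothMetric g) (r : M → ℝ) (x : M) : 0 ≤ gradSq g r x := by
  by_cases h : gradient g r x = 0
  · rw [gradSq, h]
    have := hg.smul_left x 0 (0 : TangentSpace I x) 0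
    rw [zero_smul, zero_mul] at this
    exact this.ge
  · exact (hg.pos x _ h).le

lemma isRep_normSq {B : Type*} [NormedRing B] [NormedAlgebra ℝ B] [FiniteDimensional ℝ B]
    (hg : IsSmoothMetric g) (hr : SmoothNear I r p) (𝔛 : CoordFrame I p κ) :
    IsRep ((𝔛.diffAlg B).normSq (𝔛.PGerm hg) (toGerm r hr)) (gradSq g r) := by
  refine (IsRep.sum fun b _ => (𝔛.isRep_dR b (isRep_toGerm r hr)).mul (IsRep.sum fun e _ =>
    (isRep_toGerm _ _).mul (𝔛.isRep_dR e (isRep_toGerm r hr)))).congr ?_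
  filter_upwards [𝔛.eventually_mem] with x hx using (CoordFrame.gradSq_eq hg hx).symm

end GradientNorm

end YangMills

end

noncomputable section

set_option linter.unusedSectionVars false

namespace YangMills

/-! ### Adding powers of the defining function -/

section PowerForms

open Filter Topology Module DiffAlg

variable {m : ℕ} {H : Type*} [TopologicalSpace H]
  {I : ModelWithCorners ℝ (EuclideanSpace ℝ (Fin m)) H}
  {M : Type*} [TopologicalSpace M] [ChartedSpace H M] [IsManifold I ∞ M] [T2Space M]
  {F : Type*} [NormedAddCommGroup F] [NormedSpace ℝ F] [FiniteDimensional ℝ F]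
  {V : M → Type*} [TopologicalSpace (TotalSpace F V)]
  [∀ x, AddCommGroup (V x)] [∀ x, Module ℝ (V x)] [∀ x, TopologicalSpace (V x)]
  [∀ x, IsTopologicalAddGroup (V x)] [∀ x, ContinuousSMul ℝ (V x)]
  [FiberBundle F V] [VectorBundle ℝ F V] [ContMDiffVectorBundle ∞ F V I]
  {A : CovariantDerivative I F V} {r : M → ℝ} {p : M} {κ : Type*} [Fintype κ] [DecidableEq κ]
  {𝔛 : CoordFrame I p κ} {K : EndForm I V}

/-- The product of a function and a one-form. -/
def smulForm (f : M → ℝ) (K : EndForm I V) : EndForm I V := fun x => f x • K x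

lemma SmoothFormNear.smulForm {f : M → ℝ} (hf : SmoothNear I f p) (hK : SmoothFormNear F K p) :
    SmoothFormNear F (smulForm f K) p := by
  filter_upwards [hf, hK] with x h1 h2
  exact ContMDiffAt.smul_section h1 h2

lemma SmoothNear.pow (hr : SmoothNear I r p) (n : ℕ) : SmoothNear I (fun x => r x ^ n) p :=
  hr.comp_at (n := fun t => t ^ n) (.of_forall fun _ => contDiff_id.contDiffAt.pow n)

lemma CoordFrame.connGerm_addForm (hA : A.ContMDiffCovariantDerivative ∞)
    (hr : SmoothNear I r p) (hK : SmoothFormNear F K p) (ℓ : ℕ)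
    (hA' : (addForm A (smulForm (fun x => r x ^ ℓ) K)).ContMDiffCovariantDerivative ∞) (i : κ) :
    𝔛.connGerm hA' i = 𝔛.connGerm hA i + toGerm r hr ^ ℓ • 𝔛.formGerm hK i := by
  refine (isRep_toGerm _ _).eq_of ((isRep_toGerm _ _).add
    (((isRep_toGerm _ _).pow ℓ).smul (isRep_toGerm _ _))) ?_
  filter_upwards [trivSet_mem_nhds (mem_trivSet (F := F) (V := V) p)] with x hx
  rw [𝔛.connCoef_addForm A _ hx]
  congr 1
  ext f
  exact (trivAt F p x : V x →L[ℝ] F).map_smul _ _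

end PowerForms

/-! ### The electric field at the boundary -/

section ElectricField

open Filter Topology Module DiffAlg

variable {d : ℕ} [NeZero d]
  {M : Type*} [TopologicalSpace M] [ChartedSpace (EuclideanHalfSpace d) M]
  [IsManifold (𝓡∂ d) ∞ M] [T2Space M]
  {F : Type*} [NormedAddCommGroup F] [NormedSpace ℝ F] [FiniteDimensional ℝ F]
  {V : M → Type*} [TopologicalSpace (TotalSpace F V)]
  [∀ x, AddCommGroup (V x)] [∀ x, Module ℝ (V x)] [∀ x, TopologicalSpace (V x)]
  [∀ x, IsTopologicalAddGroup (V x)] [∀ x, ContinuousSMul ℝ (V x)]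
  [FiberBundle F V] [VectorBundle ℝ F V] [ContMDiffVectorBundle ∞ F V (𝓡∂ d)]
  {σ : M → ℝ} (hσ : IsDefining (d := d) σ)

section Normal

variable {g : Π x : M, TangentSpace (𝓡∂ d) x → TangentSpace (𝓡∂ d) x → ℝ}
  (hg : IsSmoothMetric g) {p : M} {𝔛 : CoordFrame (𝓡∂ d) p (Fin d)} (h0 : 𝔛.coord 0 = σ)
  {K : EndForm (𝓡∂ d) V}
include hσ hg h0

lemma IsDefining.normalPart_germ {B : Type*} [NormedRing B] [NormedAlgebra ℝ B]
    [FiniteDimensional ℝ B] (k : Fin d → smoothGerms (𝓡∂ d) p B) :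
    (𝔛.diffAlg B).normalPart (𝔛.PGerm hg) (hσ.germ p) k = raise (𝔛.PGerm hg) k 0 := by
  simp [normalPart, hσ.dR_germ h0]

omit hσ in
lemma CoordFrame.trivAt_form_gradient {x : M} (hx : x ∈ 𝔛.U) (hx' : x ∈ trivSet F V p) (z : V x) :
    trivAt F p x (K x (gradient g σ x) z) =
      (∑ c, 𝔛.P g 0 c x • 𝔛.formComp F K c x) (trivAt F p x z) := by
  rw [𝔛.trivAt_form hx hx']
  congr 1
  refine Finset.sum_congr rfl fun b _ => ?_
  rw [coord_gradient hg hx]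
  congr 1
  have : ∀ i, 𝔛.D i σ x = if i = 0 then 1 else 0 := 𝔛.D_defining h0 hx
  simp only [this]
  simp [CoordFrame.P_symm hg b 0]

omit hσ in
lemma CoordFrame.gradient_form_eq_zero_iff {x : M} (hx : x ∈ 𝔛.U) (hx' : x ∈ trivSet F V p) :
    K x (gradient g σ x) = 0 ↔ ∑ c, 𝔛.P g 0 c x • 𝔛.formComp F K c x = 0 := by
  have e := 𝔛.trivAt_form_gradient hg h0 hx hx' (K := K)
  constructor
  · intro h
    ext f
    have := e (symAt F p x f)
    rw [trivAt_symAt hx', h] at this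
    exact this.symm.trans ((trivAt F p x : V x →L[ℝ] F).map_zero)
  · intro h
    ext z
    apply trivAt_injective hx'
    rw [e, h]
    exact ((trivAt F p x : V x →L[ℝ] F).map_zero).symm

/-- The normal part of a one-form vanishes along the boundary if and only if it is divisible by the
defining function. -/
lemma IsDefining.exists_normalPart_iff (hp : p ∈ (𝓡∂ d).boundary M) (hK : SmoothFormNear F K p) :
    (∃ N, (𝔛.diffAlg (F →L[ℝ] F)).normalPart (𝔛.PGerm hg) (hσ.germ p) (𝔛.formGerm hK) =
      hσ.germ p • N) ↔ ∀ᶠ x in 𝓝 p, x ∈ (𝓡∂ d).boundary M → K x (gradient g σ x) = 0 := by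
  have hrep : IsRep ((𝔛.diffAlg (F →L[ℝ] F)).normalPart (𝔛.PGerm hg) (hσ.germ p) (𝔛.formGerm hK))
      (fun x => ∑ c, 𝔛.P g 0 c x • 𝔛.formComp F K c x) := by
    rw [hσ.normalPart_germ hg h0]
    exact CoordFrame.isRep_raise (fun _ _ => isRep_toGerm _ _) (fun _ => isRep_toGerm _ _) 0
  have hU : ∀ᶠ x in 𝓝 p, x ∈ 𝔛.U ∧ x ∈ trivSet F V p :=
    𝔛.eventually_mem.and (trivSet_mem_nhds (mem_trivSet p))
  constructor
  · rintro ⟨N, hN⟩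
    filter_upwards [hσ.eq_zero_of_germ_eq_smul hrep hN, hU] with x h1 h2 h3
    exact (CoordFrame.gradient_form_eq_zero_iff hg h0 h2.1 h2.2).2 (h1 h3)
  · intro h
    refine hσ.exists_germ_eq_smul hp hrep ?_
    filter_upwards [h, hU] with x h1 h2 h3
    exact (CoordFrame.gradient_form_eq_zero_iff hg h0 h2.1 h2.2).1 (h1 h3)

end Normal

variable {S : Type*} [TopologicalSpace S] [ChartedSpace (EuclideanSpace ℝ (Fin (d - 1))) S]
  [IsManifold (𝓡 (d - 1)) ∞ S] {ι : C^∞⟮𝓡 (d - 1), S; 𝓡∂ d, M⟯}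

lemma SmoothNear.comp_retraction {W : Type*} [NormedAddCommGroup W] [NormedSpace ℝ W] {f : S → W}
    {r : M → S} {p : M} (hr : ∀ᶠ x in 𝓝 p, ContMDiffAt (𝓡∂ d) (𝓡 (d - 1)) ∞ r x)
    (hf : SmoothNear (𝓡 (d - 1)) f (r p)) : SmoothNear (𝓡∂ d) (fun x => f (r x)) p := by
  filter_upwards [hr, hr.self_of_nhds.continuousAt.eventually hf] with x h1 h2
  exact h2.comp x h1

set_option synthInstance.maxHeartbeats 400000 in
set_option maxHeartbeats 800000 in
/-- A one-form on `M` with prescribed tangential part `f⁻¹ E` along the boundary. -/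
lemma exists_tangential_extension [SigmaCompactSpace M] (hι : IsBoundaryInclusion ι)
    (hσ : IsDefining (d := d) σ) {f : M → ℝ}
    (hf : ∀ x ∈ (𝓡∂ d).boundary M, SmoothNear (𝓡∂ d) f x ∧ f x ≠ 0)
    {E : EndForm (𝓡 (d - 1)) (ι *ᵖ V)} (hE : ∀ y, SmoothFormNear F E y) :
    ∃ K : EndForm (𝓡∂ d) V, (∀ x, SmoothFormNear F K x) ∧
      ∀ (y : S) (v : TangentSpace (𝓡 (d - 1)) y) (z : V (ι y)),
        K (ι y) (pushVec ι v) z = (f (ι y))⁻¹ • E y v z := by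
  obtain ⟨s, hs⟩ := exists_contMDiffSection_forall_mem_convex_of_local (I := 𝓡∂ d) (n := ⊤)
    (F_fiber := EuclideanSpace ℝ (Fin d) →L[ℝ] F →L[ℝ] F)
    (fun x : M => TangentSpace (𝓡∂ d) x →L[ℝ] V x →L[ℝ] V x)
    (fun x => {k | ∀ (y : S) (k' : TangentSpace (𝓡∂ d) (ι y) →L[ℝ] V (ι y) →L[ℝ] V (ι y)),
      ι y = x → HEq k k' → ∀ (v : TangentSpace (𝓡 (d - 1)) y) (z : V (ι y)),
        k' (pushVec ι v) z = (f (ι y))⁻¹ • (E y v z : V (ι y))})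
    (fun x k hk k' hk' a b ha hb hab y l hl hll v z => by
      subst hl
      obtain rfl := eq_of_heq hll
      have e : (a • k + b • k') (pushVec ι v) z =
        a • k (pushVec ι v) z + b • k' (pushVec ι v) z := rfl
      rw [hk y k rfl HEq.rfl, hk' y k' rfl HEq.rfl] at e
      refine e.trans ((add_smul a b ((f (ι y))⁻¹ • (E y v z : V (ι y)))).symm.trans ?_)
      rw [hab]
      exact one_smul ℝ _)
    (fun p => by
      have := hι.t2Space
      by_cases hp : σ p = 0
      · have hpb := (hσ.zero_iff p).1 hp
        obtain ⟨y, rfl⟩ := hι.2 ▸ hpb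
        obtain ⟨𝔛, h0⟩ := hσ.exists_frame hpb
        obtain ⟨𝔶, h𝔶, h𝔶U, hpush⟩ := hι.exists_frame hσ 𝔛 h0
        obtain ⟨r, hr, hri⟩ := hι.exists_retraction y
        obtain ⟨hf1, hf2⟩ := hf _ hpb
        have hry : r (ι y) = y := hri.self_of_nhds
        set t : Fin d → M → F →L[ℝ] F := fun b x => if h : b = 0 then 0 else
          (f x)⁻¹ • 𝔶.formComp F E (exists_tail_eq h).choose (r x) with ht
        have ht0 : t 0 = fun _ => 0 := by simp [ht]
        have htt : ∀ i, t (tail i) = fun x => (f x)⁻¹ • 𝔶.formComp F E i (r x) := fun i => by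
          funext x
          have h := (exists_tail_eq (tail_ne_zero i)).choose_spec
          simp only [ht, tail_ne_zero, dite_false, tail_injective h]
        have hts : ∀ b, SmoothNear (𝓡∂ d) (t b) (ι y) := fun b => by
          by_cases hb : b = 0
          · rw [hb, ht0]; exact .const 0
          · obtain ⟨i, rfl⟩ := exists_tail_eq hb
            rw [htt]
            refine (hf1.inv hf2).smul (SmoothNear.comp_retraction hr ?_)
            rw [hry]
            exact CoordFrame.formComp_near 𝔶.mem (mem_trivSet_pullback (mem_trivSet _)) (hE y) i
        have hK : SmoothFormNear F (𝔛.formOf V t) (ι y) :=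
          CoordFrame.formOf_near 𝔛.mem (mem_trivSet _) hts
        have hloc : ∀ᶠ y' in 𝓝 y, ∀ (v : TangentSpace (𝓡 (d - 1)) y') (z : V (ι y')),
            𝔛.formOf V t (ι y') (pushVec ι v) z = (f (ι y'))⁻¹ • (E y' v z : V (ι y')) := by
          filter_upwards [𝔶.eventually_mem, hri, (ι.contMDiff y).continuousAt.eventually
            (trivSet_mem_nhds (mem_trivSet (F := F) (V := V) (ι y)))] with y' hy' hr' hy'' v z
          apply trivAt_injective hy''
          rw [𝔛.trivAt_form (h𝔶U y' hy') hy'']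
          have h1 := 𝔶.trivAt_form (F := F) (K := E) hy' (mem_trivSet_pullback hy'') v z
          refine Eq.trans ?_ (((trivAt F (ι y) (ι y') : V (ι y') →L[ℝ] F).map_smul (f (ι y'))⁻¹
            (E y' v z : V (ι y'))).trans (congrArg ((f (ι y'))⁻¹ • ·) h1)).symm
          simp only [CoordFrame.formComp_formOf (h𝔶U y' hy') hy'', sum_eq_zero_add_tail, ht0, htt,
            smul_zero, zero_add, hr']
          have h2 : ∀ i, mvfderiv (𝓡 (d - 1)) (𝔶.coord i) y' v =
              mvfderiv (𝓡∂ d) (𝔛.coord (tail i)) (ι y') (pushVec ι v) := fun i => by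
            rw [h𝔶]
            exact mvfderiv_comp_inclusion
              ((𝔛.coord_smooth _ _ (h𝔶U y' hy')).mdifferentiableAt (by simp)) v
          simp only [h2, smul_comm _ (f (ι y'))⁻¹, ← Finset.smul_sum]
          rfl
        refine ⟨_, hK.and (hι.1.isEmbedding.nhds_eq_comap y ▸ hloc |> eventually_comap.1),
          𝔛.formOf V t, fun y hy => hy.1.contMDiffWithinAt, fun x hx y' k' hk hkk v z => ?_⟩
        subst hk
        obtain rfl := eq_of_heq hkk
        exact hx.2 y' rfl v z
      · refine ⟨{x | σ x ≠ 0}, (isOpen_ne_fun hσ.smooth.continuous continuous_const).mem_nhds hp,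
          fun x => 0, fun x _ => ?_, fun x hx y' k' hk _ => ?_⟩
        · exact (contMDiff_zeroSection ℝ _ x).contMDiffWithinAt
        · exact absurd ((hσ.zero_iff x).2 (hk ▸ hι.mem y')) hx)
  exact ⟨fun x => s x, contMDiff_iff_smoothFormNear.2 s.contMDiff,
    fun y v z => hs (ι y) y _ rfl HEq.rfl v z⟩

end ElectricField

end YangMills

end

noncomputable section

set_option linter.unusedSectionVars false

namespace YangMills

/-! ### The critical order and the Gauss law -/

section GaussLaw

open Filter Topology Module DiffAlg

lemma normal_flux_boundary {d : ℕ} [NeZero d] {W : Type*} [AddCommGroup W] [Module ℝ W] (ρ : ℝ)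
    {P : Fin d → Fin d → ℝ} (h : 0 < P 0 0) {a : Fin d → W} {e : Fin (d - 1) → W}
    (hae : ∀ k, a (tail k) = (Real.sqrt (P 0 0))⁻¹ • e k) (i : Fin (d - 1)) :
    ρ • (P (tail i) 0 • ∑ c, P 0 c • a c - P 0 0 • ∑ c, P (tail i) c • a c) =
      ∑ k, (-1 : ℝ) • ((ρ * Real.sqrt (P 0 0)) *
        (P (tail i) (tail k) - P (tail i) 0 * P 0 (tail k) / P 0 0)) • e k := by
  rw [sum_eq_zero_add_tail, sum_eq_zero_add_tail (fun c => P (tail i) c • a c)]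
  have e1 : ρ • (P (tail i) 0 • (P 0 0 • a 0 + ∑ k, P 0 (tail k) • a (tail k)) -
      P 0 0 • (P (tail i) 0 • a 0 + ∑ k, P (tail i) (tail k) • a (tail k))) =
      ρ • (P (tail i) 0 • ∑ k, P 0 (tail k) • a (tail k) -
        P 0 0 • ∑ k, P (tail i) (tail k) • a (tail k)) := by module
  rw [e1]
  simp only [Finset.smul_sum, ← Finset.sum_sub_distrib]
  refine Finset.sum_congr rfl fun k _ => ?_
  rw [hae]
  have hr := Real.sqrt_pos.2 h
  have h2 : P 0 0 = Real.sqrt (P 0 0) * Real.sqrt (P 0 0) := (Real.mul_self_sqrt h.le).symm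
  generalize Real.sqrt (P 0 0) = r at *
  rw [h2]
  match_scalars
  field_simp
  ring

variable {d : ℕ} [NeZero d]
  {M : Type*} [TopologicalSpace M] [ChartedSpace (EuclideanHalfSpace d) M]
  [IsManifold (𝓡∂ d) ∞ M] [T2Space M]
  {F : Type*} [NormedAddCommGroup F] [NormedSpace ℝ F] [FiniteDimensional ℝ F]
  {V : M → Type*} [TopologicalSpace (TotalSpace F V)]
  [∀ x, AddCommGroup (V x)] [∀ x, Module ℝ (V x)] [∀ x, TopologicalSpace (V x)]
  [∀ x, IsTopologicalAddGroup (V x)] [∀ x, ContinuousSMul ℝ (V x)]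
  [FiberBundle F V] [VectorBundle ℝ F V] [ContMDiffVectorBundle ∞ F V (𝓡∂ d)]
  {σ : M → ℝ}
  {S : Type*} [TopologicalSpace S] [ChartedSpace (EuclideanSpace ℝ (Fin (d - 1))) S]
  [IsManifold (𝓡 (d - 1)) ∞ S] {ι : C^∞⟮𝓡 (d - 1), S; 𝓡∂ d, M⟯}
  {A : CovariantDerivative (𝓡∂ d) F V} {Abar : CovariantDerivative (𝓡 (d - 1)) F (ι *ᵖ V)}
  {g : Metric d M} {K : EndForm (𝓡∂ d) V} {E : EndForm (𝓡 (d - 1)) (ι *ᵖ V)}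

lemma gradSq_eq_P {g : Π x : M, TangentSpace (𝓡∂ d) x → TangentSpace (𝓡∂ d) x → ℝ}
    (hg : IsSmoothMetric g) {p x : M} {𝔛 : CoordFrame (𝓡∂ d) p (Fin d)} (h0 : 𝔛.coord 0 = σ)
    (hx : x ∈ 𝔛.U) : gradSq g σ x = 𝔛.P g 0 0 x := by
  rw [CoordFrame.gradSq_eq hg hx]
  simp [𝔛.D_defining h0 hx]

lemma IsDefining.gradSq_pos {g : Π x : M, TangentSpace (𝓡∂ d) x → TangentSpace (𝓡∂ d) x → ℝ}
    (hσ : IsDefining (d := d) σ) (hg : IsSmoothMetric g) {p : M} (hp : p ∈ (𝓡∂ d).boundary M) :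
    0 < gradSq g σ p := by
  obtain ⟨𝔛, h0⟩ := hσ.exists_frame hp
  rw [gradSq_eq_P hg h0 𝔛.mem]
  exact CoordFrame.P_pos hg 𝔛.mem 0

/-- The divergence of the electric field as the covariant divergence of the normal flux. -/
lemma sum_covFun_normal_flux (hι : IsBoundaryInclusion ι) (hσ : IsDefining (d := d) σ)
    (hAbar : HasBoundaryCondition ι A Abar) (hK : ∀ x, SmoothFormNear F K x)
    (hE : ∀ y, SmoothFormNear F E y)
    (hKE : ∀ (y : S) (v : TangentSpace (𝓡 (d - 1)) y) (z : V (ι y)),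
        K (ι y) (pushVec ι v) z = (Real.sqrt (gradSq g.form σ (ι y)))⁻¹ • E y v z) {y : S}
    {𝔛 : CoordFrame (𝓡∂ d) (ι y) (Fin d)} (h0 : 𝔛.coord 0 = σ)
    {𝔶 : CoordFrame (𝓡 (d - 1)) y (Fin (d - 1))} (hU : ∀ y' ∈ 𝔶.U, ι y' ∈ 𝔛.U)
    (hpush : ∀ y' ∈ 𝔶.U, ∀ i, pushVec ι (𝔶.X i y') = 𝔛.X (tail i) (ι y'))
    (f : F) :
    (∑ i, 𝔛.covFun (𝔛.connCoef A) i (fun x => 𝔛.vol g.form x • (𝔛.P g.form i 0 x •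
      ∑ c, 𝔛.P g.form 0 c x • 𝔛.formComp F K c x - 𝔛.P g.form 0 0 x •
      ∑ c, 𝔛.P g.form i c x • 𝔛.formComp F K c x)) (ι y)) f =
    -(𝔶.vol (boundaryForm ι g) y • trivAt F (ι y) (ι y) (divOneForm Abar (boundaryForm ι g)
      (fun y' v z' => E y' v z') y (symAt F (ι y) (ι y) f : V (ι y)) : V (ι y))) := by
  have hgS := isSmoothMetric_boundaryForm g hι hσ
  have hg := g.isSmoothMetric
  have := hι.t2Space
  have hbase := mem_trivSet (F := F) (V := V) (ι y)
  have htr : ∀ᶠ y' in 𝓝 y, ι y' ∈ trivSet F V (ι y) :=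
    (ι.contMDiff y).continuousAt.eventually (trivSet_mem_nhds hbase)
  have hEn := fun b => CoordFrame.formComp_near (𝔛 := 𝔶) 𝔶.mem
    (mem_trivSet_pullback (ι := ι) hbase) (hE y) b
  have hdiv := CoordFrame.trivAt_divOneForm (A := Abar) (𝔛 := 𝔶) (θ := fun y' v z' => E y' v z')
    hgS 𝔶.mem (mem_trivSet_pullback (ι := ι) hbase) hEn (by
      filter_upwards [𝔶.eventually_mem, htr] with y' hy' hy'' v z
      exact 𝔶.trivAt_form hy' (mem_trivSet_pullback hy'') v z) (symAt F (ι y) (ι y) f : V (ι y))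
  have hsym : trivAt F (V := ι *ᵖ V) y y (symAt F (ι y) (ι y) f : V (ι y)) = f := trivAt_symAt hbase f
  rw [hsym] at hdiv
  refine Eq.trans ?_ (congrArg Neg.neg hdiv.symm)
  rw [← _root_.neg_apply]
  congr 1
  rw [sum_eq_zero_add_tail, ← Finset.sum_neg_distrib]
  have hz : 𝔛.covFun (𝔛.connCoef A) 0 (fun x => 𝔛.vol g.form x • (𝔛.P g.form 0 0 x •
      ∑ c, 𝔛.P g.form 0 c x • 𝔛.formComp F K c x - 𝔛.P g.form 0 0 x •
      ∑ c, 𝔛.P g.form 0 c x • 𝔛.formComp F K c x)) (ι y) = 0 := by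
    simp only [sub_self, smul_zero, CoordFrame.covFun, CoordFrame.D, fieldDeriv, mvfderiv_const]
    simp
  rw [hz, zero_add]
  refine Finset.sum_congr rfl fun i _ => ?_
  set b : M → F →L[ℝ] F := fun x => 𝔛.vol g.form x • (𝔛.P g.form (tail i) 0 x •
      ∑ c, 𝔛.P g.form 0 c x • 𝔛.formComp F K c x - 𝔛.P g.form 0 0 x •
      ∑ c, 𝔛.P g.form (tail i) c x • 𝔛.formComp F K c x) with hb
  have hPn := fun i j => CoordFrame.P_near (𝔛 := 𝔛) hg 𝔛.mem i j
  have hKn := fun c => CoordFrame.formComp_near 𝔛.mem hbase (hK (ι y)) c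
  have hbn : SmoothNear (𝓡∂ d) b (ι y) := (CoordFrame.vol_near hg 𝔛.mem).smul
    (((hPn _ _).smul (SmoothNear.sum fun c _ => (hPn _ _).smul (hKn c))).sub
      ((hPn _ _).smul (SmoothNear.sum fun c _ => (hPn _ _).smul (hKn c))))
  set t : S → F →L[ℝ] F := fun y' => ∑ e, (𝔶.vol (boundaryForm ι g) * 𝔶.P (boundaryForm ι g) i e) y' •
    𝔶.formComp F E e y' with ht
  have hbt : (fun y' => b (ι y')) =ᶠ[𝓝 y] fun y' => -t y' := by
    filter_upwards [𝔶.eventually_mem, htr] with y' hy' hy''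
    have hxU := hU y' hy'
    have hae : ∀ k, 𝔛.formComp F K (tail k) (ι y') =
        (Real.sqrt (𝔛.P g.form 0 0 (ι y')))⁻¹ • 𝔶.formComp F E k y' := fun k => by
      ext f
      have h1 := hKE y' (𝔶.X k y') (symAt F (ι y) (ι y') f)
      rw [gradSq_eq_P hg h0 hxU, hpush y' hy'] at h1
      exact (congrArg (trivAt F (ι y) (ι y') : V (ι y') →L[ℝ] F) h1).trans
        ((trivAt F (ι y) (ι y') : V (ι y') →L[ℝ] F).map_smul (Real.sqrt (𝔛.P g.form 0 0 (ι y')))⁻¹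
          (E y' (𝔶.X k y') (symAt F (ι y) (ι y') f : V (ι y')) : V (ι y'))) |>.trans
        (congrArg ((Real.sqrt (𝔛.P g.form 0 0 (ι y')))⁻¹ • ·)
          (congrArg (fun z => trivAt F (V := ι *ᵖ V) y y' (E y' (𝔶.X k y') z))
            (symAt_pullback hy'' f).symm))
    refine (normal_flux_boundary (P := fun i j => 𝔛.P g.form i j (ι y')) (𝔛.vol g.form (ι y'))
      (CoordFrame.P_pos hg hxU 0) hae i).trans ?_
    rw [ht, ← Finset.smul_sum, neg_one_smul]
    congr 1
    refine Finset.sum_congr rfl fun k _ => ?_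
    rw [Pi.mul_apply, vol_boundaryForm hxU (hpush y' hy'), P_boundaryForm hxU (hpush y' hy')]
  have hD : 𝔛.D (tail i) b (ι y) = -𝔶.D i t y := by
    have h1 : 𝔛.D (tail i) b (ι y) = mvfderiv (𝓡 (d - 1)) (fun y' => b (ι y')) y (𝔶.X i y) := by
      rw [mvfderiv_comp_inclusion hbn.mdiff, hpush y 𝔶.mem]
      rfl
    have h2 := (fieldDeriv_congr (X := 𝔶.X i) hbt).self_of_nhds
    exact (h1.trans h2).trans (congrArg (fun L : TangentSpace (𝓡 (d - 1)) y →L[ℝ] F →L[ℝ] F => L (𝔶.X i y))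
      (mvfderiv_neg (I := 𝓡 (d - 1)) (g := t) (x := y)))
  have hbty : b (ι y) = -t y := hbt.self_of_nhds
  rw [CoordFrame.covFun, CoordFrame.covFun, hD, hbty,
    connCoef_boundary hAbar hbase (hpush y 𝔶.mem i), mul_neg, neg_mul]
  abel

set_option maxHeartbeats 1000000 in
/-- The Gauss law makes the normal component of the current vanish at the next order. -/
theorem normal_eq_zero_of_gaussLaw (hι : IsBoundaryInclusion ι) (hσ : IsDefining (d := d) σ)
    (hA : A.ContMDiffCovariantDerivative ∞) (hAbar : HasBoundaryCondition ι A Abar) {q : ℕ}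
    (hq : (d : ℝ) - 4 = q) {K₁ K' : EndForm (𝓡∂ d) V} (hK₁ : ∀ x, SmoothFormNear F K₁ x)
    (hAK : ∀ x v z, current A g.form σ x v z = σ x ^ (q + 1) • K₁ x v z)
    (hK : ∀ x, SmoothFormNear F K x) (hE : ∀ y, SmoothFormNear F E y)
    (hKE : ∀ (y : S) (v : TangentSpace (𝓡 (d - 1)) y) (z : V (ι y)),
        K (ι y) (pushVec ι v) z = (Real.sqrt (gradSq g.form σ (ι y)))⁻¹ • E y v z)
    (hgauss : ∀ (y : S) (z : V (ι y)),
      divOneForm Abar (boundaryForm ι g) (fun y' v z' => E y' v z') y z =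
        (1 / ((d : ℝ) - 3)) • K₁ (ι y) (unitNormal g.form σ (ι y)) z)
    (hK' : ∀ x, SmoothFormNear F K' x)
    (hAK' : ∀ x v z, current (addForm A (smulForm (fun x => σ x ^ (q + 1)) K)) g.form σ x v z =
      σ x ^ (q + 1) • K' x v z) (y : S) : K' (ι y) (gradient g.form σ (ι y)) = 0 := by
  have := hι.t2Space
  have hg := g.isSmoothMetric
  have hbase := mem_trivSet (F := F) (V := V) (ι y)
  obtain ⟨𝔛, h0⟩ := hσ.exists_frame (hι.mem y)
  obtain ⟨𝔶, h𝔶, hU, hpush⟩ := hι.exists_frame hσ 𝔛 h0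
  have hA' : (addForm A (smulForm (fun x => σ x ^ (q + 1)) K)).ContMDiffCovariantDerivative ∞ :=
    addForm_contMDiff hA fun x => .smulForm ((hσ.near x).pow (q + 1)) (hK x)
  have hk := (𝔛.current_germ_iff hg hA (hσ.near _) hq (hK₁ _) (q + 1)).1 (.of_forall hAK)
  have hk' := (𝔛.current_germ_iff hg hA' (hσ.near _) hq (hK' _) (q + 1)).1 (.of_forall hAK')
  have hΓ : 𝔛.connGerm hA' = fun i => 𝔛.connGerm hA i +
      hσ.germ (ι y) ^ (q + 1) • 𝔛.formGerm (hK (ι y)) i :=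
    funext fun i => 𝔛.connGerm_addForm hA (hσ.near _) (hK _) (q + 1) hA' i
  simp only [CoordFrame.curGerm, hΓ] at hk hk'
  obtain ⟨Y, hY⟩ := (𝔛.diffAlg (F →L[ℝ] F)).normal_cur_add_critical isUnit_two_germ
    hσ.smul_germ_eq_zero q hk hk'
  obtain ⟨w, -, hw⟩ := exists_isRep Y
  have hP := fun a b => isRep_toGerm _ (CoordFrame.P_near (𝔛 := 𝔛) hg 𝔛.mem a b)
  have hform : ∀ {K : EndForm (𝓡∂ d) V} (hK : SmoothFormNear F K (ι y)) i,
      IsRep (𝔛.formGerm hK i) (𝔛.formComp F K i) := fun hK i => isRep_toGerm _ _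
  have hvol := isRep_toGerm _ (CoordFrame.vol_near (𝔛 := 𝔛) hg 𝔛.mem)
  have hd1 : ∀ f : Fin d → smoothGerms (𝓡∂ d) (ι y) (F →L[ℝ] F),
      ∑ b, (𝔛.diffAlg (F →L[ℝ] F)).dR b (hσ.germ (ι y)) • f b = f 0 := fun f => by
    simp [hσ.dR_germ h0]
  have hd2 : ∀ i, (𝔛.diffAlg (F →L[ℝ] F)).grad (𝔛.PGerm hg) (hσ.germ (ι y)) i = 𝔛.PGerm hg i 0 :=
    fun i => by simp [grad, hσ.dR_germ h0]
  rw [hd1, hd1, hσ.normSq_germ h0 hg, hσ.normalPart_germ hg h0] at hY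
  simp only [hd2] at hY
  have hrep := ((hvol.smul (CoordFrame.isRep_raise hP (hform (hK' (ι y))) 0)).eq_iff
    (((hvol.smul (CoordFrame.isRep_raise hP (hform (hK₁ (ι y))) 0)).add
      ((IsRep.natCast (q + 1)).smul (IsRep.sum fun i _ => 𝔛.isRep_cov
        (fun i => isRep_toGerm _ (CoordFrame.connCoef_near hA 𝔛.mem hbase i)) i
        (hvol.smul (((hP i 0).smul (CoordFrame.isRep_raise hP (hform (hK (ι y))) 0)).sub
          ((hP 0 0).smul (CoordFrame.isRep_raise hP (hform (hK (ι y))) i))))))).add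
      ((isRep_toGerm _ (hσ.near _)).smul hw))).1 hY |>.self_of_nhds
  simp only [(hσ.zero_iff _).2 (hι.mem y), zero_smul, add_zero] at hrep
  rw [CoordFrame.gradient_form_eq_zero_iff hg h0 𝔛.mem hbase]
  have hv := CoordFrame.vol_pos hg 𝔛.mem
  have hP0 := CoordFrame.P_pos hg 𝔛.mem 0
  have hr := Real.sqrt_pos.2 hP0
  have hq0 : ((q : ℝ) + 1) ≠ 0 := by positivity
  refine (smul_eq_zero_iff_right hv.ne').1 (hrep.trans ?_)
  ext f
  have hdiv := sum_covFun_normal_flux hι hσ hAbar hK hE hKE h0 hU hpush f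
  have hgs := hgauss y (symAt F (ι y) (ι y) f)
  have hnor : trivAt F (ι y) (ι y) (K₁ (ι y) (unitNormal g.form σ (ι y)) (symAt F (ι y) (ι y) f)) =
      (Real.sqrt (𝔛.P g.form 0 0 (ι y)))⁻¹ •
        (∑ c, 𝔛.P g.form 0 c (ι y) • 𝔛.formComp F K₁ c (ι y)) f := by
    have h1 : K₁ (ι y) (unitNormal g.form σ (ι y)) (symAt F (ι y) (ι y) f) =
        (Real.sqrt (𝔛.P g.form 0 0 (ι y)))⁻¹ •
          K₁ (ι y) (gradient g.form σ (ι y)) (symAt F (ι y) (ι y) f) := by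
      rw [← gradSq_eq_P hg h0 𝔛.mem]
      exact congrArg (fun L : V (ι y) →L[ℝ] V (ι y) => L (symAt F (ι y) (ι y) f))
        ((K₁ (ι y)).map_smul _ _)
    rw [h1]
    refine ((trivAt F (ι y) (ι y) : V (ι y) →L[ℝ] F).map_smul _ _).trans ?_
    rw [CoordFrame.trivAt_form_gradient hg h0 𝔛.mem hbase, trivAt_symAt hbase]
  have hgs' : trivAt F (ι y) (ι y) (divOneForm Abar (boundaryForm ι g)
      (fun y' v z' => E y' v z') y (symAt F (ι y) (ι y) f : V (ι y)) : V (ι y)) =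
      (1 / ((d : ℝ) - 3)) • (Real.sqrt (𝔛.P g.form 0 0 (ι y)))⁻¹ •
        (∑ c, 𝔛.P g.form 0 c (ι y) • 𝔛.formComp F K₁ c (ι y)) f := by
    rw [hgs, ← hnor]
    exact (trivAt F (ι y) (ι y) : V (ι y) →L[ℝ] F).map_smul _ _
  rw [hgs', vol_boundaryForm 𝔛.mem (hpush y 𝔶.mem)] at hdiv
  rw [_root_.add_apply, _root_.smul_apply, _root_.smul_apply, hdiv,
    show (d : ℝ) - 3 = q + 1 by linarith]
  generalize (∑ c, 𝔛.P g.form 0 c (ι y) • 𝔛.formComp F K₁ c (ι y)) f = N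
  push_cast
  change _ = (0 : F)
  match_scalars
  field_simp
  ring

end GaussLaw

end YangMills

end

noncomputable section

set_option linter.unusedSectionVars false

namespace YangMills

/-! ### Improving the order of vanishing of the current -/

section Improvement

open Filter Topology Module DiffAlg

variable {d : ℕ} [NeZero d]
  {M : Type*} [TopologicalSpace M] [ChartedSpace (EuclideanHalfSpace d) M]
  [IsManifold (𝓡∂ d) ∞ M] [T2Space M] [SigmaCompactSpace M]
  {F : Type*} [NormedAddCommGroup F] [NormedSpace ℝ F] [FiniteDimensional ℝ F]
  {V : M → Type*} [TopologicalSpace (TotalSpace F V)]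
  [∀ x, AddCommGroup (V x)] [∀ x, Module ℝ (V x)] [∀ x, TopologicalSpace (V x)]
  [∀ x, IsTopologicalAddGroup (V x)] [∀ x, ContinuousSMul ℝ (V x)]
  [FiberBundle F V] [VectorBundle ℝ F V] [ContMDiffVectorBundle ∞ F V (𝓡∂ d)]
  {σ : M → ℝ} {g : Π x : M, TangentSpace (𝓡∂ d) x → TangentSpace (𝓡∂ d) x → ℝ}
  {A : CovariantDerivative (𝓡∂ d) F V} {q : ℕ}

omit [SigmaCompactSpace M] in
lemma CoordFrame.formGerm_smulForm {p : M} {κ : Type*} [Fintype κ] [DecidableEq κ]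
    {𝔛 : CoordFrame (𝓡∂ d) p κ} {f : M → ℝ} (hf : SmoothNear (𝓡∂ d) f p) {K : EndForm (𝓡∂ d) V}
    (hK : SmoothFormNear F K p) (hfK : SmoothFormNear F (smulForm f K) p) (i : κ) :
    𝔛.formGerm hfK i = toGerm f hf • 𝔛.formGerm hK i := by
  refine (isRep_toGerm _ _).eq_of ((isRep_toGerm _ _).smul (isRep_toGerm _ _))
    (.of_forall fun x => ?_)
  ext z
  exact (trivAt F p x : V x →L[ℝ] F).map_smul _ _

/-- If the germs of the current at the boundary are divisible by a power of the defining function,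
then so is the current. -/
lemma exists_form_of_boundary (hg : IsSmoothMetric g) (hσ : IsDefining (d := d) σ)
    (hA : A.ContMDiffCovariantDerivative ∞) (hq : (d : ℝ) - 4 = q) {ℓ : ℕ}
    (h : ∀ p ∈ (𝓡∂ d).boundary M, ∀ 𝔛 : CoordFrame (𝓡∂ d) p (Fin d), 𝔛.coord 0 = σ →
      ∀ b, ∃ Y, 𝔛.curGerm hg hA (hσ.near p) q b = hσ.germ p ^ ℓ • Y) :
    ∃ K : EndForm (𝓡∂ d) V, (∀ x, SmoothFormNear F K x) ∧
      ∀ x w z, current A g σ x w z = σ x ^ ℓ • K x w z := by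
  refine exists_form_of_local fun p => ?_
  by_cases hp : σ p = 0
  · obtain ⟨𝔛, h0⟩ := hσ.exists_frame ((hσ.zero_iff p).1 hp)
    exact 𝔛.exists_form_of_curGerm hg hA (hσ.near p) hq (h p ((hσ.zero_iff p).1 hp) 𝔛 h0)
  · exact exists_form_of_ne_zero hg hA hq (hσ.near p) hp ℓ

set_option maxHeartbeats 1000000 in
theorem exists_improvement (hg : IsSmoothMetric g) (hσ : IsDefining (d := d) σ)
    (hσ0 : ∀ x, 0 ≤ σ x) (hA : A.ContMDiffCovariantDerivative ∞) (hq : (d : ℝ) - 4 = q) {p : ℕ}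
    (hpq : q + 1 ≤ p) {K : EndForm (𝓡∂ d) V} (hK : ∀ x, SmoothFormNear F K x)
    (hAK : ∀ x v z, current A g σ x v z = σ x ^ p • K x v z)
    (hn : p = q + 1 → ∀ x ∈ (𝓡∂ d).boundary M, K x (gradient g σ x) = 0) :
    ∃ a : EndForm (𝓡∂ d) V, (∀ x, SmoothFormNear F a x) ∧
      ∃ K' : EndForm (𝓡∂ d) V, (∀ x, SmoothFormNear F K' x) ∧
        ∀ x v z, current (addForm A (smulForm (fun x => σ x ^ (p + 1)) a)) g σ x v z =
          σ x ^ (p + 1) • K' x v z := by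
  have hpos : ∀ x, 0 < gradSq g σ x + σ x := fun x => by
    by_cases hx : σ x = 0
    · rw [hx, add_zero]
      exact hσ.gradSq_pos hg ((hσ.zero_iff x).1 hx)
    · exact add_pos_of_nonneg_of_pos (gradSq_nonneg hg σ x) (lt_of_le_of_ne (hσ0 x) (Ne.symm hx))
  set u : M → ℝ := fun x => (gradSq g σ x + σ x)⁻¹ with hu
  set c : ℝ := -(((p + 1 : ℕ) : ℝ) * ((p : ℝ) - q))⁻¹ with hc
  have hpq' : (p : ℝ) - q ≠ 0 := sub_ne_zero.2 (by exact_mod_cast (by omega : p ≠ q))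
  have hun : ∀ x, SmoothNear (𝓡∂ d) u x := fun x =>
    ((gradSq_near hg (hσ.near x) (chartFrame x)).add (hσ.near x)).inv (hpos x).ne'
  have hcn : ∀ x : M, SmoothNear (𝓡∂ d) (fun _ : M => c) x := fun x => .const c
  have hcun : ∀ x, SmoothNear (𝓡∂ d) (fun y => c • u y) x := fun x => (hcn x).smul (hun x)
  have ha : ∀ x, SmoothFormNear F (smulForm (fun y => c • u y) K) x := fun x =>
    .smulForm (hcun x) (hK x)
  have hA' : (addForm A (smulForm (fun x => σ x ^ (p + 1))
      (smulForm (fun y => c • u y) K))).ContMDiffCovariantDerivative ∞ :=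
    addForm_contMDiff hA fun x => .smulForm ((hσ.near x).pow (p + 1)) (ha x)
  refine ⟨_, ha, exists_form_of_boundary hg hσ hA' hq fun x hx 𝔛 h0 b => ?_⟩
  have hk := (𝔛.current_germ_iff hg hA (hσ.near _) hq (hK _) p).1 (.of_forall hAK)
  have hΓ : 𝔛.connGerm hA' = fun i => 𝔛.connGerm hA i + hσ.germ x ^ (p + 1) •
      (toGerm (fun _ => c) (hcn x) * toGerm u (hun x)) • 𝔛.formGerm (hK x) i := by
    funext i
    rw [𝔛.connGerm_addForm hA (hσ.near _) (ha _) (p + 1) hA' i,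
      CoordFrame.formGerm_smulForm (hcun x) (hK x)]
    rfl
  rw [CoordFrame.curGerm, hΓ]
  refine (𝔛.diffAlg (F →L[ℝ] F)).cur_improve hk ?_ ?_ ?_ b
  · rcases hpq.eq_or_lt with h | h
    · exact (hσ.exists_normalPart_iff hg h0 hx (hK x)).2 (.of_forall (hn h.symm))
    · exact (𝔛.diffAlg (F →L[ℝ] F)).normalPart_of_cur isUnit_two_germ (CoordFrame.PGerm_symm hg)
        hσ.smul_germ_eq_zero (𝔛.isUnit_volGerm hg) (isUnit_natCast_sub_germ (by omega)) hk
  · exact ((isRep_toGerm _ _).mul ((isRep_normSq hg (hσ.near x) 𝔛).add (isRep_toGerm _ _))).eq_of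
      IsRep.one (.of_forall fun y => inv_mul_cancel₀ (hpos y).ne')
  · refine ((isRep_toGerm _ _).mul ((IsRep.natCast _).mul ((IsRep.natCast _).sub
      (IsRep.natCast _)))).eq_of (g := fun _ => -1) ?_ (.of_forall fun y => ?_)
    · exact (isRep_toGerm (fun _ : M => (-1 : ℝ)) (.const _))
    · have : ((p + 1 : ℕ) : ℝ) ≠ 0 := by positivity
      rw [hc, neg_mul, inv_mul_cancel₀ (mul_ne_zero this hpq')]

omit [T2Space M] [SigmaCompactSpace M] in
lemma addForm_addForm (A : CovariantDerivative (𝓡∂ d) F V) (B C : EndForm (𝓡∂ d) V) :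
    addForm (addForm A B) C = addForm A (B + C) := by
  have h : (addForm (addForm A B) C).toFun = (addForm A (B + C)).toFun := by
    funext s x
    ext v
    exact add_assoc (A s x v) (B x v (s x)) (C x v (s x))
  unfold addForm at h ⊢
  simp only [CovariantDerivative.mk.injEq]
  exact h

omit [T2Space M] [SigmaCompactSpace M] in
lemma addForm_zero (A : CovariantDerivative (𝓡∂ d) F V) : addForm A 0 = A := by
  have h : (addForm A 0).toFun = A.toFun := by
    funext s x
    ext v
    exact add_zero (A s x v)
  obtain ⟨f, hf⟩ := A
  unfold addForm at h ⊢
  simp only [CovariantDerivative.mk.injEq]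
  exact h

omit [SigmaCompactSpace M] in
lemma SmoothFormNear.add {B C : EndForm (𝓡∂ d) V} {x : M} (hB : SmoothFormNear F B x)
    (hC : SmoothFormNear F C x) : SmoothFormNear F (B + C) x := by
  filter_upwards [hB, hC] with y h1 h2
  exact ContMDiffAt.add_section h1 h2

set_option synthInstance.maxHeartbeats 400000 in
omit [T2Space M] [SigmaCompactSpace M] in
lemma smoothFormNear_zero (x : M) : SmoothFormNear F (0 : EndForm (𝓡∂ d) V) x :=
  .of_forall fun y => contMDiff_zeroSection ℝ _ y

omit [T2Space M] [SigmaCompactSpace M] in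
lemma smulForm_zero (f : M → ℝ) : smulForm f (0 : EndForm (𝓡∂ d) V) = 0 :=
  funext fun x => smul_zero (A := TangentSpace (𝓡∂ d) x →L[ℝ] V x →L[ℝ] V x) (f x)

/-- The partial sums of the formal power series `∑ σ ^ i a_i`. -/
def powerSum (σ : M → ℝ) (a : ℕ → EndForm (𝓡∂ d) V) : ℕ → EndForm (𝓡∂ d) V
  | 0 => 0
  | n + 1 => powerSum σ a n + smulForm (fun x => σ x ^ n) (a n)

omit [SigmaCompactSpace M] in
lemma powerSum_smooth (hσ : IsDefining (d := d) σ) {a : ℕ → EndForm (𝓡∂ d) V}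
    (ha : ∀ n x, SmoothFormNear F (a n) x) (n : ℕ) (x : M) :
    SmoothFormNear F (powerSum σ a n) x := by
  induction n with
  | zero => exact smoothFormNear_zero x
  | succ n ih => exact ih.add (.smulForm ((hσ.near x).pow n) (ha n x))

omit [T2Space M] [SigmaCompactSpace M] in
lemma smulForm_add (f : M → ℝ) (B C : EndForm (𝓡∂ d) V) :
    smulForm f (B + C) = smulForm f B + smulForm f C := funext fun x => smul_add (f x) (B x) (C x)

omit [T2Space M] [SigmaCompactSpace M] in
lemma smulForm_pow_pow (m n : ℕ) (B : EndForm (𝓡∂ d) V) :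
    smulForm (fun x => σ x ^ m) (smulForm (fun x => σ x ^ n) B) =
      smulForm (fun x => σ x ^ (m + n)) B := funext fun x => by
  change σ x ^ m • σ x ^ n • B x = σ x ^ (m + n) • B x
  rw [smul_smul, pow_add]

/-- Iterated improvement: a sequence of one-forms whose partial sums solve the equation to
increasing orders. -/
theorem exists_formal_solution (hg : IsSmoothMetric g) (hσ : IsDefining (d := d) σ)
    (hσ0 : ∀ x, 0 ≤ σ x) (hA : A.ContMDiffCovariantDerivative ∞) (hq : (d : ℝ) - 4 = q)
    {K : EndForm (𝓡∂ d) V} (hK : ∀ x, SmoothFormNear F K x)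
    (hAK : ∀ x v z, current A g σ x v z = σ x ^ (q + 1) • K x v z)
    (hn : ∀ x ∈ (𝓡∂ d).boundary M, K x (gradient g σ x) = 0) :
    ∃ a : ℕ → EndForm (𝓡∂ d) V, (∀ n x, SmoothFormNear F (a n) x) ∧
      ∀ n, ∃ K' : EndForm (𝓡∂ d) V, (∀ x, SmoothFormNear F K' x) ∧
        ∀ x v z, current (addForm A (smulForm (fun x => σ x ^ (q + 2))
          (powerSum σ a n))) g σ x v z = σ x ^ (q + 1 + n) • K' x v z := by
  let Good : ℕ → EndForm (𝓡∂ d) V → Prop := fun n B => (∀ x, SmoothFormNear F B x) ∧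
    ∃ K' : EndForm (𝓡∂ d) V, (∀ x, SmoothFormNear F K' x) ∧
      (∀ x v z, current (addForm A B) g σ x v z = σ x ^ (q + 1 + n) • K' x v z) ∧
      (n = 0 → ∀ x ∈ (𝓡∂ d).boundary M, K' x (gradient g σ x) = 0)
  have step : ∀ n B, ∃ a : EndForm (𝓡∂ d) V, Good n B → (∀ x, SmoothFormNear F a x) ∧
      Good (n + 1) (B + smulForm (fun x => σ x ^ (q + 2 + n)) a) := by
    intro n B
    by_cases h : Good n B
    swap
    · exact ⟨0, fun h' => absurd h' h⟩
    obtain ⟨hB, K', hK', hAK', hn'⟩ := h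
    obtain ⟨a, ha, K'', hK'', hAK''⟩ := exists_improvement hg hσ hσ0 (addForm_contMDiff hA hB) hq
      (by omega : q + 1 ≤ q + 1 + n) hK' hAK' (fun h => hn' (by omega))
    refine ⟨a, fun _ => ⟨ha, fun x => (hB x).add (.smulForm ((hσ.near x).pow _) (ha x)),
      K'', hK'', ?_, by omega⟩⟩
    rw [addForm_addForm] at hAK''
    rwa [show q + 2 + n = q + 1 + n + 1 by omega, show q + 1 + (n + 1) = q + 1 + n + 1 by omega]
  choose next hnext using step
  let b : ℕ → EndForm (𝓡∂ d) V := fun n => Nat.rec 0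
    (fun n B => B + smulForm (fun x => σ x ^ (q + 2 + n)) (next n B)) n
  have hb : ∀ n, Good n (b n) := by
    intro n
    induction n with
    | zero =>
      refine ⟨smoothFormNear_zero, K, hK, ?_, fun _ => hn⟩
      rwa [show b 0 = 0 from rfl, addForm_zero]
    | succ n ih => exact (hnext n (b n) ih).2
  refine ⟨fun n => next n (b n), fun n => (hnext n (b n) (hb n)).1, fun n => ?_⟩
  have hs : ∀ n, b n = smulForm (fun x => σ x ^ (q + 2)) (powerSum σ (fun n => next n (b n)) n) := by
    intro n
    induction n with
    | zero => exact (smulForm_zero _).symm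
    | succ n ih => rw [powerSum, smulForm_add, smulForm_pow_pow, ← ih]
  obtain ⟨-, K', hK', hAK', -⟩ := hb n
  exact ⟨K', hK', by rw [← hs]; exact hAK'⟩

end Improvement

end YangMills

end

noncomputable section

set_option linter.unusedSectionVars false

namespace YangMills

/-! ### Borel summation of one-forms -/

section BorelForms

open Filter Topology Module DiffAlg

lemma zero_eq_add_smul_neg_inv {W : Type*} [AddCommGroup W] [Module ℝ W] {s : ℝ} (hs : s ≠ 0)
    (w : W) : 0 = w + s • -s⁻¹ • w := by
  rw [smul_smul, mul_neg, mul_inv_cancel₀ hs, neg_one_smul, add_neg_cancel]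

lemma sum_smul_eq_add_smul {t W : Type*} [Fintype t] [AddCommGroup W] [Module ℝ W] {ρ : t → ℝ}
    {C b : t → W} {T : W} {s : ℝ} (h1 : ∑ i, ρ i = 1) (h : ∀ i, ρ i ≠ 0 → C i = T + s • b i) :
    ∑ i, ρ i • C i = T + s • ∑ i, ρ i • b i := by
  have h2 : ∀ i, ρ i • C i = ρ i • T + s • ρ i • b i := fun i => by
    by_cases hi : ρ i = 0
    · simp [hi]
    · rw [h i hi, smul_comm s, ← smul_add]
  rw [Finset.sum_congr rfl fun i _ => h2 i, Finset.sum_add_distrib, ← Finset.sum_smul, h1, one_smul,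
    Finset.smul_sum]

variable {d : ℕ} [NeZero d]
  {M : Type*} [TopologicalSpace M] [ChartedSpace (EuclideanHalfSpace d) M]
  [IsManifold (𝓡∂ d) ∞ M] [T2Space M]
  {F : Type*} [NormedAddCommGroup F] [NormedSpace ℝ F] [FiniteDimensional ℝ F]
  {V : M → Type*} [TopologicalSpace (TotalSpace F V)]
  [∀ x, AddCommGroup (V x)] [∀ x, Module ℝ (V x)] [∀ x, TopologicalSpace (V x)]
  [∀ x, IsTopologicalAddGroup (V x)] [∀ x, ContinuousSMul ℝ (V x)]
  [FiberBundle F V] [VectorBundle ℝ F V] [ContMDiffVectorBundle ∞ F V (𝓡∂ d)]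
  {σ : M → ℝ} {a : ℕ → EndForm (𝓡∂ d) V}

lemma formComp_powerSum {p : M} {κ : Type*} [Fintype κ] [DecidableEq κ] (𝔛 : CoordFrame (𝓡∂ d) p κ)
    (n : ℕ) (b : κ) (x : M) : 𝔛.formComp F (powerSum σ a n) b x =
      ∑ i ∈ Finset.range n, σ x ^ i • 𝔛.formComp F (a i) b x := by
  induction n with
  | zero =>
    ext z
    exact (trivAt F p x : V x →L[ℝ] F).map_zero
  | succ n ih =>
    rw [Finset.sum_range_succ, ← ih]
    ext z
    refine ((trivAt F p x : V x →L[ℝ] F).map_add _ _).trans ?_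
    exact congrArg (_ + ·) ((trivAt F p x : V x →L[ℝ] F).map_smul _ _)

/-- Local Borel summation. -/
lemma exists_local_borel (hσ : IsDefining (d := d) σ) (ha : ∀ n x, SmoothFormNear F (a n) x)
    (p : M) : ∃ (C : EndForm (𝓡∂ d) V) (U : Set M), IsOpen U ∧ p ∈ U ∧
      (∀ x ∈ U, SmoothFormNear F C x) ∧
      ∀ n, ∃ b : EndForm (𝓡∂ d) V, (∀ x ∈ U, SmoothFormNear F b x) ∧
        ∀ x ∈ U, C x = (powerSum σ a n + smulForm (fun x => σ x ^ n) b) x := by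
  by_cases hp : σ p = 0
  swap
  · refine ⟨0, {x | σ x ≠ 0}, isOpen_ne_fun hσ.smooth.continuous continuous_const, hp,
      fun x _ => smoothFormNear_zero x, fun n =>
      ⟨smulForm (fun x => -(σ x ^ n)⁻¹) (powerSum σ a n), fun x hx => .smulForm
        (((hσ.near x).pow n).inv (pow_ne_zero n hx)).neg (powerSum_smooth hσ ha n x),
        fun x hx => ?_⟩⟩
    exact zero_eq_add_smul_neg_inv (W := TangentSpace (𝓡∂ d) x →L[ℝ] V x →L[ℝ] V x)
      (pow_ne_zero n hx) (powerSum σ a n x)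
  have hpb := (hσ.zero_iff p).1 hp
  obtain ⟨𝔛, h0⟩ := hσ.exists_frame hpb
  obtain ⟨Ω, hΩ, hΩp, hσΩ⟩ := hσ.exists_eq_bdef_mul hpb
  have hN : ∀ᶠ x in 𝓝 p, (SmoothNear (𝓡∂ d) Ω x ∧ Ω x ≠ 0 ∧ σ x = bdef d p x * Ω x) ∧
      x ∈ 𝔛.U ∧ x ∈ trivSet F V p :=
    (hΩ.eventually.and ((hΩ.contMDiffAt.continuousAt.eventually_ne hΩp).and hσΩ)).and
      (𝔛.eventually_mem.and (trivSet_mem_nhds (mem_trivSet p)))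
  obtain ⟨N, hN', hNo, hpN⟩ := eventually_nhds_iff.1 hN
  have hcomp : ∀ n, ∀ x ∈ N, ∀ b, SmoothNear (𝓡∂ d) (𝔛.formComp F (a n) b) x := fun n x hx b =>
    CoordFrame.formComp_near (hN' x hx).2.1 (hN' x hx).2.2 (ha n x) b
  obtain ⟨G, U, hU, hpU, hG, hGn⟩ := exists_bdef_expansion hpb (hNo.mem_nhds hpN)
    (W := Fin d → F →L[ℝ] F) (f := fun n x b => Ω x ^ n • 𝔛.formComp F (a n) b x)
    (fun n x hx => contMDiffAt_pi_space.2 fun b =>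
      (((hN' x hx).1.1.pow n).smul (hcomp n x hx b)).contMDiffAt)
  have hnear : ∀ {h : M → Fin d → F →L[ℝ] F}, (∀ x ∈ U, ContMDiffAt (𝓡∂ d)
      𝓘(ℝ, Fin d → F →L[ℝ] F) ∞ h x) → ∀ x ∈ U, ∀ b, SmoothNear (𝓡∂ d) (fun x => h x b) x :=
    fun hh x hx b => by
      filter_upwards [hU.mem_nhds hx] with y hy using contMDiffAt_pi_space.1 (hh y hy) b
  refine ⟨𝔛.formOf V fun b x => G x b, U ∩ N, hU.inter hNo, ⟨hpU, hpN⟩, fun x hx =>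
    CoordFrame.formOf_near (hN' x hx.2).2.1 (hN' x hx.2).2.2 (hnear hG x hx.1), fun n => ?_⟩
  obtain ⟨h, hh, hGh⟩ := hGn n
  refine ⟨smulForm (fun x => (Ω x ^ n)⁻¹) (𝔛.formOf V fun b x => h x b), fun x hx => .smulForm
    (((hN' x hx.2).1.1.pow n).inv (pow_ne_zero n (hN' x hx.2).1.2.1))
    (CoordFrame.formOf_near (hN' x hx.2).2.1 (hN' x hx.2).2.2 (hnear hh x hx.1)), fun x hx => ?_⟩
  obtain ⟨⟨-, hΩx, hσx⟩, hxU, hxt⟩ := hN' x hx.2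
  refine 𝔛.form_ext hxU hxt fun b => ?_
  have e : 𝔛.formComp F (powerSum σ a n + smulForm (fun x => σ x ^ n)
      (smulForm (fun x => (Ω x ^ n)⁻¹) (𝔛.formOf V fun b x => h x b))) b x =
      𝔛.formComp F (powerSum σ a n) b x +
        σ x ^ n • (Ω x ^ n)⁻¹ • 𝔛.formComp F (𝔛.formOf V fun b x => h x b) b x := by
    ext z
    refine ((trivAt F p x : V x →L[ℝ] F).map_add _ _).trans (congrArg (_ + ·) ?_)
    refine ((trivAt F p x : V x →L[ℝ] F).map_smul _ _).trans (congrArg (σ x ^ n • ·) ?_)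
    exact (trivAt F p x : V x →L[ℝ] F).map_smul _ _
  rw [e, CoordFrame.formComp_formOf hxU hxt, CoordFrame.formComp_formOf hxU hxt, formComp_powerSum,
    hGh x hx.1, hσx]
  simp only [Pi.add_apply, Finset.sum_apply, Pi.smul_apply, smul_smul, mul_pow]
  rw [mul_assoc, mul_inv_cancel₀ (pow_ne_zero n hΩx), mul_one]

set_option synthInstance.maxHeartbeats 400000 in
lemma smoothFormNear_smulForm_of_tsupport {ρ : M → ℝ} (hρ : ContMDiff (𝓡∂ d) 𝓘(ℝ, ℝ) ∞ ρ)
    {U : Set M} (hs : tsupport ρ ⊆ U) {K : EndForm (𝓡∂ d) V}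
    (hK : ∀ x ∈ U, SmoothFormNear F K x) (x : M) : SmoothFormNear F (smulForm ρ K) x := by
  by_cases hx : x ∈ U
  · exact .smulForm (.of_contMDiff hρ x) (hK x hx)
  · filter_upwards [(isClosed_tsupport ρ).isOpen_compl.mem_nhds fun h => hx (hs h)] with y hy
    refine (contMDiff_zeroSection ℝ (fun x : M => TangentSpace (𝓡∂ d) x →L[ℝ] V x →L[ℝ] V x)
      y).congr_of_eventuallyEq ?_
    filter_upwards [notMem_tsupport_iff_eventuallyEq.1 hy] with w hw
    exact congrArg (TotalSpace.mk' _ w) ((congrArg (· • K w) hw).trans (zero_smul ℝ (K w)))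

set_option synthInstance.maxHeartbeats 400000 in
/-- Borel summation of one-forms. -/
theorem exists_borel [CompactSpace M] (hσ : IsDefining (d := d) σ)
    (ha : ∀ n x, SmoothFormNear F (a n) x) :
    ∃ C : EndForm (𝓡∂ d) V, (∀ x, SmoothFormNear F C x) ∧
      ∀ n, ∃ b : EndForm (𝓡∂ d) V, (∀ x, SmoothFormNear F b x) ∧
        C = powerSum σ a n + smulForm (fun x => σ x ^ n) b := by
  choose C U hU hpU hC hb using exists_local_borel hσ ha
  choose b hb hCb using hb
  obtain ⟨t, ht⟩ := isCompact_univ.elim_finite_subcover U hU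
    (fun x _ => Set.mem_iUnion.2 ⟨x, hpU x⟩)
  obtain ⟨ρ, hρ⟩ := SmoothPartitionOfUnity.exists_isSubordinate (𝓡∂ d) isClosed_univ
    (fun i : t => U i) (fun i => hU i) (by
      intro x hx
      obtain ⟨i, hi, hxi⟩ := Set.mem_iUnion₂.1 (ht hx)
      exact Set.mem_iUnion.2 ⟨⟨i, hi⟩, hxi⟩)
  have hsm : ∀ B : M → EndForm (𝓡∂ d) V, (∀ i, ∀ x ∈ U i, SmoothFormNear F (B i) x) → ∀ x,
      SmoothFormNear F (fun x => ∑ i : t, ρ i x • B i x) x := fun B hB x => by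
    have h : ∀ i : t, SmoothFormNear F (smulForm (ρ i) (B i)) x := fun i =>
      smoothFormNear_smulForm_of_tsupport (ρ i).contMDiff (hρ i) (hB i) x
    filter_upwards [eventually_all.2 h] with y hy
    exact ContMDiffAt.sum_section fun i _ => hy i
  refine ⟨_, hsm C hC, fun n => ⟨_, hsm (fun p => b p n) fun i => hb i n, funext fun x => ?_⟩⟩
  have h1 : ∑ i : t, ρ i x = 1 := by
    rw [← finsum_eq_sum_of_fintype]
    exact ρ.sum_eq_one (Set.mem_univ x)
  exact sum_smul_eq_add_smul (W := TangentSpace (𝓡∂ d) x →L[ℝ] V x →L[ℝ] V x) h1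
    fun i hi => hCb i n x (hρ i (subset_tsupport _ hi))

end BorelForms

end YangMills

end

noncomputable section

set_option linter.unusedSectionVars false

namespace YangMills

/-! ### Solutions to infinite order -/

section InfiniteOrder

open Filter Topology Module DiffAlg

lemma DiffAlg.exists_cur_add_eq {κ R A : Type*} [CommRing R] [Ring A] [Algebra R A]
    (𝔇 : DiffAlg κ R A) [Fintype κ] {ρ : R} {P : κ → κ → R} {s : R} (q p : ℕ) {Γ K : κ → A}
    (a : κ → A) (hk : ∀ b, 𝔇.cur s q ρ P Γ b = s ^ p • K b) (b : κ) :
    ∃ Y : A, 𝔇.cur s q ρ P (fun i => Γ i + s ^ (p + 1) • a i) b = s ^ p • Y := by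
  obtain ⟨Y, hY⟩ := 𝔇.cur_add (ρ := ρ) (P := P) s q p Γ a b
  refine ⟨K b + (((p + 1 : ℕ) : R) * ((p : R) - q) * ρ) • (𝔇.normSq P s • raise P a b -
    𝔇.grad P s b • 𝔇.normalPart P s a) + s • Y, ?_⟩
  rw [hY, hk]
  module

variable {d : ℕ} [NeZero d]
  {M : Type*} [TopologicalSpace M] [ChartedSpace (EuclideanHalfSpace d) M]
  [IsManifold (𝓡∂ d) ∞ M] [T2Space M]
  {F : Type*} [NormedAddCommGroup F] [NormedSpace ℝ F] [FiniteDimensional ℝ F]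
  {V : M → Type*} [TopologicalSpace (TotalSpace F V)]
  [∀ x, AddCommGroup (V x)] [∀ x, Module ℝ (V x)] [∀ x, TopologicalSpace (V x)]
  [∀ x, IsTopologicalAddGroup (V x)] [∀ x, ContinuousSMul ℝ (V x)]
  [FiberBundle F V] [VectorBundle ℝ F V] [ContMDiffVectorBundle ∞ F V (𝓡∂ d)]
  {S : Type*} [TopologicalSpace S] [ChartedSpace (EuclideanSpace ℝ (Fin (d - 1))) S]
  [IsManifold (𝓡 (d - 1)) ∞ S] {ι : C^∞⟮𝓡 (d - 1), S; 𝓡∂ d, M⟯}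
  {σ : M → ℝ} {A : CovariantDerivative (𝓡∂ d) F V} {q : ℕ}

section Perturbation

variable {g : Π x : M, TangentSpace (𝓡∂ d) x → TangentSpace (𝓡∂ d) x → ℝ}
  [SigmaCompactSpace M]

/-- Perturbations of order `p + 1` do not destroy vanishing of the current to order `p`. -/
lemma exists_form_addForm (hg : IsSmoothMetric g) (hσ : IsDefining (d := d) σ)
    (hA : A.ContMDiffCovariantDerivative ∞) (hq : (d : ℝ) - 4 = q) {p : ℕ} {K b : EndForm (𝓡∂ d) V}
    (hK : ∀ x, SmoothFormNear F K x) (hAK : ∀ x v z, current A g σ x v z = σ x ^ p • K x v z)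
    (hb : ∀ x, SmoothFormNear F b x) :
    ∃ K' : EndForm (𝓡∂ d) V, (∀ x, SmoothFormNear F K' x) ∧
      ∀ x v z, current (addForm A (smulForm (fun x => σ x ^ (p + 1)) b)) g σ x v z =
        σ x ^ p • K' x v z := by
  have hA' : (addForm A (smulForm (fun x => σ x ^ (p + 1)) b)).ContMDiffCovariantDerivative ∞ :=
    addForm_contMDiff hA fun x => .smulForm ((hσ.near x).pow (p + 1)) (hb x)
  refine exists_form_of_boundary hg hσ hA' hq fun x hx 𝔛 h0 i => ?_
  have hk := (𝔛.current_germ_iff hg hA (hσ.near _) hq (hK _) p).1 (.of_forall hAK)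
  have hΓ : 𝔛.connGerm hA' = fun i => 𝔛.connGerm hA i +
      hσ.germ x ^ (p + 1) • 𝔛.formGerm (hb x) i :=
    funext fun i => 𝔛.connGerm_addForm hA (hσ.near _) (hb _) (p + 1) hA' i
  rw [CoordFrame.curGerm, hΓ]
  exact (𝔛.diffAlg (F →L[ℝ] F)).exists_cur_add_eq q p _ hk i

/-- Perturbations of the critical order do not destroy vanishing of the current to this order. -/
lemma exists_form_addForm_critical (hg : IsSmoothMetric g) (hσ : IsDefining (d := d) σ)
    (hA : A.ContMDiffCovariantDerivative ∞) (hq : (d : ℝ) - 4 = q) {K b : EndForm (𝓡∂ d) V}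
    (hK : ∀ x, SmoothFormNear F K x)
    (hAK : ∀ x v z, current A g σ x v z = σ x ^ (q + 1) • K x v z)
    (hb : ∀ x, SmoothFormNear F b x) :
    ∃ K' : EndForm (𝓡∂ d) V, (∀ x, SmoothFormNear F K' x) ∧
      ∀ x v z, current (addForm A (smulForm (fun x => σ x ^ (q + 1)) b)) g σ x v z =
        σ x ^ (q + 1) • K' x v z := by
  have hA' : (addForm A (smulForm (fun x => σ x ^ (q + 1)) b)).ContMDiffCovariantDerivative ∞ :=
    addForm_contMDiff hA fun x => .smulForm ((hσ.near x).pow (q + 1)) (hb x)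
  refine exists_form_of_boundary hg hσ hA' hq fun x hx 𝔛 h0 i => ?_
  have hΓ : 𝔛.connGerm hA' = fun i => 𝔛.connGerm hA i +
      hσ.germ x ^ (q + 1) • 𝔛.formGerm (hb x) i :=
    funext fun i => 𝔛.connGerm_addForm hA (hσ.near _) (hb _) (q + 1) hA' i
  rw [CoordFrame.curGerm, hΓ]
  exact (𝔛.diffAlg (F →L[ℝ] F)).cur_add_critical q _
    ((𝔛.current_germ_iff hg hA (hσ.near _) hq (hK _) (q + 1)).1 (.of_forall hAK)) i

end Perturbation

theorem exists_solution [CompactSpace M]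
    {g : Π x : M, TangentSpace (𝓡∂ d) x → TangentSpace (𝓡∂ d) x → ℝ}
    (hg : IsSmoothMetric g) (hσ : IsDefining (d := d) σ)
    (hσ0 : ∀ x, 0 ≤ σ x) (hA : A.ContMDiffCovariantDerivative ∞) (hq : (d : ℝ) - 4 = q)
    {K : EndForm (𝓡∂ d) V} (hK : ∀ x, SmoothFormNear F K x)
    (hAK : ∀ x v z, current A g σ x v z = σ x ^ (q + 1) • K x v z)
    (hn : ∀ x ∈ (𝓡∂ d).boundary M, K x (gradient g σ x) = 0) :
    ∃ C : EndForm (𝓡∂ d) V, (∀ x, SmoothFormNear F C x) ∧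
      ∀ ℓ, ∃ K' : EndForm (𝓡∂ d) V, (∀ x, SmoothFormNear F K' x) ∧
        ∀ x v z, current (addForm A (smulForm (fun x => σ x ^ (q + 2)) C)) g σ x v z =
          σ x ^ ℓ • K' x v z := by
  obtain ⟨a, ha, haK⟩ := exists_formal_solution hg hσ hσ0 hA hq hK hAK hn
  obtain ⟨C, hC, hCb⟩ := exists_borel hσ ha
  refine ⟨C, hC, fun ℓ => ?_⟩
  obtain ⟨K', hK', hAK'⟩ := haK ℓ
  obtain ⟨b, hb, rfl⟩ := hCb ℓ
  have hA' : (addForm A (smulForm (fun x => σ x ^ (q + 2))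
      (powerSum σ a ℓ))).ContMDiffCovariantDerivative ∞ :=
    addForm_contMDiff hA fun x => .smulForm ((hσ.near x).pow _) (powerSum_smooth hσ ha ℓ x)
  obtain ⟨K'', hK'', hAK''⟩ := exists_form_addForm hg hσ hA' hq hK' hAK' hb
  rw [addForm_addForm, show q + 1 + ℓ + 1 = q + 2 + ℓ by omega, ← smulForm_pow_pow (q + 2) ℓ,
    ← smulForm_add] at hAK''
  refine ⟨smulForm (fun x => σ x ^ (q + 1)) K'', fun x => .smulForm ((hσ.near x).pow _) (hK'' x),
    fun x v z => (hAK'' x v z).trans ?_⟩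
  rw [add_comm, pow_add, mul_smul]
  rfl

lemma HasBoundaryCondition.addForm {Abar : CovariantDerivative (𝓡 (d - 1)) F (ι *ᵖ V)}
    (h : HasBoundaryCondition ι A Abar) (hι : IsBoundaryInclusion ι) (hσ : IsDefining (d := d) σ)
    {n : ℕ} (hn : n ≠ 0) (K : EndForm (𝓡∂ d) V) :
    HasBoundaryCondition ι (addForm A (smulForm (fun x => σ x ^ n) K)) Abar := by
  intro s hs y v
  rw [h s hs y v, addForm_apply]
  have : smulForm (fun x => σ x ^ n) K (ι y) = 0 := by
    rw [smulForm, (hσ.zero_iff _).2 (hι.mem y), zero_pow hn]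
    exact zero_smul ℝ (K (ι y))
  rw [this]
  exact (add_zero (A s (ι y) (pushVec ι v))).symm

/-- Connections solving the Yang-Mills equation to infinite order, from a solution of the modified
Gauss law. -/
theorem exists_solution_of_gaussLaw [CompactSpace M] (hι : IsBoundaryInclusion ι)
    (hσ : IsDefining (d := d) σ) (hσ0 : ∀ x, 0 ≤ σ x) {g : Metric d M}
    {Abar : CovariantDerivative (𝓡 (d - 1)) F (ι *ᵖ V)}
    (hA : A.ContMDiffCovariantDerivative ∞) (hAbar : HasBoundaryCondition ι A Abar)
    (hq : (d : ℝ) - 4 = q) {K₁ : EndForm (𝓡∂ d) V} (hK₁ : ∀ x, SmoothFormNear F K₁ x)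
    (hAK : ∀ x v z, current A g.form σ x v z = σ x ^ (q + 1) • K₁ x v z)
    {E : EndForm (𝓡 (d - 1)) (ι *ᵖ V)} (hE : ∀ y, SmoothFormNear F E y)
    (hgauss : ∀ (y : S) (z : V (ι y)),
      divOneForm Abar (boundaryForm ι g) (fun y' v z' => E y' v z') y z =
        (1 / ((d : ℝ) - 3)) • K₁ (ι y) (unitNormal g.form σ (ι y)) z) :
    ∃ A' : CovariantDerivative (𝓡∂ d) F V, A'.ContMDiffCovariantDerivative ∞ ∧
      HasBoundaryCondition ι A' Abar ∧
      ∀ ℓ, ∃ K : EndForm (𝓡∂ d) V, (∀ x, SmoothFormNear F K x) ∧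
        ∀ x v z, current A' g.form σ x v z = σ x ^ ℓ • K x v z := by
  have hg := g.isSmoothMetric
  obtain ⟨B, hB, hBE⟩ := exists_tangential_extension hι hσ
    (f := fun x => Real.sqrt (gradSq g.form σ x)) (fun x hx => by
      have h := hσ.gradSq_pos hg hx
      refine ⟨SmoothNear.comp_at ?_ (gradSq_near hg (hσ.near x) (chartFrame x)),
        (Real.sqrt_pos.2 h).ne'⟩
      filter_upwards [isOpen_ne.mem_nhds h.ne'] with t ht using Real.contDiffAt_sqrt ht) hE
  obtain ⟨K', hK', hAK'⟩ := exists_form_addForm_critical hg hσ hA hq hK₁ hAK hB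
  have hn : ∀ x ∈ (𝓡∂ d).boundary M, K' x (gradient g.form σ x) = 0 := fun x hx => by
    obtain ⟨y, rfl⟩ := hι.2 ▸ hx
    exact normal_eq_zero_of_gaussLaw hι hσ hA hAbar hq hK₁ hAK hB hE hBE hgauss hK' hAK' y
  have hA' := addForm_contMDiff hA fun x => .smulForm ((hσ.near x).pow (q + 1)) (hB x)
  obtain ⟨C, hC, hCK⟩ := exists_solution hg hσ hσ0 hA' hq hK' hAK' hn
  exact ⟨_, addForm_contMDiff hA' fun x => .smulForm ((hσ.near x).pow (q + 2)) (hC x),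
    (hAbar.addForm hι hσ (by omega) B).addForm hι hσ (by omega) C, hCK⟩

end InfiniteOrder

end YangMills

end

theorem theorem1p4
    (d : ℕ) [NeZero d] (hd : 4 ≤ d)
    (M : Type*) [TopologicalSpace M] [T2Space M] [CompactSpace M]
    [ChartedSpace (EuclideanHalfSpace d) M] [IsManifold (𝓡∂ d) ∞ M]
    (S : Type*) [TopologicalSpace S] [ChartedSpace (EuclideanSpace ℝ (Fin (d - 1))) S]
    [IsManifold (𝓡 (d - 1)) ∞ S]
    (ι : C^∞⟮𝓡 (d - 1), S; 𝓡∂ d, M⟯) (hι : YangMills.IsBoundaryInclusion ι)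
    (F : Type*) [NormedAddCommGroup F] [NormedSpace ℝ F] [FiniteDimensional ℝ F]
    (V : M → Type*) [TopologicalSpace (TotalSpace F V)]
    [∀ x, AddCommGroup (V x)] [∀ x, Module ℝ (V x)] [∀ x, TopologicalSpace (V x)]
    [∀ x, IsTopologicalAddGroup (V x)] [∀ x, ContinuousSMul ℝ (V x)]
    [FiberBundle F V] [VectorBundle ℝ F V] [ContMDiffVectorBundle ∞ F V (𝓡∂ d)]
    (c : YangMills.ConformallyCompact d M)
    (A₀ : CovariantDerivative (𝓡∂ d) F V) (hA₀ : YangMills.IsAsymptoticallyYM c A₀)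
    (Abar : CovariantDerivative (𝓡 (d - 1)) F (ι *ᵖ V))
    (hAbar : Abar.ContMDiffCovariantDerivative ∞)
    (hA₀bar : YangMills.HasBoundaryCondition ι A₀ Abar)
    (kbar : YangMills.BoundaryCurrentDensity F V c ι (3 - (d : ℤ)))
    (hkbar : YangMills.IsObstructionCurrent c ι Abar kbar)
    (hkbar_zero : ∀ g y, kbar.toFun g y = 0) :
    (∃ k₁ : YangMills.CurrentDensity F V c (2 - (d : ℤ)),
      YangMills.CurrentEq c A₀ (d - 3) k₁) ∧
    ∀ k₁ : YangMills.CurrentDensity F V c (2 - (d : ℤ)),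
      YangMills.CurrentEq c A₀ (d - 3) k₁ →
      ∀ E : YangMills.BoundaryCurrentDensity F V c ι (3 - (d : ℤ)),
        YangMills.GaussLaw c ι Abar E k₁ →
        ∃ A : CovariantDerivative (𝓡∂ d) F V,
          YangMills.IsAsymptoticallyYM c A ∧
          YangMills.HasBoundaryCondition ι A Abar ∧
          YangMills.CurrentVanishesToInfiniteOrder c A := by
  obtain ⟨g, hg⟩ := c.nonempty
  have hσ := c.isDefining ⟨g, hg⟩
  obtain ⟨q, rfl⟩ : ∃ q, d = q + 4 := ⟨d - 4, by omega⟩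
  have hq : ((q + 4 : ℕ) : ℝ) - 4 = q := by push_cast; ring
  obtain ⟨hA, k, hk⟩ := hA₀
  refine ⟨?_, fun k₁ hk₁ E hgauss => ?_⟩
  · obtain ⟨Aw, hAw, hAwbar, kw, hkw, hkwbar⟩ := hkbar
    obtain ⟨K, hK, hAK⟩ := YangMills.exists_form_of_local fun p =>
      YangMills.exists_form_succ hι g.isSmoothMetric hσ hA hAw hA₀bar hAwbar hq
        (k.smoothFormNear ⟨g, hg⟩) (kw.smoothFormNear ⟨g, hg⟩) (hk ⟨g, hg⟩) (hkw ⟨g, hg⟩)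
        (fun y v => ContinuousLinearMap.ext fun z => by
          rw [← hkwbar, hkbar_zero]
          rfl) p
    exact YangMills.exists_currentEq hq hA ⟨g, hg⟩ (by push_cast; ring) hK hAK
  · obtain ⟨A, hA', hAbar', hAK⟩ := YangMills.exists_solution_of_gaussLaw hι hσ (c.nonneg ⟨g, hg⟩)
      hA hA₀bar hq (k₁.smoothFormNear ⟨g, hg⟩) (hk₁ ⟨g, hg⟩)
      (YangMills.contMDiff_iff_smoothFormNear.2 (E.smooth ⟨g, hg⟩)) (hgauss ⟨g, hg⟩)
    have h : ∀ (ℓ : ℕ) {w : ℤ}, w = -1 - ℓ →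
        ∃ k : YangMills.CurrentDensity F V c w, YangMills.CurrentEq c A ℓ k := fun ℓ w hw => by
      obtain ⟨K, hK, hAK⟩ := hAK ℓ
      exact YangMills.exists_currentEq hq hA' ⟨g, hg⟩ hw hK hAK
    exact ⟨A, ⟨hA', h q (by push_cast; ring)⟩, hAbar', fun ℓ => h ℓ rfl⟩
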